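/- Let $\alpha,\beta,\gamma$ be smooth real functions of $(x,u)\in\mathbb R^2$ with bounded first derivatives, $0<\alpha_1\le\alpha\le\alpha_2$, $|\beta|\le\beta_2$, $0<\gamma_1\le\gamma\le\gamma_2$ for some constants. Put $$\lambda_\pm=\frac{\beta\pm\sqrt{\beta^2+\alpha^2\gamma^2}}{\alpha^2},\quad c_1=\alpha\lambda_-,\quad c_2=\alpha\lambda_+,\quad a_i=\frac{c_i\partial_u\alpha-\alpha\partial_uc_i}{2\alpha(c_2-c_1)},\quad b=\frac{\alpha\partial_x(c_1-c_2)+(c_1-c_2)\partial_x\alpha}{2\alpha(c_2-c_1)}.$$ Consider the equation $$(\alpha^2u_t+\beta u_x)_t+(\beta u_t-\gamma^2u_x)_x=\alpha\alpha_uu_t^2+\beta_uu_tu_x-\gamma\gamma_uu_x^2,\qquad u(0,\cdot)=u_0\in H^1(\mathbb R),\quad u_t(0,\cdot)=u_1\in L^2(\mathbb R),\tag{1}$$ with coefficients evaluated at $(x,u(t,x))$. A weak solution of (1) is a function $u$ on $[0,\infty)\times\mathbb R$ that is locally Hölder continuous with exponent $1/2$, such that $t\mapsto u(t,\cdot)$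 is continuously differentiable into $L^p_{\rm loc}$ for all $1\le p<2$ and Lipschitz continuous in the $L^2$ distance, $u(0,x)=u_0(x)$ for all $x$, $u_t(0,\cdot)=u_1$ a.e., and the equation holds in the sense of distributions on $(0,\infty)\times\mathbb R$. Here $u_t$ is the $L^p_{\rm loc}$-derivative and $u_x(t,\cdot)$ is the weak derivative of $u(t,\cdot)$; both are measurable on $(0,\infty)\times\mathbb R$ and locally square integrable there. Put $$R=\alpha u_t+c_2u_x,\quad S=\alpha u_t+c_1u_x,\quad \widetilde R^2=\frac{-c_1}{c_2-c_1}R^2,\quad \widetilde S^2=\frac{c_2}{c_2-c_1}S^2,$$ $$G=\frac{2c_2a_1}{\alpha(c_2-c_1)}R^2S-\frac{2c_1a_2}{\alpha(c_2-c_1)}RS^2-\frac{2c_1c_2b}{\alpha(c_2-c_1)}RS.$$ The weak solution $u$ is conservative, with energy measures $\mu^t_\pm$ $(t\ge0)$, if $\mu^t_-$ and $\mu^t_+$ are finite positive Borel measures on $\mathbb R$, weakly continuous in $t\in[0,\infty)$, such that (i) $\mu_-^t(\mathbb R)+\mu_+^t(\mathbb R)=\int_{\mathbb R}\big[\alpha^2(x,u_0)u_1^2+\gamma^2(x,u_0)u_{0,x}^2\big]dx$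 for all $t\ge 0$; (ii) for all $t\ge 0$ the absolutely continuous parts of $\mu^t_-$ and $\mu^t_+$ have densities $\widetilde R^2(t,\cdot)$ and $\widetilde S^2(t,\cdot)$; (iii) for a.e. $t$ the singular parts of $\mu^t_\pm$ are concentrated on the set of $x$ where $\partial_u\lambda_-=0$ or $\partial_u\lambda_+=0$ at $(x,u(t,x))$; (iv) $G$ is locally integrable on $(0,\infty)\times\mathbb R$, and $\mu_-$, $\mu_+$ are measure-valued solutions on $(0,\infty)\times\mathbb R$ of $w_t+(\lambda_-w)_x=G$ and $z_t+(\lambda_+z)_x=-G$, respectively. **Lemma.** Let $u$ be a conservative solution of (1) with energy measures $\mu^t_\pm$. Then for every $\bar y\in\mathbb R$ there exist a unique Lipschitz continuous map $x^-:[0,\infty)\to\mathbb R$ and a unique Lipschitz continuous map $x^+:[0,\infty)\to\mathbb R$ such that $x^\pm(0)=\bar y$, $$\dot x^\pm(t)=\lambda_\pm\big(x^\pm(t),u(t,x^\pm(t))\big)\qquad\text{for all }t\ge0,$$ and the energy balances $$\frac{d}{dt}\int_{-\infty}^{x^-(t)}\widetilde R^2(t,x)\,dx=\int_{-\infty}^{x^-(t)}G(t,x)\,dx,\qquad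 \frac{d}{dt}\int_{-\infty}^{x^+(t)}\widetilde S^2(t,x)\,dx=-\int_{-\infty}^{x^+(t)}G(t,x)\,dx$$ hold in the following sense: there are functions $e_\pm$ on $[0,\infty)$, absolutely continuous on every $[0,T]$, such that for every $t\ge0$ $$e_\pm(t)=\mu_\pm^t\big((-\infty,x^\pm(t))\big)+\theta_\pm(t)\,\mu^t_\pm\big(\{x^\pm(t)\}\big)\quad\text{for some }\theta_\pm(t)\in[0,1],$$ so that $e_-(t)=\int_{-\infty}^{x^-(t)}\widetilde R^2(t,x)\,dx$, respectively $e_+(t)=\int_{-\infty}^{x^+(t)}\widetilde S^2(t,x)\,dx$, whenever $\mu_-^t$, respectively $\mu_+^t$, is absolutely continuous; and, for a.e. $t>0$, $G(t,\cdot)$ is integrable on $(-\infty,x^\pm(t)]$ with $\dot e_-(t)=\int_{-\infty}^{x^-(t)}G(t,x)\,dx$ and $\dot e_+(t)=-\int_{-\infty}^{x^+(t)}G(t,x)\,dx$. -/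

import Mathlib

open MeasureTheory Set Filter Topology
open scoped NNReal ENNReal ContDiff

noncomputable section

/-- The coefficients `α(x,u)`, `β(x,u)`, `γ(x,u)` of the variational wave equation
`(α² u_t + β u_x)_t + (β u_t - γ² u_x)_x = α α_u u_t² + β_u u_t u_x - γ γ_u u_x²`. -/
structure Coeffs where
  α : ℝ → ℝ → ℝ
  β : ℝ → ℝ → ℝ
  γ : ℝ → ℝ → ℝ

/-- Partial derivative in the first variable of a function of two variables. -/
def pd1 (f : ℝ → ℝ → ℝ) (a b : ℝ) : ℝ := deriv (fun a' => f a' b) a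

/-- Partial derivative in the second variable of a function of two variables. -/
def pd2 (f : ℝ → ℝ → ℝ) (a b : ℝ) : ℝ := deriv (fun b' => f a b') b

namespace Coeffs

/-- Smooth coefficients, with `α`, `γ` bounded and uniformly positive, `β` bounded, and all
first derivatives bounded. -/
structure Admissible (A : Coeffs) : Prop where
  smooth_α : ContDiff ℝ ∞ (Function.uncurry A.α)
  smooth_β : ContDiff ℝ ∞ (Function.uncurry A.β)
  smooth_γ : ContDiff ℝ ∞ (Function.uncurry A.γ)
  bound_α : ∃ α₁ α₂ : ℝ, 0 < α₁ ∧ ∀ x v, α₁ ≤ A.α x v ∧ A.α x v ≤ α₂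
  bound_β : ∃ β₂ : ℝ, ∀ x v, |A.β x v| ≤ β₂
  bound_γ : ∃ γ₁ γ₂ : ℝ, 0 < γ₁ ∧ ∀ x v, γ₁ ≤ A.γ x v ∧ A.γ x v ≤ γ₂
  grad_α : ∃ M : ℝ, ∀ z, ‖fderiv ℝ (Function.uncurry A.α) z‖ ≤ M
  grad_β : ∃ M : ℝ, ∀ z, ‖fderiv ℝ (Function.uncurry A.β) z‖ ≤ M
  grad_γ : ∃ M : ℝ, ∀ z, ‖fderiv ℝ (Function.uncurry A.γ) z‖ ≤ M

variable (A : Coeffs)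

/-- The backward characteristic speed `λ₋(x,u)`. -/
def lamMinus (x v : ℝ) : ℝ :=
  (A.β x v - Real.sqrt (A.β x v ^ 2 + A.α x v ^ 2 * A.γ x v ^ 2)) / A.α x v ^ 2

/-- The forward characteristic speed `λ₊(x,u)`. -/
def lamPlus (x v : ℝ) : ℝ :=
  (A.β x v + Real.sqrt (A.β x v ^ 2 + A.α x v ^ 2 * A.γ x v ^ 2)) / A.α x v ^ 2

/-- `c₁ = α λ₋`. -/
def c1 (x v : ℝ) : ℝ := A.α x v * A.lamMinus x v

/-- `c₂ = α λ₊`. -/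
def c2 (x v : ℝ) : ℝ := A.α x v * A.lamPlus x v

/-- `a₁ = (c₁ ∂ᵤα - α ∂ᵤc₁) / (2 α (c₂ - c₁))`. -/
def a1 (x v : ℝ) : ℝ :=
  (A.c1 x v * pd2 A.α x v - A.α x v * pd2 A.c1 x v) / (2 * A.α x v * (A.c2 x v - A.c1 x v))

/-- `a₂ = (c₂ ∂ᵤα - α ∂ᵤc₂) / (2 α (c₂ - c₁))`. -/
def a2 (x v : ℝ) : ℝ :=
  (A.c2 x v * pd2 A.α x v - A.α x v * pd2 A.c2 x v) / (2 * A.α x v * (A.c2 x v - A.c1 x v))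

/-- `b = (α ∂ₓ(c₁ - c₂) + (c₁ - c₂) ∂ₓα) / (2 α (c₂ - c₁))`. -/
def b (x v : ℝ) : ℝ :=
  (A.α x v * pd1 (fun x' v' => A.c1 x' v' - A.c2 x' v') x v
      + (A.c1 x v - A.c2 x v) * pd1 A.α x v) / (2 * A.α x v * (A.c2 x v - A.c1 x v))

end Coeffs

/-- A function `u(t,x)` together with its first derivatives `u_t(t,x)` and `u_x(t,x)`; that `ut`
and `ux` really are the derivatives of `u` is part of `IsWeakSolution`. -/
structure WaveField where
  u : ℝ → ℝ → ℝ
  ut : ℝ → ℝ → ℝ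
  ux : ℝ → ℝ → ℝ

namespace WaveField

variable (A : Coeffs) (w : WaveField)

/-- Riemann variable `R = α u_t + c₂ u_x`. -/
def R (t x : ℝ) : ℝ := A.α x (w.u t x) * w.ut t x + A.c2 x (w.u t x) * w.ux t x

/-- Riemann variable `S = α u_t + c₁ u_x`. -/
def S (t x : ℝ) : ℝ := A.α x (w.u t x) * w.ut t x + A.c1 x (w.u t x) * w.ux t x

/-- Backward energy density `R̃² = -c₁ R² / (c₂ - c₁)`. -/
def Rsq (t x : ℝ) : ℝ :=
  -A.c1 x (w.u t x) / (A.c2 x (w.u t x) - A.c1 x (w.u t x)) * w.R A t x ^ 2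

/-- Forward energy density `S̃² = c₂ S² / (c₂ - c₁)`. -/
def Ssq (t x : ℝ) : ℝ :=
  A.c2 x (w.u t x) / (A.c2 x (w.u t x) - A.c1 x (w.u t x)) * w.S A t x ^ 2

/-- The source term
`G = 2c₂a₁/(α(c₂-c₁)) R²S - 2c₁a₂/(α(c₂-c₁)) RS² - 2c₁c₂b/(α(c₂-c₁)) RS`. -/
def G (t x : ℝ) : ℝ :=
  let v := w.u t x
  let k := A.α x v * (A.c2 x v - A.c1 x v)
  2 * A.c2 x v * A.a1 x v / k * (w.R A t x ^ 2 * w.S A t x)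
    - 2 * A.c1 x v * A.a2 x v / k * (w.R A t x * w.S A t x ^ 2)
    - 2 * A.c1 x v * A.c2 x v * A.b x v / k * (w.R A t x * w.S A t x)

end WaveField

/-- `g` is the weak (distributional) derivative of `f` on the real line. -/
structure HasWeakDeriv (f g : ℝ → ℝ) : Prop where
  locInt : LocallyIntegrable f
  locInt' : LocallyIntegrable g
  integral_eq : ∀ φ : ℝ → ℝ, ContDiff ℝ ∞ φ → HasCompactSupport φ →
    ∫ x, f x * deriv φ x = -∫ x, g x * φ x

/-- Initial data `u₀ ∈ H¹(ℝ)`, with weak derivative `u0x`, and `u₁ ∈ L²(ℝ)`. -/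
structure IsInitialData (u0 u0x u1 : ℝ → ℝ) : Prop where
  memLp_u0 : MemLp u0 2
  memLp_u0x : MemLp u0x 2
  weakDeriv : HasWeakDeriv u0 u0x
  memLp_u1 : MemLp u1 2

/-- Test functions `φ(t,x)` of class `C¹` with compact support in `(0,∞) × ℝ`. -/
structure IsTest (φ : ℝ → ℝ → ℝ) : Prop where
  contDiff : ContDiff ℝ 1 (Function.uncurry φ)
  compact : HasCompactSupport (Function.uncurry φ)
  support : tsupport (Function.uncurry φ) ⊆ Ioi 0 ×ˢ univ

/-- `t ↦ v(t,·)`, `t ≥ 0`, is continuously differentiable with values in `L^p_loc(ℝ)`, with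
derivative `t ↦ v'(t,·)`. -/
structure IsC1IntoLpLoc (p : ℝ≥0∞) (v v' : ℝ → ℝ → ℝ) : Prop where
  memLp : ∀ t, 0 ≤ t → ∀ r : ℝ, MemLp (v t) p (volume.restrict (Icc (-r) r))
  memLp' : ∀ t, 0 ≤ t → ∀ r : ℝ, MemLp (v' t) p (volume.restrict (Icc (-r) r))
  hasDeriv : ∀ t, 0 ≤ t → ∀ r : ℝ,
    Tendsto (fun s => eLpNorm (fun x => (v s x - v t x) / (s - t) - v' t x) p
      (volume.restrict (Icc (-r) r))) (𝓝[Ici 0 \ {t}] t) (𝓝 0)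
  continuous_deriv : ∀ t, 0 ≤ t → ∀ r : ℝ,
    Tendsto (fun s => eLpNorm (fun x => v' s x - v' t x) p
      (volume.restrict (Icc (-r) r))) (𝓝[Ici 0] t) (𝓝 0)

/-- Global weak solutions of the variational wave equation with initial data `u = u₀`,
`u_t = u₁` at time `0`. -/
structure IsWeakSolution (A : Coeffs) (u0 u1 : ℝ → ℝ) (w : WaveField) : Prop where
  /-- local Hölder continuity with exponent `1/2` on `[0,∞) × ℝ` -/
  holder : ∀ K : Set (ℝ × ℝ), IsCompact K → K ⊆ Ici 0 ×ˢ univ →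
    ∃ C : ℝ≥0, HolderOnWith C (1 / 2) (Function.uncurry w.u) K
  /-- `u_t` is the time derivative of `u` in `L^p_loc` and is continuous in time -/
  c1_Lp : ∀ p : ℝ≥0∞, 1 ≤ p → p < 2 → IsC1IntoLpLoc p w.u w.ut
  /-- `u_x` is the weak space derivative of `u` -/
  weakDeriv : ∀ t, 0 ≤ t → HasWeakDeriv (w.u t) (w.ux t)
  lipschitz_L2 : ∃ L : ℝ≥0, ∀ s t, 0 ≤ s → 0 ≤ t →
    eLpNorm (fun x => w.u t x - w.u s x) 2 volume ≤ L * ENNReal.ofReal |t - s|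
  meas_ut : AEStronglyMeasurable (Function.uncurry w.ut) (volume.restrict (Ioi 0 ×ˢ univ))
  meas_ux : AEStronglyMeasurable (Function.uncurry w.ux) (volume.restrict (Ioi 0 ×ˢ univ))
  sq_ut : LocallyIntegrableOn (fun z : ℝ × ℝ => w.ut z.1 z.2 ^ 2) (Ioi 0 ×ˢ univ)
  sq_ux : LocallyIntegrableOn (fun z : ℝ × ℝ => w.ux z.1 z.2 ^ 2) (Ioi 0 ×ˢ univ)
  init_u : ∀ x, w.u 0 x = u0 x
  init_ut : w.ut 0 =ᵐ[volume] u1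
  /-- the equation in the sense of distributions -/
  weak_eq : ∀ φ : ℝ → ℝ → ℝ, IsTest φ →
    ∫ z in Ioi (0 : ℝ) ×ˢ (univ : Set ℝ),
      (let t := z.1
       let x := z.2
       let v := w.u t x
       let p := w.ut t x
       let q := w.ux t x
       pd1 φ t x * (A.α x v ^ 2 * p + A.β x v * q)
        + pd2 φ t x * (A.β x v * p - A.γ x v ^ 2 * q)
        + φ t x * (A.α x v * pd2 A.α x v * p ^ 2 + pd2 A.β x v * p * q
            - A.γ x v * pd2 A.γ x v * q ^ 2)) = 0

/-- The initial energy `E₀`. -/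
def initialEnergy (A : Coeffs) (u0 u0x u1 : ℝ → ℝ) : ℝ :=
  ∫ x, (A.α x (u0 x) ^ 2 * u1 x ^ 2 + A.γ x (u0 x) ^ 2 * u0x x ^ 2)

/-- The family of measures `μ^t`, `t > 0`, is a measure-valued solution of
`m_t + (speed · m)_x = src`. -/
def IsMeasureSolution (μ : ℝ → FiniteMeasure ℝ) (speed src : ℝ → ℝ → ℝ) : Prop :=
  ∀ φ : ℝ → ℝ → ℝ, IsTest φ →
    (∫ t in Ioi (0 : ℝ), ∫ x, (pd1 φ t x + speed t x * pd2 φ t x) ∂(μ t : Measure ℝ))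
      + ∫ z in Ioi (0 : ℝ) ×ˢ (univ : Set ℝ), src z.1 z.2 * φ z.1 z.2 = 0

/-- Conservation of energy for `w`, with backward and forward energy measures
`μm t = μ₋^t` and `μp t = μ₊^t`. The topology on `FiniteMeasure ℝ` is the weak one. -/
structure IsConservative (A : Coeffs) (u0 u0x u1 : ℝ → ℝ) (w : WaveField)
    (μm μp : ℝ → FiniteMeasure ℝ) : Prop where
  cont_m : ContinuousOn μm (Ici 0)
  cont_p : ContinuousOn μp (Ici 0)
  total : ∀ t, 0 ≤ t →
    (μm t : Measure ℝ).real univ + (μp t : Measure ℝ).real univ = initialEnergy A u0 u0x u1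
  /-- the absolutely continuous parts have densities `R̃²` and `S̃²` -/
  density_m : ∀ t, 0 ≤ t →
    (μm t : Measure ℝ).rnDeriv volume =ᵐ[volume] fun x => ENNReal.ofReal (w.Rsq A t x)
  density_p : ∀ t, 0 ≤ t →
    (μp t : Measure ℝ).rnDeriv volume =ᵐ[volume] fun x => ENNReal.ofReal (w.Ssq A t x)
  /-- the singular parts live where `∂ᵤλ₋ = 0` or `∂ᵤλ₊ = 0`, for almost every time -/
  singular : ∀ᵐ t ∂(volume.restrict (Ioi (0 : ℝ))),
    (μm t : Measure ℝ).singularPart volume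
        {x | pd2 A.lamMinus x (w.u t x) = 0 ∨ pd2 A.lamPlus x (w.u t x) = 0}ᶜ = 0 ∧
    (μp t : Measure ℝ).singularPart volume
        {x | pd2 A.lamMinus x (w.u t x) = 0 ∨ pd2 A.lamPlus x (w.u t x) = 0}ᶜ = 0
  /-- the source term is locally integrable, so that it defines a distribution -/
  locInt_G : LocallyIntegrableOn (fun z : ℝ × ℝ => w.G A z.1 z.2) (Ioi 0 ×ˢ univ)
  /-- balance laws; the speeds are `c₁/α = λ₋` and `c₂/α = λ₊` -/
  balance_m : IsMeasureSolution μm (fun t x => A.lamMinus x (w.u t x)) (w.G A)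
  balance_p : IsMeasureSolution μp (fun t x => A.lamPlus x (w.u t x)) (fun t x => -w.G A t x)

/-- The energy balance `d/dt ∫_{-∞}^{x(t)} ρ(t,y) dy = ∫_{-∞}^{x(t)} src(t,y) dy` along the curve
`x`, for a density `ρ` which is carried by the energy measures `μ^t`. At times where `μ^t` is
absolutely continuous the energy `e(t)` to the left of the curve is the integral of `ρ`; in general
it is `μ^t((-∞,x(t))) + θ(t) μ^t({x(t)})` with `θ(t) ∈ [0,1]`. The function `e` is absolutely
continuous and its derivative is the integral of the source for almost every time. -/
def EnergyBalance (μ : ℝ → FiniteMeasure ℝ) (ρ src : ℝ → ℝ → ℝ) (x : ℝ → ℝ) : Prop :=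
  ∃ e : ℝ → ℝ,
    (∀ t, 0 ≤ t → ∃ θ ∈ Icc (0 : ℝ) 1,
      e t = (μ t : Measure ℝ).real (Iio (x t)) + θ * (μ t : Measure ℝ).real {x t}) ∧
    (∀ t, 0 ≤ t → (μ t : Measure ℝ) ≪ volume →
      IntegrableOn (ρ t) (Iic (x t)) ∧ e t = ∫ y in Iic (x t), ρ t y) ∧
    (∀ T, 0 ≤ T → AbsolutelyContinuousOnInterval e 0 T) ∧
    (∀ᵐ t ∂(volume.restrict (Ioi (0 : ℝ))),
      IntegrableOn (src t) (Iic (x t)) ∧ HasDerivAt e (∫ y in Iic (x t), src t y) t)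

/-- A Lipschitz curve `x` on `[0,∞)` with `x(0) = ybar` and `x'(t) = speed(t, x(t))`. -/
structure IsCharacteristic (speed : ℝ → ℝ → ℝ) (ybar : ℝ) (x : ℝ → ℝ) : Prop where
  lipschitz : ∃ K : ℝ≥0, LipschitzOnWith K x (Ici 0)
  init : x 0 = ybar
  ode : ∀ t, 0 ≤ t → HasDerivWithinAt x (speed t (x t)) (Ici 0) t

/-- Backward characteristics from `(0, ybar)` that satisfy the backward energy balance. -/
def IsBackwardChar (A : Coeffs) (w : WaveField) (μm : ℝ → FiniteMeasure ℝ) (ybar : ℝ)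
    (x : ℝ → ℝ) : Prop :=
  IsCharacteristic (fun t y => A.lamMinus y (w.u t y)) ybar x ∧
    EnergyBalance μm (w.Rsq A) (w.G A) x

/-- Forward characteristics from `(0, ybar)` that satisfy the forward energy balance. -/
def IsForwardChar (A : Coeffs) (w : WaveField) (μp : ℝ → FiniteMeasure ℝ) (ybar : ℝ)
    (x : ℝ → ℝ) : Prop :=
  IsCharacteristic (fun t y => A.lamPlus y (w.u t y)) ybar x ∧
    EnergyBalance μp (w.Ssq A) (fun t y => -w.G A t y) x

end

/-! The speed x ↦ λ±(x, u(t,x)) is only Hölder continuous with exponent 1/2, so the differential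
equation alone does not single out a characteristic; the energy balance does. A solution is
therefore treated as a pair (x, e): the position and the energy to its left, where an atom sitting
at x may be split (`IsBalancedCurve`). Both families are handled at once by `IsWavePair`, which
keeps only what matters: measures μ, ν with densities r, s, speeds a, c of opposite sign bounded
away from zero by δ, a source with |g| ≤ C (r√s + √r s + √r√s) which μ gains and ν loses, and the
bound |a(t,y) - a(t,x)| ≤ C ∫ (1 + √r + √s) over [x,y]. The sign σ exchanges the two roles.

Integrability of the source. Local integrability of g says nothing at infinity or near t = 0. A
Glimm-type functional helps: integrate against μ the total energy of both families lying on the side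
from which ν arrives. Since the two families cross with relative speed at least 2δ, this functional
falls at rate at least 2δ ∫ r s, up to a self-interaction of μ that is antisymmetric, and up to the
source. Young's inequality bounds |g| by a small multiple of r s plus a multiple of r + s, so the
estimate closes (`interaction_smoothed`, `lintegral_interaction_le`, `sourceIntegrable`). Products
of densities are reached from mollified measures through Fatou's lemma (`fatou_moll`); only lower
bounds are needed, so singular parts do no harm.

Existence (`exists_characteristic`). Curves are driven by an average of a against the mollified
measure μ plus Lebesgue measure on a large box. The error in the energy balance of a smoothed front
is then that of the Lebesgue part alone, which vanishes in the limit because a is continuous.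
Compactness gives a curve, and the limiting energy lies between μ((-∞,x)) and μ((-∞,x]).

Uniqueness (`balanced_unique`). For two ordered balanced curves the quantity D = M (x₂ - x₁) + (e₂ -
e₁) should satisfy Grönwall's inequality. Its growth rate is bounded by the integral over (x₁, x₂)
of |g| + M C (1 + √r + √s), and the terms containing s are not controlled by D. They are absorbed by
a bounded weight which decreases along characteristics of a at rate about 2δ s, namely the amount of
ν still to be crossed, corrected by the accumulated source (`exists_weight`, `comparison`,
`exists_distance_estimate`). Transport of the weight up to a balanced curve is `leftIntegral_sub`.
That two balanced curves can be taken as ordered follows by looking at x + e, which determines x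
(`add_le_add_of_balanced`).

At t = 0 the densities already carry the whole energy, so μ has no atoms and the initial value of e
is forced. -/

/-! ### Smoothing kernels -/

/-- The bump function underlying the smoothing kernel. -/
noncomputable def kernelBump : ContDiffBump (0 : ℝ) := ⟨1 / 2, 1, by norm_num, by norm_num⟩

/-- A smooth even probability density supported in `[-1, 1]`. -/
noncomputable def rho (z : ℝ) : ℝ := kernelBump.normed volume z

/-- The primitive of `rho`, a smooth approximation of the Heaviside function. -/
noncomputable def kap (z : ℝ) : ℝ := ∫ y in (-1 : ℝ)..z, rho y

lemma rho_contDiff : ContDiff ℝ ∞ rho := kernelBump.contDiff_normed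

@[fun_prop]
lemma rho_continuous : Continuous rho := rho_contDiff.continuous

lemma rho_nonneg (z : ℝ) : 0 ≤ rho z := kernelBump.nonneg_normed z

lemma rho_neg (z : ℝ) : rho (-z) = rho z := kernelBump.normed_neg z

lemma rho_eq_zero {z : ℝ} (hz : 1 ≤ |z|) : rho z = 0 := by
  have : z ∉ Function.support (kernelBump.normed volume) := by
    rw [ContDiffBump.support_normed_eq]
    simpa [kernelBump] using hz
  simpa [rho] using this

lemma rho_le_one (z : ℝ) : rho z ≤ 1 := by
  have := kernelBump.normed_le_div_measure_closedBall_rIn (μ := volume) z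
  refine this.trans (le_of_eq ?_)
  simp [kernelBump, Measure.real, Real.volume_closedBall]

/-- The bump equals 1 here and has integral at most 2, the length of its support. This lower bound
is what lets mollified densities dominate averages over balls in `average_le_moll`. -/
lemma half_le_rho {z : ℝ} (hz : |z| ≤ 1 / 2) : 1 / 2 ≤ rho z := by
  have h1 : (kernelBump : ℝ → ℝ) z = 1 :=
    kernelBump.one_of_mem_closedBall (by simpa [kernelBump] using hz)
  have h2 : ∫ x, (kernelBump : ℝ → ℝ) x ≤ 2 := by
    refine (kernelBump.integral_le_measure_closedBall (μ := volume)).trans (le_of_eq ?_)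
    simp [kernelBump, Measure.real, Real.volume_closedBall]
  have h3 : 0 < ∫ x, (kernelBump : ℝ → ℝ) x := kernelBump.integral_pos
  rw [rho, ContDiffBump.normed_def, h1]
  exact one_div_le_one_div_of_le h3 h2

lemma rho_hasCompactSupport : HasCompactSupport rho := kernelBump.hasCompactSupport_normed

lemma rho_integrable : Integrable rho := kernelBump.integrable_normed

lemma integral_rho : ∫ z, rho z = 1 := kernelBump.integral_normed

lemma exists_lipschitz_rho : ∃ K : ℝ, 0 ≤ K ∧ ∀ y z, |rho y - rho z| ≤ K * |y - z| := by
  obtain ⟨K, hK⟩ := rho_contDiff.lipschitzWith_of_hasCompactSupport rho_hasCompactSupport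
    (by simp)
  exact ⟨K, K.2, fun y z => by simpa [Real.dist_eq] using hK.dist_le_mul y z⟩

lemma kap_hasDerivAt (z : ℝ) : HasDerivAt kap (rho z) z :=
  intervalIntegral.integral_hasDerivAt_right (rho_continuous.intervalIntegrable _ _)
    (rho_continuous.stronglyMeasurableAtFilter _ _) rho_continuous.continuousAt

lemma deriv_kap : deriv kap = rho := funext fun z => (kap_hasDerivAt z).deriv

lemma kap_contDiff : ContDiff ℝ ∞ kap :=
  contDiff_infty_iff_deriv.2
    ⟨fun z => (kap_hasDerivAt z).differentiableAt, by rw [deriv_kap]; exact rho_contDiff⟩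

@[fun_prop]
lemma kap_continuous : Continuous kap := kap_contDiff.continuous

lemma kap_monotone : Monotone kap :=
  monotone_of_hasDerivAt_nonneg kap_hasDerivAt rho_nonneg

lemma kap_eq_zero {z : ℝ} (hz : z ≤ -1) : kap z = 0 := by
  rw [kap, intervalIntegral.integral_congr (g := fun _ => 0)]
  · simp
  · intro y hy
    rw [uIcc_of_ge hz] at hy
    exact rho_eq_zero (by rw [abs_of_nonpos] <;> linarith [hy.2])

lemma kap_one : kap 1 = 1 := by
  rw [kap, intervalIntegral.integral_of_le (by norm_num)]
  refine (setIntegral_eq_integral_of_forall_compl_eq_zero fun z hz => rho_eq_zero ?_).trans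
    integral_rho
  by_contra h
  rw [not_le, abs_lt] at h
  exact hz ⟨h.1, h.2.le⟩

lemma kap_eq_one {z : ℝ} (hz : 1 ≤ z) : kap z = 1 := by
  have h : kap z - kap 1 = ∫ y in (1 : ℝ)..z, rho y := by
    simp only [kap]
    rw [sub_eq_iff_eq_add']
    exact (intervalIntegral.integral_add_adjacent_intervals
      (rho_continuous.intervalIntegrable _ _) (rho_continuous.intervalIntegrable _ _)).symm
  rw [intervalIntegral.integral_congr (g := fun _ => 0)] at h
  · simp only [intervalIntegral.integral_zero, kap_one] at h
    linarith
  · intro y hy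
    rw [uIcc_of_le hz] at hy
    exact rho_eq_zero (hy.1.trans (le_abs_self _))

lemma kap_nonneg (z : ℝ) : 0 ≤ kap z := by
  rcases le_total z (-1) with h | h
  · rw [kap_eq_zero h]
  · exact (kap_eq_zero le_rfl).symm.le.trans (kap_monotone h)

lemma kap_le_one (z : ℝ) : kap z ≤ 1 := by
  rcases le_total 1 z with h | h
  · rw [kap_eq_one h]
  · exact (kap_monotone h).trans kap_one.le

/-! ### Continuity of integrals against weakly continuous families of measures -/

/-- Weak convergence tests against a fixed function, while here the integrand moves with x. The
product of the Dirac mass at x with the normalized measure is a weakly continuous family of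
probability measures on X × ℝ, and against it the single function φ is integrated. Where the mass
vanishes, normalization is impossible and the bound B · mass replaces it. -/
lemma continuous_integral_finiteMeasure {X : Type*} [TopologicalSpace X]
    [TopologicalSpace.PseudoMetrizableSpace X] [SecondCountableTopology X]
    {m : X → FiniteMeasure ℝ} (hm : Continuous m)
    {φ : X → ℝ → ℝ} (hφ : Continuous (Function.uncurry φ)) {B : ℝ} (hB : ∀ x y, |φ x y| ≤ B) :
    Continuous fun x => ∫ y, φ x y ∂(m x : Measure ℝ) := by
  borelize X
  have hmass : Continuous fun x => (m x).mass := FiniteMeasure.continuous_mass.comp hm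
  rw [continuous_iff_continuousAt]
  intro x₀
  by_cases h0 : m x₀ = 0
  · have h1 : Tendsto (fun x => B * ((m x).mass : ℝ)) (𝓝 x₀) (𝓝 0) := by
      have : Tendsto (fun x => B * ((m x).mass : ℝ)) (𝓝 x₀) (𝓝 (B * ((m x₀).mass : ℝ))) :=
        ((NNReal.continuous_coe.comp hmass).tendsto x₀).const_mul B
      simpa [h0] using this
    have h2 : ∫ y, φ x₀ y ∂(m x₀ : Measure ℝ) = 0 := by simp [h0]
    rw [ContinuousAt, h2]
    refine squeeze_zero_norm (fun x => ?_) h1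
    have := norm_integral_le_of_norm_le_const (μ := (m x : Measure ℝ)) (f := φ x) (C := B)
      (Eventually.of_forall fun y => hB x y)
    exact this
  · have hne : ∀ᶠ x in 𝓝 x₀, m x ≠ 0 := by
      have h1 : (m x₀).mass ≠ 0 := by simpa using h0
      have := hmass.continuousAt.eventually_ne h1
      exact this.mono fun x hx => by simpa using hx
    have hnorm : Tendsto (fun x => (m x).normalize) (𝓝 x₀) (𝓝 (m x₀).normalize) :=
      FiniteMeasure.tendsto_normalize_of_tendsto (hm.tendsto x₀) h0
    have hprod : Tendsto (fun x => (diracProba x).prod (m x).normalize) (𝓝 x₀)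
        (𝓝 ((diracProba x₀).prod (m x₀).normalize)) :=
      (ProbabilityMeasure.continuous_prod.tendsto
        (diracProba x₀, (m x₀).normalize)).comp
          ((continuous_diracProba.tendsto x₀).prodMk_nhds hnorm)
    rw [ProbabilityMeasure.tendsto_iff_forall_integral_tendsto] at hprod
    have hB' : ∀ p : X × ℝ, ‖Function.uncurry φ p‖ ≤ B := fun p => hB p.1 p.2
    have h1 := hprod (BoundedContinuousFunction.ofNormedAddCommGroup (Function.uncurry φ) hφ B hB')
    have key : ∀ x, ∫ p, (BoundedContinuousFunction.ofNormedAddCommGroup (Function.uncurry φ) hφ B hB') p ∂((diracProba x).prod (m x).normalize : Measure (X × ℝ))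
        = ∫ y, φ x y ∂((m x).normalize : Measure ℝ) := by
      intro x
      have hint : Integrable (Function.uncurry φ)
          ((diracProba x : Measure X).prod ((m x).normalize : Measure ℝ)) :=
        Integrable.of_bound hφ.aestronglyMeasurable B (Eventually.of_forall fun p => hB p.1 p.2)
      have := integral_prod _ hint
      refine Eq.trans this ?_
      simp only [diracProba, ProbabilityMeasure.coe_mk, Function.uncurry]
      rw [integral_dirac' _ _ ?_]
      apply Continuous.stronglyMeasurable
      exact continuous_of_dominated (bound := fun _ => B)
        (fun x => (hφ.comp (by fun_prop : Continuous fun y => (x, y))).aestronglyMeasurable)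
        (fun x => Eventually.of_forall fun y => hB x y) (integrable_const _)
        (Eventually.of_forall fun y => hφ.comp (by fun_prop : Continuous fun x => (x, y)))
    simp only [key] at h1
    have h2 := ((NNReal.continuous_coe.comp hmass).tendsto x₀).mul h1
    have key2 : ∀ x, m x ≠ 0 → ((m x).mass : ℝ) * ∫ y, φ x y ∂((m x).normalize : Measure ℝ)
        = ∫ y, φ x y ∂(m x : Measure ℝ) := by
      intro x hx
      rw [FiniteMeasure.toMeasure_normalize_eq_of_nonzero _ hx]
      have : (m x).mass ≠ 0 := by simpa using hx
      rw [integral_smul_nnreal_measure, NNReal.smul_def, smul_eq_mul, NNReal.coe_inv,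
        mul_inv_cancel_left₀ (by exact_mod_cast this)]
    rw [ContinuousAt, ← key2 x₀ h0]
    refine h2.congr' ?_
    filter_upwards [hne] with x hx using key2 x hx

/-! ### Joint differentiability from partial derivatives -/

/-- The partial derivatives are required only near z because the functions to be used are
differentiable in time only for t > 0. -/
lemma contDiffAt_of_partial {φ φt φx : ℝ → ℝ → ℝ} {z : ℝ × ℝ}
    (ht : ∀ᶠ p in 𝓝 z, HasDerivAt (fun s => φ s p.2) (φt p.1 p.2) p.1)
    (hx : ∀ᶠ p in 𝓝 z, HasDerivAt (φ p.1) (φx p.1 p.2) p.2)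
    (hct : Continuous (Function.uncurry φt)) (hcx : Continuous (Function.uncurry φx)) :
    ContDiffAt ℝ 1 (Function.uncurry φ) z := by
  have hL : Continuous fun c : ℝ => ContinuousLinearMap.toSpanSingleton ℝ c :=
    (ContinuousLinearMap.toSpanSingletonCLE (𝕜 := ℝ) (E := ℝ)).continuous
  have h1 : Continuous fun p : ℝ × ℝ => ContinuousLinearMap.toSpanSingleton ℝ (φt p.1 p.2) :=
    hL.comp hct
  have h2 : Continuous fun p : ℝ × ℝ => ContinuousLinearMap.toSpanSingleton ℝ (φx p.1 p.2) :=
    hL.comp hcx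
  rw [contDiffAt_one_iff]
  refine ⟨fun p => (ContinuousLinearMap.toSpanSingleton ℝ (φt p.1 p.2)).coprod
    (ContinuousLinearMap.toSpanSingleton ℝ (φx p.1 p.2)), ?_⟩
  · have h : ∀ᶠ p in 𝓝 z, HasFDerivAt (Function.uncurry φ)
        ((ContinuousLinearMap.toSpanSingleton ℝ (φt p.1 p.2)).coprod
          (ContinuousLinearMap.toSpanSingleton ℝ (φx p.1 p.2))) p := by
      filter_upwards [ht.eventually_nhds, hx.eventually_nhds] with p hp1 hp2
      have := hasStrictFDerivAt_uncurry_coprod (𝕜 := ℝ) (u := p) (f := φ)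
        (f₁ := fun s y => ContinuousLinearMap.toSpanSingleton ℝ (φt s y))
        (f₂ := fun s y => ContinuousLinearMap.toSpanSingleton ℝ (φx s y))
        (hp1.mono fun v hv => hv.hasFDerivAt) (hp2.mono fun v hv => hv.hasFDerivAt)
        h1.continuousAt h2.continuousAt
      exact this.hasFDerivAt
    refine ⟨_, h, Continuous.continuousOn ?_, fun x hx => hx⟩
    exact (ContinuousLinearMap.coprodEquivL (S := ℝ) (𝕜 := ℝ) (E := ℝ) (F := ℝ)
      (G := ℝ)).continuous.comp (h1.prodMk h2)

/-! ### Trapezoidal cutoffs and weak derivatives -/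

/-- The sequence `1 / (n + 1)` of smoothing lengths. -/
noncomputable def eps (n : ℕ) : ℝ := 1 / ((n : ℝ) + 1)

lemma eps_pos (n : ℕ) : 0 < eps n := by unfold eps; positivity

lemma eps_le_one (n : ℕ) : eps n ≤ 1 := by
  unfold eps
  rw [div_le_one (by positivity)]
  linarith [Nat.cast_nonneg (α := ℝ) n]

lemma tendsto_eps : Tendsto eps atTop (𝓝 0) := tendsto_one_div_add_atTop_nhds_zero_nat

lemma eventually_eps_lt {δ : ℝ} (hδ : 0 < δ) : ∀ᶠ n in atTop, eps n < δ :=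
  tendsto_eps.eventually (gt_mem_nhds hδ)

lemma tendsto_kap_of_pos {u h : ℕ → ℝ} {l : ℝ} (hh : ∀ n, 0 < h n) (h0 : Tendsto h atTop (𝓝 0))
    (hu : Tendsto u atTop (𝓝 l)) (hl : 0 < l) : ∀ᶠ n in atTop, kap (u n / h n) = 1 := by
  filter_upwards [hu.eventually (lt_mem_nhds (half_lt_self hl)),
    h0.eventually (gt_mem_nhds (half_pos hl))] with n h1 h2
  exact kap_eq_one ((one_le_div (hh n)).2 (h2.le.trans h1.le))

lemma tendsto_kap_of_neg {u h : ℕ → ℝ} {l : ℝ} (hh : ∀ n, 0 < h n) (h0 : Tendsto h atTop (𝓝 0))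
    (hu : Tendsto u atTop (𝓝 l)) (hl : l < 0) : ∀ᶠ n in atTop, kap (u n / h n) = 0 := by
  filter_upwards [hu.eventually (gt_mem_nhds (by linarith : l < l / 2)),
    h0.eventually (gt_mem_nhds (by linarith : 0 < -l / 2))] with n h1 h2
  refine kap_eq_zero ((div_le_iff₀ (hh n)).2 ?_)
  linarith

/-- A smooth trapezoid approximating the indicator of `(c, d)` at scale `h`. -/
noncomputable def trap (c d h t : ℝ) : ℝ := kap ((t - c) / h) - kap ((t - d) / h)

lemma trap_contDiff (c d h : ℝ) : ContDiff ℝ ∞ (trap c d h) := by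
  unfold trap
  exact (kap_contDiff.comp (by fun_prop)).sub (kap_contDiff.comp (by fun_prop))

lemma trap_hasDerivAt (c d h t : ℝ) :
    HasDerivAt (trap c d h) (rho ((t - c) / h) / h - rho ((t - d) / h) / h) t := by
  have key : ∀ c, HasDerivAt (fun t => kap ((t - c) / h)) (rho ((t - c) / h) / h) t := fun c => by
    have := (kap_hasDerivAt ((t - c) / h)).comp t (((hasDerivAt_id t).sub_const c).div_const h)
    simpa [div_eq_mul_inv] using! this
  exact (key c).sub (key d)

lemma trap_abs_le (c d h t : ℝ) : |trap c d h t| ≤ 1 := by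
  rw [trap, abs_le]
  constructor <;> linarith [kap_nonneg ((t - c) / h), kap_nonneg ((t - d) / h),
    kap_le_one ((t - c) / h), kap_le_one ((t - d) / h)]

lemma trap_nonneg {c d h : ℝ} (hcd : c ≤ d) (hh : 0 < h) :
    0 ≤ trap c d h t :=
  sub_nonneg.2 (kap_monotone (by gcongr))

lemma trap_eq_zero {c d h t : ℝ} (hcd : c ≤ d) (hh : 0 < h) (ht : t ∉ Icc (c - h) (d + h)) :
    trap c d h t = 0 := by
  simp only [mem_Icc, not_and_or, not_le] at ht
  rcases ht with ht | ht
  · rw [trap, kap_eq_zero, kap_eq_zero, sub_self] <;> rw [div_le_iff₀ hh] <;> linarith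
  · rw [trap, kap_eq_one, kap_eq_one, sub_self] <;> rw [le_div_iff₀ hh] <;> linarith

lemma trap_tsupport {c d h : ℝ} (hcd : c ≤ d) (hh : 0 < h) :
    tsupport (trap c d h) ⊆ Icc (c - h) (d + h) :=
  closure_minimal (fun _ ht => by_contra fun h' => ht (trap_eq_zero hcd hh h')) isClosed_Icc

lemma trap_hasCompactSupport {c d h : ℝ} (hcd : c ≤ d) (hh : 0 < h) :
    HasCompactSupport (trap c d h) :=
  isCompact_Icc.of_isClosed_subset (isClosed_tsupport _) (trap_tsupport hcd hh)

lemma trap_eventually {c d t : ℝ} (h : t ≠ c) (h' : t ≠ d) (hcd : c ≤ d) :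
    ∀ᶠ n in atTop, trap c d (eps n) t = (Ioc c d).indicator 1 t := by
  rcases lt_or_gt_of_ne h with h | h
  · filter_upwards [tendsto_kap_of_neg eps_pos tendsto_eps (tendsto_const_nhds (x := t - c)) (by linarith),
      tendsto_kap_of_neg eps_pos tendsto_eps (tendsto_const_nhds (x := t - d)) (by linarith)] with n h1 h2
    rw [trap, h1, h2, indicator_of_notMem (fun hh => by linarith [hh.1]), sub_self]
  rcases lt_or_gt_of_ne h' with h' | h'
  · filter_upwards [tendsto_kap_of_pos eps_pos tendsto_eps (tendsto_const_nhds (x := t - c)) (by linarith),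
      tendsto_kap_of_neg eps_pos tendsto_eps (tendsto_const_nhds (x := t - d)) (by linarith)] with n h1 h2
    rw [trap, h1, h2, indicator_of_mem (show t ∈ Ioc c d from ⟨h, h'.le⟩), sub_zero, Pi.one_apply]
  · filter_upwards [tendsto_kap_of_pos eps_pos tendsto_eps (tendsto_const_nhds (x := t - c)) (by linarith),
      tendsto_kap_of_pos eps_pos tendsto_eps (tendsto_const_nhds (x := t - d)) (by linarith)] with n h1 h2
    rw [trap, h1, h2, indicator_of_notMem (fun hh => by linarith [hh.2]), sub_self]

lemma tendsto_integral_rho {f : ℝ → ℝ} (hf : Continuous f) (c : ℝ) :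
    Tendsto (fun n => ∫ t, rho ((t - c) / eps n) / eps n * f t) atTop (𝓝 (f c)) := by
  have h1 : ∀ n, ∫ t, rho ((t - c) / eps n) / eps n * f t = ∫ z, rho z * f (c + eps n * z) := by
    intro n
    have hn := eps_pos n
    have e1 := integral_sub_right_eq_self (μ := volume)
      (fun t => rho (t / eps n) / eps n * f (c + t)) c
    simp only [add_sub_cancel] at e1
    rw [e1]
    have e2 := Measure.integral_comp_div (fun z => rho z / eps n * f (c + eps n * z)) (eps n)
    simp only [mul_div_cancel₀ _ hn.ne'] at e2
    rw [e2, smul_eq_mul, ← integral_const_mul, abs_of_pos hn]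
    congr 1 with z
    field_simp
  simp only [h1]
  obtain ⟨B, hB⟩ := (isCompact_Icc (a := c - 1) (b := c + 1)).exists_bound_of_continuousOn
    hf.continuousOn
  have h2 : Tendsto (fun n => ∫ z, rho z * f (c + eps n * z)) atTop (𝓝 (∫ z, rho z * f c)) := by
    refine tendsto_integral_of_dominated_convergence (fun z => rho z * B)
      (fun n => (by fun_prop : Continuous fun z => rho z * f (c + eps n * z)).aestronglyMeasurable)
      (rho_integrable.mul_const B) (fun n => Eventually.of_forall fun z => ?_)
      (Eventually.of_forall fun z => ?_)
    · rcases le_or_gt 1 |z| with hz | hz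
      · simp [rho_eq_zero hz]
      · rw [norm_mul, Real.norm_of_nonneg (rho_nonneg z)]
        refine mul_le_mul_of_nonneg_left (hB _ ?_) (rho_nonneg z)
        have : |eps n * z| ≤ 1 := by
          rw [abs_mul, abs_of_pos (eps_pos n)]
          nlinarith [eps_pos n, eps_le_one n, abs_nonneg z]
        rw [abs_le] at this
        exact ⟨by linarith, by linarith⟩
    · have : Tendsto (fun n => c + eps n * z) atTop (𝓝 (c + 0 * z)) :=
        (tendsto_eps.mul_const z).const_add c
      rw [zero_mul, add_zero] at this
      exact ((hf.tendsto c).comp this).const_mul _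
  rwa [integral_mul_const, integral_rho, one_mul] at h2

/-- A trapezoid is an admissible test function, and its derivative is an approximate Dirac mass at c
minus one at d; letting its slopes become vertical gives the formula. It serves both for the time
evolution of energy integrals on (0,∞) and for u(t,·) in space. -/
lemma sub_eq_integral_of_weakDeriv {U : Set ℝ} (hU : IsOpen U) {c d : ℝ} (hcd : c ≤ d)
    (hI : Icc c d ⊆ U) {f g : ℝ → ℝ} (hf : Continuous f) (hg : LocallyIntegrableOn g U)
    (h : ∀ χ : ℝ → ℝ, ContDiff ℝ ∞ χ → HasCompactSupport χ → tsupport χ ⊆ U →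
      ∫ t, f t * deriv χ t = -∫ t, g t * χ t) :
    f d - f c = ∫ t in c..d, g t := by
  -- The trapezoid at scale `eps n` overhangs [c,d] by `eps n` on both sides, so some room inside U
  -- is needed.
  obtain ⟨δ, hδ, hδU⟩ : ∃ δ > 0, Icc (c - δ) (d + δ) ⊆ U := by
    obtain ⟨δ₁, h₁, h₁'⟩ := Metric.isOpen_iff.1 hU c (hI ⟨le_rfl, hcd⟩)
    obtain ⟨δ₂, h₂, h₂'⟩ := Metric.isOpen_iff.1 hU d (hI ⟨hcd, le_rfl⟩)
    refine ⟨min δ₁ δ₂ / 2, by positivity, fun t ht => ?_⟩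
    have m1 := min_le_left δ₁ δ₂
    have m2 := min_le_right δ₁ δ₂
    rcases lt_or_ge t c with h | h
    · exact h₁' (by rw [Metric.mem_ball, Real.dist_eq, abs_lt]; constructor <;> linarith [ht.1])
    rcases lt_or_ge d t with h' | h'
    · exact h₂' (by rw [Metric.mem_ball, Real.dist_eq, abs_lt]; constructor <;> linarith [ht.2])
    · exact hI ⟨h, h'⟩
  have hgi : IntegrableOn g (Icc (c - δ) (d + δ)) := hg.integrableOn_compact_subset hδU isCompact_Icc
  have key : ∀ᶠ n in atTop, (∫ t, rho ((t - c) / eps n) / eps n * f t)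
      - (∫ t, rho ((t - d) / eps n) / eps n * f t)
      = -∫ t in Icc (c - δ) (d + δ), g t * trap c d (eps n) t := by
    filter_upwards [eventually_eps_lt hδ] with n hn
    have hp := eps_pos n
    have hsub : tsupport (trap c d (eps n)) ⊆ Icc (c - δ) (d + δ) :=
      (trap_tsupport hcd hp).trans (Icc_subset_Icc (by linarith) (by linarith))
    have := h (trap c d (eps n)) (trap_contDiff _ _ _) (trap_hasCompactSupport hcd hp)
      (hsub.trans hδU)
    have hint : ∀ c, Integrable fun t => rho ((t - c) / eps n) / eps n * f t := fun c => by
      refine Continuous.integrable_of_hasCompactSupport (by fun_prop) ?_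
      refine HasCompactSupport.of_support_subset_isCompact
        (isCompact_Icc (a := c - eps n) (b := c + eps n)) fun t ht => ?_
      by_contra h'
      apply ht
      have : 1 ≤ |(t - c) / eps n| := by
        rw [abs_div, abs_of_pos hp, le_div_iff₀ hp, one_mul]
        by_contra h''
        rw [not_le, abs_lt] at h''
        exact h' ⟨by linarith, by linarith⟩
      simp [rho_eq_zero this]
    rw [← integral_sub (hint c) (hint d), setIntegral_eq_integral_of_forall_compl_eq_zero, ← this]
    · congr 1 with t
      rw [(trap_hasDerivAt c d (eps n) t).deriv]
      ring
    · intro t ht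
      rw [image_eq_zero_of_notMem_tsupport (fun h' => ht (hsub h')), mul_zero]
  have hlim := ((tendsto_integral_rho hf c).sub (tendsto_integral_rho hf d)).congr' key
  have hlim2 : Tendsto (fun n => -∫ t in Icc (c - δ) (d + δ), g t * trap c d (eps n) t) atTop
      (𝓝 (-∫ t in Icc (c - δ) (d + δ), g t * (Ioc c d).indicator 1 t)) := by
    refine Tendsto.neg (tendsto_integral_of_dominated_convergence (fun t => ‖g t‖)
      (fun n => hgi.1.mul (trap_contDiff _ _ _).continuous.aestronglyMeasurable) hgi.norm
      (fun n => Eventually.of_forall fun t => ?_) ?_)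
    · rw [norm_mul]
      exact mul_le_of_le_one_right (norm_nonneg _) (trap_abs_le _ _ _ _)
    · have h1 : ∀ᵐ t ∂(volume.restrict (Icc (c - δ) (d + δ))), t ≠ c :=
        ae_restrict_of_ae (Measure.ae_ne volume c)
      have h2 : ∀ᵐ t ∂(volume.restrict (Icc (c - δ) (d + δ))), t ≠ d :=
        ae_restrict_of_ae (Measure.ae_ne volume d)
      filter_upwards [h1, h2] with t ht ht'
      exact (tendsto_const_nhds.congr' ((trap_eventually ht ht' hcd).mono
        fun n hn => hn.symm)).const_mul _
  have hfin := tendsto_nhds_unique hlim hlim2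
  have : ∫ t in Icc (c - δ) (d + δ), g t * (Ioc c d).indicator 1 t = ∫ t in c..d, g t := by
    have : (fun t => g t * (Ioc c d).indicator 1 t) = (Ioc c d).indicator g := by
      ext t
      by_cases ht : t ∈ Ioc c d <;> simp [ht]
    rw [this, setIntegral_indicator measurableSet_Ioc, intervalIntegral.integral_of_le hcd,
      inter_eq_self_of_subset_right]
    intro t ht
    exact ⟨by linarith [ht.1], by linarith [ht.2]⟩
  rw [this] at hfin
  linarith

/-! ### Balance laws tested with bounded functions -/

/-- `φ(t,x)` is bounded and continuous, with bounded continuous partial derivatives `φt` and `φx`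
at positive times. -/
structure IsC1b (φ φt φx : ℝ → ℝ → ℝ) : Prop where
  dt : ∀ t, 0 < t → ∀ x, HasDerivAt (fun s => φ s x) (φt t x) t
  dx : ∀ t, 0 < t → ∀ x, HasDerivAt (φ t) (φx t x) x
  cont : Continuous (Function.uncurry φ)
  cont_t : Continuous (Function.uncurry φt)
  cont_x : Continuous (Function.uncurry φx)
  bdd : ∃ B : ℝ, ∀ t x, |φ t x| ≤ B ∧ |φt t x| ≤ B ∧ |φx t x| ≤ B

lemma Continuous.slice {f : ℝ → ℝ → ℝ} (hf : Continuous (Function.uncurry f)) (t : ℝ) :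
    Continuous (f t) :=
  hf.comp (by fun_prop : Continuous fun x : ℝ => (t, x))

lemma integrable_of_continuous_of_bdd {m : Measure ℝ} [IsFiniteMeasure m] {f : ℝ → ℝ}
    (hf : Continuous f) {B : ℝ} (hB : ∀ x, |f x| ≤ B) : Integrable f m :=
  Integrable.of_bound hf.aestronglyMeasurable B (Eventually.of_forall hB)

namespace IsC1b

variable {φ φt φx ψ ψt ψx : ℝ → ℝ → ℝ}

lemma mul (hφ : IsC1b φ φt φx) (hψ : IsC1b ψ ψt ψx) :
    IsC1b (fun t x => φ t x * ψ t x) (fun t x => φt t x * ψ t x + φ t x * ψt t x)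
      (fun t x => φx t x * ψ t x + φ t x * ψx t x) := by
  refine ⟨fun t ht x => (hφ.dt t ht x).mul (hψ.dt t ht x),
    fun t ht x => (hφ.dx t ht x).mul (hψ.dx t ht x),
    hφ.cont.mul hψ.cont, (hφ.cont_t.mul hψ.cont).add (hφ.cont.mul hψ.cont_t),
    (hφ.cont_x.mul hψ.cont).add (hφ.cont.mul hψ.cont_x), ?_⟩
  obtain ⟨B, hB⟩ := hφ.bdd
  obtain ⟨C, hC⟩ := hψ.bdd
  have hB0 : 0 ≤ B := (abs_nonneg _).trans (hB 0 0).1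
  have hC0 : 0 ≤ C := (abs_nonneg _).trans (hC 0 0).1
  have key : ∀ {p q}, |p| ≤ B → |q| ≤ C → |p * q| ≤ B * C := fun h1 h2 => by
    rw [abs_mul]; exact mul_le_mul h1 h2 (abs_nonneg _) hB0
  refine ⟨2 * (B * C), fun t x => ⟨?_, ?_, ?_⟩⟩
  · have := key (hB t x).1 (hC t x).1
    nlinarith [mul_nonneg hB0 hC0]
  · exact (abs_add_le _ _).trans (by
      have := key (hB t x).2.1 (hC t x).1
      have := key (hB t x).1 (hC t x).2.1
      linarith)
  · exact (abs_add_le _ _).trans (by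
      have := key (hB t x).2.2 (hC t x).1
      have := key (hB t x).1 (hC t x).2.2
      linarith)

lemma of_space {ψ ψ' : ℝ → ℝ} (h : ∀ x, HasDerivAt ψ (ψ' x) x) (hc : Continuous ψ') {B : ℝ}
    (hB : ∀ x, |ψ x| ≤ B ∧ |ψ' x| ≤ B) :
    IsC1b (fun _ x => ψ x) (fun _ _ => 0) (fun _ x => ψ' x) where
  dt t _ x := hasDerivAt_const t (ψ x)
  dx _ _ x := h x
  cont := (continuous_iff_continuousAt.2 fun x => (h x).continuousAt).comp continuous_snd
  cont_t := continuous_const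
  cont_x := hc.comp continuous_snd
  bdd := ⟨B, fun _ x => ⟨(hB x).1, by simpa using (abs_nonneg _).trans (hB x).1, (hB x).2⟩⟩

/-- The factor χ confines the product to positive times, where φ is C¹; away from the support of χ
the product vanishes identically. -/
lemma isTest (hφ : IsC1b φ φt φx) {r : ℝ} (hr : ∀ t x, r < |x| → φ t x = 0) {χ : ℝ → ℝ}
    (hχ : ContDiff ℝ ∞ χ) (hχc : HasCompactSupport χ) (hχs : tsupport χ ⊆ Ioi 0) :
    IsTest fun t x => χ t * φ t x := by
  have hsupp : tsupport (Function.uncurry fun t x => χ t * φ t x) ⊆ tsupport χ ×ˢ Icc (-r) r := by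
    refine closure_minimal (fun p hp => ⟨subset_tsupport _ ?_, ?_⟩)
      ((isClosed_tsupport _).prod isClosed_Icc)
    · exact fun h => hp (by simp [Function.uncurry, h])
    · refine abs_le.1 ?_
      by_contra h
      exact hp (by simp [Function.uncurry, hr p.1 p.2 (not_le.1 h)])
  refine ⟨contDiff_iff_contDiffAt.2 fun z => ?_,
    (hχc.prod isCompact_Icc).of_isClosed_subset (isClosed_tsupport _) hsupp,
    hsupp.trans (prod_mono hχs (subset_univ _))⟩
  by_cases hz : z.1 ∈ tsupport χ
  · have hpos : ∀ᶠ p : ℝ × ℝ in 𝓝 z, 0 < p.1 :=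
      continuous_fst.continuousAt.eventually (lt_mem_nhds (hχs hz))
    have h1 : ContDiffAt ℝ 1 (Function.uncurry φ) z :=
      contDiffAt_of_partial (hpos.mono fun p hp => hφ.dt p.1 hp p.2)
        (hpos.mono fun p hp => hφ.dx p.1 hp p.2) hφ.cont_t hφ.cont_x
    have h2 : ContDiffAt ℝ 1 (fun p : ℝ × ℝ => χ p.1) z :=
      ((hχ.of_le (by simp)).comp contDiff_fst).contDiffAt
    exact h2.mul h1
  · have : ∀ᶠ p : ℝ × ℝ in 𝓝 z, χ p.1 = 0 :=
      continuous_fst.continuousAt.eventually (notMem_tsupport_iff_eventuallyEq.1 hz)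
    exact contDiffAt_const.congr_of_eventuallyEq (f := fun _ => (0 : ℝ))
      (this.mono fun p hp => by simp [Function.uncurry, hp])

end IsC1b

lemma restrict_Ioi_prod_univ (s : Set ℝ) :
    (volume : Measure (ℝ × ℝ)).restrict (s ×ˢ univ) = (volume.restrict s).prod volume := by
  rw [Measure.volume_eq_prod, ← Measure.prod_restrict, Measure.restrict_univ]

lemma integrable_mul_of_compact_support {g : ℝ → ℝ → ℝ}
    (hg : LocallyIntegrableOn (fun z : ℝ × ℝ => g z.1 z.2) (Ioi 0 ×ˢ univ)) {φ : ℝ → ℝ → ℝ}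
    (hφ : Continuous (Function.uncurry φ)) {r : ℝ} (hr : ∀ t x, r < |x| → φ t x = 0)
    {K : Set ℝ} (hK : IsCompact K) (hK0 : K ⊆ Ioi 0) :
    Integrable (fun z : ℝ × ℝ => g z.1 z.2 * φ z.1 z.2) ((volume.restrict K).prod volume) := by
  have h1 : IntegrableOn (fun z : ℝ × ℝ => g z.1 z.2) (K ×ˢ Icc (-r) r) :=
    hg.integrableOn_compact_subset (prod_mono hK0 (subset_univ _)) (hK.prod isCompact_Icc)
  obtain ⟨B, hB⟩ := (hK.prod (isCompact_Icc (a := -r) (b := r))).exists_bound_of_continuousOn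
    hφ.continuousOn
  have hms : MeasurableSet (K ×ˢ Icc (-r) r) := hK.measurableSet.prod measurableSet_Icc
  have h2 : IntegrableOn (fun z : ℝ × ℝ => g z.1 z.2 * φ z.1 z.2) (K ×ˢ Icc (-r) r) :=
    h1.mul_bdd (c := B) hφ.aestronglyMeasurable ((ae_restrict_mem hms).mono fun z hz => hB z hz)
  rw [← restrict_Ioi_prod_univ, ← IntegrableOn]
  have hms' : MeasurableSet (K ×ˢ (univ : Set ℝ)) := hK.measurableSet.prod MeasurableSet.univ
  refine h2.of_forall_sdiff_eq_zero hms' fun z hz => ?_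
  rw [hr, mul_zero]
  by_contra h
  rw [not_lt, abs_le] at h
  exact hz.2 ⟨hz.1.1, h⟩

/-- Testing with χ(t) φ(t,x) for arbitrary χ says that t ↦ ∫ φ dm^t has an integrable weak
derivative on compact subsets of (0,∞). As this function is continuous,
`sub_eq_integral_of_weakDeriv` gives the identity for every pair of positive times and not only
almost every pair. -/
lemma balance_of_compact {m : ℝ → FiniteMeasure ℝ} (hm : Continuous m) {a g : ℝ → ℝ → ℝ}
    (ha : Continuous (Function.uncurry a)) {Λ : ℝ} (haΛ : ∀ t x, |a t x| ≤ Λ)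
    (hg : LocallyIntegrableOn (fun z : ℝ × ℝ => g z.1 z.2) (Ioi 0 ×ˢ univ))
    (hbal : IsMeasureSolution m a g) {φ φt φx : ℝ → ℝ → ℝ} (hφ : IsC1b φ φt φx)
    {r : ℝ} (hr : ∀ t x, r < |x| → φ t x = 0) {t₁ t₂ : ℝ} (h₁ : 0 < t₁) (h₁₂ : t₁ ≤ t₂) :
    (∫ x, φ t₂ x ∂(m t₂ : Measure ℝ)) - ∫ x, φ t₁ x ∂(m t₁ : Measure ℝ)
      = (∫ s in t₁..t₂, ∫ x, (φt s x + a s x * φx s x) ∂(m s : Measure ℝ))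
        + ∫ s in t₁..t₂, ∫ x, g s x * φ s x := by
  obtain ⟨B, hB⟩ := hφ.bdd
  have hB0 : 0 ≤ B := (abs_nonneg _).trans (hB 0 0).1
  have hΛ0 : 0 ≤ Λ := (abs_nonneg _).trans (haΛ 0 0)
  have hFb : ∀ s x, |φt s x + a s x * φx s x| ≤ B + Λ * B := fun s x => by
    refine (abs_add_le _ _).trans (add_le_add (hB s x).2.1 ?_)
    rw [abs_mul]
    exact mul_le_mul (haΛ s x) (hB s x).2.2 (abs_nonneg _) hΛ0
  have hFc : Continuous (Function.uncurry fun s x => φt s x + a s x * φx s x) :=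
    hφ.cont_t.add (ha.mul hφ.cont_x)
  have hf := continuous_integral_finiteMeasure hm hφ.cont fun t x => (hB t x).1
  have hF := continuous_integral_finiteMeasure hm hFc hFb
  have hGloc : LocallyIntegrableOn (fun s => ∫ x, g s x * φ s x) (Ioi 0) := by
    rw [locallyIntegrableOn_iff isOpen_Ioi.isLocallyClosed]
    exact fun K hK0 hK => (integrable_mul_of_compact_support hg hφ.cont hr hK hK0).integral_prod_left
  have key := sub_eq_integral_of_weakDeriv (U := Ioi 0) isOpen_Ioi h₁₂
    (fun t ht => h₁.trans_le ht.1) hf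
    (hF.locallyIntegrable.locallyIntegrableOn (Ioi 0) |>.add hGloc) ?_
  · rw [key]
    refine intervalIntegral.integral_add (hF.intervalIntegrable _ _) ?_
    rw [intervalIntegrable_iff_integrableOn_Icc_of_le h₁₂]
    exact hGloc.integrableOn_compact_subset (fun t ht => h₁.trans_le ht.1) isCompact_Icc
  · intro χ hχ hχc hχs
    have h0 := hbal _ (hφ.isTest hr hχ hχc hχs)
    have hχd : ∀ t, HasDerivAt χ (deriv χ t) t := fun t =>
      ((hχ.differentiable (by simp)) t).hasDerivAt
    have hχ0 : ∀ t, t ∉ Ioi (0 : ℝ) → χ t = 0 := fun t ht =>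
      image_eq_zero_of_notMem_tsupport fun h => ht (hχs h)
    have hdχ0 : ∀ t, t ∉ Ioi (0 : ℝ) → deriv χ t = 0 := fun t ht =>
      image_eq_zero_of_notMem_tsupport fun h => ht (hχs (tsupport_deriv_subset h))
    have e1 : ∫ t in Ioi (0 : ℝ), ∫ x, (pd1 (fun t x => χ t * φ t x) t x
        + a t x * pd2 (fun t x => χ t * φ t x) t x) ∂(m t : Measure ℝ)
        = ∫ t in Ioi (0 : ℝ), (deriv χ t * (∫ x, φ t x ∂(m t : Measure ℝ))
          + χ t * ∫ x, (φt t x + a t x * φx t x) ∂(m t : Measure ℝ)) := by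
      refine setIntegral_congr_fun measurableSet_Ioi fun t ht => ?_
      rw [← integral_const_mul, ← integral_const_mul, ← integral_add]
      · congr 1 with x
        have d1 : pd1 (fun t x => χ t * φ t x) t x = deriv χ t * φ t x + χ t * φt t x :=
          ((hχd t).mul (hφ.dt t ht x)).deriv
        have d2 : pd2 (fun t x => χ t * φ t x) t x = χ t * φx t x :=
          ((hφ.dx t ht x).const_mul (χ t)).deriv
        rw [d1, d2]
        ring
      · exact (integrable_of_continuous_of_bdd (hφ.cont.slice t) fun x => (hB t x).1).const_mul _
      · exact (integrable_of_continuous_of_bdd (hFc.slice t) fun x => hFb t x).const_mul _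
    have e2 : ∫ z in Ioi (0 : ℝ) ×ˢ (univ : Set ℝ), g z.1 z.2 * (χ z.1 * φ z.1 z.2)
        = ∫ t, χ t * ∫ x, g t x * φ t x := by
      have hint := integrable_mul_of_compact_support hg (φ := fun t x => χ t * φ t x)
        ((hχ.continuous.comp continuous_fst).mul hφ.cont) (r := r) (fun t x h => by simp [hr t x h])
        hχc hχs
      have hsub : tsupport χ ×ˢ (univ : Set ℝ) ⊆ Ioi (0 : ℝ) ×ˢ (univ : Set ℝ) :=
        prod_mono hχs le_rfl
      rw [setIntegral_eq_of_subset_of_forall_sdiff_eq_zero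
        (measurableSet_Ioi.prod MeasurableSet.univ) hsub, restrict_Ioi_prod_univ,
        integral_prod _ hint]
      · have e5 : ∀ t, ∫ x, g t x * (χ t * φ t x) = χ t * ∫ x, g t x * φ t x := fun t => by
          rw [← integral_const_mul]
          congr 1 with x
          ring
        simp only [e5]
        exact setIntegral_eq_integral_of_forall_compl_eq_zero fun t ht => by
          rw [image_eq_zero_of_notMem_tsupport ht, zero_mul]
      · intro z hz
        rw [image_eq_zero_of_notMem_tsupport (fun h => hz.2 ⟨h, mem_univ _⟩), zero_mul, mul_zero]
    rw [e1, e2, setIntegral_eq_integral_of_forall_compl_eq_zero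
      (fun t ht => by rw [hχ0 t ht, hdχ0 t ht]; ring), integral_add] at h0
    · have e3 : ∫ t, ((fun s => ∫ x, (φt s x + a s x * φx s x) ∂(m s : Measure ℝ))
          + fun s => ∫ x, g s x * φ s x) t * χ t
          = (∫ t, χ t * ∫ x, (φt t x + a t x * φx t x) ∂(m t : Measure ℝ))
            + ∫ t, χ t * ∫ x, g t x * φ t x := by
        rw [← integral_add]
        · congr 1 with t
          simp only [Pi.add_apply]
          ring
        · exact (hχ.continuous.mul hF).integrable_of_hasCompactSupport hχc.mul_right
        · rw [← integrableOn_iff_integrable_of_support_subset (s := tsupport χ)]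
          · exact (hGloc.integrableOn_compact_subset hχs hχc).continuousOn_mul
              hχ.continuous.continuousOn hχc
          · exact fun t ht => subset_tsupport _ fun h => ht (by simp [h])
      rw [e3]
      have e4 : ∫ t, (∫ x, φ t x ∂(m t : Measure ℝ)) * deriv χ t
          = ∫ t, deriv χ t * ∫ x, φ t x ∂(m t : Measure ℝ) := by
        congr 1 with t; ring
      rw [e4]
      linarith
    · exact ((hχ.continuous_deriv (by simp)).mul hf).integrable_of_hasCompactSupport
        hχc.deriv.mul_right
    · exact (hχ.continuous.mul hF).integrable_of_hasCompactSupport hχc.mul_right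

/-! ### Spatial cutoffs -/

/-- A cutoff equal to `1` on `[-L, L]` and vanishing outside `[-3L, 3L]`. -/
noncomputable def cut (L x : ℝ) : ℝ := trap (-(2 * L)) (2 * L) L x

/-- The derivative of `cut L`. -/
noncomputable def cut' (L x : ℝ) : ℝ :=
  rho ((x - -(2 * L)) / L) / L - rho ((x - 2 * L) / L) / L

lemma cut_hasDerivAt (L x : ℝ) : HasDerivAt (cut L) (cut' L x) x := trap_hasDerivAt _ _ _ _

@[fun_prop]
lemma cut_continuous (L : ℝ) : Continuous (cut L) := (trap_contDiff _ _ _).continuous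

@[fun_prop]
lemma cut'_continuous (L : ℝ) : Continuous (cut' L) := by unfold cut'; fun_prop

lemma cut_nonneg {L : ℝ} (hL : 0 < L) (x : ℝ) : 0 ≤ cut L x := trap_nonneg (by linarith) hL

lemma cut_abs_le (L x : ℝ) : |cut L x| ≤ 1 := trap_abs_le _ _ _ _

lemma cut_le_one (L x : ℝ) : cut L x ≤ 1 := (le_abs_self _).trans (cut_abs_le L x)

lemma cut_eq_one {L x : ℝ} (hL : 0 < L) (hx : |x| ≤ L) : cut L x = 1 := by
  rw [abs_le] at hx
  rw [cut, trap, kap_eq_one, kap_eq_zero, sub_zero]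
  · rw [div_le_iff₀ hL]; linarith
  · rw [le_div_iff₀ hL]; linarith

lemma cut_eq_zero {L x : ℝ} (hL : 0 < L) (hx : 3 * L < |x|) : cut L x = 0 := by
  refine trap_eq_zero (by linarith) hL fun h => ?_
  have : |x| ≤ 3 * L := abs_le.2 ⟨by linarith [h.1], by linarith [h.2]⟩
  linarith

lemma cut'_abs_le {L : ℝ} (hL : 0 < L) (x : ℝ) : |cut' L x| ≤ 1 / L := by
  have key : ∀ z, 0 ≤ rho z / L ∧ rho z / L ≤ 1 / L := fun z =>
    ⟨div_nonneg (rho_nonneg z) hL.le, by gcongr; exact rho_le_one z⟩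
  rw [cut', abs_le]
  constructor <;> linarith [(key ((x - -(2 * L)) / L)).1, (key ((x - -(2 * L)) / L)).2,
    (key ((x - 2 * L) / L)).1, (key ((x - 2 * L) / L)).2]

lemma cut_sub_abs_le {L : ℝ} (hL : 0 < L) (x y : ℝ) : |cut L x - cut L y| ≤ 1 / L * |x - y| := by
  have := Convex.norm_image_sub_le_of_norm_hasDerivWithin_le (f := cut L) (s := univ)
    (fun x _ => (cut_hasDerivAt L x).hasDerivWithinAt) (fun x _ => cut'_abs_le hL x) convex_univ
    (mem_univ y) (mem_univ x)
  simpa using this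

lemma tendsto_cut (x : ℝ) : Tendsto (fun n : ℕ => cut ((n : ℝ) + 1) x) atTop (𝓝 1) := by
  obtain ⟨N, hN⟩ := exists_nat_ge |x|
  refine tendsto_const_nhds.congr' ?_
  filter_upwards [eventually_ge_atTop N] with n hn
  have : (N : ℝ) ≤ n := by exact_mod_cast hn
  exact (cut_eq_one (by positivity) (by linarith)).symm

lemma tendsto_cut' (x : ℝ) : Tendsto (fun n : ℕ => cut' ((n : ℝ) + 1) x) atTop (𝓝 0) :=
  squeeze_zero_norm (fun n => cut'_abs_le (by positivity) x) tendsto_one_div_add_atTop_nhds_zero_nat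

lemma isC1b_cut {L : ℝ} (hL : 1 ≤ L) :
    IsC1b (fun _ x => cut L x) (fun _ _ => 0) (fun _ x => cut' L x) :=
  IsC1b.of_space (cut_hasDerivAt L) (cut'_continuous L) (B := 1) fun x =>
    ⟨cut_abs_le L x, (cut'_abs_le (by linarith) x).trans (by rw [div_le_one] <;> linarith)⟩

/-! ### Passage to the limit in iterated integrals -/

lemma integral_abs_le_of_bdd {m : FiniteMeasure ℝ} {f : ℝ → ℝ} {B E : ℝ} (hB0 : 0 ≤ B)
    (hB : ∀ x, |f x| ≤ B) (hE : (m : Measure ℝ).real univ ≤ E) :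
    |∫ x, f x ∂(m : Measure ℝ)| ≤ B * E :=
  (norm_integral_le_of_norm_le_const (f := f) (Eventually.of_forall hB)).trans
    (mul_le_mul_of_nonneg_left hE hB0)

lemma tendsto_integral_finiteMeasure {m : FiniteMeasure ℝ} {F : ℕ → ℝ → ℝ} {G : ℝ → ℝ}
    (hF : ∀ n, Continuous (F n)) {B : ℝ} (hB : ∀ n x, |F n x| ≤ B)
    (hlim : ∀ x, Tendsto (fun n => F n x) atTop (𝓝 (G x))) :
    Tendsto (fun n => ∫ x, F n x ∂(m : Measure ℝ)) atTop (𝓝 (∫ x, G x ∂(m : Measure ℝ))) :=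
  tendsto_integral_of_dominated_convergence (fun _ => B)
    (fun n => (hF n).aestronglyMeasurable) (integrable_const _)
    (fun n => Eventually.of_forall (hB n)) (Eventually.of_forall hlim)

lemma tendsto_iterated_integral {m : ℝ → FiniteMeasure ℝ} (hm : Continuous m) {E : ℝ}
    (hE : ∀ t, (m t : Measure ℝ).real univ ≤ E) {F : ℕ → ℝ → ℝ → ℝ} {G : ℝ → ℝ → ℝ}
    (hF : ∀ n, Continuous (Function.uncurry (F n))) {B : ℝ} (hB : ∀ n s x, |F n s x| ≤ B)
    {t₁ t₂ : ℝ} (h₁₂ : t₁ ≤ t₂)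
    (hlim : ∀ s ∈ Ioc t₁ t₂, ∀ x, Tendsto (fun n => F n s x) atTop (𝓝 (G s x))) :
    Tendsto (fun n => ∫ s in t₁..t₂, ∫ x, F n s x ∂(m s : Measure ℝ)) atTop
      (𝓝 (∫ s in t₁..t₂, ∫ x, G s x ∂(m s : Measure ℝ))) := by
  have hB0 : 0 ≤ B := (abs_nonneg _).trans (hB 0 0 0)
  refine intervalIntegral.tendsto_integral_filter_of_dominated_convergence (fun _ => B * E)
    (Eventually.of_forall fun n => (continuous_integral_finiteMeasure hm (hF n)
      (hB n)).aestronglyMeasurable)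
    (Eventually.of_forall fun n => Eventually.of_forall fun s _ =>
      integral_abs_le_of_bdd hB0 (hB n s) (hE s)) (by simp) (Eventually.of_forall fun s hs => ?_)
  rw [uIoc_of_le h₁₂] at hs
  exact tendsto_integral_finiteMeasure (fun n => (hF n).slice s) (fun n => hB n s) (hlim s hs)

/-- The source is integrable on bounded time intervals. -/
def SourceIntegrable (g : ℝ → ℝ → ℝ) : Prop :=
  ∀ T : ℝ, Integrable (Function.uncurry g) ((volume.restrict (Ioc 0 T)).prod volume)

namespace SourceIntegrable

variable {g : ℝ → ℝ → ℝ}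

lemma ae_slice (hg : SourceIntegrable g) (T : ℝ) :
    ∀ᵐ s ∂(volume.restrict (Ioc 0 T)), Integrable (g s) := (hg T).prod_right_ae

lemma norm_slice (hg : SourceIntegrable g) (T : ℝ) :
    Integrable (fun s => ∫ x, |g s x|) (volume.restrict (Ioc 0 T)) :=
  (hg T).norm.integral_prod_left

lemma mul_bdd (hg : SourceIntegrable g) {φ : ℝ → ℝ → ℝ} (hφ : Measurable (Function.uncurry φ))
    {B : ℝ} (hB : ∀ s x, |φ s x| ≤ B) : SourceIntegrable fun s x => g s x * φ s x := fun T =>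
  (hg T).mul_bdd (c := B) hφ.aestronglyMeasurable (Eventually.of_forall fun z => hB z.1 z.2)

lemma intervalIntegrable (hg : SourceIntegrable g) {φ : ℝ → ℝ → ℝ}
    (hφ : Measurable (Function.uncurry φ)) {B : ℝ} (hB : ∀ s x, |φ s x| ≤ B) {t₁ t₂ : ℝ}
    (h₁ : 0 ≤ t₁) (h₁₂ : t₁ ≤ t₂) :
    IntervalIntegrable (fun s => ∫ x, g s x * φ s x) volume t₁ t₂ := by
  rw [intervalIntegrable_iff_integrableOn_Ioc_of_le h₁₂]
  have : IntegrableOn (fun s => ∫ x, g s x * φ s x) (Ioc 0 t₂) :=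
    (hg.mul_bdd hφ hB t₂).integral_prod_left
  exact this.mono_set (Ioc_subset_Ioc_left h₁)

lemma tendsto_integral (hg : SourceIntegrable g) {F : ℕ → ℝ → ℝ → ℝ} {G : ℝ → ℝ → ℝ}
    (hF : ∀ n, Measurable (Function.uncurry (F n))) {B : ℝ} (hB : ∀ n s x, |F n s x| ≤ B)
    {t₁ t₂ : ℝ} (h₁ : 0 ≤ t₁) (h₁₂ : t₁ ≤ t₂)
    (hlim : ∀ s ∈ Ioc t₁ t₂, ∀ᵐ x, Tendsto (fun n => F n s x) atTop (𝓝 (G s x))) :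
    Tendsto (fun n => ∫ s in t₁..t₂, ∫ x, g s x * F n s x) atTop
      (𝓝 (∫ s in t₁..t₂, ∫ x, g s x * G s x)) := by
  have hae : ∀ᵐ s, s ∈ Ioc t₁ t₂ → Integrable (g s) := by
    have := hg.ae_slice t₂
    rw [ae_restrict_iff' measurableSet_Ioc] at this
    filter_upwards [this] with s hs h using hs ⟨h₁.trans_lt h.1, h.2⟩
  have hbd : ∀ n s x, ‖g s x * F n s x‖ ≤ |g s x| * B := fun n s x => by
    rw [norm_mul]
    exact mul_le_mul_of_nonneg_left (hB n s x) (abs_nonneg _)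
  have hslice : ∀ n s, Measurable (F n s) := fun n s =>
    (hF n).comp (measurable_const.prodMk measurable_id)
  refine intervalIntegral.tendsto_integral_filter_of_dominated_convergence
    (fun s => ∫ x, |g s x| * B)
    (Eventually.of_forall fun n => ?_) (Eventually.of_forall fun n => ?_) ?_ ?_
  · rw [uIoc_of_le h₁₂]
    exact (hg.intervalIntegrable (hF n) (hB n) h₁ h₁₂).1.aestronglyMeasurable
  · filter_upwards [hae] with s hs h
    rw [uIoc_of_le h₁₂] at h
    have hi := hs h
    refine (norm_integral_le_integral_norm _).trans (integral_mono_of_nonneg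
      (Eventually.of_forall fun x => norm_nonneg _) (hi.abs.mul_const B)
      (Eventually.of_forall fun x => hbd n s x))
  · have : IntervalIntegrable (fun s => ∫ x, |g s x| * B) volume t₁ t₂ := by
      simp only [integral_mul_const]
      refine IntervalIntegrable.mul_const ?_ B
      rw [intervalIntegrable_iff_integrableOn_Ioc_of_le h₁₂]
      exact IntegrableOn.mono_set (hg.norm_slice t₂) (Ioc_subset_Ioc_left h₁)
    exact this
  · filter_upwards [hae] with s hs h
    rw [uIoc_of_le h₁₂] at h
    have hi := hs h
    refine tendsto_integral_of_dominated_convergence (fun x => |g s x| * B)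
      (fun n => hi.aestronglyMeasurable.mul (hslice n s).aestronglyMeasurable)
      (hi.abs.mul_const B) (fun n => Eventually.of_forall fun x => hbd n s x) ?_
    filter_upwards [hlim s h] with x hx using hx.const_mul _

end SourceIntegrable

/-- Spatial cutoffs at scale n + 1 have derivatives of size 1/(n+1), so they disappear in the limit
by dominated convergence; for the source this uses integrability over the whole line. -/
lemma balance_global_of_pos {m : ℝ → FiniteMeasure ℝ} (hm : Continuous m) {E : ℝ}
    (hE : ∀ t, (m t : Measure ℝ).real univ ≤ E) {a g : ℝ → ℝ → ℝ}
    (ha : Continuous (Function.uncurry a)) {Λ : ℝ} (haΛ : ∀ t x, |a t x| ≤ Λ)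
    (hgl : LocallyIntegrableOn (fun z : ℝ × ℝ => g z.1 z.2) (Ioi 0 ×ˢ univ))
    (hg : SourceIntegrable g) (hbal : IsMeasureSolution m a g) {φ φt φx : ℝ → ℝ → ℝ}
    (hφ : IsC1b φ φt φx) {t₁ t₂ : ℝ} (h₁ : 0 < t₁) (h₁₂ : t₁ ≤ t₂) :
    (∫ x, φ t₂ x ∂(m t₂ : Measure ℝ)) - ∫ x, φ t₁ x ∂(m t₁ : Measure ℝ)
      = (∫ s in t₁..t₂, ∫ x, (φt s x + a s x * φx s x) ∂(m s : Measure ℝ))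
        + ∫ s in t₁..t₂, ∫ x, g s x * φ s x := by
  obtain ⟨B, hB⟩ := hφ.bdd
  have hB0 : 0 ≤ B := (abs_nonneg _).trans (hB 0 0).1
  have hΛ0 : 0 ≤ Λ := (abs_nonneg _).trans (haΛ 0 0)
  have h1n : ∀ n : ℕ, (1 : ℝ) ≤ (n : ℝ) + 1 := fun n => by linarith [Nat.cast_nonneg (α := ℝ) n]
  have hψ := fun n : ℕ => (isC1b_cut (h1n n)).mul hφ
  have key := fun n : ℕ => balance_of_compact hm ha haΛ hgl hbal (hψ n)
    (r := 3 * ((n : ℝ) + 1)) (fun t x h => by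
      simp [cut_eq_zero (by linarith [h1n n] : (0 : ℝ) < (n : ℝ) + 1) h]) h₁ h₁₂
  have hcutb : ∀ (n : ℕ) {y x c : ℝ}, |y| ≤ c → |cut ((n : ℝ) + 1) x * y| ≤ c := fun n y x c h => by
    rw [abs_mul]
    exact (mul_le_of_le_one_left (abs_nonneg _) (cut_abs_le _ _)).trans h
  have hcutb' : ∀ (n : ℕ) {y x c : ℝ}, |y| ≤ c → |cut' ((n : ℝ) + 1) x * y| ≤ c :=
    fun n y x c h => by
      rw [abs_mul]
      refine (mul_le_of_le_one_left (abs_nonneg _) ((cut'_abs_le (by linarith [h1n n]) _).trans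
        ?_)).trans h
      rw [div_le_one (by linarith [h1n n])]
      exact h1n n
  have hl : ∀ t, Tendsto (fun n : ℕ => ∫ x, cut ((n : ℝ) + 1) x * φ t x ∂(m t : Measure ℝ)) atTop
      (𝓝 (∫ x, φ t x ∂(m t : Measure ℝ))) := fun t =>
    tendsto_integral_finiteMeasure (fun n => (hψ n).cont.slice t)
      (fun n x => hcutb n (hB t x).1) fun x => by simpa using (tendsto_cut x).mul_const (φ t x)
  refine tendsto_nhds_unique ((hl t₂).sub (hl t₁)) ?_
  simp only [key]
  refine Tendsto.add (tendsto_iterated_integral hm hE (B := B + Λ * (B + B))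
    (F := fun n s x => (0 * φ s x + cut ((n : ℝ) + 1) x * φt s x)
      + a s x * (cut' ((n : ℝ) + 1) x * φ s x + cut ((n : ℝ) + 1) x * φx s x))
    (fun n => (hψ n).cont_t.add (ha.mul (hψ n).cont_x)) (fun n s x => ?_) h₁₂ fun s _ x => ?_)
    (hg.tendsto_integral (fun n => (hψ n).cont.measurable)
      (fun n s x => hcutb n (hB s x).1) h₁.le h₁₂ fun s _ => Eventually.of_forall fun x => by
        simpa using (tendsto_cut x).mul_const (φ s x))
  · refine (abs_add_le _ _).trans (add_le_add ?_ ?_)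
    · rw [zero_mul, zero_add]
      exact hcutb n (hB s x).2.1
    · rw [abs_mul]
      exact mul_le_mul (haΛ s x) ((abs_add_le _ _).trans
        (add_le_add (hcutb' n (hB s x).1) (hcutb n (hB s x).2.2))) (abs_nonneg _) hΛ0
  · have e1 := (tendsto_cut x).mul_const (φt s x)
    have e2 := (tendsto_cut' x).mul_const (φ s x)
    have e3 := (tendsto_cut x).mul_const (φx s x)
    have := (e1.const_add (0 * φ s x)).add ((e2.add e3).const_mul (a s x))
    simpa using this

/-- The time t₁ = 0 is reached by letting t₁ decrease to 0: the energy integrals are continuous, and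
the right-hand side is continuous as an integral in its lower limit. -/
lemma balance_global {m : ℝ → FiniteMeasure ℝ} (hm : Continuous m) {E : ℝ}
    (hE : ∀ t, (m t : Measure ℝ).real univ ≤ E) {a g : ℝ → ℝ → ℝ}
    (ha : Continuous (Function.uncurry a)) {Λ : ℝ} (haΛ : ∀ t x, |a t x| ≤ Λ)
    (hgl : LocallyIntegrableOn (fun z : ℝ × ℝ => g z.1 z.2) (Ioi 0 ×ˢ univ))
    (hg : SourceIntegrable g) (hbal : IsMeasureSolution m a g) {φ φt φx : ℝ → ℝ → ℝ}
    (hφ : IsC1b φ φt φx) {t₁ t₂ : ℝ} (h₁ : 0 ≤ t₁) (h₁₂ : t₁ ≤ t₂) :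
    (∫ x, φ t₂ x ∂(m t₂ : Measure ℝ)) - ∫ x, φ t₁ x ∂(m t₁ : Measure ℝ)
      = (∫ s in t₁..t₂, ∫ x, (φt s x + a s x * φx s x) ∂(m s : Measure ℝ))
        + ∫ s in t₁..t₂, ∫ x, g s x * φ s x := by
  rcases h₁.lt_or_eq with h₁ | rfl
  · exact balance_global_of_pos hm hE ha haΛ hgl hg hbal hφ h₁ h₁₂
  rcases h₁₂.eq_or_lt with rfl | h₂
  · simp
  obtain ⟨B, hB⟩ := hφ.bdd
  have hΛ0 : 0 ≤ Λ := (abs_nonneg _).trans (haΛ 0 0)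
  have hf := continuous_integral_finiteMeasure hm hφ.cont fun t x => (hB t x).1
  have hF := continuous_integral_finiteMeasure hm
    (φ := fun s x => φt s x + a s x * φx s x) (hφ.cont_t.add (ha.mul hφ.cont_x))
    (B := B + Λ * B) fun s x => by
      refine (abs_add_le _ _).trans (add_le_add (hB s x).2.1 ?_)
      rw [abs_mul]
      exact mul_le_mul (haΛ s x) (hB s x).2.2 (abs_nonneg _) hΛ0
  have hG := hg.intervalIntegrable hφ.cont.measurable (fun t x => (hB t x).1) le_rfl h₁₂
  have c1 := intervalIntegral.continuousOn_primitive_interval_left (hF.integrableOn_uIcc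
    (μ := volume) (a := 0) (b := t₂))
  have c2 := intervalIntegral.continuousOn_primitive_interval_left
    (((intervalIntegrable_iff' (by simp)).1 hG))
  rw [uIcc_of_le h₁₂] at c1 c2
  have hne : (𝓝[Ioc 0 t₂] (0 : ℝ)).NeBot := by
    rw [nhdsWithin_Ioc_eq_nhdsGT h₂]; infer_instance
  have h0 : (0 : ℝ) ∈ Icc 0 t₂ := ⟨le_rfl, h₁₂⟩
  have l1 := (((c1 0 h0).mono Ioc_subset_Icc_self).tendsto).add
    ((c2 0 h0).mono Ioc_subset_Icc_self).tendsto
  have l2 : Tendsto (fun t => (∫ x, φ t₂ x ∂(m t₂ : Measure ℝ)) - ∫ x, φ t x ∂(m t : Measure ℝ))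
      (𝓝[Ioc 0 t₂] (0 : ℝ)) _ := ((hf.tendsto 0).mono_left nhdsWithin_le_nhds).const_sub _
  refine tendsto_nhds_unique (l2.congr' ?_) l1
  filter_upwards [self_mem_nhdsWithin] with t ht
  exact balance_global_of_pos hm hE ha haΛ hgl hg hbal hφ ht.1 ht.2

/-! ### Mollified measures -/

/-- The mollified density, with weight `b`, of the measures `m t` at scale `h`. -/
noncomputable def moll (h : ℝ) (m : ℝ → FiniteMeasure ℝ) (b : ℝ → ℝ → ℝ) (t x : ℝ) : ℝ :=
  ∫ y, rho ((x - y) / h) / h * b t y ∂(m t : Measure ℝ)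

/-- The mollified distribution function of the measures `m t` at scale `h`, integrating from the
left for `σ = 1` and from the right for `σ = -1`. -/
noncomputable def cumul (σ h : ℝ) (m : ℝ → FiniteMeasure ℝ) (t x : ℝ) : ℝ :=
  ∫ y, kap (σ * (x - y) / h) ∂(m t : Measure ℝ)

lemma rho_div_nonneg {h : ℝ} (hh : 0 < h) (z : ℝ) : 0 ≤ rho z / h :=
  div_nonneg (rho_nonneg z) hh.le

lemma rho_div_abs_le {h : ℝ} (hh : 0 < h) (z : ℝ) : |rho z / h| ≤ 1 / h := by
  rw [abs_of_nonneg (rho_div_nonneg hh z)]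
  gcongr
  exact rho_le_one z

lemma kap_abs_le_one (z : ℝ) : |kap z| ≤ 1 := by
  rw [abs_of_nonneg (kap_nonneg z)]
  exact kap_le_one z

section moll

variable {m : ℝ → FiniteMeasure ℝ} {b : ℝ → ℝ → ℝ} {h Λ E : ℝ}

lemma moll_kernel_abs_le (hh : 0 < h) (hb : ∀ t x, |b t x| ≤ Λ) (t x y : ℝ) :
    |rho ((x - y) / h) / h * b t y| ≤ 1 / h * Λ := by
  rw [abs_mul]
  exact mul_le_mul (rho_div_abs_le hh _) (hb t y) (abs_nonneg _) (by positivity)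

lemma moll_kernel_continuous (hbc : Continuous (Function.uncurry b)) :
    Continuous fun p : (ℝ × ℝ) × ℝ => rho ((p.1.2 - p.2) / h) / h * b p.1.1 p.2 := by
  have : Continuous fun p : (ℝ × ℝ) × ℝ => b p.1.1 p.2 :=
    hbc.comp (by fun_prop : Continuous fun p : (ℝ × ℝ) × ℝ => (p.1.1, p.2))
  fun_prop

lemma moll_continuous (hm : Continuous m) (hh : 0 < h) (hbc : Continuous (Function.uncurry b))
    (hb : ∀ t x, |b t x| ≤ Λ) : Continuous (Function.uncurry (moll h m b)) :=
  continuous_integral_finiteMeasure (X := ℝ × ℝ) (m := fun p => m p.1)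
    (φ := fun p y => rho ((p.2 - y) / h) / h * b p.1 y) (hm.comp continuous_fst)
    (moll_kernel_continuous hbc) fun p y => moll_kernel_abs_le hh hb p.1 p.2 y

lemma moll_integrable (hh : 0 < h) (hbc : Continuous (Function.uncurry b))
    (hb : ∀ t x, |b t x| ≤ Λ) (t x : ℝ) :
    Integrable (fun y => rho ((x - y) / h) / h * b t y) (m t : Measure ℝ) :=
  integrable_of_continuous_of_bdd (by have := hbc.slice t; fun_prop)
    (moll_kernel_abs_le hh hb t x)

lemma moll_abs_le (hE : ∀ t, (m t : Measure ℝ).real univ ≤ E) (hh : 0 < h)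
    (hb : ∀ t x, |b t x| ≤ Λ) (t x : ℝ) : |moll h m b t x| ≤ 1 / h * Λ * E :=
  integral_abs_le_of_bdd (by have := (abs_nonneg _).trans (hb 0 0); positivity)
    (fun y => moll_kernel_abs_le hh hb t x y) (hE t)

lemma moll_one_nonneg (hh : 0 < h) (t x : ℝ) : 0 ≤ moll h m (fun _ _ => 1) t x :=
  integral_nonneg fun y => by simpa using rho_div_nonneg hh _

lemma cumul_continuous {σ : ℝ} (hm : Continuous m) :
    Continuous (Function.uncurry (cumul σ h m)) :=
  continuous_integral_finiteMeasure (X := ℝ × ℝ) (m := fun p => m p.1)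
    (φ := fun p y => kap (σ * (p.2 - y) / h)) (hm.comp continuous_fst)
    (by simp only [Function.uncurry_def]; fun_prop) fun p y => kap_abs_le_one _

lemma cumul_nonneg {σ : ℝ} (t x : ℝ) : 0 ≤ cumul σ h m t x :=
  integral_nonneg fun _ => kap_nonneg _

lemma cumul_le {σ : ℝ} (hE : ∀ t, (m t : Measure ℝ).real univ ≤ E) (t x : ℝ) :
    cumul σ h m t x ≤ E := by
  have := integral_abs_le_of_bdd (f := fun y => kap (σ * (x - y) / h)) zero_le_one
    (fun y => kap_abs_le_one _) (hE t)
  rw [one_mul] at this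
  exact (le_abs_self _).trans this

lemma kap_scaled_hasDerivAt_left (σ h y x : ℝ) :
    HasDerivAt (fun x => kap (σ * (x - y) / h)) (rho (σ * (x - y) / h) * (σ / h)) x := by
  have := (kap_hasDerivAt (σ * (x - y) / h)).comp x
    ((((hasDerivAt_id x).sub_const y).const_mul σ).div_const h)
  simpa using! this

lemma kap_scaled_hasDerivAt_right (σ h x y : ℝ) :
    HasDerivAt (fun y => kap (σ * (x - y) / h)) (-(rho (σ * (x - y) / h) * (σ / h))) y := by
  have := (kap_hasDerivAt (σ * (x - y) / h)).comp y
    ((((hasDerivAt_id y).const_sub x).const_mul σ).div_const h)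
  convert! this using 1
  ring

lemma rho_sign {σ : ℝ} (hσ : σ = 1 ∨ σ = -1) (z h : ℝ) : rho (σ * z / h) = rho (z / h) := by
  rcases hσ with rfl | rfl
  · rw [one_mul]
  · rw [neg_one_mul, neg_div, rho_neg]

lemma cumul_hasDerivAt {σ : ℝ} (hσ : σ = 1 ∨ σ = -1) (hh : 0 < h) (t x : ℝ) :
    HasDerivAt (cumul σ h m t) (σ * moll h m (fun _ _ => 1) t x) x := by
  have key := (hasDerivAt_integral_of_dominated_loc_of_deriv_le (μ := (m t : Measure ℝ))
    (F := fun x y => kap (σ * (x - y) / h)) (F' := fun x y => rho (σ * (x - y) / h) * (σ / h))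
    (x₀ := x) (s := univ) (bound := fun _ => 1 / h) univ_mem
    (Eventually.of_forall fun x => (by fun_prop : Continuous fun y =>
      kap (σ * (x - y) / h)).aestronglyMeasurable)
    (integrable_of_continuous_of_bdd (by fun_prop) fun y => kap_abs_le_one _)
    (by fun_prop : Continuous fun y => rho (σ * (x - y) / h) * (σ / h)).aestronglyMeasurable
    (Eventually.of_forall fun y x _ => ?_) (integrable_const _)
    (Eventually.of_forall fun y x _ => kap_scaled_hasDerivAt_left σ h y x)).2
  · have e : σ * moll h m (fun _ _ => 1) t x
        = ∫ y, rho (σ * (x - y) / h) * (σ / h) ∂(m t : Measure ℝ) := by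
      rw [moll, ← integral_const_mul]
      congr 1 with y
      rw [rho_sign hσ]
      ring
    rw [e]
    exact key
  · rw [rho_sign hσ, norm_mul, norm_div, Real.norm_of_nonneg (rho_nonneg _),
      Real.norm_of_nonneg hh.le]
    have : ‖σ‖ = 1 := by rcases hσ with rfl | rfl <;> simp
    rw [this]
    exact mul_le_of_le_one_left (by positivity) (rho_le_one _)

end moll

/-- Half of the local averages of a measure are dominated by its mollified density. -/
lemma average_le_moll (m : ℝ → FiniteMeasure ℝ) {h : ℝ} (hh : 0 < h) (t x : ℝ) :
    (1 / 2 : ℝ≥0∞) * ((m t : Measure ℝ) (Metric.closedBall x (h / 2))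
        / volume (Metric.closedBall x (h / 2)))
      ≤ ENNReal.ofReal (moll h m (fun _ _ => 1) t x) := by
  have h1 : (m t : Measure ℝ).real (Metric.closedBall x (h / 2)) * (1 / 2 / h)
      ≤ moll h m (fun _ _ => 1) t x := by
    rw [← smul_eq_mul, ← setIntegral_const]
    have hi := moll_integrable (m := m) (Λ := 1) (b := fun _ _ => 1) hh continuous_const
      (by simp) t x
    refine (setIntegral_mono_on (integrable_const _).integrableOn hi.integrableOn
      Metric.isClosed_closedBall.measurableSet fun y hy => ?_).trans
      (setIntegral_le_integral hi (Eventually.of_forall fun y => ?_))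
    · rw [mul_one]
      gcongr
      refine half_le_rho ?_
      rw [Metric.mem_closedBall, Real.dist_eq, abs_sub_comm] at hy
      rw [abs_div, abs_of_pos hh, div_le_iff₀ hh]
      linarith
    · simpa using rho_div_nonneg hh _
  have hvol : volume (Metric.closedBall x (h / 2)) = ENNReal.ofReal h := by
    rw [Real.volume_closedBall]
    congr 1
    ring
  rw [hvol]
  refine le_trans (le_of_eq ?_) (ENNReal.ofReal_le_ofReal h1)
  rw [ENNReal.ofReal_mul measureReal_nonneg, Measure.real, ENNReal.ofReal_toReal
    (measure_ne_top _ _), ENNReal.ofReal_div_of_pos hh, ENNReal.ofReal_div_of_pos two_pos]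
  simp only [ENNReal.ofReal_one, ENNReal.ofReal_ofNat, div_eq_mul_inv, one_mul]
  ring

/-- By Besicovitch differentiation the averages of the measure over small balls converge almost
everywhere to the density of its absolutely continuous part, and half of each average lies below the
mollified density. Fatou's lemma concludes; the factor 2 pays for that half. -/
lemma fatou_moll (m : ℝ → FiniteMeasure ℝ) (t : ℝ) {k : ℝ → ℝ≥0∞} (hk : AEMeasurable k)
    (hkf : ∀ᵐ x, k x ≠ ⊤) :
    (∫⁻ x, k x * (m t : Measure ℝ).rnDeriv volume x)
      ≤ 2 * liminf (fun n => ∫⁻ x, k x * ENNReal.ofReal (moll (eps n) m (fun _ _ => 1) t x))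
        atTop := by
  have hmeas : ∀ n, AEMeasurable fun x =>
      k x * ENNReal.ofReal (moll (eps n) m (fun _ _ => 1) t x) := fun n => by
    have hc : Continuous (moll (eps n) m (fun _ _ => 1) t) := by
      have := moll_continuous (m := fun _ : ℝ => m t) (b := fun _ _ => (1 : ℝ)) (Λ := 1)
        continuous_const (eps_pos n) continuous_const (by simp)
      exact this.slice t
    exact hk.mul hc.measurable.ennreal_ofReal.aemeasurable
  have h1 : ∫⁻ x, liminf (fun n => k x * ENNReal.ofReal (moll (eps n) m (fun _ _ => 1) t x)) atTop
      ≤ liminf (fun n => ∫⁻ x, k x * ENNReal.ofReal (moll (eps n) m (fun _ _ => 1) t x)) atTop :=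
    lintegral_liminf_le' hmeas
  have hhalf : Tendsto (fun n => eps n / 2) atTop (𝓝[>] 0) := by
    rw [tendsto_nhdsWithin_iff]
    refine ⟨by simpa using tendsto_eps.div_const 2, Eventually.of_forall fun n => ?_⟩
    exact half_pos (eps_pos n)
  have h2 : ∀ᵐ x, k x * (1 / 2 * (m t : Measure ℝ).rnDeriv volume x)
      ≤ liminf (fun n => k x * ENNReal.ofReal (moll (eps n) m (fun _ _ => 1) t x)) atTop := by
    filter_upwards [Besicovitch.ae_tendsto_rnDeriv (m t : Measure ℝ) volume, hkf] with x hx hkx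
    have hlim : Tendsto (fun n => k x * (1 / 2 * ((m t : Measure ℝ)
        (Metric.closedBall x (eps n / 2)) / volume (Metric.closedBall x (eps n / 2))))) atTop
        (𝓝 (k x * (1 / 2 * (m t : Measure ℝ).rnDeriv volume x))) :=
      ENNReal.Tendsto.const_mul (ENNReal.Tendsto.const_mul (hx.comp hhalf)
        (Or.inr (by simp))) (Or.inr hkx)
    rw [← hlim.liminf_eq]
    exact liminf_le_liminf (Eventually.of_forall fun n => by
      gcongr
      exact average_le_moll m (eps_pos n) t x)
  have h3 := (lintegral_mono_ae h2).trans h1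
  have h4 : (∫⁻ x, k x * (m t : Measure ℝ).rnDeriv volume x)
      = 2 * ∫⁻ x, k x * (1 / 2 * (m t : Measure ℝ).rnDeriv volume x) := by
    rw [← lintegral_const_mul' _ _ ENNReal.ofNat_ne_top]
    congr 1 with x
    rw [mul_left_comm, ← mul_assoc 2, one_div, ENNReal.mul_inv_cancel (by simp) (by simp), one_mul]
  rw [h4]
  gcongr

/-! ### Pairs of transversal waves -/

/-- Two families of measures `μ`, `ν` transported with speeds `a`, `c` of opposite sign, which
exchange mass through the source `g`. The densities of their absolutely continuous parts are `r`
and `s`, and the source is controlled by the interaction of the two families. -/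
structure IsWavePair (σ δ Λ E C : ℝ) (μ ν : ℝ → FiniteMeasure ℝ) (a c g r s : ℝ → ℝ → ℝ) :
    Prop where
  sign : σ = 1 ∨ σ = -1
  δ_pos : 0 < δ
  C_nonneg : 0 ≤ C
  cont_μ : Continuous μ
  cont_ν : Continuous ν
  cont_a : Continuous (Function.uncurry a)
  cont_c : Continuous (Function.uncurry c)
  a_le : ∀ t x, |a t x| ≤ Λ
  c_le : ∀ t x, |c t x| ≤ Λ
  sep_a : ∀ t x, σ * a t x ≤ -δ
  sep_c : ∀ t x, δ ≤ σ * c t x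
  mass : ∀ t, (μ t : Measure ℝ).real univ + (ν t : Measure ℝ).real univ ≤ E
  bal_μ : IsMeasureSolution μ a g
  bal_ν : IsMeasureSolution ν c fun t x => -g t x
  locInt : LocallyIntegrableOn (fun z : ℝ × ℝ => g z.1 z.2) (Ioi 0 ×ˢ univ)
  r_nonneg : ∀ t x, 0 ≤ r t x
  s_nonneg : ∀ t x, 0 ≤ s t x
  meas_r : AEMeasurable (Function.uncurry r) ((volume.restrict (Ioi 0)).prod volume)
  meas_s : AEMeasurable (Function.uncurry s) ((volume.restrict (Ioi 0)).prod volume)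
  dens_r : ∀ t, 0 ≤ t →
    (μ t : Measure ℝ).rnDeriv volume =ᵐ[volume] fun x => ENNReal.ofReal (r t x)
  dens_s : ∀ t, 0 ≤ t →
    (ν t : Measure ℝ).rnDeriv volume =ᵐ[volume] fun x => ENNReal.ofReal (s t x)
  g_le : ∀ t, 0 < t → ∀ x, |g t x| ≤ C * (r t x * √(s t x) + √(r t x) * s t x
    + √(r t x) * √(s t x))
  a_var : ∀ t, 0 ≤ t → ∀ x y, x ≤ y →
    |a t y - a t x| ≤ C * ∫ z in x..y, (1 + √(r t z) + √(s t z))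

namespace IsWavePair

variable {σ δ Λ E C : ℝ} {μ ν : ℝ → FiniteMeasure ℝ} {a c g r s : ℝ → ℝ → ℝ}

lemma mass_μ (H : IsWavePair σ δ Λ E C μ ν a c g r s) (t : ℝ) :
    (μ t : Measure ℝ).real univ ≤ E := by
  linarith [H.mass t, measureReal_nonneg (μ := (ν t : Measure ℝ)) (s := univ)]

lemma mass_ν (H : IsWavePair σ δ Λ E C μ ν a c g r s) (t : ℝ) :
    (ν t : Measure ℝ).real univ ≤ E := by
  linarith [H.mass t, measureReal_nonneg (μ := (μ t : Measure ℝ)) (s := univ)]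

lemma E_nonneg (H : IsWavePair σ δ Λ E C μ ν a c g r s) : 0 ≤ E :=
  measureReal_nonneg.trans (H.mass_μ 0)

lemma Λ_nonneg (H : IsWavePair σ δ Λ E C μ ν a c g r s) : 0 ≤ Λ :=
  (abs_nonneg _).trans (H.a_le 0 0)

lemma sign_sq (H : IsWavePair σ δ Λ E C μ ν a c g r s) : σ * σ = 1 := by
  rcases H.sign with rfl | rfl <;> norm_num

lemma locInt_neg (H : IsWavePair σ δ Λ E C μ ν a c g r s) :
    LocallyIntegrableOn (fun z : ℝ × ℝ => -g z.1 z.2) (Ioi 0 ×ˢ univ) := H.locInt.neg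

/-- In the sum of the two balance laws the source cancels, so spatial cutoffs can be removed without
knowing that g is integrable over the line. This makes the identity available before
`sourceIntegrable`. -/
lemma conservation (H : IsWavePair σ δ Λ E C μ ν a c g r s) {ψ ψ' : ℝ → ℝ}
    (h : ∀ x, HasDerivAt ψ (ψ' x) x) (hc : Continuous ψ') {B : ℝ}
    (hB : ∀ x, |ψ x| ≤ B ∧ |ψ' x| ≤ B) {t₁ t₂ : ℝ} (h₁ : 0 < t₁) (h₁₂ : t₁ ≤ t₂) :
    ((∫ x, ψ x ∂(μ t₂ : Measure ℝ)) + ∫ x, ψ x ∂(ν t₂ : Measure ℝ))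
        - ((∫ x, ψ x ∂(μ t₁ : Measure ℝ)) + ∫ x, ψ x ∂(ν t₁ : Measure ℝ))
      = (∫ τ in t₁..t₂, ∫ x, a τ x * ψ' x ∂(μ τ : Measure ℝ))
        + ∫ τ in t₁..t₂, ∫ x, c τ x * ψ' x ∂(ν τ : Measure ℝ) := by
  have hB0 : 0 ≤ B := (abs_nonneg _).trans (hB 0).1
  have hψc : Continuous ψ := continuous_iff_continuousAt.2 fun x => (h x).continuousAt
  have h1n : ∀ n : ℕ, (1 : ℝ) ≤ (n : ℝ) + 1 := fun n => by linarith [Nat.cast_nonneg (α := ℝ) n]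
  have hψ := fun n : ℕ => (isC1b_cut (h1n n)).mul (IsC1b.of_space h hc hB)
  have hz : ∀ (n : ℕ) (t x : ℝ), 3 * ((n : ℝ) + 1) < |x| → cut ((n : ℝ) + 1) x * ψ x = 0 :=
    fun n t x hx => by
      simp [cut_eq_zero (by linarith [h1n n] : (0 : ℝ) < (n : ℝ) + 1) hx]
  have k1 := fun n : ℕ => balance_of_compact H.cont_μ H.cont_a H.a_le H.locInt H.bal_μ (hψ n)
    (hz n) h₁ h₁₂
  have k2 := fun n : ℕ => balance_of_compact H.cont_ν H.cont_c H.c_le H.locInt_neg H.bal_ν (hψ n)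
    (hz n) h₁ h₁₂
  have hcb : ∀ (n : ℕ) x, |cut ((n : ℝ) + 1) x * ψ x| ≤ B := fun n x => by
    rw [abs_mul]
    exact (mul_le_of_le_one_left (abs_nonneg _) (cut_abs_le _ _)).trans (hB x).1
  have hcb' : ∀ (n : ℕ) x, |cut' ((n : ℝ) + 1) x * ψ x + cut ((n : ℝ) + 1) x * ψ' x| ≤ B + B :=
    fun n x => by
      refine (abs_add_le _ _).trans (add_le_add ?_ ?_) <;> rw [abs_mul]
      · refine (mul_le_of_le_one_left (abs_nonneg _) ((cut'_abs_le (by linarith [h1n n]) _).trans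
          ?_)).trans (hB x).1
        rw [div_le_one (by linarith [h1n n])]
        exact h1n n
      · exact (mul_le_of_le_one_left (abs_nonneg _) (cut_abs_le _ _)).trans (hB x).2
  have hl : ∀ m : FiniteMeasure ℝ,
      Tendsto (fun n : ℕ => ∫ x, cut ((n : ℝ) + 1) x * ψ x ∂(m : Measure ℝ)) atTop
        (𝓝 (∫ x, ψ x ∂(m : Measure ℝ))) := fun m =>
    tendsto_integral_finiteMeasure (fun n => by fun_prop) hcb fun x => by
      simpa using (tendsto_cut x).mul_const (ψ x)
  have hr : ∀ {m : ℝ → FiniteMeasure ℝ} {b : ℝ → ℝ → ℝ}, Continuous m →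
      (∀ t, (m t : Measure ℝ).real univ ≤ E) → Continuous (Function.uncurry b) →
      (∀ t x, |b t x| ≤ Λ) → Tendsto (fun n : ℕ => ∫ τ in t₁..t₂, ∫ x, b τ x *
        (cut' ((n : ℝ) + 1) x * ψ x + cut ((n : ℝ) + 1) x * ψ' x) ∂(m τ : Measure ℝ)) atTop
        (𝓝 (∫ τ in t₁..t₂, ∫ x, b τ x * ψ' x ∂(m τ : Measure ℝ))) := by
    intro m b hm hE hbc hb
    refine tendsto_iterated_integral hm hE (B := Λ * (B + B)) (fun n => ?_) (fun n s x => ?_) h₁₂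
      fun s _ x => ?_
    · exact hbc.mul (by fun_prop : Continuous fun p : ℝ × ℝ =>
        cut' ((n : ℝ) + 1) p.2 * ψ p.2 + cut ((n : ℝ) + 1) p.2 * ψ' p.2)
    · rw [abs_mul]
      exact mul_le_mul (hb s x) (hcb' n x) (abs_nonneg _) H.Λ_nonneg
    · have := (((tendsto_cut' x).mul_const (ψ x)).add
        ((tendsto_cut x).mul_const (ψ' x))).const_mul (b s x)
      simpa using this
  have L := ((hl (μ t₂)).add (hl (ν t₂))).sub ((hl (μ t₁)).add (hl (ν t₁)))
  have R := (hr H.cont_μ H.mass_μ H.cont_a H.a_le).add (hr H.cont_ν H.mass_ν H.cont_c H.c_le)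
  refine tendsto_nhds_unique (L.congr fun n => ?_) R
  have e1 := k1 n
  have e2 := k2 n
  simp only [zero_mul, mul_zero, add_zero, zero_add, neg_mul, integral_neg,
    intervalIntegral.integral_neg] at e1 e2
  linarith

/-- The smoothed total energy on one side of `x`. -/
noncomputable def pot (σ h : ℝ) (μ ν : ℝ → FiniteMeasure ℝ) (t x : ℝ) : ℝ :=
  cumul σ h μ t x + cumul σ h ν t x

/-- The time derivative is the flux of total energy through x. The functional uses the total energy
rather than the energy of ν alone for this reason: the individual distribution functions would also
feel the source, which is not yet under control. -/
lemma isC1b_pot (H : IsWavePair σ δ Λ E C μ ν a c g r s) {h : ℝ} (hh : 0 < h) :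
    IsC1b (pot σ h μ ν) (fun t x => -(σ * (moll h μ a t x + moll h ν c t x)))
      (fun t x => σ * (moll h μ (fun _ _ => 1) t x + moll h ν (fun _ _ => 1) t x)) := by
  have hσ1 : |σ| = 1 := by rcases H.sign with rfl | rfl <;> simp
  have cμ := moll_continuous H.cont_μ hh H.cont_a H.a_le
  have cν := moll_continuous H.cont_ν hh H.cont_c H.c_le
  have cμ1 := moll_continuous (b := fun _ _ => 1) (Λ := 1) H.cont_μ hh continuous_const (by simp)
  have cν1 := moll_continuous (b := fun _ _ => 1) (Λ := 1) H.cont_ν hh continuous_const (by simp)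
  have cJ : Continuous (Function.uncurry fun t x => -(σ * (moll h μ a t x + moll h ν c t x))) :=
    ((cμ.add cν).const_mul σ).neg
  refine ⟨fun t ht x => ?_, fun t _ x => ?_,
    (cumul_continuous H.cont_μ).add (cumul_continuous H.cont_ν), cJ,
    (cμ1.add cν1).const_mul σ, ?_⟩
  -- The reference time t/2 is used because `conservation` starts from a positive time.
  · have key : ∀ t₂, t / 2 ≤ t₂ → pot σ h μ ν t₂ x = pot σ h μ ν (t / 2) x
        + ∫ τ in (t / 2)..t₂, -(σ * (moll h μ a τ x + moll h ν c τ x)) := by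
      intro t₂ h₂
      have := H.conservation (ψ := fun y => kap (σ * (x - y) / h))
        (ψ' := fun y => -(rho (σ * (x - y) / h) * (σ / h))) (B := 1 + 1 / h)
        (fun y => kap_scaled_hasDerivAt_right σ h x y) (by fun_prop)
        (fun y => ⟨(kap_abs_le_one _).trans (by linarith [div_pos one_pos hh]), by
          rw [abs_neg, abs_mul, abs_div, hσ1, abs_of_nonneg (rho_nonneg _), abs_of_pos hh]
          have := mul_le_of_le_one_left (by positivity : 0 ≤ 1 / h) (rho_le_one (σ * (x - y) / h))
          linarith⟩) (half_pos ht) h₂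
      have e : ∀ (m : ℝ → FiniteMeasure ℝ) (b : ℝ → ℝ → ℝ) (τ : ℝ),
          ∫ y, b τ y * -(rho (σ * (x - y) / h) * (σ / h)) ∂(m τ : Measure ℝ)
            = -(σ * moll h m b τ x) := fun m b τ => by
        rw [moll, ← integral_const_mul, ← integral_neg]
        congr 1 with y
        rw [rho_sign H.sign]
        ring
      simp only [e] at this
      rw [← intervalIntegral.integral_add] at this
      · have e2 : ∀ τ, -(σ * (moll h μ a τ x + moll h ν c τ x))
            = -(σ * moll h μ a τ x) + -(σ * moll h ν c τ x) := fun τ => by ring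
        simp only [e2, ← this, pot, cumul]
        ring
      · exact (((cμ.comp (by fun_prop : Continuous fun τ : ℝ => (τ, x))).const_mul
          σ).neg).intervalIntegrable _ _
      · exact (((cν.comp (by fun_prop : Continuous fun τ : ℝ => (τ, x))).const_mul
          σ).neg).intervalIntegrable _ _
    have cJx : Continuous fun τ => -(σ * (moll h μ a τ x + moll h ν c τ x)) :=
      cJ.comp (by fun_prop : Continuous fun τ : ℝ => (τ, x))
    have hd := (intervalIntegral.integral_hasDerivAt_right (cJx.intervalIntegrable (t / 2) t)
      (cJx.stronglyMeasurableAtFilter _ _) cJx.continuousAt).const_add (pot σ h μ ν (t / 2) x)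
    refine hd.congr_of_eventuallyEq ?_
    filter_upwards [lt_mem_nhds (half_lt_self ht)] with t₂ h₂ using key t₂ h₂.le
  · have := (cumul_hasDerivAt H.sign hh t x (m := μ)).add (cumul_hasDerivAt H.sign hh t x (m := ν))
    rw [mul_add]
    exact this
  · have hE := H.E_nonneg
    have hΛ := H.Λ_nonneg
    have b1 : ∀ {m : ℝ → FiniteMeasure ℝ} {b : ℝ → ℝ → ℝ} {Λ' : ℝ}, 
        (∀ t, (m t : Measure ℝ).real univ ≤ E) → (∀ t x, |b t x| ≤ Λ') → Λ' ≤ Λ + 1 →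
        ∀ t x, |moll h m b t x| ≤ 1 / h * (Λ + 1) * E := fun hm hb hl t x =>
      (moll_abs_le hm hh hb t x).trans (by gcongr)
    have h0 : 0 ≤ 1 / h * (Λ + 1) * E := by positivity
    refine ⟨2 * E + 2 * (1 / h * (Λ + 1) * E), fun t x => ⟨?_, ?_, ?_⟩⟩
    · have p1 := cumul_nonneg (m := μ) (h := h) (σ := σ) t x
      have p2 := cumul_nonneg (m := ν) (h := h) (σ := σ) t x
      rw [pot, abs_of_nonneg (add_nonneg p1 p2)]
      linarith [cumul_le H.mass_μ t x (h := h) (σ := σ), cumul_le H.mass_ν t x (h := h) (σ := σ)]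
    · rw [abs_neg, abs_mul, hσ1, one_mul]
      refine (abs_add_le _ _).trans ?_
      linarith [b1 H.mass_μ H.a_le (by linarith) t x, b1 H.mass_ν H.c_le (by linarith) t x]
    · rw [abs_mul, hσ1, one_mul]
      refine (abs_add_le _ _).trans ?_
      linarith [b1 H.mass_μ (b := fun _ _ => 1) (Λ' := 1) (by simp) (by linarith) t x,
        b1 H.mass_ν (b := fun _ _ => 1) (Λ' := 1) (by simp) (by linarith) t x]

end IsWavePair

/-! ### The interaction functional and its decay -/

lemma rho_div_mul_abs_le {h : ℝ} (hh : 0 < h) (z : ℝ) : rho (z / h) / h * |z| ≤ 1 := by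
  rcases le_or_gt 1 |z / h| with hz | hz
  · simp [rho_eq_zero hz]
  · rw [abs_div, abs_of_pos hh, div_lt_one hh] at hz
    calc rho (z / h) / h * |z| ≤ 1 / h * h := by
          gcongr
          · exact rho_le_one _
      _ = 1 := by field_simp

/-- The self-interaction term of one family of waves is antisymmetric, up to the cutoff. -/
lemma abs_self_interaction_le {m : FiniteMeasure ℝ} {b : ℝ → ℝ} (hb : Continuous b) {Λ E L h : ℝ}
    (hΛ : ∀ x, |b x| ≤ Λ) (hE : (m : Measure ℝ).real univ ≤ E) (hL : 0 < L) (hh : 0 < h) :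
    |∫ x, cut L x * (b x * (∫ y, rho ((x - y) / h) / h * 1 ∂(m : Measure ℝ))
      - ∫ y, rho ((x - y) / h) / h * b y ∂(m : Measure ℝ)) ∂(m : Measure ℝ)| ≤ Λ / L * E * E := by
  have hΛ0 : 0 ≤ Λ := (abs_nonneg _).trans (hΛ 0)
  have hE0 : 0 ≤ E := measureReal_nonneg.trans hE
  set k : ℝ × ℝ → ℝ := fun p => rho ((p.1 - p.2) / h) / h * (b p.1 - b p.2) with hk
  have hkc : Continuous k := by fun_prop
  have hkb : ∀ p, |k p| ≤ 1 / h * (Λ + Λ) := fun p => by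
    rw [hk, abs_mul]
    exact mul_le_mul (rho_div_abs_le hh _) ((abs_sub _ _).trans (add_le_add (hΛ _) (hΛ _)))
      (abs_nonneg _) (by positivity)
  have hint : ∀ q : ℝ × ℝ → ℝ, Continuous q → (∀ p, |q p| ≤ 1) →
      Integrable (fun p => q p * k p) ((m : Measure ℝ).prod (m : Measure ℝ)) := fun q hq hq1 => by
    refine Integrable.of_bound (hq.mul hkc).aestronglyMeasurable (1 / h * (Λ + Λ))
      (Eventually.of_forall fun p => ?_)
    rw [norm_mul]
    exact (mul_le_of_le_one_left (abs_nonneg _) (hq1 p)).trans (hkb p)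
  have i1 := hint (fun p => cut L p.1) (by fun_prop) fun p => cut_abs_le _ _
  have i2 := hint (fun p => cut L p.2) (by fun_prop) fun p => cut_abs_le _ _
  have e1 : ∫ x, cut L x * (b x * (∫ y, rho ((x - y) / h) / h * 1 ∂(m : Measure ℝ))
      - ∫ y, rho ((x - y) / h) / h * b y ∂(m : Measure ℝ)) ∂(m : Measure ℝ)
      = ∫ p, cut L p.1 * k p ∂((m : Measure ℝ).prod (m : Measure ℝ)) := by
    rw [integral_prod _ i1]
    congr 1 with x
    have j1 : Integrable (fun y => b x * (rho ((x - y) / h) / h * 1)) (m : Measure ℝ) :=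
      integrable_of_continuous_of_bdd (B := |b x| * (1 / h)) (by fun_prop) fun y => by
        rw [abs_mul, mul_one]
        gcongr
        exact rho_div_abs_le hh _
    have j2 : Integrable (fun y => rho ((x - y) / h) / h * b y) (m : Measure ℝ) :=
      integrable_of_continuous_of_bdd (B := 1 / h * Λ) (by fun_prop) fun y => by
        rw [abs_mul]
        exact mul_le_mul (rho_div_abs_le hh _) (hΛ y) (abs_nonneg _) (by positivity)
    rw [← integral_const_mul, ← integral_sub j1 j2, ← integral_const_mul]
    congr 1 with y
    simp only [hk]
    ring
  have e2 : ∫ p, cut L p.1 * k p ∂((m : Measure ℝ).prod (m : Measure ℝ))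
      = -∫ p, cut L p.2 * k p ∂((m : Measure ℝ).prod (m : Measure ℝ)) := by
    rw [← integral_prod_swap (fun p => cut L p.2 * k p), ← integral_neg]
    congr 1 with p
    have : rho ((p.2 - p.1) / h) = rho ((p.1 - p.2) / h) := by
      rw [← rho_neg]; congr 1; ring
    simp only [hk, Prod.fst_swap, Prod.snd_swap, this]
    ring
  -- Symmetrizing replaces the cutoff by a difference of cutoffs, at most |x - y| / L. That factor
  -- compensates the kernel of size 1/h, so the resulting bound does not depend on h.
  have e3 : 2 * ∫ p, cut L p.1 * k p ∂((m : Measure ℝ).prod (m : Measure ℝ))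
      = ∫ p, (cut L p.1 - cut L p.2) * k p ∂((m : Measure ℝ).prod (m : Measure ℝ)) := by
    have : ∀ p, (cut L p.1 - cut L p.2) * k p = cut L p.1 * k p - cut L p.2 * k p := fun p => by
      ring
    simp only [this]
    rw [integral_sub i1 i2]
    linarith
  have e4 : |∫ p, (cut L p.1 - cut L p.2) * k p ∂((m : Measure ℝ).prod (m : Measure ℝ))|
      ≤ 2 * Λ / L * (E * E) := by
    refine (norm_integral_le_of_norm_le_const (μ := (m : Measure ℝ).prod (m : Measure ℝ))
      (f := fun p => (cut L p.1 - cut L p.2) * k p) (C := 2 * Λ / L)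
      (Eventually.of_forall fun p => ?_)).trans ?_
    · rw [norm_mul]
      calc ‖cut L p.1 - cut L p.2‖ * ‖k p‖
          ≤ (1 / L * |p.1 - p.2|) * (rho ((p.1 - p.2) / h) / h * (Λ + Λ)) := by
            refine mul_le_mul (cut_sub_abs_le hL _ _) ?_ (norm_nonneg _) (by positivity)
            rw [hk, norm_mul, Real.norm_of_nonneg (rho_div_nonneg hh _)]
            exact mul_le_mul_of_nonneg_left ((abs_sub _ _).trans (add_le_add (hΛ _) (hΛ _)))
              (rho_div_nonneg hh _)
        _ = 2 * Λ / L * (rho ((p.1 - p.2) / h) / h * |p.1 - p.2|) := by ring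
        _ ≤ 2 * Λ / L * 1 := by gcongr; exact rho_div_mul_abs_le hh _
        _ = 2 * Λ / L := mul_one _
    · have : ((m : Measure ℝ).prod (m : Measure ℝ)).real univ
          = (m : Measure ℝ).real univ * (m : Measure ℝ).real univ := by
        simp [Measure.real, ← univ_prod_univ, Measure.prod_prod]
      rw [this]
      gcongr
  rw [e1]
  have e5 : |2 * ∫ p, cut L p.1 * k p ∂((m : Measure ℝ).prod (m : Measure ℝ))|
      ≤ 2 * Λ / L * (E * E) := by rw [e3]; exact e4
  rw [abs_mul, abs_two] at e5
  have : 2 * Λ / L * (E * E) = 2 * (Λ / L * E * E) := by ring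
  linarith

namespace IsWavePair

variable {σ δ Λ E C : ℝ} {μ ν : ℝ → FiniteMeasure ℝ} {a c g r s : ℝ → ℝ → ℝ}

/-- Under the integral, σ (a(t,x) - c(τ,y)) ≤ -2δ for all pairs of points, because both speeds are
separated from zero uniformly. No continuity of the speeds is needed. -/
lemma moll_sep (H : IsWavePair σ δ Λ E C μ ν a c g r s) {h : ℝ} (hh : 0 < h) (t τ x : ℝ) :
    σ * (a t x * moll h ν (fun _ _ => 1) τ x - moll h ν c τ x)
      ≤ -(2 * δ * moll h ν (fun _ _ => 1) τ x) := by
  have i1 := moll_integrable (m := ν) (b := fun _ _ => 1) (Λ := 1) hh continuous_const (by simp) τ x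
  have i2 := moll_integrable (m := ν) hh H.cont_c H.c_le τ x
  simp only [moll]
  rw [← integral_const_mul, ← integral_sub (i1.const_mul _) i2, ← integral_const_mul,
    ← integral_const_mul, ← integral_neg]
  refine integral_mono (((i1.const_mul _).sub i2).const_mul _) (i1.const_mul _).neg fun y => ?_
  have h1 := rho_div_nonneg hh ((x - y) / h)
  have h2 := H.sep_a t x
  have h3 := H.sep_c τ y
  have : 0 ≤ rho ((x - y) / h) / h * (σ * c τ y - δ + (-δ - σ * a t x)) :=
    mul_nonneg h1 (by linarith)
  simp only
  nlinarith

lemma pot_mem (H : IsWavePair σ δ Λ E C μ ν a c g r s) {h : ℝ} (t x : ℝ) :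
    0 ≤ pot σ h μ ν t x ∧ pot σ h μ ν t x ≤ 2 * E := by
  have p1 := cumul_nonneg (m := μ) (h := h) (σ := σ) t x
  have p2 := cumul_nonneg (m := ν) (h := h) (σ := σ) t x
  have p3 := cumul_le H.mass_μ t x (h := h) (σ := σ)
  have p4 := cumul_le H.mass_ν t x (h := h) (σ := σ)
  constructor <;> simp only [pot] <;> linarith

/-- The derivative of the potential along a splits into a ν-part, at most -2δ times the mollified
density of ν by `moll_sep`, and a μ-part, which is antisymmetric and contributes at most ΛE² by
`abs_self_interaction_le`. The derivative of the cutoff adds at most 2ΛE², whence the constant 3. -/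
lemma interaction_slice (H : IsWavePair σ δ Λ E C μ ν a c g r s) {h L : ℝ} (hh : 0 < h)
    (hL : 1 ≤ L) (t : ℝ) :
    ∫ x, ((0 * pot σ h μ ν t x + cut L x * -(σ * (moll h μ a t x + moll h ν c t x)))
        + a t x * (cut' L x * pot σ h μ ν t x + cut L x *
          (σ * (moll h μ (fun _ _ => 1) t x + moll h ν (fun _ _ => 1) t x)))) ∂(μ t : Measure ℝ)
      ≤ 3 * Λ * E * E - 2 * δ * ∫ x, cut L x * moll h ν (fun _ _ => 1) t x ∂(μ t : Measure ℝ) := by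
  have hL0 : 0 < L := by linarith
  have hE := H.E_nonneg
  have hΛ := H.Λ_nonneg
  have ca := H.cont_a.slice t
  have c1 := (moll_continuous H.cont_μ hh H.cont_a H.a_le).slice t
  have c2 := (moll_continuous H.cont_ν hh H.cont_c H.c_le).slice t
  have c3 := (moll_continuous (b := fun _ _ => 1) (Λ := 1) H.cont_μ hh continuous_const
    (by simp)).slice t
  have c4 := (moll_continuous (b := fun _ _ => 1) (Λ := 1) H.cont_ν hh continuous_const
    (by simp)).slice t
  have c5 := (H.isC1b_pot hh).cont.slice t
  have cs : HasCompactSupport (cut L) := trap_hasCompactSupport (by linarith) hL0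
  have cs' : HasCompactSupport (cut' L) := by
    have : cut' L = deriv (cut L) := funext fun x => (cut_hasDerivAt L x).deriv.symm
    rw [this]
    exact cs.deriv
  have J : ∀ {f q : ℝ → ℝ}, Continuous f → HasCompactSupport f → Continuous q →
      Integrable (fun x => f x * q x) (μ t : Measure ℝ) := fun hf hfs hq =>
    (hf.mul hq).integrable_of_hasCompactSupport hfs.mul_right
  have i1 : Integrable (fun x => σ * (cut L x * (a t x * moll h μ (fun _ _ => 1) t x
      - moll h μ a t x))) (μ t : Measure ℝ) :=
    (J (cut_continuous L) cs ((ca.mul c3).sub c1)).const_mul σ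
  have i2 := (J (cut_continuous L) cs c4).const_mul (2 * δ)
  have i3 : Integrable (fun _ : ℝ => Λ * (1 / L) * (2 * E)) (μ t : Measure ℝ) := integrable_const _
  have i0 : Integrable (fun x =>
      ((0 * pot σ h μ ν t x + cut L x * -(σ * (moll h μ a t x + moll h ν c t x)))
        + a t x * (cut' L x * pot σ h μ ν t x + cut L x *
          (σ * (moll h μ (fun _ _ => 1) t x + moll h ν (fun _ _ => 1) t x)))))
      (μ t : Measure ℝ) := by
    have l1 : Integrable (fun x => cut L x * -(σ * (moll h μ a t x + moll h ν c t x)))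
        (μ t : Measure ℝ) := J (cut_continuous L) cs ((c1.add c2).const_mul σ).neg
    have l2 : Integrable (fun x => cut' L x * (a t x * pot σ h μ ν t x)) (μ t : Measure ℝ) :=
      J (cut'_continuous L) cs' (ca.mul c5)
    have l3 : Integrable (fun x => cut L x * (a t x *
        (σ * (moll h μ (fun _ _ => 1) t x + moll h ν (fun _ _ => 1) t x)))) (μ t : Measure ℝ) :=
      J (cut_continuous L) cs (ca.mul ((c3.add c4).const_mul σ))
    refine ((l1.add l2).add l3).congr (Eventually.of_forall fun x => ?_)
    simp only [Pi.add_apply]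
    ring
  have anti := abs_self_interaction_le (m := μ t) ca (H.a_le t) (H.mass_μ t) hL0 hh
  have hmono := integral_mono (g := fun x => σ * (cut L x * (a t x * moll h μ (fun _ _ => 1) t x
      - moll h μ a t x)) - 2 * δ * (cut L x * moll h ν (fun _ _ => 1) t x) + Λ * (1 / L) * (2 * E))
      i0 ((i1.sub i2).add i3) fun x => by
    have k1 := mul_le_mul_of_nonneg_left (H.moll_sep hh t t x) (cut_nonneg hL0 x)
    have k2 : a t x * (cut' L x * pot σ h μ ν t x) ≤ Λ * (1 / L) * (2 * E) := by
      refine (le_abs_self _).trans ?_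
      rw [abs_mul, abs_mul, mul_assoc]
      refine mul_le_mul (H.a_le t x) (mul_le_mul (cut'_abs_le hL0 x) ?_ (abs_nonneg _)
        (by positivity)) (by positivity) hΛ
      rw [abs_of_nonneg (H.pot_mem t x).1]
      exact (H.pot_mem t x).2
    simp only
    linarith
  refine hmono.trans ?_
  rw [integral_add (by exact i1.sub i2) i3, integral_sub i1 i2, integral_const_mul, integral_const_mul,
    integral_const, smul_eq_mul]
  have hσ1 : |σ| = 1 := by rcases H.sign with rfl | rfl <;> simp
  have k3 : σ * ∫ x, cut L x * (a t x * moll h μ (fun _ _ => 1) t x - moll h μ a t x)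
      ∂(μ t : Measure ℝ) ≤ Λ * E * E := by
    refine (le_abs_self _).trans ?_
    rw [abs_mul, hσ1, one_mul]
    refine anti.trans ?_
    gcongr
    exact div_le_self hΛ hL
  have k4 : (μ t : Measure ℝ).real univ * (Λ * (1 / L) * (2 * E)) ≤ E * (Λ * 1 * (2 * E)) := by
    gcongr
    · exact H.mass_μ t
    · rw [div_le_one hL0]; exact hL
  linarith

/-- The functional ∫ cut · pot dμ stays between 0 and 2E², so its total decrease is bounded by 2E²
plus what the errors and the source can restore. The bound is independent of h. -/
lemma interaction_smoothed (H : IsWavePair σ δ Λ E C μ ν a c g r s) {h L : ℝ} (hh : 0 < h)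
    (hL : 1 ≤ L) {t₁ t₂ : ℝ} (h₁ : 0 < t₁) (h₁₂ : t₁ ≤ t₂) :
    2 * δ * ∫ τ in t₁..t₂, ∫ x, cut L x * moll h ν (fun _ _ => 1) τ x ∂(μ τ : Measure ℝ)
      ≤ 2 * E * E + (t₂ - t₁) * (3 * Λ * E * E)
        + 2 * E * ∫ τ in t₁..t₂, ∫ x, |g τ x| * cut L x := by
  have hL0 : 0 < L := by linarith
  have hE := H.E_nonneg
  have hφ := (isC1b_cut hL).mul (H.isC1b_pot hh)
  have hr : ∀ t x : ℝ, 3 * L < |x| → cut L x * pot σ h μ ν t x = 0 := fun t x hx => by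
    simp [cut_eq_zero hL0 hx]
  have key := balance_of_compact H.cont_μ H.cont_a H.a_le H.locInt H.bal_μ hφ hr h₁ h₁₂
  obtain ⟨B, hB⟩ := hφ.bdd
  have hB0 : 0 ≤ B := (abs_nonneg _).trans (hB 0 0).1
  have cJ := continuous_integral_finiteMeasure (B := B + Λ * B) H.cont_μ
    (φ := fun t x => (0 * pot σ h μ ν t x
        + cut L x * -(σ * (moll h μ a t x + moll h ν c t x)))
      + a t x * (cut' L x * pot σ h μ ν t x + cut L x *
        (σ * (moll h μ (fun _ _ => 1) t x + moll h ν (fun _ _ => 1) t x))))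
    (hφ.cont_t.add (H.cont_a.mul hφ.cont_x)) fun t x => by
      refine (abs_add_le _ _).trans (add_le_add (hB t x).2.1 ?_)
      rw [abs_mul]
      exact mul_le_mul (H.a_le t x) (hB t x).2.2 (abs_nonneg _) H.Λ_nonneg
  have c4 := moll_continuous (b := fun _ _ => 1) (Λ := 1) H.cont_ν hh continuous_const (by simp)
  have cK := continuous_integral_finiteMeasure (B := 1 * (1 / h * 1 * E)) H.cont_μ
    (φ := fun t x => cut L x * moll h ν (fun _ _ => 1) t x)
    (((cut_continuous L).comp continuous_snd).mul c4) fun t x => by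
      rw [abs_mul]
      exact mul_le_mul (cut_abs_le _ _) (moll_abs_le H.mass_ν hh (by simp) t x) (abs_nonneg _)
        zero_le_one
  have m1 : (∫ τ in t₁..t₂, ∫ x,
      ((0 * pot σ h μ ν τ x + cut L x * -(σ * (moll h μ a τ x + moll h ν c τ x)))
        + a τ x * (cut' L x * pot σ h μ ν τ x + cut L x *
          (σ * (moll h μ (fun _ _ => 1) τ x + moll h ν (fun _ _ => 1) τ x)))) ∂(μ τ : Measure ℝ))
      ≤ ∫ τ in t₁..t₂, (3 * Λ * E * E
        - 2 * δ * ∫ x, cut L x * moll h ν (fun _ _ => 1) τ x ∂(μ τ : Measure ℝ)) :=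
    intervalIntegral.integral_mono_on h₁₂ (cJ.intervalIntegrable _ _)
      ((continuous_const.sub (cK.const_mul _)).intervalIntegrable _ _)
      fun τ _ => H.interaction_slice hh hL τ
  rw [intervalIntegral.integral_sub (by simp) ((cK.const_mul _).intervalIntegrable _ _),
    intervalIntegral.integral_const, intervalIntegral.integral_const_mul, smul_eq_mul] at m1
  have hK : Icc t₁ t₂ ⊆ Ioi 0 := fun t ht => h₁.trans_le ht.1
  have I1 := integrable_mul_of_compact_support H.locInt hφ.cont hr isCompact_Icc hK
  have I2 := integrable_mul_of_compact_support (g := fun t x => |g t x|) H.locInt.norm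
    (φ := fun _ x => cut L x) (r := 3 * L) ((cut_continuous L).comp continuous_snd)
    (fun _ x hx => cut_eq_zero hL0 hx) isCompact_Icc hK
  have J1 : IntervalIntegrable (fun τ => ∫ x, g τ x * (cut L x * pot σ h μ ν τ x)) volume t₁ t₂ :=
    (intervalIntegrable_iff_integrableOn_Icc_of_le h₁₂).2 I1.integral_prod_left
  have J2 : IntervalIntegrable (fun τ => ∫ x, |g τ x| * cut L x) volume t₁ t₂ :=
    (intervalIntegrable_iff_integrableOn_Icc_of_le h₁₂).2 I2.integral_prod_left
  have m2 : (∫ τ in t₁..t₂, ∫ x, g τ x * (cut L x * pot σ h μ ν τ x))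
      ≤ ∫ τ in t₁..t₂, 2 * E * ∫ x, |g τ x| * cut L x := by
    refine intervalIntegral.integral_mono_ae_restrict h₁₂ J1 (J2.const_mul _) ?_
    filter_upwards [I1.prod_right_ae, I2.prod_right_ae] with τ h1 h2
    rw [← integral_const_mul]
    refine integral_mono h1 (h2.const_mul _) fun x => ?_
    have p := H.pot_mem (h := h) τ x
    have q := cut_nonneg hL0 x
    calc g τ x * (cut L x * pot σ h μ ν τ x) ≤ |g τ x| * (cut L x * (2 * E)) :=
          mul_le_mul (le_abs_self _) (mul_le_mul_of_nonneg_left p.2 q) (mul_nonneg q p.1)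
            (abs_nonneg _)
      _ = 2 * E * (|g τ x| * cut L x) := by ring
  rw [intervalIntegral.integral_const_mul] at m2
  have n1 : 0 ≤ ∫ x, cut L x * pot σ h μ ν t₂ x ∂(μ t₂ : Measure ℝ) :=
    integral_nonneg fun x => mul_nonneg (cut_nonneg hL0 x) (H.pot_mem t₂ x).1
  have n2 : ∫ x, cut L x * pot σ h μ ν t₁ x ∂(μ t₁ : Measure ℝ) ≤ 2 * E * E := by
    refine (le_abs_self _).trans (integral_abs_le_of_bdd (by positivity) (fun x => ?_)
      (H.mass_μ t₁))
    rw [abs_mul, abs_of_nonneg (H.pot_mem t₁ x).1]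
    exact (mul_le_of_le_one_left (H.pot_mem t₁ x).1 (cut_abs_le _ _)).trans (H.pot_mem t₁ x).2
  linarith

end IsWavePair

/-! ### Integrability of the source -/

/-- In terms of square roots, the right side minus the left side is a sum of squares. The parameter
η is free, so the quadratic interaction p q enters with an arbitrarily small factor. -/
lemma interaction_young {C η p q : ℝ} (hC : 0 ≤ C) (hη : 0 < η) (hp : 0 ≤ p) (hq : 0 ≤ q) :
    C * (p * √q + √p * q + √p * √q) ≤ η * (p * q) + (C ^ 2 / (2 * η) + C / 2) * (p + q) := by
  obtain ⟨u, hu, rfl⟩ : ∃ u, 0 ≤ u ∧ p = u ^ 2 := ⟨√p, Real.sqrt_nonneg _, (Real.sq_sqrt hp).symm⟩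
  obtain ⟨v, hv, rfl⟩ : ∃ v, 0 ≤ v ∧ q = v ^ 2 := ⟨√q, Real.sqrt_nonneg _, (Real.sq_sqrt hq).symm⟩
  rw [Real.sqrt_sq hu, Real.sqrt_sq hv]
  have h : η * (u ^ 2 * v ^ 2) + (C ^ 2 / (2 * η) + C / 2) * (u ^ 2 + v ^ 2)
      - C * (u ^ 2 * v + u * v ^ 2 + u * v)
      = u ^ 2 * ((η * v - C) ^ 2 / (2 * η)) + v ^ 2 * ((η * u - C) ^ 2 / (2 * η))
        + C / 2 * (u - v) ^ 2 := by
    field_simp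
    ring
  have : 0 ≤ u ^ 2 * ((η * v - C) ^ 2 / (2 * η)) + v ^ 2 * ((η * u - C) ^ 2 / (2 * η))
        + C / 2 * (u - v) ^ 2 := by positivity
  linarith

lemma lintegral_mul_rnDeriv_le (m : Measure ℝ) {f : ℝ → ℝ≥0∞} (hf : Measurable f) :
    ∫⁻ x, f x * m.rnDeriv volume x ≤ ∫⁻ x, f x ∂m := by
  have h := lintegral_mono' (m.withDensity_rnDeriv_le volume) (le_refl f)
  rw [lintegral_withDensity_eq_lintegral_mul _ (Measure.measurable_rnDeriv _ _) hf] at h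
  refine le_trans (le_of_eq ?_) h
  congr 1 with x
  simp [mul_comm]

lemma lintegral_rnDeriv_le_ofReal {m : FiniteMeasure ℝ} {E : ℝ}
    (hE : (m : Measure ℝ).real univ ≤ E) :
    ∫⁻ x, (m : Measure ℝ).rnDeriv volume x ≤ ENNReal.ofReal E := by
  refine (Measure.lintegral_rnDeriv_le).trans ?_
  rw [← ofReal_measureReal]
  exact ENNReal.ofReal_le_ofReal hE

namespace IsWavePair

variable {σ δ Λ E C : ℝ} {μ ν : ℝ → FiniteMeasure ℝ} {a c g r s : ℝ → ℝ → ℝ}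

/-- This is the limit h → 0 of `interaction_smoothed`: `fatou_moll` in space for fixed time, then
Fatou in time. The factor 2 lost in space turns the rate 2δ into δ. Passing from the measure μ to
its density only lowers the left side. -/
lemma lintegral_interaction_le (H : IsWavePair σ δ Λ E C μ ν a c g r s) {L : ℝ} (hL : 1 ≤ L)
    {t₁ t₂ : ℝ} (h₁ : 0 < t₁) (h₁₂ : t₁ ≤ t₂) :
    ∫⁻ τ in Ioc t₁ t₂, ∫⁻ x, ENNReal.ofReal (cut L x) * (μ τ : Measure ℝ).rnDeriv volume x
        * (ν τ : Measure ℝ).rnDeriv volume x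
      ≤ ENNReal.ofReal ((2 * E * E + (t₂ - t₁) * (3 * Λ * E * E)
        + 2 * E * ∫ τ in t₁..t₂, ∫ x, |g τ x| * cut L x) / δ) := by
  have hL0 : 0 < L := by linarith
  set J : ℕ → ℝ → ℝ := fun n τ =>
    ∫ x, cut L x * moll (eps n) ν (fun _ _ => 1) τ x ∂(μ τ : Measure ℝ) with hJ
  have hmc : ∀ n, Continuous (Function.uncurry (moll (eps n) ν fun _ _ => 1)) := fun n =>
    moll_continuous (Λ := 1) H.cont_ν (eps_pos n) continuous_const (by simp)
  have hbd : ∀ n t x, |cut L x * moll (eps n) ν (fun _ _ => 1) t x| ≤ 1 * (1 / eps n * 1 * E) :=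
    fun n t x => by
      rw [abs_mul]
      exact mul_le_mul (cut_abs_le _ _) (moll_abs_le H.mass_ν (eps_pos n) (by simp) t x)
        (abs_nonneg _) zero_le_one
  have cJ : ∀ n, Continuous (J n) := fun n =>
    continuous_integral_finiteMeasure H.cont_μ
      (φ := fun t x => cut L x * moll (eps n) ν (fun _ _ => 1) t x)
      (((cut_continuous L).comp continuous_snd).mul (hmc n)) (hbd n)
  have hnn : ∀ n τ x, 0 ≤ cut L x * moll (eps n) ν (fun _ _ => 1) τ x := fun n τ x =>
    mul_nonneg (cut_nonneg hL0 x) (moll_one_nonneg (eps_pos n) τ x)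
  have hJ0 : ∀ n τ, 0 ≤ J n τ := fun n τ => integral_nonneg (hnn n τ)
  have inner : ∀ τ, ∫⁻ x, ENNReal.ofReal (cut L x) * (μ τ : Measure ℝ).rnDeriv volume x
        * (ν τ : Measure ℝ).rnDeriv volume x
      ≤ 2 * liminf (fun n => ENNReal.ofReal (J n τ)) atTop := fun τ => by
    refine (fatou_moll ν τ
      ((((cut_continuous L).measurable.ennreal_ofReal).mul
        (Measure.measurable_rnDeriv _ _)).aemeasurable) ?_).trans ?_
    · filter_upwards [Measure.rnDeriv_lt_top (μ τ : Measure ℝ) volume] with x hx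
      exact ENNReal.mul_ne_top ENNReal.ofReal_ne_top hx.ne
    · gcongr 2 * ?_
      refine liminf_le_liminf (Eventually.of_forall fun n => ?_)
      have hcm : Continuous fun x => cut L x * moll (eps n) ν (fun _ _ => 1) τ x :=
        (cut_continuous L).mul ((hmc n).slice τ)
      rw [hJ, ofReal_integral_eq_lintegral_ofReal
        (integrable_of_continuous_of_bdd hcm (hbd n τ)) (Eventually.of_forall (hnn n τ))]
      refine le_trans (le_of_eq ?_) (lintegral_mul_rnDeriv_le _ hcm.measurable.ennreal_ofReal)
      congr 1 with x
      rw [ENNReal.ofReal_mul (cut_nonneg hL0 x), Pi.mul_apply]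
      ring
  have hJint : ∀ n, ∫⁻ τ in Ioc t₁ t₂, ENNReal.ofReal (J n τ)
      = ENNReal.ofReal (∫ τ in t₁..t₂, J n τ) := fun n => by
    rw [intervalIntegral.integral_of_le h₁₂, ofReal_integral_eq_lintegral_ofReal
      ((cJ n).intervalIntegrable t₁ t₂).1 (Eventually.of_forall (hJ0 n))]
  calc _ ≤ ∫⁻ τ in Ioc t₁ t₂, 2 * liminf (fun n => ENNReal.ofReal (J n τ)) atTop :=
        lintegral_mono inner
    _ = 2 * ∫⁻ τ in Ioc t₁ t₂, liminf (fun n => ENNReal.ofReal (J n τ)) atTop :=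
        lintegral_const_mul' _ _ ENNReal.ofNat_ne_top
    _ ≤ 2 * liminf (fun n => ∫⁻ τ in Ioc t₁ t₂, ENNReal.ofReal (J n τ)) atTop := by
        gcongr
        exact lintegral_liminf_le fun n => (cJ n).measurable.ennreal_ofReal
    _ ≤ 2 * ENNReal.ofReal ((2 * E * E + (t₂ - t₁) * (3 * Λ * E * E)
        + 2 * E * ∫ τ in t₁..t₂, ∫ x, |g τ x| * cut L x) / (2 * δ)) := by
        gcongr
        refine (liminf_le_liminf (v := fun _ => ENNReal.ofReal _) (Eventually.of_forall fun n => ?_)).trans_eq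
          (tendsto_const_nhds.liminf_eq)
        rw [hJint]
        refine ENNReal.ofReal_le_ofReal ?_
        rw [le_div_iff₀ (by linarith [H.δ_pos])]
        have := H.interaction_smoothed (eps_pos n) hL h₁ h₁₂
        rw [hJ]
        linarith
    _ = _ := by
        rw [← ENNReal.ofReal_ofNat 2, ← ENNReal.ofReal_mul (by norm_num)]
        congr 1
        have := H.δ_pos
        field_simp

lemma aemeasurable_g (H : IsWavePair σ δ Λ E C μ ν a c g r s) :
    AEStronglyMeasurable (Function.uncurry g) ((volume.restrict (Ioi 0)).prod volume) := by
  have := H.locInt.aestronglyMeasurable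
  rwa [restrict_Ioi_prod_univ] at this

lemma lintegral_source_slice_le (H : IsWavePair σ δ Λ E C μ ν a c g r s) {L η : ℝ} (hL : 0 < L)
    (hη : 0 < η) {τ : ℝ} (hτ : 0 < τ) :
    ∫⁻ x, ENNReal.ofReal (|g τ x| * cut L x)
      ≤ ENNReal.ofReal η * (∫⁻ x, ENNReal.ofReal (cut L x) * (μ τ : Measure ℝ).rnDeriv volume x
          * (ν τ : Measure ℝ).rnDeriv volume x)
        + ENNReal.ofReal (C ^ 2 / (2 * η) + C / 2) * (2 * ENNReal.ofReal E) := by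
  have hC := H.C_nonneg
  set K := C ^ 2 / (2 * η) + C / 2 with hK
  have hK0 : 0 ≤ K := by positivity
  have hpt : ∀ᵐ x, ENNReal.ofReal (|g τ x| * cut L x)
      ≤ ENNReal.ofReal η * (ENNReal.ofReal (cut L x) * (μ τ : Measure ℝ).rnDeriv volume x
          * (ν τ : Measure ℝ).rnDeriv volume x)
        + ENNReal.ofReal K * ((μ τ : Measure ℝ).rnDeriv volume x
          + (ν τ : Measure ℝ).rnDeriv volume x) := by
    filter_upwards [H.dens_r τ hτ.le, H.dens_s τ hτ.le] with x hx hx'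
    have hr := H.r_nonneg τ x
    have hs := H.s_nonneg τ x
    have hc := cut_nonneg hL x
    rw [hx, hx', ← ENNReal.ofReal_mul hc, ← ENNReal.ofReal_mul (by positivity),
      ← ENNReal.ofReal_mul hη.le, ← ENNReal.ofReal_add hr hs, ← ENNReal.ofReal_mul hK0,
      ← ENNReal.ofReal_add (by positivity) (by positivity)]
    refine ENNReal.ofReal_le_ofReal ?_
    have h1 := (H.g_le τ hτ x).trans (interaction_young hC hη hr hs)
    calc |g τ x| * cut L x ≤ (η * (r τ x * s τ x) + K * (r τ x + s τ x)) * cut L x := by gcongr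
      _ = η * (cut L x * r τ x * s τ x) + K * (r τ x + s τ x) * cut L x := by ring
      _ ≤ η * (cut L x * r τ x * s τ x) + K * (r τ x + s τ x) * 1 := by
          gcongr
          exact cut_le_one L x
      _ = _ := by ring
  refine (lintegral_mono_ae hpt).trans ?_
  have m1 := Measure.measurable_rnDeriv (μ τ : Measure ℝ) volume
  have m2 := Measure.measurable_rnDeriv (ν τ : Measure ℝ) volume
  rw [lintegral_add_right _ (by exact (m1.add m2).const_mul _), lintegral_const_mul' _ _ ENNReal.ofReal_ne_top,
    lintegral_const_mul' _ _ ENNReal.ofReal_ne_top, lintegral_add_left m1, two_mul]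
  gcongr
  · exact lintegral_rnDeriv_le_ofReal (H.mass_μ τ)
  · exact lintegral_rnDeriv_le_ofReal (H.mass_ν τ)

/-- The constant bounding the total interaction up to time `T`. -/
lemma exists_source_cut_bound (H : IsWavePair σ δ Λ E C μ ν a c g r s) (T : ℝ) :
    ∃ K : ℝ, ∀ L, 1 ≤ L → ∀ t, 0 < t → t ≤ T →
      ∫⁻ z, ENNReal.ofReal (|g z.1 z.2| * cut L z.2) ∂((volume.restrict (Ioc t T)).prod volume)
        ≤ ENNReal.ofReal K := by
  have hE := H.E_nonneg
  have hΛ := H.Λ_nonneg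
  have hC := H.C_nonneg
  have hδ := H.δ_pos
  -- With this choice 2Eη/δ ≤ 1/2, so the integral Γ of |g| reappears on the right with factor at
  -- most 1/2 and can be absorbed. The absorption is legitimate since Γ is finite thanks to the
  -- cutoff, and the resulting bound depends neither on L nor on the initial time t.
  set η := δ / (4 * (E + 1)) with hη
  have hη0 : 0 < η := by positivity
  set K₀ := C ^ 2 / (2 * η) + C / 2 with hK₀
  have hK₀0 : 0 ≤ K₀ := by positivity
  refine ⟨2 * ((2 * E * E + T * (3 * Λ * E * E)) / 4 + K₀ * (2 * E) * T), fun L hL t ht htT => ?_⟩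
  have hL0 : 0 < L := by linarith
  have hT0 : 0 < T := ht.trans_le htT
  have hsub : Icc t T ⊆ Ioi 0 := fun τ hτ => ht.trans_le hτ.1
  have I0 := integrable_mul_of_compact_support (g := fun t x => |g t x|) H.locInt.norm
    (φ := fun _ x => cut L x) (r := 3 * L) ((cut_continuous L).comp continuous_snd)
    (fun _ x hx => cut_eq_zero hL0 hx) isCompact_Icc hsub
  have I1 : Integrable (fun z : ℝ × ℝ => |g z.1 z.2| * cut L z.2)
      ((volume.restrict (Ioc t T)).prod volume) := by
    rw [← restrict_Ioi_prod_univ] at I0 ⊢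
    exact IntegrableOn.mono_set I0 (prod_mono Ioc_subset_Icc_self le_rfl)
  have hnn : ∀ z : ℝ × ℝ, 0 ≤ |g z.1 z.2| * cut L z.2 := fun z =>
    mul_nonneg (abs_nonneg _) (cut_nonneg hL0 _)
  rw [← ofReal_integral_eq_lintegral_ofReal I1 (Eventually.of_forall hnn)]
  refine ENNReal.ofReal_le_ofReal ?_
  set Γ := ∫ z, |g z.1 z.2| * cut L z.2 ∂((volume.restrict (Ioc t T)).prod volume) with hΓ
  have hΓ0 : 0 ≤ Γ := integral_nonneg hnn
  have e1 : ∫ τ in t..T, ∫ x, |g τ x| * cut L x = Γ := by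
    rw [intervalIntegral.integral_of_le htT, hΓ, integral_prod _ I1]
  have b1 := H.lintegral_interaction_le hL ht htT
  rw [e1] at b1
  set Q := ∫⁻ τ in Ioc t T, ∫⁻ x, ENNReal.ofReal (cut L x) * (μ τ : Measure ℝ).rnDeriv volume x
        * (ν τ : Measure ℝ).rnDeriv volume x with hQ
  have b2 : ENNReal.ofReal Γ ≤ ENNReal.ofReal η * Q
      + ENNReal.ofReal K₀ * (2 * ENNReal.ofReal E) * ENNReal.ofReal T := by
    rw [hΓ, ofReal_integral_eq_lintegral_ofReal I1 (Eventually.of_forall hnn),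
      lintegral_prod _ I1.aemeasurable.ennreal_ofReal]
    calc _ ≤ ∫⁻ τ in Ioc t T, (ENNReal.ofReal η * (∫⁻ x, ENNReal.ofReal (cut L x)
          * (μ τ : Measure ℝ).rnDeriv volume x * (ν τ : Measure ℝ).rnDeriv volume x)
          + ENNReal.ofReal K₀ * (2 * ENNReal.ofReal E)) :=
          setLIntegral_mono' measurableSet_Ioc fun τ hτ =>
            H.lintegral_source_slice_le hL0 hη0 (ht.trans hτ.1)
      _ = ENNReal.ofReal η * Q + ENNReal.ofReal K₀ * (2 * ENNReal.ofReal E)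
          * ENNReal.ofReal (T - t) := by
          rw [lintegral_add_right _ measurable_const,
            lintegral_const_mul' _ _ ENNReal.ofReal_ne_top]
          simp [hQ]
      _ ≤ _ := by
          gcongr
          linarith
  have hE2 : 2 * ENNReal.ofReal E = ENNReal.ofReal (2 * E) := by
    rw [ENNReal.ofReal_mul (by norm_num), ENNReal.ofReal_ofNat]
  have hX0 : 0 ≤ (2 * E * E + (T - t) * (3 * Λ * E * E) + 2 * E * Γ) / δ := by
    have : 0 ≤ T - t := by linarith
    positivity
  have b3 : ENNReal.ofReal Γ ≤ ENNReal.ofReal (η * ((2 * E * E + (T - t) * (3 * Λ * E * E)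
      + 2 * E * Γ) / δ) + K₀ * (2 * E) * T) := by
    rw [ENNReal.ofReal_add (by positivity) (by positivity), ENNReal.ofReal_mul hη0.le,
      ENNReal.ofReal_mul (by positivity), ENNReal.ofReal_mul hK₀0, ← hE2]
    exact b2.trans (by gcongr)
  rw [ENNReal.ofReal_le_ofReal_iff (by positivity)] at b3
  have e2 : η * ((2 * E * E + (T - t) * (3 * Λ * E * E) + 2 * E * Γ) / δ)
      = (2 * E * E + (T - t) * (3 * Λ * E * E) + 2 * E * Γ) / (4 * (E + 1)) := by
    rw [hη]
    field_simp
  rw [e2] at b3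
  have e3 : (2 * E * E + (T - t) * (3 * Λ * E * E) + 2 * E * Γ) / (4 * (E + 1))
      ≤ (2 * E * E + T * (3 * Λ * E * E)) / 4 + Γ / 2 := by
    rw [div_le_iff₀ (by positivity)]
    have p1 : 0 ≤ t * (3 * Λ * E * E) := by positivity
    have p2 : 0 ≤ (2 * E * E + T * (3 * Λ * E * E)) * E := by positivity
    nlinarith
  linarith

/-- The bound of `exists_source_cut_bound` is uniform in the cutoff and in the lower time, so
Fatou's lemma lets the strips (`eps n` · T, T] and the cutoffs exhaust (0,T] × ℝ. -/
lemma sourceIntegrable (H : IsWavePair σ δ Λ E C μ ν a c g r s) : SourceIntegrable g := by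
  intro T
  rcases le_or_gt T 0 with hT | hT
  · simp [Ioc_eq_empty_of_le hT]
  obtain ⟨K, hK⟩ := H.exists_source_cut_bound T
  have hmeas : AEStronglyMeasurable (Function.uncurry g)
      ((volume.restrict (Ioc 0 T)).prod volume) :=
    H.aemeasurable_g.mono_measure (Measure.prod_mono
      (Measure.restrict_mono Ioc_subset_Ioi_self le_rfl) le_rfl)
  refine ⟨hmeas, ?_⟩
  have hsmall : ∀ n, 0 < eps n * T ∧ eps n * T ≤ T := fun n =>
    ⟨mul_pos (eps_pos n) hT, mul_le_of_le_one_left hT.le (eps_le_one n)⟩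
  set f : ℕ → ℝ × ℝ → ℝ≥0∞ := fun n => (Ioc (eps n * T) T ×ˢ (univ : Set ℝ)).indicator
    fun z => ENNReal.ofReal (|g z.1 z.2| * cut ((n : ℝ) + 1) z.2) with hf
  have hms : ∀ n, MeasurableSet (Ioc (eps n * T) T ×ˢ (univ : Set ℝ)) := fun n =>
    measurableSet_Ioc.prod MeasurableSet.univ
  have hfm : ∀ n, AEMeasurable (f n) ((volume.restrict (Ioc 0 T)).prod volume) := fun n => by
    refine AEMeasurable.indicator (AEMeasurable.ennreal_ofReal ?_) (hms n)
    exact hmeas.norm.aemeasurable.mul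
      ((cut_continuous _).measurable.comp measurable_snd).aemeasurable
  have hfb : ∀ n, ∫⁻ z, f n z ∂((volume.restrict (Ioc 0 T)).prod volume) ≤ ENNReal.ofReal K :=
    fun n => by
      rw [hf, lintegral_indicator (hms n)]
      have : ((volume.restrict (Ioc 0 T)).prod volume).restrict
          (Ioc (eps n * T) T ×ˢ (univ : Set ℝ))
          = (volume.restrict (Ioc (eps n * T) T)).prod (volume : Measure ℝ) := by
        rw [← Measure.prod_restrict, Measure.restrict_restrict measurableSet_Ioc,
          Measure.restrict_univ, inter_eq_self_of_subset_left]
        exact Ioc_subset_Ioc_left (hsmall n).1.le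
      rw [this]
      exact hK _ (by linarith [Nat.cast_nonneg (α := ℝ) n]) _ (hsmall n).1 (hsmall n).2
  have hlim : ∀ᵐ z ∂((volume.restrict (Ioc 0 T)).prod volume),
      Tendsto (fun n => f n z) atTop (𝓝 ‖Function.uncurry g z‖ₑ) := by
    have : ∀ᵐ z ∂((volume.restrict (Ioc 0 T)).prod (volume : Measure ℝ)), z.1 ∈ Ioc 0 T := by
      rw [← restrict_Ioi_prod_univ]
      filter_upwards [ae_restrict_mem (measurableSet_Ioc.prod MeasurableSet.univ)] with z hz
        using hz.1
    filter_upwards [this] with z hz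
    have h0 : Tendsto (fun n => eps n * T) atTop (𝓝 0) := by simpa using tendsto_eps.mul_const T
    have h1 : ∀ᶠ n in atTop, f n z = ENNReal.ofReal (|g z.1 z.2| * cut ((n : ℝ) + 1) z.2) := by
      filter_upwards [h0.eventually (gt_mem_nhds hz.1)] with n hn
      exact indicator_of_mem (show z ∈ Ioc (eps n * T) T ×ˢ (univ : Set ℝ) from
        ⟨⟨hn, hz.2⟩, mem_univ _⟩) _
    have h2 := ENNReal.tendsto_ofReal ((tendsto_cut z.2).const_mul |g z.1 z.2|)
    rw [mul_one] at h2
    have h3 : ‖Function.uncurry g z‖ₑ = ENNReal.ofReal |g z.1 z.2| := Real.enorm_eq_ofReal_abs _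
    rw [h3]
    exact h2.congr' (h1.mono fun n hn => hn.symm)
  have := lintegral_liminf_le' (u := atTop) hfm
  rw [lintegral_congr_ae (hlim.mono fun z hz => hz.liminf_eq)] at this
  refine lt_of_le_of_lt (this.trans ?_) (ENNReal.ofReal_lt_top (r := K))
  exact (liminf_le_liminf (v := fun _ => ENNReal.ofReal K) (Eventually.of_forall hfb)).trans_eq
    tendsto_const_nhds.liminf_eq

end IsWavePair

/-! ### Smoothed velocity fields -/

/-- Lebesgue measure on `[-R, R]`, as a constant family of finite measures. -/
noncomputable def boxMeasure (R : ℝ) (_ : ℝ) : FiniteMeasure ℝ :=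
  ⟨volume.restrict (Icc (-R) R), inferInstance⟩

lemma coe_boxMeasure (R t : ℝ) :
    (boxMeasure R t : Measure ℝ) = volume.restrict (Icc (-R) R) := rfl

lemma half_le_moll_boxMeasure {R h x : ℝ} (hh : 0 < h) (h1 : h ≤ 1) (hx : |x| ≤ R - 1) (t : ℝ) :
    1 / 2 ≤ moll h (boxMeasure R) (fun _ _ => 1) t x := by
  have key := average_le_moll (boxMeasure R) hh t x
  have hsub : Metric.closedBall x (h / 2) ⊆ Icc (-R) R := by
    rw [Real.closedBall_eq_Icc]
    rw [abs_le] at hx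
    exact Icc_subset_Icc (by linarith) (by linarith)
  rw [coe_boxMeasure, Measure.restrict_apply' measurableSet_Icc, inter_eq_self_of_subset_left hsub,
    ENNReal.div_self, mul_one] at key
  · by_contra hcon
    rw [not_le] at hcon
    have := key.trans_lt ((ENNReal.ofReal_lt_ofReal_iff (by norm_num)).2 hcon)
    rw [ENNReal.ofReal_div_of_pos two_pos] at this
    simp at this
  · rw [Real.volume_closedBall]
    simpa using hh
  · rw [Real.volume_closedBall]
    exact ENNReal.ofReal_ne_top

lemma moll_boxMeasure_le_one {R h : ℝ} (hh : 0 < h) (t x : ℝ) :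
    moll h (boxMeasure R) (fun _ _ => 1) t x ≤ 1 := by
  have e : ∫ y, rho ((x - y) / h) / h = 1 := by
    rw [integral_sub_left_eq_self (fun y => rho (y / h) / h) volume x, integral_div,
      Measure.integral_comp_div (fun y => rho y) h, integral_rho, smul_eq_mul, mul_one,
      abs_of_pos hh, div_self hh.ne']
  have hi : Integrable fun y => rho ((x - y) / h) / h := by
    by_contra hcon
    rw [integral_undef hcon] at e
    norm_num at e
  rw [moll, coe_boxMeasure]
  simp only [mul_one]
  refine le_of_le_of_eq ?_ e
  exact setIntegral_le_integral hi (Eventually.of_forall fun y => rho_div_nonneg hh _)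

section moll

variable {m : ℝ → FiniteMeasure ℝ} {b : ℝ → ℝ → ℝ} {h Λ E : ℝ}

lemma rho_mul_abs_le {h x y α w β : ℝ} (hh : 0 < h) (hw : |y - x| ≤ h → |β - α| ≤ w) :
    |rho ((x - y) / h) / h * (β - α)| ≤ rho ((x - y) / h) / h * w := by
  rcases le_or_gt (|y - x|) h with h1 | h1
  · rw [abs_mul, abs_of_nonneg (rho_div_nonneg hh _)]
    exact mul_le_mul_of_nonneg_left (hw h1) (rho_div_nonneg hh _)
  · rw [rho_eq_zero]
    · simp
    · rw [abs_div, abs_of_pos hh, le_div_iff₀ hh, one_mul, abs_sub_comm]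
      exact h1.le

lemma moll_sub_abs_le (hh : 0 < h) (hbc : Continuous (Function.uncurry b))
    (hb : ∀ t x, |b t x| ≤ Λ) {t x α w : ℝ} (hw : ∀ y, |y - x| ≤ h → |b t y - α| ≤ w) :
    |moll h m b t x - α * moll h m (fun _ _ => 1) t x| ≤ w * moll h m (fun _ _ => 1) t x := by
  have i1 := moll_integrable (m := m) (b := fun _ _ => 1) (Λ := 1) hh continuous_const (by simp) t x
  have i2 := moll_integrable (m := m) hh hbc hb t x
  simp only [moll]
  rw [← integral_const_mul, ← integral_const_mul, ← integral_sub i2 (i1.const_mul _)]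
  refine (norm_integral_le_integral_norm _).trans (integral_mono ((i2.sub (i1.const_mul _)).norm)
    (i1.const_mul _) fun y => ?_)
  have := rho_mul_abs_le hh (hw y)
  simp only [Real.norm_eq_abs, Pi.sub_apply]
  rw [show rho ((x - y) / h) / h * b t y - α * (rho ((x - y) / h) / h * 1)
    = rho ((x - y) / h) / h * (b t y - α) by ring]
  linarith

/-- The constant is of order 1/h² and blows up as h → 0; it is used only at fixed h, to solve the
approximate differential equation. -/
lemma exists_moll_lipschitz (hh : 0 < h) (hE : ∀ t, (m t : Measure ℝ).real univ ≤ E)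
    (hbc : Continuous (Function.uncurry b)) (hb : ∀ t x, |b t x| ≤ Λ) :
    ∃ K : ℝ, 0 ≤ K ∧ ∀ t x x', |moll h m b t x - moll h m b t x'| ≤ K * |x - x'| := by
  obtain ⟨K, hK0, hK⟩ := exists_lipschitz_rho
  have hΛ0 : 0 ≤ Λ := (abs_nonneg _).trans (hb 0 0)
  have hE0 : 0 ≤ E := measureReal_nonneg.trans (hE 0)
  refine ⟨K / h / h * Λ * E, by positivity, fun t x x' => ?_⟩
  rw [moll, moll, ← integral_sub (moll_integrable hh hbc hb t x) (moll_integrable hh hbc hb t x')]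
  refine (integral_abs_le_of_bdd (B := K / h / h * Λ * |x - x'|) (by positivity) (fun y => ?_)
    (hE t)).trans (le_of_eq (by ring))
  rw [← sub_mul, ← sub_div, abs_mul, abs_div, abs_of_pos hh]
  have h1 := hK ((x - y) / h) ((x' - y) / h)
  rw [← sub_div, sub_sub_sub_cancel_right, abs_div, abs_of_pos hh] at h1
  calc |rho ((x - y) / h) - rho ((x' - y) / h)| / h * |b t y|
      ≤ K * (|x - x'| / h) / h * Λ := by gcongr; exact hb t y
    _ = _ := by ring

end moll

lemma abs_div_sub_div_le {N N' D D' Λ : ℝ} (hD : 1 / 2 ≤ D) (hD' : 1 / 2 ≤ D')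
    (hN : |N| ≤ Λ * D) : |N / D - N' / D'| ≤ 2 * (|N - N'| + Λ * |D - D'|) := by
  have h1 : (0 : ℝ) < D := by linarith
  have h2 : (0 : ℝ) < D' := by linarith
  have hΛ : 0 ≤ Λ := by
    by_contra h
    rw [not_le] at h
    nlinarith [abs_nonneg N]
  have e : N / D - N' / D' = ((N - N') + N / D * (D' - D)) / D' := by
    field_simp
    ring
  have h3 : |N / D| ≤ Λ := by
    rw [abs_div, abs_of_pos h1, div_le_iff₀ h1]
    exact hN
  rw [e, abs_div, abs_of_pos h2, div_le_iff₀ h2]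
  have h4 : |N - N' + N / D * (D' - D)| ≤ |N - N'| + Λ * |D - D'| := by
    refine (abs_add_le _ _).trans ?_
    rw [abs_mul, abs_sub_comm D' D]
    gcongr
  have h5 : 0 ≤ |N - N'| + Λ * |D - D'| := by positivity
  nlinarith

/-- Curves moving with a velocity which averages the speed `a` against mollified measures. -/
lemma exists_approximate_characteristic {m : ℝ → FiniteMeasure ℝ} {a : ℝ → ℝ → ℝ} {Λ E : ℝ}
    (hm : Continuous m) (hE : ∀ t, (m t : Measure ℝ).real univ ≤ E)
    (ha : Continuous (Function.uncurry a)) (hΛ : ∀ t x, |a t x| ≤ Λ) (ybar : ℝ) {h : ℝ}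
    (hh : 0 < h) (h1 : h ≤ 1) {T : ℝ} (hT : 0 ≤ T) :
    ∃ X v : ℝ → ℝ, Continuous v ∧ (∀ t, |v t| ≤ Λ) ∧ X 0 = ybar ∧ (∀ t, HasDerivAt X (v t) t) ∧
      ∀ t ∈ Icc 0 T, ∀ α w : ℝ, (∀ y, |y - X t| ≤ h → |a t y - α| ≤ w) →
        |v t - α| ≤ w ∧
        |∫ y, rho ((X t - y) / h) / h * (v t - a t y) ∂(m t : Measure ℝ)| ≤ 2 * w := by
  have hΛ0 : 0 ≤ Λ := (abs_nonneg _).trans (hΛ 0 0)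
  set R₀ := Λ * T with hR₀
  have hR₀0 : 0 ≤ R₀ := by positivity
  set R := |ybar| + R₀ + 1 with hR
  -- Lebesgue measure on a box is added to m so that the denominator D of the average stays at least
  -- 1/2 even where m has no mass. The box exceeds the reachable interval by 1, which leaves room
  -- for the kernel because h ≤ 1.
  set κ := boxMeasure R
  have hκc : Continuous κ := continuous_const
  have hκE : ∀ t, (κ t : Measure ℝ).real univ ≤ (κ 0 : Measure ℝ).real univ := fun t => le_rfl
  set N : ℝ → ℝ → ℝ := fun t x => moll h m a t x + moll h κ a t x with hN
  set D : ℝ → ℝ → ℝ := fun t x => moll h m (fun _ _ => 1) t x + moll h κ (fun _ _ => 1) t x with hD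
  have hNc : Continuous (Function.uncurry N) :=
    (moll_continuous hm hh ha hΛ).add (moll_continuous hκc hh ha hΛ)
  have hDc : Continuous (Function.uncurry D) :=
    (moll_continuous (Λ := 1) hm hh continuous_const (by simp)).add
      (moll_continuous (Λ := 1) hκc hh continuous_const (by simp))
  -- Clamping makes the velocity field globally bounded and Lipschitz. It is inactive along the
  -- solution: with speed at most Λ the curve stays within R₀ = ΛT of its start up to time T.
  set cl : ℝ → ℝ := fun x => max (ybar - R₀) (min (ybar + R₀) x) with hcl
  have hclc : Continuous cl := by fun_prop
  have hcl1 : ∀ x x', |cl x - cl x'| ≤ |x - x'| := fun x x' =>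
    (abs_max_sub_max_le_max _ _ _ _).trans (by
      simpa [min_comm] using abs_min_sub_min_le_max x (ybar + R₀) x' (ybar + R₀))
  have hclR : ∀ x, |cl x| ≤ R - 1 := fun x => by
    have h1 : ybar - R₀ ≤ cl x := le_max_left _ _
    have h2 : cl x ≤ ybar + R₀ := max_le (by linarith) (min_le_left _ _)
    rw [abs_le]
    constructor <;> linarith [neg_abs_le ybar, le_abs_self ybar]
  have hD0 : ∀ t x, 1 / 2 ≤ D t (cl x) := fun t x => by
    have := half_le_moll_boxMeasure hh h1 (hclR x) t
    have := moll_one_nonneg (m := m) hh t (cl x)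
    simp only [hD]
    linarith
  have havg : ∀ t x α w : ℝ, (∀ y, |y - x| ≤ h → |a t y - α| ≤ w) →
      |N t x - α * D t x| ≤ w * D t x := fun t x α w hw => by
    have e1 := moll_sub_abs_le (m := m) hh ha hΛ hw
    have e2 := moll_sub_abs_le (m := κ) hh ha hΛ hw
    simp only [hN, hD]
    rw [show moll h m a t x + moll h κ a t x
        - α * (moll h m (fun _ _ => 1) t x + moll h κ (fun _ _ => 1) t x)
      = (moll h m a t x - α * moll h m (fun _ _ => 1) t x)
        + (moll h κ a t x - α * moll h κ (fun _ _ => 1) t x) by ring]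
    exact (abs_add_le _ _).trans (by linarith)
  have hNΛ : ∀ t x, |N t x| ≤ Λ * D t x := fun t x => by
    simpa using havg t x 0 Λ fun y _ => by simpa using hΛ t y
  set V : ℝ → ℝ → ℝ := fun t x => N t (cl x) / D t (cl x) with hV
  have hVc : Continuous (Function.uncurry V) := by
    refine (hNc.comp (by fun_prop : Continuous fun p : ℝ × ℝ => (p.1, cl p.2))).div
      (hDc.comp (by fun_prop : Continuous fun p : ℝ × ℝ => (p.1, cl p.2))) fun p => ?_
    have := hD0 p.1 p.2
    exact (show (0 : ℝ) < D p.1 (cl p.2) by linarith).ne'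
  have hVavg : ∀ t x α w : ℝ, (∀ y, |y - cl x| ≤ h → |a t y - α| ≤ w) → |V t x - α| ≤ w :=
    fun t x α w hw => by
      have hp : 0 < D t (cl x) := by linarith [hD0 t x]
      have := havg t (cl x) α w hw
      rw [show V t x - α = (N t (cl x) - α * D t (cl x)) / D t (cl x) by
        rw [hV]; field_simp, abs_div, abs_of_pos hp, div_le_iff₀ hp]
      exact this
  have hVΛ : ∀ t x, |V t x| ≤ Λ := fun t x => by
    simpa using hVavg t x 0 Λ fun y _ => by simpa using hΛ t y
  obtain ⟨K₁, hK₁0, hK₁⟩ := exists_moll_lipschitz hh hE ha hΛ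
  obtain ⟨K₂, hK₂0, hK₂⟩ := exists_moll_lipschitz hh hκE ha hΛ
  obtain ⟨K₃, hK₃0, hK₃⟩ := exists_moll_lipschitz (b := fun _ _ => 1) (Λ := 1) hh hE
    continuous_const (by simp)
  obtain ⟨K₄, hK₄0, hK₄⟩ := exists_moll_lipschitz (b := fun _ _ => 1) (Λ := 1) hh hκE
    continuous_const (by simp)
  have hVL : ∀ t x x', |V t x - V t x'| ≤ 2 * ((K₁ + K₂) + Λ * (K₃ + K₄)) * |x - x'| :=
    fun t x x' => by
      have b1 : |N t (cl x) - N t (cl x')| ≤ (K₁ + K₂) * |x - x'| := by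
        simp only [hN]
        rw [add_sub_add_comm, add_mul]
        refine (abs_add_le _ _).trans (add_le_add ?_ ?_)
        · exact (hK₁ _ _ _).trans (mul_le_mul_of_nonneg_left (hcl1 _ _) hK₁0)
        · exact (hK₂ _ _ _).trans (mul_le_mul_of_nonneg_left (hcl1 _ _) hK₂0)
      have b2 : |D t (cl x) - D t (cl x')| ≤ (K₃ + K₄) * |x - x'| := by
        simp only [hD]
        rw [add_sub_add_comm, add_mul]
        refine (abs_add_le _ _).trans (add_le_add ?_ ?_)
        · exact (hK₃ _ _ _).trans (mul_le_mul_of_nonneg_left (hcl1 _ _) hK₃0)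
        · exact (hK₄ _ _ _).trans (mul_le_mul_of_nonneg_left (hcl1 _ _) hK₄0)
      refine (abs_div_sub_div_le (hD0 t x) (hD0 t x') (hNΛ _ _)).trans ?_
      have := mul_le_mul_of_nonneg_left b2 hΛ0
      linarith
  have hPL : IsPicardLindelof V (tmin := 0) (tmax := T) ⟨0, le_rfl, hT⟩ ybar
      (Λ * T).toNNReal 0 Λ.toNNReal (2 * ((K₁ + K₂) + Λ * (K₃ + K₄))).toNNReal := by
    refine ⟨fun t _ => ?_, fun x _ => ?_, fun t _ x _ => ?_, ?_⟩
    · refine LipschitzWith.lipschitzOnWith (LipschitzWith.of_dist_le_mul fun x x' => ?_)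
      rw [Real.dist_eq, Real.dist_eq, Real.coe_toNNReal _ (by positivity)]
      exact hVL t x x'
    · exact (hVc.comp (by fun_prop : Continuous fun t : ℝ => (t, x))).continuousOn
    · rw [Real.coe_toNNReal _ hΛ0]
      exact hVΛ t x
    · rw [Real.coe_toNNReal _ hΛ0, Real.coe_toNNReal _ hR₀0]
      simp [max_eq_left hT, hR₀]
  obtain ⟨α, hα0, hα⟩ := hPL.exists_eq_forall_mem_Icc_hasDerivWithinAt₀
  have hαc : ContinuousOn α (Icc 0 T) := fun t ht => (hα t ht).continuousWithinAt
  have hβc : Continuous fun s => α (projIcc 0 T hT s) :=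
    (continuousOn_iff_continuous_domRestrict.1 hαc).comp continuous_projIcc
  -- Freezing the position α outside [0,T] gives a velocity that is continuous on all of ℝ, and its
  -- primitive X is differentiable everywhere.
  set v : ℝ → ℝ := fun s => V s (α (projIcc 0 T hT s)) with hv
  have hvc : Continuous v := hVc.comp (continuous_id.prodMk hβc)
  have hvα : ∀ t ∈ Icc 0 T, v t = V t (α t) := fun t ht => by
    simp only [hv, projIcc_of_mem hT ht]
  set X : ℝ → ℝ := fun t => ybar + ∫ s in (0 : ℝ)..t, v s with hX
  have hXα : ∀ t ∈ Icc 0 T, X t = α t := fun t ht => by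
    have h0 := intervalIntegral.integral_eq_sub_of_hasDerivAt_of_le ht.1
      (hαc.mono (Icc_subset_Icc_right ht.2)) (f' := v) (fun s hs => by
        have hs' : s ∈ Icc 0 T := ⟨hs.1.le, hs.2.le.trans ht.2⟩
        rw [hvα s hs']
        exact (hα s hs').hasDerivAt (Icc_mem_nhds hs.1 (hs.2.trans_le ht.2)))
      (hvc.intervalIntegrable _ _)
    rw [hX]
    simp only
    rw [h0]
    simp only at hα0
    rw [hα0]
    ring
  have hclX : ∀ t ∈ Icc 0 T, cl (X t) = X t := fun t ht => by
    have h2 : |X t - ybar| ≤ R₀ := by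
      have h3 := intervalIntegral.norm_integral_le_of_norm_le_const (a := 0) (b := t) (f := v)
        (C := Λ) fun s _ => hVΛ s _
      rw [sub_zero, abs_of_nonneg ht.1] at h3
      simp only [hX, add_sub_cancel_left]
      exact h3.trans (mul_le_mul_of_nonneg_left ht.2 hΛ0)
    rw [abs_le] at h2
    simp only [hcl]
    rw [min_eq_right (by linarith), max_eq_right (by linarith)]
  refine ⟨X, v, hvc, fun t => hVΛ t _, by simp [hX], fun t => ?_, fun t ht α' w hw => ?_⟩
  · exact (intervalIntegral.integral_hasDerivAt_right (hvc.intervalIntegrable _ _)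
      (hvc.stronglyMeasurableAtFilter _ _) hvc.continuousAt).const_add ybar
  · have hvX : v t = V t (X t) := by rw [hvα t ht, hXα t ht]
    have hw' : ∀ y, |y - cl (X t)| ≤ h → |a t y - α'| ≤ w := by rwa [hclX t ht]
    have k1 : |v t - α'| ≤ w := by rw [hvX]; exact hVavg t (X t) α' w hw'
    refine ⟨k1, ?_⟩
    have hw0 : 0 ≤ w := (abs_nonneg _).trans k1
    have i1 := moll_integrable (m := m) (b := fun _ _ => 1) (Λ := 1) hh continuous_const (by simp)
      t (X t)
    have i2 := moll_integrable (m := m) hh ha hΛ t (X t)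
    have e1 : ∫ y, rho ((X t - y) / h) / h * (v t - a t y) ∂(m t : Measure ℝ)
        = v t * moll h m (fun _ _ => 1) t (X t) - moll h m a t (X t) := by
      simp only [moll]
      rw [← integral_const_mul, ← integral_sub (i1.const_mul _) i2]
      congr 1 with y
      ring
    have e2 : v t * D t (X t) = N t (X t) := by
      have := hD0 t (X t)
      rw [hvX, hV]
      simp only
      rw [hclX t ht] at this ⊢
      exact div_mul_cancel₀ _ (by linarith)
    -- Since v D = N, the mismatch between v and a against m is the opposite of their mismatch
    -- against the box measure. The latter has mollified density at most 1, so the error is at most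
    -- 2w however large the concentration of m near the curve.
    have e3 : v t * moll h m (fun _ _ => 1) t (X t) - moll h m a t (X t)
        = (moll h κ a t (X t) - α' * moll h κ (fun _ _ => 1) t (X t))
          - (v t - α') * moll h κ (fun _ _ => 1) t (X t) := by
      simp only [hN, hD] at e2
      linarith
    rw [e1, e3]
    have p1 := moll_sub_abs_le (m := κ) hh ha hΛ hw
    have p2 := moll_boxMeasure_le_one (R := R) hh t (X t)
    have p3 := moll_one_nonneg (m := κ) hh t (X t)
    refine (abs_sub _ _).trans ?_
    rw [abs_mul, abs_of_nonneg p3]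
    have p4 := mul_le_mul k1 p2 p3 hw0
    have p5 := mul_le_mul_of_nonneg_left p2 hw0
    linarith

/-! ### Compactness of families of Lipschitz curves -/

/-- Tychonoff's theorem gives convergence at all rational times, and the common Lipschitz constant
carries the Cauchy property to the remaining times. -/
lemma exists_subseq_tendsto_of_lipschitz {X : ℕ → ℝ → ℝ} {Λ ybar : ℝ}
    (hX : ∀ n s t, |X n s - X n t| ≤ Λ * |s - t|) (h0 : ∀ n, X n 0 = ybar) :
    ∃ k : ℕ → ℕ, StrictMono k ∧ ∃ x : ℝ → ℝ, ∀ t, Tendsto (fun n => X (k n) t) atTop (𝓝 (x t)) := by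
  have hΛ : 0 ≤ Λ := by simpa using (abs_nonneg _).trans (hX 0 1 0)
  have hmem : ∀ n, (fun q : ℚ => X n q) ∈
      Set.pi univ fun q : ℚ => Icc (ybar - Λ * |(q : ℝ)|) (ybar + Λ * |(q : ℝ)|) := fun n q _ => by
    have := hX n q 0
    rw [h0, sub_zero, abs_le] at this
    exact ⟨by linarith, by linarith⟩
  obtain ⟨l, -, k, hk, hl⟩ := (isCompact_univ_pi fun q : ℚ => isCompact_Icc
    (a := ybar - Λ * |(q : ℝ)|) (b := ybar + Λ * |(q : ℝ)|)).tendsto_subseq hmem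
  rw [tendsto_pi_nhds] at hl
  have hc : ∀ t, ∃ x, Tendsto (fun n => X (k n) t) atTop (𝓝 x) := fun t => by
    refine cauchySeq_tendsto_of_complete (Metric.cauchySeq_iff.2 fun ε hε => ?_)
    obtain ⟨q, hq⟩ := exists_rat_btwn (show t < t + ε / (4 * (Λ + 1)) by
      linarith [show 0 < ε / (4 * (Λ + 1)) by positivity])
    have hq' : Λ * |t - q| ≤ ε / 4 := by
      rw [abs_sub_comm, abs_of_pos (by linarith [hq.1])]
      calc Λ * (q - t) ≤ (Λ + 1) * (ε / (4 * (Λ + 1))) := by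
            have := hq.1
            gcongr <;> linarith [hq.2]
        _ = ε / 4 := by field_simp
    obtain ⟨N, hN⟩ := Metric.cauchySeq_iff.1 (hl q).cauchySeq (ε / 2) (half_pos hε)
    refine ⟨N, fun m hm n hn => ?_⟩
    have h1 := hN m hm n hn
    have h2 := hX (k m) t q
    have h3 := hX (k n) t q
    simp only [Function.comp_apply, Real.dist_eq] at h1 ⊢
    rw [abs_lt] at h1 ⊢
    rw [abs_le] at h2 h3
    constructor <;> linarith [h1.1, h1.2, h2.1, h2.2, h3.1, h3.2]
  choose x hx using hc
  exact ⟨k, hk, x, hx⟩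

/-! ### Limits of smoothed distribution functions -/

lemma tendsto_integral_kap_of_null {m : FiniteMeasure ℝ} {u h : ℕ → ℝ} {l : ℝ} (hh : ∀ n, 0 < h n)
    (h0 : Tendsto h atTop (𝓝 0)) (hu : Tendsto u atTop (𝓝 l)) (hl : (m : Measure ℝ) {l} = 0) :
    Tendsto (fun n => ∫ y, kap ((u n - y) / h n) ∂(m : Measure ℝ)) atTop
      (𝓝 ((m : Measure ℝ).real (Iio l))) := by
  rw [← integral_indicator_one measurableSet_Iio]
  refine tendsto_integral_of_dominated_convergence (fun _ => 1)
    (fun n => (by fun_prop : Continuous fun y => kap ((u n - y) / h n)).aestronglyMeasurable)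
    (integrable_const _) (fun n => Eventually.of_forall fun y => kap_abs_le_one _) ?_
  have hne : ∀ᵐ y ∂(m : Measure ℝ), y ≠ l := by
    rw [ae_iff]
    simpa using hl
  filter_upwards [hne] with y hy
  refine tendsto_const_nhds.congr' ?_
  rcases lt_or_gt_of_ne hy with hy | hy
  · filter_upwards [tendsto_kap_of_pos hh h0 (hu.sub_const y) (sub_pos.2 hy)] with n hn
    simp [hn, hy]
  · filter_upwards [tendsto_kap_of_neg hh h0 (hu.sub_const y) (sub_neg.2 hy)] with n hn
    simp [hn, hy.le]

/-- Off l the smoothed step converges to the indicator of (-∞,l), but at l its value depends on how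
fast u approaches l compared with h. An atom at l can thus be counted with any fraction; discarding
the kernel on [l,∞), respectively replacing it by 1 on (-∞,l], gives the two bounds. -/
lemma mem_Icc_of_tendsto_integral_kap {m : FiniteMeasure ℝ} {u h : ℕ → ℝ} {l e : ℝ}
    (hh : ∀ n, 0 < h n) (h0 : Tendsto h atTop (𝓝 0)) (hu : Tendsto u atTop (𝓝 l))
    (he : Tendsto (fun n => ∫ y, kap ((u n - y) / h n) ∂(m : Measure ℝ)) atTop (𝓝 e)) :
    e ∈ Icc ((m : Measure ℝ).real (Iio l)) ((m : Measure ℝ).real (Iic l)) := by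
  have hki : ∀ n, Integrable (fun y => kap ((u n - y) / h n)) (m : Measure ℝ) := fun n =>
    integrable_of_continuous_of_bdd (by fun_prop) fun y => kap_abs_le_one _
  constructor
  · have h1 : Tendsto (fun n => ∫ y, (Iio l).indicator (fun y => kap ((u n - y) / h n)) y
        ∂(m : Measure ℝ)) atTop (𝓝 ((m : Measure ℝ).real (Iio l))) := by
      rw [← integral_indicator_one measurableSet_Iio]
      refine tendsto_integral_of_dominated_convergence (fun _ => 1)
        (fun n => ((hki n).indicator measurableSet_Iio).aestronglyMeasurable)
        (integrable_const _) (fun n => Eventually.of_forall fun y => ?_)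
        (Eventually.of_forall fun y => ?_)
      · exact (norm_indicator_le_norm_self _ _).trans (kap_abs_le_one _)
      · by_cases hy : y < l
        · refine tendsto_const_nhds.congr' ?_
          filter_upwards [tendsto_kap_of_pos hh h0 (hu.sub_const y) (sub_pos.2 hy)] with n hn
          simp [hn, hy]
        · simp [hy]
    exact le_of_tendsto_of_tendsto' h1 he fun n =>
      integral_mono ((hki n).indicator measurableSet_Iio) (hki n)
        (indicator_le_self' fun y _ => kap_nonneg _)
  · have h1 : Tendsto (fun n => ∫ y, ((Iic l).indicator 1 y
        + (Ioi l).indicator (fun y => kap ((u n - y) / h n)) y)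
        ∂(m : Measure ℝ)) atTop (𝓝 ((m : Measure ℝ).real (Iic l))) := by
      rw [← integral_indicator_one measurableSet_Iic]
      refine tendsto_integral_of_dominated_convergence (fun _ => 1 + 1)
        (fun n => (((integrable_const (1 : ℝ)).indicator measurableSet_Iic).add
          ((hki n).indicator measurableSet_Ioi)).aestronglyMeasurable)
        (integrable_const _) (fun n => Eventually.of_forall fun y => ?_)
        (Eventually.of_forall fun y => ?_)
      · refine (norm_add_le _ _).trans (add_le_add ?_ ?_)
        · refine (norm_indicator_le_norm_self _ _).trans ?_
          simp
        · exact (norm_indicator_le_norm_self _ _).trans (kap_abs_le_one _)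
      · by_cases hy : y ≤ l
        · simp [hy]
        · refine tendsto_const_nhds.congr' ?_
          filter_upwards [tendsto_kap_of_neg hh h0 (hu.sub_const y)
            (sub_neg.2 (not_le.1 hy))] with n hn
          simp [hn, hy, not_le.1 hy]
    refine le_of_tendsto_of_tendsto' he h1 fun n => integral_mono (hki n)
      (((integrable_const (1 : ℝ)).indicator measurableSet_Iic).add
          ((hki n).indicator measurableSet_Ioi)) fun y => ?_
    by_cases hy : y ≤ l
    · simpa [hy] using kap_le_one ((u n - y) / h n)
    · simp [hy, not_le.1 hy]

/-! ### Existence of characteristics -/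

/-- A weakly continuous, uniformly finite family of measures transported with a continuous bounded
speed and an integrable source. -/
structure IsTransport (Λ E : ℝ) (m : ℝ → FiniteMeasure ℝ) (a g : ℝ → ℝ → ℝ) : Prop where
  cont_m : Continuous m
  mass : ∀ t, (m t : Measure ℝ).real univ ≤ E
  cont_a : Continuous (Function.uncurry a)
  a_le : ∀ t x, |a t x| ≤ Λ
  locInt : LocallyIntegrableOn (fun z : ℝ × ℝ => g z.1 z.2) (Ioi 0 ×ˢ univ)
  source : SourceIntegrable g
  bal : IsMeasureSolution m a g

lemma IsWavePair.isTransport {σ δ Λ E C : ℝ} {μ ν : ℝ → FiniteMeasure ℝ} {a c g r s : ℝ → ℝ → ℝ}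
    (H : IsWavePair σ δ Λ E C μ ν a c g r s) : IsTransport Λ E μ a g :=
  ⟨H.cont_μ, H.mass_μ, H.cont_a, H.a_le, H.locInt, H.sourceIntegrable, H.bal_μ⟩

namespace IsTransport

variable {Λ E : ℝ} {m : ℝ → FiniteMeasure ℝ} {a g : ℝ → ℝ → ℝ}

lemma Λ_nonneg (H : IsTransport Λ E m a g) : 0 ≤ Λ := (abs_nonneg _).trans (H.a_le 0 0)

lemma isC1b_kap_curve {X v : ℝ → ℝ} (hv : Continuous v) (hvΛ : ∀ t, |v t| ≤ Λ)
    (hX : ∀ t, HasDerivAt X (v t) t) {h : ℝ} (hh : 0 < h) :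
    IsC1b (fun t y => kap ((X t - y) / h)) (fun t y => rho ((X t - y) / h) / h * v t)
      (fun t y => -(rho ((X t - y) / h) / h)) := by
  have hXc : Continuous X := continuous_iff_continuousAt.2 fun t => (hX t).continuousAt
  have hΛ : 0 ≤ Λ := (abs_nonneg _).trans (hvΛ 0)
  refine ⟨fun t _ y => ?_, fun t _ y => ?_, by simp only [Function.uncurry_def]; fun_prop,
    by simp only [Function.uncurry_def]; fun_prop, by simp only [Function.uncurry_def]; fun_prop,
    1 + 1 / h * Λ + 1 / h, fun t y => ?_⟩
  · have := (kap_hasDerivAt ((X t - y) / h)).comp t (((hX t).sub_const y).div_const h)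
    convert! this using 1
    ring
  · have := kap_scaled_hasDerivAt_right 1 h (X t) y
    simp only [one_mul] at this
    convert! this using 1
    ring
  · have h1 : 0 ≤ 1 / h * Λ := by positivity
    have h2 : 0 ≤ 1 / h := by positivity
    have h3 : |rho ((X t - y) / h) / h| ≤ 1 / h := rho_div_abs_le hh _
    refine ⟨(kap_abs_le_one _).trans (by linarith), ?_, by rw [abs_neg]; linarith⟩
    rw [abs_mul]
    have := mul_le_mul h3 (hvΛ t) (abs_nonneg _) h2
    linarith

/-- The balance law is tested with a smoothed step that moves along the approximate curve. The
transport term Z tends to 0 by the choice of velocity, the source term converges by dominated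
convergence, and the initial term converges because there is no atom at the starting point. The
velocities are averages of a near the curve, so they converge to a along the limit. -/
theorem exists_characteristic (H : IsTransport Λ E m a g) {ybar : ℝ}
    (h0 : (m 0 : Measure ℝ) {ybar} = 0) :
    ∃ x : ℝ → ℝ, (∀ s t, |x s - x t| ≤ Λ * |s - t|) ∧ x 0 = ybar ∧
      (∀ t, 0 ≤ t → HasDerivWithinAt x (a t (x t)) (Ici 0) t) ∧
      ∀ t, 0 ≤ t → (m 0 : Measure ℝ).real (Iio ybar) + (∫ s in (0 : ℝ)..t, ∫ y in Iic (x s), g s y)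
        ∈ Icc ((m t : Measure ℝ).real (Iio (x t))) ((m t : Measure ℝ).real (Iic (x t))) := by
  have hΛ := H.Λ_nonneg
  -- The n-th curve uses scale `eps n` and horizon T = n, so that every fixed time is eventually
  -- covered.
  choose X v hv hvΛ hX0 hX hav using fun n : ℕ => exists_approximate_characteristic H.cont_m H.mass
    H.cont_a H.a_le ybar (eps_pos n) (eps_le_one n) (Nat.cast_nonneg (α := ℝ) n)
  have hXL : ∀ n s t, |X n s - X n t| ≤ Λ * |s - t| := fun n s t => by
    simpa using Convex.norm_image_sub_le_of_norm_hasDerivWithin_le (f := X n) (s := univ)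
      (fun t _ => (hX n t).hasDerivWithinAt) (fun t _ => hvΛ n t) convex_univ
      (mem_univ t) (mem_univ s)
  obtain ⟨k, hk, x, hx⟩ := exists_subseq_tendsto_of_lipschitz hXL hX0
  have heps : Tendsto (fun n => eps (k n)) atTop (𝓝 0) := tendsto_eps.comp hk.tendsto_atTop
  have hxL : ∀ s t, |x s - x t| ≤ Λ * |s - t| := fun s t =>
    le_of_tendsto' ((hx s).sub (hx t)).abs fun n => hXL (k n) s t
  have hxc : Continuous x := by
    refine (LipschitzWith.of_dist_le_mul (K := Λ.toNNReal) fun s t => ?_).continuous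
    rw [Real.dist_eq, Real.dist_eq, Real.coe_toNNReal _ hΛ]
    exact hxL s t
  have hx0 : x 0 = ybar := tendsto_nhds_unique (hx 0) (by simp only [hX0]; exact tendsto_const_nhds)
  have hax : Continuous fun s => a s (x s) := H.cont_a.comp (continuous_id.prodMk hxc)
  have hlarge : ∀ t : ℝ, ∀ᶠ n in atTop, t ≤ (k n : ℝ) := fun t =>
    (tendsto_natCast_atTop_atTop.comp hk.tendsto_atTop).eventually_ge_atTop t
  have hosc : ∀ t, ∀ w, 0 < w → ∀ᶠ n in atTop, ∀ y, |y - X (k n) t| ≤ eps (k n) →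
      |a t y - a t (x t)| ≤ w := fun t w hw => by
    obtain ⟨d, hd, hd'⟩ := Metric.continuousAt_iff.1 (H.cont_a.slice t).continuousAt w hw
    filter_upwards [Metric.tendsto_nhds.1 (hx t) (d / 2) (half_pos hd),
      heps.eventually (gt_mem_nhds (half_pos hd))] with n h1 h2 y hy
    have : dist y (x t) < d := by
      rw [Real.dist_eq] at h1 ⊢
      calc |y - x t| ≤ |y - X (k n) t| + |X (k n) t - x t| := abs_sub_le _ _ _
        _ < d := by linarith
    exact (hd' this).le
  have hvlim : ∀ t, 0 ≤ t → Tendsto (fun n => v (k n) t) atTop (𝓝 (a t (x t))) := fun t ht => by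
    refine Metric.tendsto_nhds.2 fun w hw => ?_
    filter_upwards [hosc t (w / 2) (half_pos hw), hlarge t] with n h1 h2
    exact ((hav (k n) t ⟨ht, h2⟩ _ _ h1).1).trans_lt (half_lt_self hw)
  set Z : ℕ → ℝ → ℝ := fun n t => ∫ y, rho ((X n t - y) / eps n) / eps n * (v n t - a t y)
    ∂(m t : Measure ℝ) with hZ
  have hZlim : ∀ t, 0 ≤ t → Tendsto (fun n => Z (k n) t) atTop (𝓝 0) := fun t ht => by
    refine Metric.tendsto_nhds.2 fun w hw => ?_
    filter_upwards [hosc t (w / 4) (by linarith), hlarge t] with n h1 h2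
    have := (hav (k n) t ⟨ht, h2⟩ _ _ h1).2
    rw [Real.dist_eq, sub_zero]
    exact this.trans_lt (by linarith)
  have hint : ∀ t, 0 ≤ t → x t = ybar + ∫ s in (0 : ℝ)..t, a s (x s) := fun t ht => by
    have e : ∀ n, X n t = ybar + ∫ s in (0 : ℝ)..t, v n s := fun n => by
      rw [intervalIntegral.integral_eq_sub_of_hasDerivAt (fun s _ => hX n s)
        ((hv n).intervalIntegrable _ _), hX0]
      ring
    refine tendsto_nhds_unique (hx t) ?_
    simp only [e]
    refine Tendsto.const_add _ (intervalIntegral.tendsto_integral_filter_of_dominated_convergence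
      (fun _ => Λ) (Eventually.of_forall fun n => (hv (k n)).aestronglyMeasurable)
      (Eventually.of_forall fun n => Eventually.of_forall fun s _ => hvΛ (k n) s)
      intervalIntegrable_const (Eventually.of_forall fun s hs => hvlim s ?_))
    rw [uIoc_of_le ht] at hs
    exact hs.1.le
  refine ⟨x, hxL, hx0, fun t ht => ?_, fun t ht => ?_⟩
  · have hd : HasDerivAt (fun t => ybar + ∫ s in (0 : ℝ)..t, a s (x s)) (a t (x t)) t :=
      (intervalIntegral.integral_hasDerivAt_right (hax.intervalIntegrable _ _)
        (hax.stronglyMeasurableAtFilter _ _) hax.continuousAt).const_add ybar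
    exact hd.hasDerivWithinAt.congr (fun s hs => hint s hs) (hint t ht)
  refine mem_Icc_of_tendsto_integral_kap (fun n => eps_pos (k n)) heps (hx t) ?_
  have hbal : ∀ n, ∫ y, kap ((X n t - y) / eps n) ∂(m t : Measure ℝ)
      = (∫ y, kap ((ybar - y) / eps n) ∂(m 0 : Measure ℝ)) + ((∫ s in (0 : ℝ)..t, Z n s)
        + ∫ s in (0 : ℝ)..t, ∫ y, g s y * kap ((X n s - y) / eps n)) := fun n => by
    have := balance_global H.cont_m H.mass H.cont_a H.a_le H.locInt H.source H.bal
      (isC1b_kap_curve (hv n) (hvΛ n) (hX n) (eps_pos n)) le_rfl ht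
    rw [hX0, sub_eq_iff_eq_add'] at this
    rw [this, hZ]
    congr 4 with s
    congr 1 with y
    ring
  simp only [hbal]
  have hZb : ∀ (n : ℕ) s, s ∈ Icc (0 : ℝ) n → |Z n s| ≤ 2 * Λ := fun n s hs =>
    (hav n s hs 0 Λ fun y _ => by simpa using H.a_le s y).2
  have hZc : ∀ n, Continuous (Z n) := fun n => by
    have hXc : Continuous (X n) := continuous_iff_continuousAt.2 fun t => (hX n t).continuousAt
    have := hv n
    have ha := H.cont_a
    refine continuous_integral_finiteMeasure H.cont_m (B := 1 / eps n * (Λ + Λ))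
      (φ := fun t y => rho ((X n t - y) / eps n) / eps n * (v n t - a t y)) ?_ fun t y => ?_
    · simp only [Function.uncurry_def] at ha ⊢
      fun_prop
    · rw [abs_mul]
      exact mul_le_mul (rho_div_abs_le (eps_pos n) _) ((abs_sub _ _).trans
        (add_le_add (hvΛ n t) (H.a_le t y))) (abs_nonneg _) (by have := eps_pos n; positivity)
  have l1 := tendsto_integral_kap_of_null (m := m 0) (fun n => eps_pos (k n)) heps
    (tendsto_const_nhds (x := ybar)) h0
  have l2 : Tendsto (fun n => ∫ s in (0 : ℝ)..t, Z (k n) s) atTop (𝓝 0) := by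
    have := intervalIntegral.tendsto_integral_filter_of_dominated_convergence (μ := volume)
      (a := 0) (b := t) (F := fun n s => Z (k n) s) (f := fun _ => 0) (l := atTop)
      (fun _ => 2 * Λ) (Eventually.of_forall fun n => (hZc (k n)).aestronglyMeasurable) ?_
      intervalIntegrable_const (Eventually.of_forall fun s hs => hZlim s ?_)
    · simpa using this
    · filter_upwards [hlarge t] with n hn
      refine Eventually.of_forall fun s hs => hZb (k n) s ?_
      rw [uIoc_of_le ht] at hs
      exact ⟨hs.1.le, hs.2.trans hn⟩
    · rw [uIoc_of_le ht] at hs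
      exact hs.1.le
  have l3 := H.source.tendsto_integral (F := fun n s y => kap ((X (k n) s - y) / eps (k n)))
    (G := fun s y => (Iic (x s)).indicator 1 y) (B := 1) (t₁ := 0) (t₂ := t)
    (fun n => by
      have hXc : Continuous (X (k n)) :=
        continuous_iff_continuousAt.2 fun t => (hX (k n) t).continuousAt
      simp only [Function.uncurry_def]
      exact Continuous.measurable (by fun_prop))
    (fun n s y => kap_abs_le_one _) le_rfl ht fun s _ => by
      filter_upwards [Measure.ae_ne volume (x s)] with y hy
      refine tendsto_const_nhds.congr' ?_
      rcases lt_or_gt_of_ne hy with hy | hy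
      · filter_upwards [tendsto_kap_of_pos (fun n => eps_pos (k n)) heps ((hx s).sub_const y)
          (sub_pos.2 hy)] with n hn
        simp [hn, hy.le]
      · filter_upwards [tendsto_kap_of_neg (fun n => eps_pos (k n)) heps ((hx s).sub_const y)
          (sub_neg.2 hy)] with n hn
        simp [hn, hy]
  have e3 : ∀ s, ∫ y, g s y * (Iic (x s)).indicator 1 y = ∫ y in Iic (x s), g s y := fun s => by
    rw [← integral_indicator measurableSet_Iic]
    congr 1 with y
    by_cases hy : y ≤ x s <;> simp [hy]
  simp only [e3] at l3
  simpa using l1.add (l2.add l3)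

end IsTransport

/-! ### Transport of the part of a measure to the left of a characteristic -/

/-- The integral of `q` against the part of `m` of total mass `e` which lies to the left of `x`,
where the atom of `m` at `x` is split accordingly. -/
noncomputable def leftIntegral (m : Measure ℝ) (x e : ℝ) (q : ℝ → ℝ) : ℝ :=
  (∫ y in Iio x, q y ∂m) + q x * (e - m.real (Iio x))

/-- The curve `x` is a characteristic of the speed `a`, and `e` is a balanced amount of energy of
`m` to the left of `x`. -/
structure IsBalancedCurve (m : ℝ → FiniteMeasure ℝ) (a g : ℝ → ℝ → ℝ) (x e : ℝ → ℝ) : Prop where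
  cont_x : Continuous x
  deriv_x : ∀ t, 0 < t → HasDerivAt x (a t (x t)) t
  cont_e : ContinuousOn e (Ici 0)
  bal_e : ∀ t₁ t₂, 0 ≤ t₁ → t₁ ≤ t₂ → e t₂ - e t₁ = ∫ s in t₁..t₂, ∫ y in Iic (x s), g s y
  mem : ∀ t, 0 ≤ t → e t ∈ Icc ((m t : Measure ℝ).real (Iio (x t)))
    ((m t : Measure ℝ).real (Iic (x t)))

lemma hasDerivAt_along {φ φt φx : ℝ → ℝ → ℝ}
    (hdt : ∀ t, 0 < t → ∀ x, HasDerivAt (fun s => φ s x) (φt t x) t)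
    (hdx : ∀ t, 0 < t → ∀ x, HasDerivAt (φ t) (φx t x) x)
    (hct : Continuous (Function.uncurry φt)) (hcx : Continuous (Function.uncurry φx))
    {x : ℝ → ℝ} {v t : ℝ} (ht : 0 < t) (hx : HasDerivAt x v t) :
    HasDerivAt (fun s => φ s (x s)) (φt t (x t) + v * φx t (x t)) t := by
  have hev : ∀ᶠ p : ℝ × ℝ in 𝓝 (t, x t), 0 < p.1 :=
    continuous_fst.continuousAt.eventually (lt_mem_nhds ht)
  have hd : HasFDerivAt (Function.uncurry φ) (fderiv ℝ (Function.uncurry φ) (t, x t)) (t, x t) :=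
    ((contDiffAt_of_partial (hev.mono fun p hp => hdt p.1 hp p.2)
      (hev.mono fun p hp => hdx p.1 hp p.2) hct hcx).differentiableAt (by simp)).hasFDerivAt
  set L := fderiv ℝ (Function.uncurry φ) (t, x t)
  have h1 : L (1, 0) = φt t (x t) := by
    have := hd.comp_hasDerivAt t ((hasDerivAt_id t).prodMk (hasDerivAt_const t (x t)))
    exact this.unique (hdt t ht (x t))
  have h2 : L (0, 1) = φx t (x t) := by
    have := hd.comp_hasDerivAt (x t) ((hasDerivAt_const (x t) t).prodMk (hasDerivAt_id (x t)))
    exact this.unique (hdx t ht (x t))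
  have h3 := hd.comp_hasDerivAt t ((hasDerivAt_id t).prodMk hx)
  have h4 : L (1, v) = φt t (x t) + v * φx t (x t) := by
    rw [show ((1 : ℝ), v) = (1, 0) + v • ((0 : ℝ), (1 : ℝ)) by simp, map_add, map_smul, h1, h2,
      smul_eq_mul]
  rw [← h4]
  exact h3

/-- Integration by parts for primitives of integrable functions. -/
lemma mul_sub_mul_eq_integral {f f' g g' : ℝ → ℝ} {a b : ℝ} (hab : a ≤ b)
    (hf' : IntervalIntegrable f' volume a b) (hg' : IntervalIntegrable g' volume a b)
    (hf : ∀ t ∈ Icc a b, f t - f a = ∫ s in a..t, f' s)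
    (hg : ∀ t ∈ Icc a b, g t - g a = ∫ s in a..t, g' s) :
    f b * g b - f a * g a = ∫ s in a..b, (f' s * g s + f s * g' s) := by
  have hF : ∀ {u u' : ℝ → ℝ}, IntervalIntegrable u' volume a b →
      AbsolutelyContinuousOnInterval (fun t => u a + ∫ s in a..t, u' s) a b := fun {u u'} hu =>
    (LipschitzOnWith.absolutelyContinuousOnInterval (K := 0)
      (LipschitzWith.const (u a)).lipschitzOnWith).fun_add
      (hu.absolutelyContinuousOnInterval_intervalIntegral (by simp))
  have key := (hF (u := f) hf').integral_deriv_mul_eq_sub (hF (u := g) hg')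
  have e1 : f b = f a + ∫ s in a..b, f' s := by linarith [hf b ⟨hab, le_rfl⟩]
  have e2 : g b = g a + ∫ s in a..b, g' s := by linarith [hg b ⟨hab, le_rfl⟩]
  simp only [intervalIntegral.integral_same, add_zero] at key
  rw [e1, e2, ← key]
  refine intervalIntegral.integral_congr_ae ?_
  filter_upwards [hf'.ae_hasDerivAt_integral, hg'.ae_hasDerivAt_integral] with t h1 h2 ht
  rw [uIoc_of_le hab] at ht
  have ht' : t ∈ Icc a b := ⟨ht.1.le, ht.2⟩
  rw [((h1 (by rwa [uIcc_of_le hab]) a (by simp)).const_add (f a)).deriv,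
    ((h2 (by rwa [uIcc_of_le hab]) a (by simp)).const_add (g a)).deriv, ← hf t ht', ← hg t ht']
  ring

lemma measurable_indicator_Iic_curve {x : ℝ → ℝ} (hx : Continuous x) :
    Measurable (Function.uncurry fun s y => (Iic (x s)).indicator (1 : ℝ → ℝ) y) := by
  have : Function.uncurry (fun s y => (Iic (x s)).indicator (1 : ℝ → ℝ) y)
      = {p : ℝ × ℝ | p.2 ≤ x p.1}.indicator 1 := by
    ext p
    by_cases h : p.2 ≤ x p.1 <;> simp [Function.uncurry, h]
  rw [this]
  exact measurable_one.indicator (measurableSet_le measurable_snd (hx.measurable.comp measurable_fst))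

namespace SourceIntegrable

variable {g : ℝ → ℝ → ℝ}

lemma intervalIntegrable_Iic (hg : SourceIntegrable g) {x : ℝ → ℝ} (hx : Continuous x)
    {φ : ℝ → ℝ → ℝ} (hφ : Measurable (Function.uncurry φ)) {B : ℝ} (hB : ∀ s y, |φ s y| ≤ B)
    {t₁ t₂ : ℝ} (h₁ : 0 ≤ t₁) (h₁₂ : t₁ ≤ t₂) :
    IntervalIntegrable (fun s => ∫ y in Iic (x s), g s y * φ s y) volume t₁ t₂ := by
  have := hg.intervalIntegrable (φ := fun s y => (Iic (x s)).indicator (1 : ℝ → ℝ) y * φ s y)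
    (B := B) ((measurable_indicator_Iic_curve hx).mul hφ) (fun s y => ?_) h₁ h₁₂
  · convert! this using 2 with s
    rw [← integral_indicator measurableSet_Iic]
    congr 1 with y
    by_cases hy : y ≤ x s <;> simp [hy]
  · have h0 : 0 ≤ B := (abs_nonneg _).trans (hB s y)
    by_cases hy : y ≤ x s <;> simp [hy, h0, hB s y]

lemma intervalIntegrable_Iic_one (hg : SourceIntegrable g) {x : ℝ → ℝ} (hx : Continuous x)
    {t₁ t₂ : ℝ} (h₁ : 0 ≤ t₁) (h₁₂ : t₁ ≤ t₂) :
    IntervalIntegrable (fun s => ∫ y in Iic (x s), g s y) volume t₁ t₂ := by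
  simpa using hg.intervalIntegrable_Iic hx (φ := fun _ _ => 1) (B := 1) measurable_const
    (by simp) h₁ h₁₂

lemma ae_integrable (hg : SourceIntegrable g) {t₁ t₂ : ℝ} (h₁ : 0 ≤ t₁) :
    ∀ᵐ s, s ∈ Ioc t₁ t₂ → Integrable (g s) := by
  have := hg.ae_slice t₂
  rw [ae_restrict_iff' measurableSet_Ioc] at this
  filter_upwards [this] with s hs h using hs ⟨h₁.trans_lt h.1, h.2⟩

end SourceIntegrable

/-- The shift by 1 makes the step vanish already at y = x. The limit is then the indicator of the
open half-line at every point, so atoms on the curve are excluded unambiguously. -/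
lemma kap_sub_one_eventually {x y : ℝ} :
    ∀ᶠ n in atTop, kap ((x - y) / eps n - 1) = (Iio x).indicator 1 y := by
  rcases lt_or_ge y x with h | h
  · filter_upwards [eventually_eps_lt (half_pos (sub_pos.2 h))] with n hn
    rw [kap_eq_one]
    · simp [h]
    · rw [le_sub_iff_add_le, le_div_iff₀ (eps_pos n)]
      linarith
  · refine Eventually.of_forall fun n => ?_
    rw [kap_eq_zero]
    · simp [h]
    · have : (x - y) / eps n ≤ 0 := div_nonpos_of_nonpos_of_nonneg (by linarith) (eps_pos n).le
      linarith

lemma tendsto_integral_kap_sub_one {m : FiniteMeasure ℝ} {q : ℝ → ℝ} (hq : Continuous q) {B : ℝ}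
    (hB : ∀ y, |q y| ≤ B) (x : ℝ) :
    Tendsto (fun n => ∫ y, q y * kap ((x - y) / eps n - 1) ∂(m : Measure ℝ)) atTop
      (𝓝 (∫ y in Iio x, q y ∂(m : Measure ℝ))) := by
  rw [← integral_indicator measurableSet_Iio]
  refine tendsto_integral_finiteMeasure (fun n => by fun_prop) (B := B) (fun n y => ?_) fun y => ?_
  · rw [abs_mul]
    exact (mul_le_of_le_one_right (abs_nonneg _) (kap_abs_le_one _)).trans (hB y)
  · refine tendsto_const_nhds.congr' ?_
    filter_upwards [kap_sub_one_eventually (x := x) (y := y)] with n hn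
    rw [hn]
    by_cases hy : y < x <;> simp [hy]

lemma intervalIntegrable_setIntegral_Iio {m : ℝ → FiniteMeasure ℝ} (hm : Continuous m) {E : ℝ}
    (hE : ∀ t, (m t : Measure ℝ).real univ ≤ E) {x : ℝ → ℝ} (hx : Continuous x) {q : ℝ → ℝ → ℝ}
    (hq : Continuous (Function.uncurry q)) {B : ℝ} (hB : ∀ s y, |q s y| ≤ B) (t₁ t₂ : ℝ) :
    IntervalIntegrable (fun s => ∫ y in Iio (x s), q s y ∂(m s : Measure ℝ)) volume t₁ t₂ := by
  have hB0 : 0 ≤ B := (abs_nonneg _).trans (hB 0 0)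
  have hlim := fun s => tendsto_integral_kap_sub_one (m := m s) (hq.slice s) (hB s) (x s)
  have hb : ∀ n s y, |q s y * kap ((x s - y) / eps n - 1)| ≤ B := fun n s y => by
    rw [abs_mul]
    exact (mul_le_of_le_one_right (abs_nonneg _) (kap_abs_le_one _)).trans (hB s y)
  have hc : ∀ n, Continuous fun s => ∫ y, q s y * kap ((x s - y) / eps n - 1)
      ∂(m s : Measure ℝ) := fun n => by
    refine continuous_integral_finiteMeasure hm
      (φ := fun s y => q s y * kap ((x s - y) / eps n - 1)) ?_ (hb n)
    simp only [Function.uncurry_def] at hq ⊢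
    fun_prop
  have hmeas : Measurable fun s => ∫ y in Iio (x s), q s y ∂(m s : Measure ℝ) :=
    measurable_of_tendsto_metrizable (fun n => (hc n).measurable) (tendsto_pi_nhds.2 hlim)
  refine (intervalIntegrable_const (c := B * E)).mono_fun' hmeas.aestronglyMeasurable
    (Eventually.of_forall fun s => ?_)
  exact le_of_tendsto' (hlim s).abs fun n => integral_abs_le_of_bdd hB0 (hb n s) (hE s)

/-- The uniform bound is asked only on (t₁,t₂], as the Lipschitz bounds to be used hold only at
positive times; a bound for each single n suffices for measurability. -/
lemma tendsto_iterated_integral_of_bddOn {m : ℝ → FiniteMeasure ℝ} (hm : Continuous m) {E : ℝ}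
    (hE : ∀ t, (m t : Measure ℝ).real univ ≤ E) {F : ℕ → ℝ → ℝ → ℝ} {G : ℝ → ℝ → ℝ}
    (hF : ∀ n, Continuous (Function.uncurry (F n))) (hbdd : ∀ n, ∃ B : ℝ, ∀ s x, |F n s x| ≤ B)
    {t₁ t₂ B : ℝ} (h₁₂ : t₁ ≤ t₂) (hB0 : 0 ≤ B) (hB : ∀ n, ∀ s ∈ Ioc t₁ t₂, ∀ x, |F n s x| ≤ B)
    (hlim : ∀ s ∈ Ioc t₁ t₂, ∀ x, Tendsto (fun n => F n s x) atTop (𝓝 (G s x))) :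
    Tendsto (fun n => ∫ s in t₁..t₂, ∫ x, F n s x ∂(m s : Measure ℝ)) atTop
      (𝓝 (∫ s in t₁..t₂, ∫ x, G s x ∂(m s : Measure ℝ))) := by
  rw [← uIoc_of_le h₁₂] at hB hlim
  refine intervalIntegral.tendsto_integral_filter_of_dominated_convergence (fun _ => B * E)
    (Eventually.of_forall fun n => ?_)
    (Eventually.of_forall fun n => Eventually.of_forall fun s hs =>
      integral_abs_le_of_bdd hB0 (hB n s hs) (hE s)) (by simp)
    (Eventually.of_forall fun s hs => tendsto_integral_finiteMeasure
      (fun n => (hF n).slice s) (fun n => hB n s hs) (hlim s hs))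
  obtain ⟨B', hB'⟩ := hbdd n
  exact (continuous_integral_finiteMeasure hm (hF n) hB').aestronglyMeasurable

namespace IsTransport

variable {Λ E : ℝ} {m : ℝ → FiniteMeasure ℝ} {a g : ℝ → ℝ → ℝ} {x e : ℝ → ℝ}

/-- The function φ(t,x(t)) - φ(t,y) vanishes on the curve. In a layer of width 2ε behind the curve
it is of order ε and compensates the derivative 1/ε of the truncation, so truncation is harmless
whatever mass sits near the curve. -/
lemma setIntegral_Iio_sub (H : IsTransport Λ E m a g) (hx : Continuous x)
    (hx' : ∀ t, 0 < t → HasDerivAt x (a t (x t)) t) {φ φt φx : ℝ → ℝ → ℝ}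
    (hφ : IsC1b φ φt φx) {t₁ t₂ : ℝ} (h₁ : 0 ≤ t₁) (h₁₂ : t₁ ≤ t₂) :
    (∫ y in Iio (x t₂), (φ t₂ (x t₂) - φ t₂ y) ∂(m t₂ : Measure ℝ))
        - ∫ y in Iio (x t₁), (φ t₁ (x t₁) - φ t₁ y) ∂(m t₁ : Measure ℝ)
      = (∫ s in t₁..t₂, ∫ y in Iio (x s), ((φt s (x s) + a s (x s) * φx s (x s))
          - (φt s y + a s y * φx s y)) ∂(m s : Measure ℝ))
        + ∫ s in t₁..t₂, ∫ y in Iic (x s), g s y * (φ s (x s) - φ s y) := by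
  obtain ⟨B, hB⟩ := hφ.bdd
  have hΛ := H.Λ_nonneg
  have hB0 : 0 ≤ B := (abs_nonneg _).trans (hB 0 0).1
  have ha : Continuous fun p : ℝ × ℝ => a p.1 p.2 := H.cont_a
  have hc : Continuous fun p : ℝ × ℝ => φ p.1 p.2 := hφ.cont
  have hct : Continuous fun p : ℝ × ℝ => φt p.1 p.2 := hφ.cont_t
  have hcx : Continuous fun p : ℝ × ℝ => φx p.1 p.2 := hφ.cont_x
  have hv : Continuous fun t => a t (x t) := by fun_prop
  have h1 : IsC1b (fun t y => φ t (x t) - φ t y)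
      (fun t y => (φt t (x t) + a t (x t) * φx t (x t)) - φt t y) (fun t y => -φx t y) := by
    refine ⟨fun t ht y => ?_, fun t ht y => ?_, by simp only [Function.uncurry_def]; fun_prop,
      by simp only [Function.uncurry_def]; fun_prop,
      by simp only [Function.uncurry_def]; fun_prop, 2 * B + Λ * B, fun t y => ⟨?_, ?_, ?_⟩⟩
    · exact (hasDerivAt_along hφ.dt hφ.dx hφ.cont_t hφ.cont_x ht (hx' t ht)).sub (hφ.dt t ht y)
    · simpa using (hφ.dx t ht y).const_sub (φ t (x t))
    · refine (abs_sub _ _).trans ?_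
      linarith [(hB t (x t)).1, (hB t y).1, mul_nonneg hΛ hB0]
    · refine (abs_sub _ _).trans ?_
      have := abs_add_le (φt t (x t)) (a t (x t) * φx t (x t))
      rw [abs_mul] at this
      linarith [(hB t (x t)).2.1, (hB t y).2.1, mul_le_mul (H.a_le t (x t)) (hB t (x t)).2.2
        (abs_nonneg _) hΛ]
    · rw [abs_neg]
      linarith [(hB t y).2.2, mul_nonneg hΛ hB0]
  have h2 : ∀ n, IsC1b (fun t y => kap ((x t - y) / eps n - 1))
      (fun t y => rho ((x t - y) / eps n - 1) / eps n * a t (x t))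
      (fun t y => -(rho ((x t - y) / eps n - 1) / eps n)) := fun n => by
    have hn := eps_pos n
    refine ⟨fun t ht y => ?_, fun t ht y => ?_, by simp only [Function.uncurry_def]; fun_prop,
      by simp only [Function.uncurry_def]; fun_prop,
      by simp only [Function.uncurry_def]; fun_prop, 1 + 1 / eps n * Λ + 1 / eps n, fun t y => ?_⟩
    · have := (kap_hasDerivAt ((x t - y) / eps n - 1)).comp t
        ((((hx' t ht).sub_const y).div_const (eps n)).sub_const 1)
      convert! this using 1
      ring
    · have := (kap_hasDerivAt ((x t - y) / eps n - 1)).comp y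
        ((((hasDerivAt_id y).const_sub (x t)).div_const (eps n)).sub_const 1)
      convert! this using 1
      ring
    · have h1 : 0 ≤ 1 / eps n * Λ := by positivity
      have h2 : 0 ≤ 1 / eps n := by positivity
      have h3 : |rho ((x t - y) / eps n - 1) / eps n| ≤ 1 / eps n := rho_div_abs_le hn _
      refine ⟨(kap_abs_le_one _).trans (by linarith), ?_, by rw [abs_neg]; linarith⟩
      rw [abs_mul]
      have := mul_le_mul h3 (H.a_le t (x t)) (abs_nonneg _) h2
      linarith
  have hlip : ∀ t, 0 < t → ∀ y z, |φ t y - φ t z| ≤ B * |y - z| := fun t ht y z => by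
    simpa using Convex.norm_image_sub_le_of_norm_hasDerivWithin_le (f := φ t) (s := univ)
      (fun y _ => (hφ.dx t ht y).hasDerivWithinAt) (fun y _ => (hB t y).2.2) convex_univ
      (mem_univ z) (mem_univ y)
  have key := fun n => balance_global H.cont_m H.mass H.cont_a H.a_le H.locInt H.source H.bal
    (h1.mul (h2 n)) h₁ h₁₂
  have l0 : ∀ t, Tendsto (fun n => ∫ y, (φ t (x t) - φ t y) * kap ((x t - y) / eps n - 1)
      ∂(m t : Measure ℝ)) atTop
      (𝓝 (∫ y in Iio (x t), (φ t (x t) - φ t y) ∂(m t : Measure ℝ))) := fun t =>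
    tendsto_integral_kap_sub_one (B := B + B) (continuous_const.sub (hφ.cont.slice t))
      (fun y => (abs_sub _ _).trans (add_le_add (hB t _).1 (hB t y).1)) (x t)
  refine tendsto_nhds_unique ((l0 t₂).sub (l0 t₁)) ?_
  simp only [key]
  refine Tendsto.add ?_ ?_
  · have e : ∀ s, ∫ y in Iio (x s), ((φt s (x s) + a s (x s) * φx s (x s))
          - (φt s y + a s y * φx s y)) ∂(m s : Measure ℝ)
        = ∫ y, (Iio (x s)).indicator 1 y * ((φt s (x s) + a s (x s) * φx s (x s))
          - (φt s y + a s y * φx s y)) ∂(m s : Measure ℝ) := fun s => by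
      rw [← integral_indicator measurableSet_Iio]
      congr 1 with y
      by_cases hy : y < x s <;> simp [hy]
    simp only [e]
    have hφv : ∀ s y, |φt s y + a s y * φx s y| ≤ B + Λ * B := fun s y => by
      refine (abs_add_le _ _).trans (add_le_add (hB s y).2.1 ?_)
      rw [abs_mul]
      exact mul_le_mul (H.a_le s y) (hB s y).2.2 (abs_nonneg _) hΛ
    -- The terms with the derivative of the truncation combine into one with factor a(s,x(s)) -
    -- a(s,y), because the curve moves with speed a. That term is bounded uniformly in n and tends
    -- to 0 at every y, including y = x(s).
    have split : ∀ n s y, (φt s (x s) + a s (x s) * φx s (x s) - φt s y)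
          * kap ((x s - y) / eps n - 1)
        + (φ s (x s) - φ s y) * (rho ((x s - y) / eps n - 1) / eps n * a s (x s))
        + a s y * (-φx s y * kap ((x s - y) / eps n - 1)
          + (φ s (x s) - φ s y) * -(rho ((x s - y) / eps n - 1) / eps n))
        = kap ((x s - y) / eps n - 1) * ((φt s (x s) + a s (x s) * φx s (x s))
            - (φt s y + a s y * φx s y))
          + (φ s (x s) - φ s y) * (rho ((x s - y) / eps n - 1) / eps n)
            * (a s (x s) - a s y) := fun n s y => by ring
    have b1 : ∀ n s y, |kap ((x s - y) / eps n - 1) * ((φt s (x s) + a s (x s) * φx s (x s))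
        - (φt s y + a s y * φx s y))| ≤ 2 * (B + Λ * B) := fun n s y => by
      rw [abs_mul]
      refine (mul_le_of_le_one_left (abs_nonneg _) (kap_abs_le_one _)).trans
        ((abs_sub _ _).trans ?_)
      linarith [hφv s (x s), hφv s y]
    have b2 : ∀ s y, |a s (x s) - a s y| ≤ Λ + Λ := fun s y =>
      (abs_sub _ _).trans (add_le_add (H.a_le s _) (H.a_le s y))
    simp only [split]
    refine tendsto_iterated_integral_of_bddOn H.cont_m H.mass (fun n => ?_) (fun n => ?_) h₁₂
      (B := 2 * (B + Λ * B) + B * 2 * (Λ + Λ)) (by positivity) (fun n s hs y => ?_) fun s _ y => ?_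
    · simp only [Function.uncurry_def]
      fun_prop
    · refine ⟨2 * (B + Λ * B) + (B + B) * (1 / eps n) * (Λ + Λ), fun s y =>
        (abs_add_le _ _).trans (add_le_add (b1 n s y) ?_)⟩
      have := eps_pos n
      rw [abs_mul, abs_mul]
      refine mul_le_mul (mul_le_mul ((abs_sub _ _).trans (add_le_add (hB s _).1 (hB s y).1))
        (rho_div_abs_le this _) (abs_nonneg _) (by positivity)) (b2 s y) (abs_nonneg _)
        (by positivity)
    · refine (abs_add_le _ _).trans (add_le_add (b1 n s y) ?_)
      have hn := eps_pos n
      rw [abs_mul]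
      refine mul_le_mul ?_ (b2 s y) (abs_nonneg _) (by positivity)
      rw [abs_mul]
      rcases le_or_gt 1 |(x s - y) / eps n - 1| with hz | hz
      · rw [rho_eq_zero hz, zero_div, abs_zero, mul_zero]
        positivity
      · rw [abs_lt] at hz
        have hz2 : |x s - y| ≤ 2 * eps n := by
          have z1 : 0 < (x s - y) / eps n := by linarith [hz.1]
          have z2 : (x s - y) / eps n < 2 := by linarith [hz.2]
          rw [div_lt_iff₀ hn] at z2
          have z3 : 0 < x s - y := by simpa [hn] using (div_pos_iff_of_pos_right hn).1 z1
          rw [abs_of_pos z3]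
          exact z2.le
        calc |φ s (x s) - φ s y| * |rho ((x s - y) / eps n - 1) / eps n|
            ≤ (B * (2 * eps n)) * (1 / eps n) := by
              refine mul_le_mul ((hlip s (h₁.trans_lt hs.1) _ _).trans
                (mul_le_mul_of_nonneg_left hz2 hB0)) (rho_div_abs_le hn _) (abs_nonneg _)
                (by positivity)
          _ = B * 2 := by field_simp
    · refine tendsto_const_nhds.congr' ?_
      rcases eq_or_ne y (x s) with rfl | hy
      · filter_upwards [kap_sub_one_eventually (x := x s) (y := x s)] with n h1
        rw [h1]
        ring
      · filter_upwards [kap_sub_one_eventually (x := x s) (y := y),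
          eventually_eps_lt (half_pos (abs_pos.2 (sub_ne_zero.2 hy.symm)))] with n h1 h2
        rw [h1, rho_eq_zero, zero_div, mul_zero, zero_mul, add_zero]
        have hn := eps_pos n
        have h3 : 2 ≤ |(x s - y) / eps n| := by
          rw [abs_div, abs_of_pos hn, le_div_iff₀ hn]
          linarith
        have := abs_sub_abs_le_abs_sub ((x s - y) / eps n) 1
        rw [abs_one] at this
        linarith
  · have := H.source.tendsto_integral
      (F := fun n s y => (φ s (x s) - φ s y) * kap ((x s - y) / eps n - 1))
      (G := fun s y => (φ s (x s) - φ s y) * (Iic (x s)).indicator 1 y) (B := B + B) (fun n => ?_)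
      (fun n s y => ?_) h₁ h₁₂ fun s _ => ?_
    · have e : ∀ s, ∫ y, g s y * ((φ s (x s) - φ s y) * (Iic (x s)).indicator 1 y)
          = ∫ y in Iic (x s), g s y * (φ s (x s) - φ s y) := fun s => by
        rw [← integral_indicator measurableSet_Iic]
        congr 1 with y
        by_cases hy : y ≤ x s <;> simp [hy]
      simp only [e] at this
      exact this
    · exact Continuous.measurable (by simp only [Function.uncurry_def]; fun_prop)
    · rw [abs_mul]
      exact (mul_le_of_le_one_right (abs_nonneg _) (kap_abs_le_one _)).trans
        ((abs_sub _ _).trans (add_le_add (hB s _).1 (hB s y).1))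
    · refine Eventually.of_forall fun y => tendsto_const_nhds.congr' ?_
      filter_upwards [kap_sub_one_eventually (x := x s) (y := y)] with n hn
      rw [hn]
      rcases lt_trichotomy y (x s) with hy | rfl | hy
      · simp [hy, hy.le]
      · simp
      · simp [hy, hy.le]

/-- The transport equation for the part of the measures to the left of a characteristic. -/
theorem leftIntegral_sub (H : IsTransport Λ E m a g) (hx : IsBalancedCurve m a g x e)
    {φ φt φx : ℝ → ℝ → ℝ} (hφ : IsC1b φ φt φx) {t₁ t₂ : ℝ} (h₁ : 0 ≤ t₁) (h₁₂ : t₁ ≤ t₂) :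
    leftIntegral (m t₂) (x t₂) (e t₂) (φ t₂) - leftIntegral (m t₁) (x t₁) (e t₁) (φ t₁)
      = (∫ s in t₁..t₂, leftIntegral (m s) (x s) (e s) fun y => φt s y + a s y * φx s y)
        + ∫ s in t₁..t₂, ∫ y in Iic (x s), g s y * φ s y := by
  obtain ⟨B, hB⟩ := hφ.bdd
  have hΛ := H.Λ_nonneg
  have hxc := hx.cont_x
  have ha : Continuous fun p : ℝ × ℝ => a p.1 p.2 := H.cont_a
  have hc : Continuous fun p : ℝ × ℝ => φ p.1 p.2 := hφ.cont
  have hct : Continuous fun p : ℝ × ℝ => φt p.1 p.2 := hφ.cont_t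
  have hcx : Continuous fun p : ℝ × ℝ => φx p.1 p.2 := hφ.cont_x
  set q : ℝ → ℝ → ℝ := fun s y => φt s y + a s y * φx s y with hq
  have hqc : Continuous (Function.uncurry q) := by simp only [hq, Function.uncurry_def]; fun_prop
  have hqs : ∀ s, Continuous (q s) := fun s => hqc.slice s
  have hqb : ∀ s y, |q s y| ≤ B + Λ * B := fun s y => by
    refine (abs_add_le _ _).trans (add_le_add (hB s y).2.1 ?_)
    rw [abs_mul]
    exact mul_le_mul (H.a_le s y) (hB s y).2.2 (abs_nonneg _) hΛ
  have hψ'c : Continuous fun s => q s (x s) := hqc.comp (continuous_id.prodMk hxc)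
  have ii : ∀ s, ∀ f : ℝ → ℝ, Continuous f → (∃ K, ∀ y, |f y| ≤ K) →
      IntegrableOn f (Iio (x s)) (m s : Measure ℝ) := fun s f hf ⟨K, hK⟩ =>
    (integrable_of_continuous_of_bdd hf hK).integrableOn
  -- In this form the mass of (-∞,x), possibly discontinuous in time, no longer appears. The product
  -- f(x) e is treated by integration by parts with the absolutely continuous e, the remainder by
  -- `setIntegral_Iio_sub`.
  have hleft : ∀ s, ∀ f : ℝ → ℝ, Continuous f → (∃ K, ∀ y, |f y| ≤ K) →
      leftIntegral (m s) (x s) (e s) f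
        = f (x s) * e s - ∫ y in Iio (x s), (f (x s) - f y) ∂(m s : Measure ℝ) := fun s f hf hK => by
    rw [integral_sub (integrable_const _) (ii s f hf hK), setIntegral_const, smul_eq_mul,
      leftIntegral]
    ring
  have hprod := mul_sub_mul_eq_integral (f := fun s => φ s (x s)) (f' := fun s => q s (x s))
    (g := e) h₁₂ (hψ'c.intervalIntegrable _ _) (H.source.intervalIntegrable_Iic_one hxc h₁ h₁₂)
    (fun t ht => by
      have hcont : Continuous fun s => φ s (x s) := by fun_prop
      refine (intervalIntegral.integral_eq_sub_of_hasDerivAt_of_le ht.1 hcont.continuousOn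
        (fun s hs => ?_) (hψ'c.intervalIntegrable _ _)).symm
      have hs0 : 0 < s := h₁.trans_lt hs.1
      exact hasDerivAt_along hφ.dt hφ.dx hφ.cont_t hφ.cont_x hs0 (hx.deriv_x s hs0))
    (fun t ht => hx.bal_e t₁ t h₁ ht.1)
  have hA := H.setIntegral_Iio_sub hxc hx.deriv_x hφ h₁ h₁₂
  rw [hleft t₂ _ (hφ.cont.slice t₂) ⟨B, fun y => (hB _ y).1⟩,
    hleft t₁ _ (hφ.cont.slice t₁) ⟨B, fun y => (hB _ y).1⟩]
  have hec : ContinuousOn e (uIcc t₁ t₂) := by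
    rw [uIcc_of_le h₁₂]
    exact hx.cont_e.mono fun s hs => h₁.trans hs.1
  have i1 : IntervalIntegrable (fun s => q s (x s) * e s) volume t₁ t₂ :=
    (hψ'c.continuousOn.mul hec).intervalIntegrable
  have i2 : IntervalIntegrable (fun s => φ s (x s) * ∫ y in Iic (x s), g s y) volume t₁ t₂ :=
    (H.source.intervalIntegrable_Iic_one hxc h₁ h₁₂).continuousOn_mul
      (by fun_prop : Continuous fun s => φ s (x s)).continuousOn
  have i3 : IntervalIntegrable (fun s => ∫ y in Iio (x s), (q s (x s) - q s y) ∂(m s : Measure ℝ))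
      volume t₁ t₂ :=
    intervalIntegrable_setIntegral_Iio H.cont_m H.mass hxc
      (q := fun s y => q s (x s) - q s y) (B := (B + Λ * B) + (B + Λ * B))
      (by simp only [Function.uncurry_def] at hqc ⊢; fun_prop)
      (fun s y => (abs_sub _ _).trans (add_le_add (hqb s _) (hqb s y))) t₁ t₂
  have i4 : IntervalIntegrable (fun s => ∫ y in Iic (x s), g s y * (φ s (x s) - φ s y))
      volume t₁ t₂ :=
    H.source.intervalIntegrable_Iic hxc (φ := fun s y => φ s (x s) - φ s y) (B := B + B)
      (Continuous.measurable (by simp only [Function.uncurry_def]; fun_prop))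
      (fun s y => (abs_sub _ _).trans (add_le_add (hB s _).1 (hB s y).1)) h₁ h₁₂
  have e1 : (∫ s in t₁..t₂, leftIntegral (m s) (x s) (e s) (q s))
      = (∫ s in t₁..t₂, q s (x s) * e s)
        - ∫ s in t₁..t₂, ∫ y in Iio (x s), (q s (x s) - q s y) ∂(m s : Measure ℝ) := by
    rw [← intervalIntegral.integral_sub i1 i3]
    congr 1 with s
    exact hleft s _ (hqs s) ⟨_, hqb s⟩
  have e2 : (∫ s in t₁..t₂, ∫ y in Iic (x s), g s y * φ s y)
      = (∫ s in t₁..t₂, φ s (x s) * ∫ y in Iic (x s), g s y)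
        - ∫ s in t₁..t₂, ∫ y in Iic (x s), g s y * (φ s (x s) - φ s y) := by
    rw [← intervalIntegral.integral_sub i2 i4]
    refine intervalIntegral.integral_congr_ae ?_
    filter_upwards [H.source.ae_integrable h₁] with s hs h
    rw [uIoc_of_le h₁₂] at h
    have hgs := (hs h).integrableOn (s := Iic (x s))
    have hgφ : ∀ f : ℝ → ℝ, Continuous f → (∀ y, |f y| ≤ B + B) →
        IntegrableOn (fun y => g s y * f y) (Iic (x s)) := fun f hf hfb =>
      hgs.mul_bdd (c := B + B) hf.aestronglyMeasurable (Eventually.of_forall hfb)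
    rw [← integral_const_mul, ← integral_sub (hgs.const_mul _) (hgφ
      (fun y => φ s (x s) - φ s y) (continuous_const.sub (hφ.cont.slice s))
      fun y => (abs_sub _ _).trans (add_le_add (hB s _).1 (hB s y).1))]
    congr 1 with y
    ring
  rw [intervalIntegral.integral_add i1 i2] at hprod
  rw [e1, e2]
  linarith

end IsTransport

/-! ### Steklov averages -/

/-- The average of `w` over the time interval `[t, t + h]`. -/
noncomputable def steklov (h : ℝ) (w : ℝ → ℝ → ℝ) (t x : ℝ) : ℝ := 1 / h * ∫ s in (0 : ℝ)..h, w (t + s) x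

section steklov

variable {h : ℝ} {w w' : ℝ → ℝ → ℝ}

lemma steklov_continuous (hw : Continuous (Function.uncurry w)) :
    Continuous (Function.uncurry (steklov h w)) := by
  have := intervalIntegral.continuous_parametric_intervalIntegral_of_continuous' (μ := volume)
    (f := fun (p : ℝ × ℝ) s => w (p.1 + s) p.2) (by
      simp only [Function.uncurry_def] at hw ⊢
      fun_prop) 0 h
  exact this.const_mul (1 / h)

lemma steklov_mem (hh : 0 < h) (hw : Continuous (Function.uncurry w)) {l u : ℝ}
    (hlu : ∀ t x, l ≤ w t x ∧ w t x ≤ u) (t x : ℝ) :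
    l ≤ steklov h w t x ∧ steklov h w t x ≤ u := by
  have hc : Continuous fun s => w (t + s) x := by
    simp only [Function.uncurry_def] at hw; fun_prop
  have h1 := intervalIntegral.integral_mono_on hh.le
    (intervalIntegrable_const (μ := volume) (c := l)) (hc.intervalIntegrable 0 h) fun s _ => (hlu (t + s) x).1
  have h2 := intervalIntegral.integral_mono_on hh.le
    (hc.intervalIntegrable 0 h) (intervalIntegrable_const (μ := volume) (c := u)) fun s _ => (hlu (t + s) x).2
  rw [intervalIntegral.integral_const, smul_eq_mul, sub_zero] at h1 h2
  rw [steklov, one_div_mul_eq_div, le_div_iff₀ hh, div_le_iff₀ hh]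
  constructor <;> linarith

lemma steklov_hasDerivAt_left (hw : Continuous (Function.uncurry w)) (t x : ℝ) :
    HasDerivAt (fun t => steklov h w t x) (1 / h * (w (t + h) x - w t x)) t := by
  have hc : Continuous fun s => w s x := by
    simp only [Function.uncurry_def] at hw; fun_prop
  have e : (fun t => steklov h w t x)
      = fun t => 1 / h * ((∫ s in (0 : ℝ)..t + h, w s x) - ∫ s in (0 : ℝ)..t, w s x) := by
    ext t
    rw [steklov, intervalIntegral.integral_comp_add_left (fun s => w s x), add_zero,
      intervalIntegral.integral_interval_sub_left (hc.intervalIntegrable _ _)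
        (hc.intervalIntegrable _ _)]
  have hd : ∀ t, HasDerivAt (fun t => ∫ s in (0 : ℝ)..t, w s x) (w t x) t := fun t =>
    intervalIntegral.integral_hasDerivAt_right (hc.intervalIntegrable _ _)
      (hc.stronglyMeasurableAtFilter _ _) hc.continuousAt
  rw [e]
  exact (((hd (t + h)).comp_add_const t h).sub (hd t)).const_mul _

lemma steklov_hasDerivAt_right (hw : Continuous (Function.uncurry w))
    (hw' : Continuous (Function.uncurry w')) (hd : ∀ t x, HasDerivAt (w t) (w' t x) x) {B : ℝ}
    (hB : ∀ t x, |w' t x| ≤ B) (t x : ℝ) :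
    HasDerivAt (steklov h w t) (steklov h w' t x) x := by
  have hc : ∀ x, Continuous fun s => w (t + s) x := fun x => by
    simp only [Function.uncurry_def] at hw; fun_prop
  have hc' : ∀ x, Continuous fun s => w' (t + s) x := fun x => by
    simp only [Function.uncurry_def] at hw'; fun_prop
  have := (intervalIntegral.hasDerivAt_integral_of_dominated_loc_of_deriv_le (μ := volume)
    (a := 0) (b := h) (F := fun x s => w (t + s) x) (F' := fun x s => w' (t + s) x)
    (bound := fun _ => B) (x₀ := x) (s := univ) univ_mem
    (Eventually.of_forall fun x => (hc x).aestronglyMeasurable)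
    ((hc x).intervalIntegrable _ _) (hc' x).aestronglyMeasurable
    (Eventually.of_forall fun s _ y _ => hB _ y) intervalIntegrable_const
    (Eventually.of_forall fun s _ y _ => hd (t + s) y)).2
  exact this.const_mul (1 / h)

end steklov

/-! ### Weights decreasing along characteristics -/

namespace IsWavePair

variable {σ δ Λ E C : ℝ} {μ ν : ℝ → FiniteMeasure ℝ} {a c g r s : ℝ → ℝ → ℝ}

lemma isTransport_ν (H : IsWavePair σ δ Λ E C μ ν a c g r s) :
    IsTransport Λ E ν c (fun t x => -g t x) :=
  ⟨H.cont_ν, H.mass_ν, H.cont_c, H.c_le, H.locInt_neg, fun T => (H.sourceIntegrable T).neg,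
    H.bal_ν⟩

lemma mul_moll_one_le (H : IsWavePair σ δ Λ E C μ ν a c g r s) {ε : ℝ} (hε : 0 < ε) (t x : ℝ) :
    δ * moll ε ν (fun _ _ => 1) t x ≤ σ * moll ε ν c t x := by
  simp only [moll]
  rw [← integral_const_mul, ← integral_const_mul]
  refine integral_mono ((moll_integrable (m := ν) (b := fun _ _ => 1) (Λ := 1) hε continuous_const
    (by simp) t x).const_mul _) ((moll_integrable hε H.cont_c H.c_le t x).const_mul _) fun y => ?_
  have := mul_le_mul_of_nonneg_left (H.sep_c t y) (rho_div_nonneg hε ((x - y) / ε))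
  linarith

/-- The smoothed amount of the measures `ν` which is still to be crossed decreases along the
characteristics of `a`, up to the total variation of the source. -/
lemma cumul_sub_le (H : IsWavePair σ δ Λ E C μ ν a c g r s) {ε : ℝ} (hε : 0 < ε) (x : ℝ)
    {t₁ t₂ : ℝ} (h₁ : 0 ≤ t₁) (h₁₂ : t₁ ≤ t₂) :
    cumul σ ε ν t₂ x - cumul σ ε ν t₁ x
      ≤ -(∫ τ in t₁..t₂, σ * moll ε ν c τ x) + ∫ τ in t₁..t₂, ∫ y, |g τ y| := by
  have T := H.isTransport_ν
  have hσ1 : |σ| = 1 := by rcases H.sign with rfl | rfl <;> simp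
  have hφ : IsC1b (fun _ y => kap (σ * (x - y) / ε)) (fun _ _ => 0)
      (fun _ y => -(rho (σ * (x - y) / ε) * (σ / ε))) :=
    IsC1b.of_space (fun y => kap_scaled_hasDerivAt_right σ ε x y) (by fun_prop) (B := 1 + 1 / ε)
      fun y => ⟨(kap_abs_le_one _).trans (by linarith [div_pos one_pos hε]), by
          rw [abs_neg, abs_mul, abs_div, hσ1, abs_of_nonneg (rho_nonneg _), abs_of_pos hε]
          have := mul_le_of_le_one_left (by positivity : 0 ≤ 1 / ε) (rho_le_one (σ * (x - y) / ε))
          linarith⟩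
  have key := balance_global T.cont_m T.mass T.cont_a T.a_le T.locInt T.source T.bal hφ h₁ h₁₂
  have e1 : ∀ τ, ∫ y, (0 + c τ y * -(rho (σ * (x - y) / ε) * (σ / ε))) ∂(ν τ : Measure ℝ)
      = -(σ * moll ε ν c τ x) := fun τ => by
    rw [moll, ← integral_const_mul, ← integral_neg]
    congr 1 with y
    rw [rho_sign H.sign]
    ring
  simp only [e1, intervalIntegral.integral_neg] at key
  have hnorm : IntervalIntegrable (fun τ => ∫ y, |g τ y|) volume t₁ t₂ := by
    rw [intervalIntegrable_iff_integrableOn_Ioc_of_le h₁₂]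
    exact IntegrableOn.mono_set (H.sourceIntegrable.norm_slice t₂) (Ioc_subset_Ioc_left h₁)
  have e2 : (∫ τ in t₁..t₂, ∫ y, -g τ y * kap (σ * (x - y) / ε))
      ≤ ∫ τ in t₁..t₂, ∫ y, |g τ y| := by
    have hi := T.source.intervalIntegrable (φ := fun _ y => kap (σ * (x - y) / ε)) (B := 1)
      (Continuous.measurable (by simp only [Function.uncurry_def]; fun_prop))
      (fun _ _ => kap_abs_le_one _) h₁ h₁₂
    rw [intervalIntegral.integral_of_le h₁₂, intervalIntegral.integral_of_le h₁₂]
    refine setIntegral_mono_ae_restrict hi.1 hnorm.1 ?_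
    rw [EventuallyLE, ae_restrict_iff' measurableSet_Ioc]
    filter_upwards [H.sourceIntegrable.ae_integrable h₁] with τ hτ h
    refine (le_abs_self _).trans ((norm_integral_le_integral_norm
      (fun y => -g τ y * kap (σ * (x - y) / ε))).trans (integral_mono_of_nonneg (Eventually.of_forall fun y => norm_nonneg _) (hτ h).abs
        (Eventually.of_forall fun y => ?_)))
    simp only [norm_mul, norm_neg]
    exact mul_le_of_le_one_right (abs_nonneg _) (kap_abs_le_one _)
  simp only [cumul]
  linarith

/-- The weight is 1 plus the smoothed mass of ν on the side from which ν arrives, plus K - P(t),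
where P accumulates the spatial L¹ norms of the source. Along characteristics of a the ν-mass falls
at rate at least 2δ times the mollified density of ν: one δ from the motion of ν, one from the
motion at speed a. The source raises it by no more than the growth of P. Since the source is only
integrable in time, a Steklov average is taken to obtain a C¹ function. The bound B depends on
neither smoothing scale. -/
theorem exists_weight (H : IsWavePair σ δ Λ E C μ ν a c g r s) (T : ℝ) :
    ∃ B : ℝ, 1 ≤ B ∧ ∀ ε h : ℝ, 0 < ε → 0 < h → h ≤ 1 → ∃ φ φt φx : ℝ → ℝ → ℝ,
      IsC1b φ φt φx ∧ (∀ t x, 1 ≤ φ t x ∧ φ t x ≤ B) ∧ (∀ t x, 0 ≤ σ * φx t x) ∧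
      ∀ t, 0 ≤ t → t ≤ T → ∀ x, φt t x + a t x * φx t x
        ≤ -(2 * δ * steklov h (moll ε ν fun _ _ => 1) t x) := by
  -- The average at a time t ≤ T looks ahead by h ≤ 1, hence T + 1; the truncation makes γ
  -- integrable on ℝ and keeps P within [-K, K].
  set γ : ℝ → ℝ := (Ioc 0 (T + 1)).indicator fun τ => ∫ y, |g τ y| with hγ
  have hγi : Integrable γ :=
    (integrable_indicator_iff measurableSet_Ioc).2 (H.sourceIntegrable.norm_slice (T + 1))
  set P : ℝ → ℝ := fun t => ∫ τ in (0 : ℝ)..t, γ τ with hP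
  have hPc : Continuous P := intervalIntegral.continuous_primitive (fun _ _ =>
    hγi.intervalIntegrable) 0
  set K := ∫ τ, |γ τ| with hK
  have hK0 : 0 ≤ K := integral_nonneg fun _ => abs_nonneg _
  have hPK : ∀ t, |P t| ≤ K := fun t =>
    (intervalIntegral.norm_integral_le_integral_norm_uIoc).trans
      (setIntegral_le_integral hγi.norm (Eventually.of_forall fun _ => norm_nonneg _))
  have hE := H.E_nonneg
  have hσ1 : |σ| = 1 := by rcases H.sign with rfl | rfl <;> simp
  refine ⟨1 + E + 2 * K, by linarith, fun ε h hε hh h1 => ?_⟩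
  set M := moll ε ν fun _ _ => 1 with hM
  have hMc : Continuous (Function.uncurry M) :=
    moll_continuous (Λ := 1) H.cont_ν hε continuous_const (by simp)
  have hMb : ∀ t x, |M t x| ≤ 1 / ε * 1 * E := fun t x =>
    moll_abs_le (b := fun _ _ => 1) H.mass_ν hε (by simp) t x
  have hM0 : ∀ t x, 0 ≤ M t x := fun t x => moll_one_nonneg hε t x
  set w : ℝ → ℝ → ℝ := fun t x => 1 + (cumul σ ε ν t x + (K - P t)) with hw
  have hfc : Continuous (Function.uncurry (cumul σ ε ν)) := cumul_continuous H.cont_ν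
  have hwc : Continuous (Function.uncurry w) := by
    simp only [hw, Function.uncurry_def] at hfc ⊢
    fun_prop
  have hwb : ∀ t x, 1 ≤ w t x ∧ w t x ≤ 1 + E + 2 * K := fun t x => by
    have := cumul_nonneg (m := ν) (σ := σ) (h := ε) t x
    have := cumul_le (σ := σ) (h := ε) H.mass_ν t x
    have := abs_le.1 (hPK t)
    simp only [hw]
    constructor <;> linarith
  have hσMc : Continuous (Function.uncurry fun t x => σ * M t x) := hMc.const_mul σ
  have hσMb : ∀ t x, |σ * M t x| ≤ 1 / ε * 1 * E := fun t x => by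
    rw [abs_mul, hσ1, one_mul]
    exact hMb t x
  have hst : ∀ t x, steklov h (fun t x => σ * M t x) t x = σ * steklov h M t x := fun t x => by
    simp only [steklov, intervalIntegral.integral_const_mul]
    ring
  refine ⟨steklov h w, fun t x => 1 / h * (w (t + h) x - w t x),
    steklov h fun t x => σ * M t x, ⟨fun t _ x => steklov_hasDerivAt_left hwc t x, fun t _ x =>
      steklov_hasDerivAt_right hwc hσMc (fun t x => ?_) hσMb t x,
      steklov_continuous hwc, ?_, steklov_continuous hσMc, ?_⟩,
    steklov_mem hh hwc hwb, fun t x => ?_, fun t ht htT x => ?_⟩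
  · exact (((cumul_hasDerivAt H.sign hε t x).add_const (K - P t)).const_add 1)
  · simp only [Function.uncurry_def] at hwc ⊢
    fun_prop
  · refine ⟨1 + E + 2 * K + 1 / h * (1 + E + 2 * K) + 1 / ε * 1 * E, fun t x => ?_⟩
    have p0 : 0 ≤ 1 + E + 2 * K := by linarith
    have p1 : 0 ≤ 1 / h * (1 + E + 2 * K) := by positivity
    have p2 : 0 ≤ 1 / ε * 1 * E := by positivity
    have p3 := steklov_mem hh hwc hwb t x
    have p4 : |w (t + h) x - w t x| ≤ 1 + E + 2 * K := by
      have := hwb (t + h) x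
      have := hwb t x
      rw [abs_le]
      constructor <;> linarith
    have p5 := steklov_mem hh hσMc (fun t x => abs_le.1 (hσMb t x)) t x
    refine ⟨?_, ?_, ?_⟩
    · rw [abs_of_nonneg] <;> linarith
    · rw [abs_mul, abs_of_pos (by positivity : 0 < 1 / h)]
      have := mul_le_mul_of_nonneg_left p4 (by positivity : 0 ≤ 1 / h)
      linarith
    · have := abs_le.2 p5
      linarith
  · rw [hst, ← mul_assoc, H.sign_sq, one_mul]
    exact (steklov_mem hh hMc (u := 1 / ε * 1 * E)
      (fun t x => ⟨hM0 t x, (le_abs_self _).trans (hMb t x)⟩) t x).1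
  · have k1 := H.cumul_sub_le hε x ht (by linarith : t ≤ t + h)
    have k2 : (∫ τ in t..t + h, ∫ y, |g τ y|) = P (t + h) - P t := by
      rw [hP]
      simp only
      rw [intervalIntegral.integral_interval_sub_left hγi.intervalIntegrable
        hγi.intervalIntegrable, intervalIntegral.integral_of_le (by linarith),
        intervalIntegral.integral_of_le (by linarith)]
      refine setIntegral_congr_fun measurableSet_Ioc fun τ hτ => ?_
      have hτ' : τ ∈ Ioc 0 (T + 1) := ⟨ht.trans_lt hτ.1, by linarith [hτ.2]⟩
      rw [hγ, indicator_of_mem hτ']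
    have k3 : w (t + h) x - w t x ≤ -(∫ τ in t..t + h, σ * moll ε ν c τ x) := by
      simp only [hw]
      linarith
    have hcc : Continuous fun τ => moll ε ν c τ x :=
      (moll_continuous H.cont_ν hε H.cont_c H.c_le).comp (by fun_prop : Continuous fun τ : ℝ => (τ, x))
    have hMx : Continuous fun τ => M τ x := hMc.comp (by fun_prop : Continuous fun τ : ℝ => (τ, x))
    have k4 : δ * ∫ τ in t..t + h, M τ x ≤ ∫ τ in t..t + h, σ * moll ε ν c τ x := by
      rw [← intervalIntegral.integral_const_mul]
      exact intervalIntegral.integral_mono_on (by linarith)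
        ((hMx.const_mul δ).intervalIntegrable _ _) ((hcc.const_mul σ).intervalIntegrable _ _)
        fun τ _ => H.mul_moll_one_le hε τ x
    have k5 : steklov h M t x = 1 / h * ∫ τ in t..t + h, M τ x := by
      rw [steklov, intervalIntegral.integral_comp_add_left (fun s => M s x), add_zero]
    have k6 : 0 ≤ ∫ τ in t..t + h, M τ x :=
      intervalIntegral.integral_nonneg (by linarith) fun τ _ => hM0 τ x
    have k7 := mul_le_mul_of_nonneg_right (H.sep_a t x) k6
    have hh' : 0 ≤ 1 / h := by positivity
    rw [hst, k5]
    have : 1 / h * (w (t + h) x - w t x) + a t x * (σ * (1 / h * ∫ τ in t..t + h, M τ x))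
        = 1 / h * ((w (t + h) x - w t x) + σ * a t x * ∫ τ in t..t + h, M τ x) := by ring
    rw [this]
    have := mul_le_mul_of_nonneg_left (show (w (t + h) x - w t x)
      + σ * a t x * ∫ τ in t..t + h, M τ x ≤ -(2 * δ * ∫ τ in t..t + h, M τ x) by linarith) hh'
    refine this.trans (le_of_eq (by ring))

end IsWavePair

/-! ### Comparison of two balanced characteristics -/

/-- This integrates an inequality f ≤ R - X in which X and R may be infinite and need not be
measurable. Splitting f into its positive and negative parts avoids any subtraction in [0,∞]. -/
lemma ofReal_integral_add_lintegral_le {α : Type*} [MeasurableSpace α] {ν : Measure α} {f : α → ℝ}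
    {X R : α → ℝ≥0∞} (hf : Integrable f ν) (h0 : 0 ≤ ∫ s, f s ∂ν)
    (h : ∀ᵐ s ∂ν, X s + ENNReal.ofReal (f s) ≤ R s + ENNReal.ofReal (-f s)) :
    ENNReal.ofReal (∫ s, f s ∂ν) + ∫⁻ s, X s ∂ν ≤ ∫⁻ s, R s ∂ν := by
  have h1 := lintegral_mono_ae h
  have m1 : AEMeasurable (fun s => ENNReal.ofReal (f s)) ν := hf.aemeasurable.ennreal_ofReal
  have m2 : AEMeasurable (fun s => ENNReal.ofReal (-f s)) ν := hf.neg.aemeasurable.ennreal_ofReal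
  rw [lintegral_add_right' _ m1, lintegral_add_right' _ m2] at h1
  have hp : (∫⁻ s, ENNReal.ofReal (f s) ∂ν) ≠ ⊤ := hf.lintegral_lt_top.ne
  have hn : (∫⁻ s, ENNReal.ofReal (-f s) ∂ν) ≠ ⊤ := hf.neg.lintegral_lt_top.ne
  have h2 : ENNReal.ofReal (∫ s, f s ∂ν) + ∫⁻ s, ENNReal.ofReal (-f s) ∂ν
      = ∫⁻ s, ENNReal.ofReal (f s) ∂ν := by
    rw [← ENNReal.ofReal_toReal hn, ← ENNReal.ofReal_add h0 ENNReal.toReal_nonneg,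
      integral_eq_lintegral_pos_part_sub_lintegral_neg_part hf, sub_add_cancel,
      ENNReal.ofReal_toReal hp]
  refine (ENNReal.add_le_add_iff_right hn).1 ?_
  rw [add_right_comm, h2, add_comm]
  exact h1

/-- The difference is the integral over the open interval plus nonnegative shares of the atoms at
the two endpoints. When the positions agree only the share q(x₁) (e₂ - e₁) of the common atom
remains. -/
lemma setIntegral_Ioo_le_leftIntegral_sub {m : FiniteMeasure ℝ} {x₁ x₂ e₁ e₂ : ℝ} (hx : x₁ ≤ x₂)
    (he : e₁ ≤ e₂) (h₁ : e₁ ≤ (m : Measure ℝ).real (Iic x₁))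
    (h₂ : (m : Measure ℝ).real (Iio x₂) ≤ e₂) {q : ℝ → ℝ} (hq : Integrable q (m : Measure ℝ))
    (hq0 : ∀ y, 0 ≤ q y) :
    ∫ y in Ioo x₁ x₂, q y ∂(m : Measure ℝ)
      ≤ leftIntegral m x₂ e₂ q - leftIntegral m x₁ e₁ q := by
  rcases hx.eq_or_lt with rfl | hx
  · simp only [Ioo_self, Measure.restrict_empty, integral_zero_measure, leftIntegral]
    have := mul_nonneg (hq0 x₁) (sub_nonneg.2 he)
    linarith
  · have e1 : ∫ y in Iio x₂, q y ∂(m : Measure ℝ)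
        = (∫ y in Iic x₁, q y ∂(m : Measure ℝ)) + ∫ y in Ioo x₁ x₂, q y ∂(m : Measure ℝ) := by
      rw [← setIntegral_union _ measurableSet_Ioo hq.integrableOn hq.integrableOn,
        Iic_union_Ioo_eq_Iio hx]
      exact Set.disjoint_left.2 fun y h h' => absurd h'.1 (not_lt.2 h)
    have e2 : ∫ y in Iic x₁, q y ∂(m : Measure ℝ)
        = (∫ y in Iio x₁, q y ∂(m : Measure ℝ)) + q x₁ * (m : Measure ℝ).real {x₁} := by
      rw [← Iio_union_right, setIntegral_union _ (measurableSet_singleton _) hq.integrableOn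
        hq.integrableOn, integral_singleton, smul_eq_mul, mul_comm]
      simp
    have e3 : (m : Measure ℝ).real (Iic x₁)
        = (m : Measure ℝ).real (Iio x₁) + (m : Measure ℝ).real {x₁} := by
      rw [← Iio_union_right, measureReal_union (by simp) (measurableSet_singleton _)]
    have p1 := mul_nonneg (hq0 x₂) (sub_nonneg.2 h₂)
    have p2 := mul_nonneg (hq0 x₁) (sub_nonneg.2 h₁)
    rw [e3] at p2
    simp only [leftIntegral]
    rw [e1, e2]
    linarith

/-- The derivative of an integral between two moving endpoints. -/
lemma integral_moving_sub {φ φt φx a : ℝ → ℝ → ℝ} (hφ : IsC1b φ φt φx)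
    (ha : Continuous (Function.uncurry a)) {x₁ x₂ : ℝ → ℝ} (hc₁ : Continuous x₁)
    (hc₂ : Continuous x₂) (h₁ : ∀ t, 0 < t → HasDerivAt x₁ (a t (x₁ t)) t)
    (h₂ : ∀ t, 0 < t → HasDerivAt x₂ (a t (x₂ t)) t) :
    Continuous (fun s => (∫ y in x₁ s..x₂ s, φt s y)
      + (a s (x₂ s) * φ s (x₂ s) - a s (x₁ s) * φ s (x₁ s))) ∧
    ∀ t₀ t, 0 ≤ t₀ → t₀ ≤ t → (∫ y in x₁ t..x₂ t, φ t y) - ∫ y in x₁ t₀..x₂ t₀, φ t₀ y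
      = ∫ s in t₀..t, ((∫ y in x₁ s..x₂ s, φt s y)
        + (a s (x₂ s) * φ s (x₂ s) - a s (x₁ s) * φ s (x₁ s))) := by
  obtain ⟨B, hB⟩ := hφ.bdd
  have ha' : Continuous fun p : ℝ × ℝ => a p.1 p.2 := ha
  have hc : Continuous fun p : ℝ × ℝ => φ p.1 p.2 := hφ.cont
  have hct : Continuous fun p : ℝ × ℝ => φt p.1 p.2 := hφ.cont_t
  set Ψ : ℝ → ℝ → ℝ := fun t x => ∫ y in (0 : ℝ)..x, φ t y with hΨ
  set Ψt : ℝ → ℝ → ℝ := fun t x => ∫ y in (0 : ℝ)..x, φt t y with hΨt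
  have hpar : ∀ {f : ℝ → ℝ → ℝ}, Continuous (Function.uncurry f) →
      Continuous (Function.uncurry fun t x => ∫ y in (0 : ℝ)..x, f t y) := fun {f} hf =>
    intervalIntegral.continuous_parametric_intervalIntegral_of_continuous (μ := volume)
      (f := fun (p : ℝ × ℝ) y => f p.1 y) (s := fun p : ℝ × ℝ => p.2) (by
        simp only [Function.uncurry_def] at hf ⊢; fun_prop) continuous_snd
  have hΨc := hpar hφ.cont
  have hΨtc := hpar hφ.cont_t
  have hΨx : ∀ t, 0 < t → ∀ x, HasDerivAt (Ψ t) (φ t x) x := fun t _ x =>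
    intervalIntegral.integral_hasDerivAt_right ((hφ.cont.slice t).intervalIntegrable _ _)
      ((hφ.cont.slice t).stronglyMeasurableAtFilter _ _) (hφ.cont.slice t).continuousAt
  have hΨd : ∀ t, 0 < t → ∀ x, HasDerivAt (fun t => Ψ t x) (Ψt t x) t := fun t ht x =>
    (intervalIntegral.hasDerivAt_integral_of_dominated_loc_of_deriv_le (μ := volume)
      (a := 0) (b := x) (F := φ) (F' := φt) (bound := fun _ => B) (x₀ := t) (s := Ioi 0)
      (Ioi_mem_nhds ht) (Eventually.of_forall fun t => (hφ.cont.slice t).aestronglyMeasurable)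
      ((hφ.cont.slice t).intervalIntegrable _ _) (hφ.cont_t.slice t).aestronglyMeasurable
      (Eventually.of_forall fun y _ s _ => (hB s y).2.1) intervalIntegrable_const
      (Eventually.of_forall fun y _ s hs => hφ.dt s hs y)).2
  have hsub : ∀ {f : ℝ → ℝ → ℝ}, Continuous (Function.uncurry f) → ∀ t,
      ∫ y in x₁ t..x₂ t, f t y
        = (∫ y in (0 : ℝ)..x₂ t, f t y) - ∫ y in (0 : ℝ)..x₁ t, f t y := fun {f} hf t =>
    (intervalIntegral.integral_interval_sub_left ((hf.slice t).intervalIntegrable _ _)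
      ((hf.slice t).intervalIntegrable _ _)).symm
  simp only [hsub hφ.cont, hsub hφ.cont_t]
  have hc1 : ∀ {f : ℝ → ℝ → ℝ}, Continuous (Function.uncurry f) → ∀ {x : ℝ → ℝ}, Continuous x →
      Continuous fun t => f t (x t) := fun hf x hx => hf.comp (continuous_id.prodMk hx)
  have hcont : Continuous fun s => (Ψt s (x₂ s) - Ψt s (x₁ s))
      + (a s (x₂ s) * φ s (x₂ s) - a s (x₁ s) * φ s (x₁ s)) :=
    ((hc1 hΨtc hc₂).sub (hc1 hΨtc hc₁)).add (((hc1 ha hc₂).mul (hc1 hφ.cont hc₂)).sub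
      ((hc1 ha hc₁).mul (hc1 hφ.cont hc₁)))
  refine ⟨hcont, fun t₀ t h0 h => ?_⟩
  refine (intervalIntegral.integral_eq_sub_of_hasDerivAt_of_le h
    ((hc1 hΨc hc₂).sub (hc1 hΨc hc₁)).continuousOn (fun s hs => ?_)
    (hcont.intervalIntegrable _ _)).symm
  have hs0 : 0 < s := h0.trans_lt hs.1
  have d2 := hasDerivAt_along hΨd hΨx hΨtc hφ.cont hs0 (h₂ s hs0)
  have d1 := hasDerivAt_along hΨd hΨx hΨtc hφ.cont hs0 (h₁ s hs0)
  convert! d2.sub d1 using 1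
  ring

namespace IsTransport

variable {Λ E : ℝ} {m : ℝ → FiniteMeasure ℝ} {a g : ℝ → ℝ → ℝ} {x e : ℝ → ℝ}

lemma intervalIntegrable_leftIntegral (H : IsTransport Λ E m a g)
    (hx : IsBalancedCurve m a g x e) {q : ℝ → ℝ → ℝ} (hq : Continuous (Function.uncurry q)) {B : ℝ}
    (hB : ∀ s y, |q s y| ≤ B) {t₁ t₂ : ℝ} (h₁ : 0 ≤ t₁) (h₁₂ : t₁ ≤ t₂) :
    IntervalIntegrable (fun s => leftIntegral (m s) (x s) (e s) (q s)) volume t₁ t₂ := by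
  have i1 := intervalIntegrable_setIntegral_Iio H.cont_m H.mass hx.cont_x hq hB t₁ t₂
  have i2 := intervalIntegrable_setIntegral_Iio H.cont_m H.mass hx.cont_x (q := fun _ _ => 1)
    continuous_const (B := 1) (by simp) t₁ t₂
  simp only [setIntegral_const, smul_eq_mul, mul_one] at i2
  have hec : ContinuousOn e (uIcc t₁ t₂) := by
    rw [uIcc_of_le h₁₂]
    exact hx.cont_e.mono fun s hs => h₁.trans hs.1
  exact i1.add ((hec.intervalIntegrable.sub i2).continuousOn_mul
    (hq.comp (continuous_id.prodMk hx.cont_x)).continuousOn)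

end IsTransport

namespace IsWavePair

variable {σ δ Λ E C : ℝ} {μ ν : ℝ → FiniteMeasure ℝ} {a c g r s : ℝ → ℝ → ℝ}

lemma integrable_of_rnDeriv {m : FiniteMeasure ℝ} {r : ℝ → ℝ} (hr : ∀ x, 0 ≤ r x)
    (h : (m : Measure ℝ).rnDeriv volume =ᵐ[volume] fun x => ENNReal.ofReal (r x)) :
    Integrable r := by
  have h1 : Integrable fun x => ((m : Measure ℝ).rnDeriv volume x).toReal :=
    Measure.integrable_toReal_rnDeriv
  refine h1.congr ?_
  filter_upwards [h] with x hx
  rw [hx, ENNReal.toReal_ofReal (hr x)]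

lemma integrable_sqrt {r : ℝ → ℝ} (hr0 : ∀ x, 0 ≤ r x) (hr : Integrable r) (x y : ℝ) :
    IntervalIntegrable (fun z => √(r z)) volume x y := by
  refine ((intervalIntegrable_const (c := (1 : ℝ))).add hr.intervalIntegrable).mono_fun'
    (Real.continuous_sqrt.comp_aestronglyMeasurable hr.aestronglyMeasurable).restrict
    (Eventually.of_forall fun z => ?_)
  simp only [Real.norm_of_nonneg (Real.sqrt_nonneg _)]
  nlinarith [Real.sq_sqrt (hr0 z), Real.sqrt_nonneg (r z), sq_nonneg (√(r z) - 1)]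

lemma intervalIntegrable_variation (H : IsWavePair σ δ Λ E C μ ν a c g r s) {t : ℝ} (ht : 0 ≤ t)
    (x y : ℝ) : IntervalIntegrable (fun z => 1 + √(r t z) + √(s t z)) volume x y :=
  (intervalIntegrable_const.add (integrable_sqrt (H.r_nonneg t)
    (integrable_of_rnDeriv (H.r_nonneg t) (H.dens_r t ht)) x y)).add
    (integrable_sqrt (H.s_nonneg t) (integrable_of_rnDeriv (H.s_nonneg t) (H.dens_s t ht)) x y)

lemma variation_nonneg (t z : ℝ) : 0 ≤ 1 + √(r t z) + √(s t z) := by positivity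

/-- The boundary term is φ(x₂) (a(x₂) - a(x₁)) plus a(x₁) ∫ φx. Replacing a(x₁) by a(y) under the
integral costs the oscillation of a times ∫ |φx|, and monotonicity of φ in x bounds the latter by B.
Thus neither a derivative of a nor a pointwise bound for φx, which would degenerate with the
smoothing, enters. -/
lemma moving_rate_le (H : IsWavePair σ δ Λ E C μ ν a c g r s) {φ φt φx : ℝ → ℝ → ℝ}
    (hφ : IsC1b φ φt φx) {B : ℝ} (hB : ∀ t x, 1 ≤ φ t x ∧ φ t x ≤ B)
    (hmono : ∀ t x, 0 ≤ σ * φx t x) {t x₁ x₂ : ℝ} (ht : 0 < t) (hx : x₁ ≤ x₂) :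
    (∫ y in x₁..x₂, φt t y) + (a t x₂ * φ t x₂ - a t x₁ * φ t x₁)
      ≤ (∫ y in x₁..x₂, (φt t y + a t y * φx t y))
        + 2 * B * (C * ∫ z in x₁..x₂, (1 + √(r t z) + √(s t z))) := by
  set w := C * ∫ z in x₁..x₂, (1 + √(r t z) + √(s t z)) with hw
  have hwa : ∀ y ∈ Icc x₁ x₂, |a t y - a t x₁| ≤ w := fun y hy => by
    refine (H.a_var t ht.le x₁ y hy.1).trans (mul_le_mul_of_nonneg_left ?_ H.C_nonneg)
    exact intervalIntegral.integral_mono_interval le_rfl hy.1 hy.2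
      (Eventually.of_forall fun z => variation_nonneg t z) (H.intervalIntegrable_variation ht.le _ _)
  have hw0 : 0 ≤ w := (abs_nonneg _).trans (hwa x₂ ⟨hx, le_rfl⟩)
  have ca := H.cont_a.slice t
  have ct := hφ.cont_t.slice t
  have cx := hφ.cont_x.slice t
  have e1 : ∫ y in x₁..x₂, φx t y = φ t x₂ - φ t x₁ :=
    intervalIntegral.integral_eq_sub_of_hasDerivAt (fun y _ => hφ.dx t ht y)
      (cx.intervalIntegrable _ _)
  have e2 : (∫ y in x₁..x₂, (φt t y + a t y * φx t y))
      = (∫ y in x₁..x₂, φt t y) + ∫ y in x₁..x₂, a t y * φx t y :=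
    intervalIntegral.integral_add (ct.intervalIntegrable _ _) ((ca.mul cx).intervalIntegrable _ _)
  have e3 : ∫ y in x₁..x₂, (a t x₁ - a t y) * φx t y
      = a t x₁ * (φ t x₂ - φ t x₁) - ∫ y in x₁..x₂, a t y * φx t y := by
    rw [← e1, ← intervalIntegral.integral_const_mul, ← intervalIntegral.integral_sub
      ((cx.const_mul _).intervalIntegrable _ _)
      ((by fun_prop : Continuous fun y => a t y * φx t y).intervalIntegrable _ _)]
    congr 1 with y
    ring
  have hσ : ∀ y, |φx t y| = σ * φx t y := fun y => by
    rw [← abs_of_nonneg (hmono t y), abs_mul]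
    rcases H.sign with h | h <;> simp [h]
  have e4 : ∫ y in x₁..x₂, (a t x₁ - a t y) * φx t y ≤ w * B := by
    calc ∫ y in x₁..x₂, (a t x₁ - a t y) * φx t y
        ≤ ∫ y in x₁..x₂, w * (σ * φx t y) := by
          refine intervalIntegral.integral_mono_on hx
            (((continuous_const.sub ca).mul cx).intervalIntegrable _ _)
            (((cx.const_mul σ).const_mul w).intervalIntegrable _ _) fun y hy => ?_
          rw [← hσ]
          refine (le_abs_self _).trans ?_
          rw [abs_mul, abs_sub_comm]
          exact mul_le_mul_of_nonneg_right (hwa y hy) (abs_nonneg _)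
      _ = w * (σ * (φ t x₂ - φ t x₁)) := by
          rw [intervalIntegral.integral_const_mul, intervalIntegral.integral_const_mul, e1]
      _ ≤ w * B := by
          refine mul_le_mul_of_nonneg_left ?_ hw0
          have := hB t x₁
          have := hB t x₂
          rcases H.sign with h | h <;> rw [h] <;> linarith
  have e5 : φ t x₂ * (a t x₂ - a t x₁) ≤ B * w := by
    have h1 := hB t x₂
    have h2 := (abs_le.1 (hwa x₂ ⟨hx, le_rfl⟩)).2
    calc φ t x₂ * (a t x₂ - a t x₁) ≤ φ t x₂ * w :=
          mul_le_mul_of_nonneg_left h2 (by linarith)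
      _ ≤ B * w := mul_le_mul_of_nonneg_right h1.2 hw0
  rw [e2]
  linarith

lemma lintegral_density_mul_le {m : FiniteMeasure ℝ} {r N : ℝ → ℝ} {M x₁ x₂ B : ℝ} (hM : 0 ≤ M)
    (hr : ∀ x, 0 ≤ r x)
    (h : (m : Measure ℝ).rnDeriv volume =ᵐ[volume] fun x => ENNReal.ofReal (r x))
    (hN : Continuous N) (hN0 : ∀ x, 0 ≤ N x) (hNB : ∀ x, N x ≤ B) (hx : x₁ ≤ x₂) :
    ∫⁻ y in Ioo x₁ x₂, ENNReal.ofReal (M + r y) * ENNReal.ofReal (N y)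
      ≤ ENNReal.ofReal ((∫ y in Ioo x₁ x₂, N y ∂(m : Measure ℝ)) + M * ∫ y in x₁..x₂, N y) := by
  have hi1 : IntegrableOn N (Ioo x₁ x₂) (m : Measure ℝ) :=
    (integrable_of_continuous_of_bdd hN fun y => by
      rw [abs_of_nonneg (hN0 y)]; exact hNB y).integrableOn
  have hi2 : IntegrableOn N (Ioo x₁ x₂) := (hN.integrableOn_Icc).mono_set Ioo_subset_Icc_self
  have e1 : ∫⁻ y in Ioo x₁ x₂, ENNReal.ofReal (M + r y) * ENNReal.ofReal (N y)
      = (∫⁻ y, (Ioo x₁ x₂).indicator (fun y => ENNReal.ofReal (N y)) y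
          * (m : Measure ℝ).rnDeriv volume y)
        + ENNReal.ofReal M * ∫⁻ y in Ioo x₁ x₂, ENNReal.ofReal (N y) := by
    rw [← lintegral_const_mul _ hN.measurable.ennreal_ofReal, ← lintegral_indicator measurableSet_Ioo,
      ← lintegral_indicator measurableSet_Ioo, ← lintegral_add_right _
      ((hN.measurable.ennreal_ofReal.const_mul _).indicator measurableSet_Ioo)]
    refine lintegral_congr_ae ?_
    filter_upwards [h] with y hy
    by_cases hyI : y ∈ Ioo x₁ x₂
    · simp only [indicator_of_mem hyI, hy]
      rw [ENNReal.ofReal_add hM (hr y)]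
      ring
    · simp [indicator_of_notMem hyI]
  rw [e1, ENNReal.ofReal_add (integral_nonneg hN0)
    (mul_nonneg hM (intervalIntegral.integral_nonneg hx fun y _ => hN0 y)), ENNReal.ofReal_mul hM,
    intervalIntegral.integral_of_le hx, integral_Ioc_eq_integral_Ioo,
    ofReal_integral_eq_lintegral_ofReal hi1 (Eventually.of_forall hN0),
    ofReal_integral_eq_lintegral_ofReal hi2 (Eventually.of_forall hN0)]
  refine add_le_add ?_ le_rfl
  rw [← lintegral_indicator measurableSet_Ioo]
  exact lintegral_mul_rnDeriv_le _ (hN.measurable.ennreal_ofReal.indicator measurableSet_Ioo)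

end IsWavePair

lemma leftIntegral_neg (m : Measure ℝ) (x e : ℝ) (q : ℝ → ℝ) :
    leftIntegral m x e (fun y => -q y) = -leftIntegral m x e q := by
  simp only [leftIntegral, integral_neg]
  ring

lemma leftIntegral_sub_one {m : FiniteMeasure ℝ} (x e : ℝ) {q : ℝ → ℝ}
    (hq : Integrable q (m : Measure ℝ)) :
    leftIntegral m x e (fun y => q y - 1) = leftIntegral m x e q - e := by
  simp only [leftIntegral]
  rw [integral_sub hq.integrableOn (integrable_const _), setIntegral_const, smul_eq_mul, mul_one]
  ring

lemma add_ofReal_le_add_ofReal {X R : ℝ≥0∞} {f x r : ℝ} (hx : 0 ≤ x) (hr : 0 ≤ r) (h : f ≤ -x + r)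
    (hX : X ≤ ENNReal.ofReal x) (hR : ENNReal.ofReal r ≤ R) :
    X + ENNReal.ofReal f ≤ R + ENNReal.ofReal (-f) := by
  refine (add_le_add_left hX _).trans (le_trans ?_ (add_le_add_left hR _))
  rcases le_total 0 f with hf | hf
  · rw [ENNReal.ofReal_of_nonpos (neg_nonpos.2 hf), add_zero, ← ENNReal.ofReal_add hx hf]
    exact ENNReal.ofReal_le_ofReal (by linarith)
  · rw [ENNReal.ofReal_of_nonpos hf, add_zero, ← ENNReal.ofReal_add hr (by linarith)]
    exact ENNReal.ofReal_le_ofReal (by linarith)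

namespace IsWavePair

variable {σ δ Λ E C : ℝ} {μ ν : ℝ → FiniteMeasure ℝ} {a c g r s : ℝ → ℝ → ℝ} {x₁ x₂ e₁ e₂ : ℝ → ℝ}

/-- Comparison of two ordered characteristics, by means of a weight which decreases along the
characteristics at a rate `N`. -/
lemma comparison_of_weight (H : IsWavePair σ δ Λ E C μ ν a c g r s)
    (h₁ : IsBalancedCurve μ a g x₁ e₁) (h₂ : IsBalancedCurve μ a g x₂ e₂) {t₀ t : ℝ} (h0 : 0 ≤ t₀)
    (h0t : t₀ ≤ t) (hx : ∀ τ ∈ Icc t₀ t, x₁ τ ≤ x₂ τ) (he : ∀ τ ∈ Icc t₀ t, e₁ τ ≤ e₂ τ)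
    (hx0 : x₁ t₀ = x₂ t₀) (he0 : e₁ t₀ = e₂ t₀) {M : ℝ} (hM : 0 ≤ M) {φ φt φx N : ℝ → ℝ → ℝ}
    (hφ : IsC1b φ φt φx) {B : ℝ} (hB : ∀ t x, 1 ≤ φ t x ∧ φ t x ≤ B)
    (hmono : ∀ t x, 0 ≤ σ * φx t x) (hNc : Continuous (Function.uncurry N)) {K : ℝ}
    (hNb : ∀ t x, 0 ≤ N t x ∧ N t x ≤ K)
    (hN : ∀ τ ∈ Ioc t₀ t, ∀ y, φt τ y + a τ y * φx τ y ≤ -N τ y) :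
    ENNReal.ofReal (M * (x₂ t - x₁ t) + (e₂ t - e₁ t))
        + ∫⁻ τ in Ioc t₀ t, ∫⁻ y in Ioo (x₁ τ) (x₂ τ),
          ENNReal.ofReal (M + r τ y) * ENNReal.ofReal (N τ y)
      ≤ ∫⁻ τ in Ioc t₀ t, ∫⁻ y in Ioo (x₁ τ) (x₂ τ),
          ENNReal.ofReal (B * |g τ y| + 2 * M * B * C * (1 + √(r τ y) + √(s τ y))) := by
  have Hμ := H.isTransport
  have hΛ := H.Λ_nonneg
  have hB0 : 0 ≤ B := by linarith [hB 0 0]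
  obtain ⟨B', hB'⟩ := hφ.bdd
  have hB'0 : 0 ≤ B' := (abs_nonneg _).trans (hB' 0 0).1
  set q : ℝ → ℝ → ℝ := fun τ y => φt τ y + a τ y * φx τ y with hq
  have hqc : Continuous (Function.uncurry q) := hφ.cont_t.add (H.cont_a.mul hφ.cont_x)
  have hqb : ∀ τ y, |q τ y| ≤ B' + Λ * B' := fun τ y => by
    refine (abs_add_le _ _).trans (add_le_add (hB' τ y).2.1 ?_)
    rw [abs_mul]
    exact mul_le_mul (H.a_le τ y) (hB' τ y).2.2 (abs_nonneg _) hΛ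
  have hφi : ∀ τ, Integrable (φ τ) (μ τ : Measure ℝ) := fun τ =>
    integrable_of_continuous_of_bdd (hφ.cont.slice τ) fun y => (hB' τ y).1
  obtain ⟨hrate_c, hrate⟩ := integral_moving_sub hφ H.cont_a h₁.cont_x h₂.cont_x h₁.deriv_x
    h₂.deriv_x
  set rate : ℝ → ℝ := fun τ => (∫ y in x₁ τ..x₂ τ, φt τ y)
    + (a τ (x₂ τ) * φ τ (x₂ τ) - a τ (x₁ τ) * φ τ (x₁ τ)) with hrate_def
  set L : ℝ → ℝ := fun τ => leftIntegral (μ τ) (x₂ τ) (e₂ τ) (q τ)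
    - leftIntegral (μ τ) (x₁ τ) (e₁ τ) (q τ) with hL
  set S : ℝ → ℝ := fun τ => (∫ y in Iic (x₂ τ), g τ y * φ τ y)
    - ∫ y in Iic (x₁ τ), g τ y * φ τ y with hS
  have hφm : Measurable (Function.uncurry φ) := hφ.cont.measurable
  have iL₂ := Hμ.intervalIntegrable_leftIntegral h₂ hqc hqb h0 h0t
  have iL₁ := Hμ.intervalIntegrable_leftIntegral h₁ hqc hqb h0 h0t
  have iS₂ := Hμ.source.intervalIntegrable_Iic h₂.cont_x hφm (fun τ y => (hB' τ y).1) h0 h0t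
  have iS₁ := Hμ.source.intervalIntegrable_Iic h₁.cont_x hφm (fun τ y => (hB' τ y).1) h0 h0t
  have iR : IntervalIntegrable (fun τ => M * rate τ) volume t₀ t :=
    (hrate_c.const_mul M).intervalIntegrable _ _
  have iL : IntervalIntegrable L volume t₀ t := iL₂.sub iL₁
  have iS : IntervalIntegrable S volume t₀ t := iS₂.sub iS₁
  -- Position and energy agree at t₀, so the weighted distance starts from 0 and equals the integral
  -- of its rate.
  have hint : ∫ τ in t₀..t, (L τ + S τ + M * rate τ)
      = (leftIntegral (μ t) (x₂ t) (e₂ t) (φ t) - leftIntegral (μ t) (x₁ t) (e₁ t) (φ t))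
        + M * ∫ y in x₁ t..x₂ t, φ t y := by
    rw [intervalIntegral.integral_add (iL.add iS) iR, intervalIntegral.integral_add iL iS,
      intervalIntegral.integral_sub iL₂ iL₁, intervalIntegral.integral_sub iS₂ iS₁,
      intervalIntegral.integral_const_mul, ← hrate t₀ t h0 h0t]
    have k₁ := Hμ.leftIntegral_sub h₁ hφ h0 h0t
    have k₂ := Hμ.leftIntegral_sub h₂ hφ h0 h0t
    rw [hx0, he0] at k₁
    rw [hx0, intervalIntegral.integral_same, sub_zero]
    linarith
  have ht : t ∈ Icc t₀ t := ⟨h0t, le_rfl⟩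
  have hD0 : 0 ≤ M * (x₂ t - x₁ t) + (e₂ t - e₁ t) :=
    add_nonneg (mul_nonneg hM (sub_nonneg.2 (hx t ht))) (sub_nonneg.2 (he t ht))
  -- The weight is at least 1, so the weighted distance dominates the unweighted one.
  have hD : M * (x₂ t - x₁ t) + (e₂ t - e₁ t) ≤ ∫ τ in t₀..t, (L τ + S τ + M * rate τ) := by
    have ht0 := h0.trans h0t
    have k1 := setIntegral_Ioo_le_leftIntegral_sub (q := fun y => φ t y - 1) (hx t ht) (he t ht)
      (h₁.mem t ht0).2 (h₂.mem t ht0).1 ((hφi t).sub (integrable_const 1)) fun y => sub_nonneg.2 (hB t y).1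
    have k2 : 0 ≤ ∫ y in Ioo (x₁ t) (x₂ t), (φ t y - 1) ∂(μ t : Measure ℝ) :=
      integral_nonneg fun y => sub_nonneg.2 (hB t y).1
    have k3 := leftIntegral_sub_one (x₁ t) (e₁ t) (hφi t)
    have k4 := leftIntegral_sub_one (x₂ t) (e₂ t) (hφi t)
    have k5 := intervalIntegral.integral_mono_on (μ := volume) (hx t ht) intervalIntegrable_const
      ((hφ.cont.slice t).intervalIntegrable _ _) fun y _ => (hB t y).1
    rw [intervalIntegral.integral_const, smul_eq_mul, mul_one] at k5
    have k6 := mul_le_mul_of_nonneg_left k5 hM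
    rw [hint]
    linarith
  have iF : Integrable (fun τ => L τ + S τ + M * rate τ) (volume.restrict (Ioc t₀ t)) :=
    ((iL.add iS).add iR).1
  rw [intervalIntegral.integral_of_le h0t] at hD
  refine (add_le_add_left (ENNReal.ofReal_le_ofReal hD) _).trans
    (ofReal_integral_add_lintegral_le iF (hD0.trans hD) ?_)
  rw [ae_restrict_iff' measurableSet_Ioc]
  filter_upwards [Hμ.source.ae_integrable h0] with τ hτ hτI
  have hgτ := hτ hτI
  have hτ0 : 0 < τ := h0.trans_lt hτI.1
  have hτ' : τ ∈ Icc t₀ t := ⟨hτI.1.le, hτI.2⟩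
  have cN := hNc.slice τ
  have hxτ := hx τ hτ'
  set V : ℝ → ℝ := fun z => 1 + √(r τ z) + √(s τ z) with hV
  have iV : IntervalIntegrable V volume (x₁ τ) (x₂ τ) := H.intervalIntegrable_variation hτ0.le _ _
  have iB : IntervalIntegrable (fun y => B * |g τ y|) volume (x₁ τ) (x₂ τ) :=
    (hgτ.abs.const_mul B).intervalIntegrable
  have hNμ : 0 ≤ ∫ y in Ioo (x₁ τ) (x₂ τ), N τ y ∂(μ τ : Measure ℝ) :=
    integral_nonneg fun y => (hNb τ y).1
  have hNv : 0 ≤ ∫ y in x₁ τ..x₂ τ, N τ y :=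
    intervalIntegral.integral_nonneg hxτ fun y _ => (hNb τ y).1
  have hR0 : ∀ y, 0 ≤ B * |g τ y| + 2 * M * B * C * V y := fun y => by
    have := H.C_nonneg
    have := variation_nonneg (r := r) (s := s) τ y
    positivity
  refine add_ofReal_le_add_ofReal (x := (∫ y in Ioo (x₁ τ) (x₂ τ), N τ y ∂(μ τ : Measure ℝ))
      + M * ∫ y in x₁ τ..x₂ τ, N τ y)
    (r := ∫ y in x₁ τ..x₂ τ, (B * |g τ y| + 2 * M * B * C * V y)) (add_nonneg hNμ
      (mul_nonneg hM hNv)) (intervalIntegral.integral_nonneg hxτ fun y _ => hR0 y) ?_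
    (lintegral_density_mul_le hM (H.r_nonneg τ) (H.dens_r τ hτ0.le) cN (fun y => (hNb τ y).1)
      (fun y => (hNb τ y).2) hxτ) (le_of_eq ?_)
  · have p1 : L τ ≤ -∫ y in Ioo (x₁ τ) (x₂ τ), N τ y ∂(μ τ : Measure ℝ) := by
      have iq : Integrable (fun y => -q τ y) (μ τ : Measure ℝ) :=
        integrable_of_continuous_of_bdd (hqc.slice τ).neg fun y => by rw [abs_neg]; exact hqb τ y
      have hq0 : ∀ y, N τ y ≤ -q τ y := fun y => le_neg_of_le_neg (hN τ hτI y)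
      have k1 := setIntegral_Ioo_le_leftIntegral_sub hxτ (he τ hτ') (h₁.mem τ hτ0.le).2
        (h₂.mem τ hτ0.le).1 iq fun y => (hNb τ y).1.trans (hq0 y)
      rw [leftIntegral_neg, leftIntegral_neg] at k1
      have k2 := setIntegral_mono (μ := (μ τ : Measure ℝ)) (s := Ioo (x₁ τ) (x₂ τ))
        (integrable_of_continuous_of_bdd cN (B := K) fun y => by
          rw [abs_of_nonneg (hNb τ y).1]; exact (hNb τ y).2).integrableOn iq.integrableOn hq0
      simp only [hL]
      linarith
    have p2 : S τ ≤ ∫ y in x₁ τ..x₂ τ, B * |g τ y| := by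
      have igφ : Integrable fun y => g τ y * φ τ y :=
        hgτ.mul_bdd (c := B') (hφ.cont.slice τ).aestronglyMeasurable
          (Eventually.of_forall fun y => (hB' τ y).1)
      simp only [hS]
      rw [intervalIntegral.integral_Iic_sub_Iic igφ.integrableOn igφ.integrableOn]
      refine intervalIntegral.integral_mono_on hxτ igφ.intervalIntegrable iB fun y _ => ?_
      have := hB τ y
      calc g τ y * φ τ y ≤ |g τ y| * φ τ y :=
            mul_le_mul_of_nonneg_right (le_abs_self _) (by linarith)
        _ ≤ |g τ y| * B := mul_le_mul_of_nonneg_left this.2 (abs_nonneg _)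
        _ = B * |g τ y| := mul_comm _ _
    have p3 := H.moving_rate_le hφ hB hmono hτ0 hxτ
    have p4 : ∫ y in x₁ τ..x₂ τ, q τ y ≤ -∫ y in x₁ τ..x₂ τ, N τ y := by
      rw [← intervalIntegral.integral_neg]
      exact intervalIntegral.integral_mono_on hxτ ((hqc.slice τ).intervalIntegrable _ _)
        (cN.neg.intervalIntegrable _ _) fun y _ => hN τ hτI y
    have p5 : rate τ ≤ -(∫ y in x₁ τ..x₂ τ, N τ y) + 2 * B * (C * ∫ z in x₁ τ..x₂ τ, V z) :=
      p3.trans (add_le_add_left p4 _)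
    have p6 := mul_le_mul_of_nonneg_left p5 hM
    rw [intervalIntegral.integral_add iB (iV.const_mul _),
      intervalIntegral.integral_const_mul (2 * M * B * C)]
    linarith
  · have iI : IntegrableOn (fun y => B * |g τ y| + 2 * M * B * C * V y) (Ioo (x₁ τ) (x₂ τ)) := by
      have := (iB.add (iV.const_mul (2 * M * B * C))).1
      exact this.mono_set Ioo_subset_Ioc_self
    rw [intervalIntegral.integral_of_le hxτ, integral_Ioc_eq_integral_Ioo,
      ofReal_integral_eq_lintegral_ofReal iI (Eventually.of_forall hR0)]

end IsWavePair

/-! ### Removal of the smoothing and Grönwall's inequality -/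

lemma tendsto_steklov {w : ℝ → ℝ → ℝ} (hw : Continuous (Function.uncurry w)) (t x : ℝ) :
    Tendsto (fun n => steklov (eps n) w t x) atTop (𝓝 (w t x)) := by
  have hc : Continuous fun s => w (t + s) x := by
    simp only [Function.uncurry_def] at hw; fun_prop
  have hd : HasDerivAt (fun h => ∫ s in (0 : ℝ)..h, w (t + s) x) (w t x) 0 := by
    simpa using intervalIntegral.integral_hasDerivAt_right (hc.intervalIntegrable 0 0)
      (hc.stronglyMeasurableAtFilter _ _) hc.continuousAt
  have := hd.tendsto_slope_zero_right.comp (tendsto_nhdsWithin_iff.2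
    ⟨tendsto_eps, Eventually.of_forall fun n => mem_Ioi.2 (eps_pos n)⟩)
  refine this.congr fun n => ?_
  simp [steklov]

lemma lintegral_Ioo_density_le {m : FiniteMeasure ℝ} {r : ℝ → ℝ} {k l x₁ x₂ : ℝ} (hk : 0 ≤ k)
    (hl : 0 ≤ l) (hr : ∀ x, 0 ≤ r x)
    (h : (m : Measure ℝ).rnDeriv volume =ᵐ[volume] fun x => ENNReal.ofReal (r x)) (hx : x₁ ≤ x₂) :
    ∫⁻ y in Ioo x₁ x₂, ENNReal.ofReal (k + l * r y)
      ≤ ENNReal.ofReal (k * (x₂ - x₁) + l * (m : Measure ℝ).real (Ioo x₁ x₂)) := by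
  have e1 : ∫⁻ y in Ioo x₁ x₂, ENNReal.ofReal (k + l * r y)
      = ∫⁻ y in Ioo x₁ x₂, (ENNReal.ofReal k
        + ENNReal.ofReal l * (m : Measure ℝ).rnDeriv volume y) := by
    refine lintegral_congr_ae (ae_restrict_of_ae ?_)
    filter_upwards [h] with y hy
    rw [hy, ENNReal.ofReal_add hk (mul_nonneg hl (hr y)), ENNReal.ofReal_mul hl]
  rw [e1, lintegral_add_left measurable_const, lintegral_const_mul' _ _ ENNReal.ofReal_ne_top,
    setLIntegral_const, Real.volume_Ioo, ENNReal.ofReal_add (mul_nonneg hk (sub_nonneg.2 hx))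
    (mul_nonneg hl measureReal_nonneg), ENNReal.ofReal_mul hk, ENNReal.ofReal_mul hl,
    ofReal_measureReal]
  gcongr
  exact Measure.setLIntegral_rnDeriv_le _

/-- Grönwall's inequality is applied to the primitive of D, which is differentiable, after extending
D constantly to the left of t₀. -/
lemma le_zero_of_le_integral {D : ℝ → ℝ} {K t₀ t : ℝ} (h : t₀ ≤ t) (hD : ContinuousOn D (Ici t₀))
    (hD0 : ∀ τ ∈ Icc t₀ t, 0 ≤ D τ) (hle : ∀ τ ∈ Icc t₀ t, D τ ≤ K * ∫ z in t₀..τ, D z) :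
    D t ≤ 0 := by
  have hc : Continuous fun τ => D (max τ t₀) :=
    hD.comp_continuous (by fun_prop) fun τ => mem_Ici.2 (le_max_right _ _)
  have heq : ∀ τ, t₀ ≤ τ → ∫ z in t₀..τ, D (max z t₀) = ∫ z in t₀..τ, D z := fun τ hτ =>
    intervalIntegral.integral_congr fun z hz => by
      rw [uIcc_of_le hτ] at hz
      simp [max_eq_left hz.1]
  have hderiv : ∀ τ, HasDerivAt (fun τ => ∫ z in t₀..τ, D (max z t₀)) (D (max τ t₀)) τ := fun τ =>
    intervalIntegral.integral_hasDerivAt_right (hc.intervalIntegrable _ _)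
      (hc.stronglyMeasurableAtFilter _ _) hc.continuousAt
  have key := norm_le_gronwallBound_of_norm_deriv_right_le (a := t₀) (b := t) (δ := 0) (K := K)
    (ε := 0) (fun τ _ => (hderiv τ).continuousAt.continuousWithinAt)
    (fun τ _ => (hderiv τ).hasDerivWithinAt) (by simp) (fun τ hτ => by
      have hτ' : τ ∈ Icc t₀ t := ⟨hτ.1, hτ.2.le⟩
      have h0 : 0 ≤ ∫ z in t₀..τ, D z := intervalIntegral.integral_nonneg hτ.1 fun z hz =>
        hD0 z ⟨hz.1, hz.2.trans hτ.2.le⟩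
      rw [heq τ hτ.1, max_eq_left hτ.1, Real.norm_of_nonneg (hD0 τ hτ'), Real.norm_of_nonneg h0,
        add_zero]
      exact hle τ hτ') t ⟨h, le_rfl⟩
  rw [heq t h, gronwallBound_ε0_δ0] at key
  have h0 : ∫ z in t₀..t, D z = 0 := norm_le_zero_iff.1 key
  have := hle t ⟨h, le_rfl⟩
  rwa [h0, mul_zero] at this

namespace IsWavePair

variable {σ δ Λ E C : ℝ} {μ ν : ℝ → FiniteMeasure ℝ} {a c g r s : ℝ → ℝ → ℝ}

/-- The weights of `exists_weight` are inserted in `comparison_of_weight`. The right side depends on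
them only through B, so it stays fixed while first the Steklov length and then the mollification
scale tend to 0, with Fatou's lemma on the left. -/
lemma comparison (H : IsWavePair σ δ Λ E C μ ν a c g r s) (T : ℝ) :
    ∃ B : ℝ, 1 ≤ B ∧ ∀ (x₁ x₂ e₁ e₂ : ℝ → ℝ) (t₀ t M : ℝ), IsBalancedCurve μ a g x₁ e₁ →
      IsBalancedCurve μ a g x₂ e₂ → 0 ≤ t₀ → t₀ ≤ t → t ≤ T → (∀ τ ∈ Icc t₀ t, x₁ τ ≤ x₂ τ) →
      (∀ τ ∈ Icc t₀ t, e₁ τ ≤ e₂ τ) → x₁ t₀ = x₂ t₀ → e₁ t₀ = e₂ t₀ → 0 ≤ M →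
      ENNReal.ofReal (M * (x₂ t - x₁ t) + (e₂ t - e₁ t))
          + ∫⁻ τ in Ioc t₀ t, ∫⁻ y in Ioo (x₁ τ) (x₂ τ),
            ENNReal.ofReal (M + r τ y) * ENNReal.ofReal (δ * s τ y)
        ≤ ∫⁻ τ in Ioc t₀ t, ∫⁻ y in Ioo (x₁ τ) (x₂ τ),
            ENNReal.ofReal (B * |g τ y| + 2 * M * B * C * (1 + √(r τ y) + √(s τ y))) := by
  obtain ⟨B, hB1, hB⟩ := H.exists_weight T
  refine ⟨B, hB1, fun x₁ x₂ e₁ e₂ t₀ t M h₁ h₂ h0 h0t htT hx he hx0 he0 hM => ?_⟩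
  have hδ := H.δ_pos
  have hE := H.E_nonneg
  set R := ∫⁻ τ in Ioc t₀ t, ∫⁻ y in Ioo (x₁ τ) (x₂ τ),
    ENNReal.ofReal (B * |g τ y| + 2 * M * B * C * (1 + √(r τ y) + √(s τ y)))
  set D := ENNReal.ofReal (M * (x₂ t - x₁ t) + (e₂ t - e₁ t))
  set P := (volume.restrict (Ioc t₀ t)).prod (volume : Measure ℝ) with hP
  set k : ℝ × ℝ → ℝ≥0∞ := {z : ℝ × ℝ | z.2 ∈ Ioo (x₁ z.1) (x₂ z.1)}.indicator
    fun z => ENNReal.ofReal (M + r z.1 z.2) with hk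
  have hPle : P ≤ (volume.restrict (Ioi 0)).prod (volume : Measure ℝ) :=
    Measure.prod_mono (Measure.restrict_mono (fun τ hτ => h0.trans_lt hτ.1) le_rfl) le_rfl
  have hset : MeasurableSet {z : ℝ × ℝ | z.2 ∈ Ioo (x₁ z.1) (x₂ z.1)} :=
    (measurableSet_lt (h₁.cont_x.measurable.comp measurable_fst) measurable_snd).inter
      (measurableSet_lt measurable_snd (h₂.cont_x.measurable.comp measurable_fst))
  have hkm : AEMeasurable k P :=
    ((H.meas_r.mono_measure hPle).const_add M).ennreal_ofReal.indicator hset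
  have hkv : ∀ τ y, k (τ, y)
      = (Ioo (x₁ τ) (x₂ τ)).indicator (fun y => ENNReal.ofReal (M + r τ y)) y := fun τ y => by
    simp only [hk, indicator, mem_ofPred_eq]
  have hslice : ∀ f : ℝ → ℝ → ℝ≥0∞, (∫⁻ τ in Ioc t₀ t, ∫⁻ y in Ioo (x₁ τ) (x₂ τ),
      ENNReal.ofReal (M + r τ y) * f τ y) = ∫⁻ τ in Ioc t₀ t, ∫⁻ y, k (τ, y) * f τ y := fun f => by
    congr 1 with τ
    rw [← lintegral_indicator measurableSet_Ioo]
    congr 1 with y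
    rw [hkv]
    by_cases hy : y ∈ Ioo (x₁ τ) (x₂ τ)
    · rw [indicator_of_mem hy, indicator_of_mem hy]
    · rw [indicator_of_notMem hy, indicator_of_notMem hy, zero_mul]
  have hprod : ∀ f : ℝ → ℝ → ℝ, Continuous (Function.uncurry f) →
      (∫⁻ τ in Ioc t₀ t, ∫⁻ y in Ioo (x₁ τ) (x₂ τ), ENNReal.ofReal (M + r τ y)
        * ENNReal.ofReal (f τ y)) = ∫⁻ z, k z * ENNReal.ofReal (f z.1 z.2) ∂P := fun f hf => by
    rw [hslice, hP, lintegral_prod (fun z => k z * ENNReal.ofReal (f z.1 z.2)) (hkm.mul hf.measurable.ennreal_ofReal.aemeasurable)]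
  have hMc : ∀ n, Continuous (Function.uncurry (moll (eps n) ν fun _ _ => 1)) := fun n =>
    moll_continuous (Λ := 1) H.cont_ν (eps_pos n) continuous_const (by simp)
  have hMb : ∀ n t x, 0 ≤ moll (eps n) ν (fun _ _ => 1) t x
      ∧ moll (eps n) ν (fun _ _ => 1) t x ≤ 1 / eps n * 1 * E := fun n t x =>
    ⟨moll_one_nonneg (eps_pos n) t x, (le_abs_self _).trans
      (moll_abs_le (b := fun _ _ => 1) H.mass_ν (eps_pos n) (by simp) t x)⟩
  have step1 : ∀ n j, D + ∫⁻ z, k z * ENNReal.ofReal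
      (2 * δ * steklov (eps j) (moll (eps n) ν fun _ _ => 1) z.1 z.2) ∂P ≤ R := fun n j => by
    obtain ⟨φ, φt, φx, hφ, hφB, hmono, hw⟩ := hB (eps n) (eps j) (eps_pos n) (eps_pos j)
      (eps_le_one j)
    have hsc : Continuous (Function.uncurry fun t x =>
        2 * δ * steklov (eps j) (moll (eps n) ν fun _ _ => 1) t x) :=
      (steklov_continuous (h := eps j) (hMc n)).const_mul (2 * δ)
    have := H.comparison_of_weight h₁ h₂ h0 h0t hx he hx0 he0 hM hφ hφB hmono
      (N := fun t x => 2 * δ * steklov (eps j) (moll (eps n) ν fun _ _ => 1) t x) hsc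
      (K := 2 * δ * (1 / eps n * 1 * E)) (fun t x => ?_)
      fun τ hτ y => hw τ (h0.trans hτ.1.le) (hτ.2.trans htT) y
    · rwa [hprod _ hsc] at this
    · have := steklov_mem (eps_pos j) (hMc n) (hMb n) t x
      exact ⟨by have := this.1; positivity, mul_le_mul_of_nonneg_left this.2 (by positivity)⟩
  -- Together with D < ∞ this makes the truncated difference R - D a genuine one, so that D can be
  -- added back at the end.
  have hDR : D ≤ R := le_self_add.trans (step1 0 0)
  have hDtop : D ≠ ⊤ := ENNReal.ofReal_ne_top
  have step2 : ∀ n, ∫⁻ z, k z * ENNReal.ofReal (2 * δ * moll (eps n) ν (fun _ _ => 1) z.1 z.2) ∂P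
      ≤ R - D := fun n => by
    have hmeas : ∀ j, AEMeasurable (fun z => k z * ENNReal.ofReal
        (2 * δ * steklov (eps j) (moll (eps n) ν fun _ _ => 1) z.1 z.2)) P := fun j =>
      hkm.mul ((steklov_continuous (hMc n)).const_mul (2 * δ)).measurable.ennreal_ofReal.aemeasurable
    calc _ = ∫⁻ z, liminf (fun j => k z * ENNReal.ofReal
          (2 * δ * steklov (eps j) (moll (eps n) ν fun _ _ => 1) z.1 z.2)) atTop ∂P := by
          congr 1 with z
          refine (Tendsto.liminf_eq (ENNReal.Tendsto.const_mul ((ENNReal.continuous_ofReal.tendsto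
            _).comp ((tendsto_steklov (hMc n) z.1 z.2).const_mul (2 * δ))) (Or.inr ?_))).symm
          simp only [hk, indicator]
          split_ifs <;> simp
      _ ≤ liminf (fun j => ∫⁻ z, k z * ENNReal.ofReal
          (2 * δ * steklov (eps j) (moll (eps n) ν fun _ _ => 1) z.1 z.2) ∂P) atTop :=
          lintegral_liminf_le' hmeas
      _ ≤ liminf (fun _ : ℕ => R - D) atTop := liminf_le_liminf (Eventually.of_forall fun j =>
          ENNReal.le_sub_of_add_le_left hDtop (step1 n j))
      _ = R - D := liminf_const _
  set A : ℕ → ℝ → ℝ≥0∞ := fun n τ => ∫⁻ y, k (τ, y)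
    * ENNReal.ofReal (moll (eps n) ν (fun _ _ => 1) τ y) with hA
  have hcpos : ENNReal.ofReal (2 * δ) ≠ 0 := by simpa using hδ
  have step3 : ∀ n, ∫⁻ τ in Ioc t₀ t, A n τ ≤ (R - D) / ENNReal.ofReal (2 * δ) := fun n => by
    rw [ENNReal.le_div_iff_mul_le (Or.inl hcpos) (Or.inl ENNReal.ofReal_ne_top), mul_comm]
    refine le_trans (le_of_eq ?_) (step2 n)
    have hm := hkm.mul (hMc n).measurable.ennreal_ofReal.aemeasurable
    rw [hA, hP, ← lintegral_prod (fun z : ℝ × ℝ => k z *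
      ENNReal.ofReal (moll (eps n) ν (fun _ _ => 1) z.1 z.2)) hm,
      ← lintegral_const_mul' _ _ ENNReal.ofReal_ne_top]
    congr 1 with z
    rw [ENNReal.ofReal_mul (by positivity : 0 ≤ 2 * δ)]
    ring
  -- The mollification is removed slice by slice; the factor 2 lost here is the reason why the decay
  -- rate 2δ becomes δ in the conclusion.
  have step4 : ∀ τ ∈ Ioc t₀ t, ∫⁻ y, k (τ, y) * ENNReal.ofReal (s τ y)
      ≤ 2 * liminf (fun n => A n τ) atTop := fun τ hτ => by
    have hτ0 : 0 ≤ τ := h0.trans hτ.1.le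
    have hkτ : AEMeasurable fun y => k (τ, y) := by
      rw [show (fun y => k (τ, y)) = _ from funext (hkv τ)]
      exact ((integrable_of_rnDeriv (H.r_nonneg τ)
        (H.dens_r τ hτ0)).aemeasurable.const_add M).ennreal_ofReal.indicator measurableSet_Ioo
    refine le_trans (le_of_eq (lintegral_congr_ae ?_)) (fatou_moll ν τ hkτ
      (Eventually.of_forall fun y => ?_))
    · filter_upwards [H.dens_s τ hτ0] with y hy
      rw [hy]
    · simp only [hk, indicator]
      split_ifs <;> simp
  have step5 : ∫⁻ τ in Ioc t₀ t, ∫⁻ y, k (τ, y) * ENNReal.ofReal (δ * s τ y) ≤ R - D := by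
    have hAm : ∀ n, AEMeasurable (A n) (volume.restrict (Ioc t₀ t)) := fun n =>
      (hkm.mul (hMc n).measurable.ennreal_ofReal.aemeasurable).lintegral_prod_right'
    calc ∫⁻ τ in Ioc t₀ t, ∫⁻ y, k (τ, y) * ENNReal.ofReal (δ * s τ y)
        = ENNReal.ofReal δ * ∫⁻ τ in Ioc t₀ t, ∫⁻ y, k (τ, y) * ENNReal.ofReal (s τ y) := by
          rw [← lintegral_const_mul' _ _ ENNReal.ofReal_ne_top]
          congr 1 with τ
          rw [← lintegral_const_mul' _ _ ENNReal.ofReal_ne_top]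
          congr 1 with y
          rw [ENNReal.ofReal_mul hδ.le]
          ring
      _ ≤ ENNReal.ofReal δ * ∫⁻ τ in Ioc t₀ t, 2 * liminf (fun n => A n τ) atTop := by
          exact mul_le_mul' le_rfl (setLIntegral_mono' measurableSet_Ioc step4)
      _ = ENNReal.ofReal (2 * δ) * ∫⁻ τ in Ioc t₀ t, liminf (fun n => A n τ) atTop := by
          rw [lintegral_const_mul' _ _ (by simp), ENNReal.ofReal_mul (by norm_num : (0 : ℝ) ≤ 2),
            ENNReal.ofReal_ofNat]
          ring
      _ ≤ ENNReal.ofReal (2 * δ) * ((R - D) / ENNReal.ofReal (2 * δ)) := by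
          refine mul_le_mul' le_rfl ((lintegral_liminf_le' hAm).trans ?_)
          exact (liminf_le_liminf (Eventually.of_forall step3)).trans (liminf_const _).le
      _ = R - D := ENNReal.mul_div_cancel hcpos ENNReal.ofReal_ne_top
  rw [hslice fun τ y => ENNReal.ofReal (δ * s τ y)]
  calc _ ≤ D + (R - D) := by gcongr
    _ = R := add_tsub_cancel_of_le hDR

end IsWavePair

/-- The terms which are not controlled by the distance of two characteristics are absorbed by the
decay of the weight. -/
lemma exists_absorption {B C δ : ℝ} (hB : 1 ≤ B) (hC : 0 ≤ C) (hδ : 0 < δ) :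
    ∃ M K : ℝ, 1 ≤ M ∧ 0 ≤ K ∧ ∀ p q γ : ℝ, 0 ≤ p → 0 ≤ q →
      γ ≤ C * (p * √q + √p * q + √p * √q) →
      B * γ + 2 * M * B * C * (1 + √p + √q) ≤ 1 / 2 * ((M + p) * (δ * q)) + (K * M + K * p) := by
  set D := B * C with hD
  have hD0 : 0 ≤ D := by positivity
  -- L is the constant of `interaction_young` with η = δ/2, so the source costs δ/2 · pq + L (p +
  -- q). The choice of M gives L q ≤ M δ q / 4, and Young's inequality bounds the term 2MD√q by M δ
  -- q / 4 plus a constant. Together they use exactly half of (M + p) δ q.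
  set L := D ^ 2 / (2 * (δ / 2)) + D / 2 with hL
  have hL0 : 0 ≤ L := by positivity
  set M := 1 + 4 * L / δ with hM
  have hM1 : 1 ≤ M := by
    have : 0 ≤ 4 * L / δ := by positivity
    linarith
  have hML : 4 * L ≤ δ * M := by
    have e : δ * M = δ + 4 * L := by rw [hM]; field_simp
    linarith
  set K := 3 * D + 4 * D ^ 2 / δ + L + M * D with hK
  have hK0 : 0 ≤ K := by positivity
  refine ⟨M, K, hM1, hK0, fun p q γ hp hq hγ => ?_⟩
  have h1 := interaction_young hD0 (half_pos hδ) hp hq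
  have h2 : B * γ ≤ D * (p * √q + √p * q + √p * √q) := by
    rw [hD, mul_assoc]
    exact mul_le_mul_of_nonneg_left hγ (by linarith)
  have h3 : 2 * D * √q ≤ δ / 4 * q + 4 * D ^ 2 / δ := by
    have e : δ / 4 * q + 4 * D ^ 2 / δ - 2 * D * √q = δ / 4 * (√q - 4 * D / δ) ^ 2 := by
      nth_rewrite 1 [← Real.sq_sqrt hq]
      field_simp
      ring
    have : 0 ≤ δ / 4 * (√q - 4 * D / δ) ^ 2 := by positivity
    linarith
  have h4 : 2 * √p ≤ 1 + p := by nlinarith [Real.sq_sqrt hp, sq_nonneg (√p - 1)]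
  have h5 := mul_le_mul_of_nonneg_left h3 (by linarith : 0 ≤ M)
  have h6 := mul_le_mul_of_nonneg_left h4 (by positivity : 0 ≤ M * D)
  have h7 := mul_le_mul_of_nonneg_right hML hq
  have h8 : 2 * M * B * C * (1 + √p + √q) = 2 * (M * D) + M * D * (2 * √p) + M * (2 * D * √q) := by
    rw [hD]; ring
  have h9 : (3 * D + 4 * D ^ 2 / δ) * M + (L + M * D) * p ≤ K * M + K * p := by
    have k1 : 3 * D + 4 * D ^ 2 / δ ≤ K := by
      have : 0 ≤ M * D := by positivity
      linarith
    have k2 : L + M * D ≤ K := by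
      have : 0 ≤ 4 * D ^ 2 / δ := by positivity
      linarith
    exact add_le_add (mul_le_mul_of_nonneg_right k1 (by linarith))
      (mul_le_mul_of_nonneg_right k2 hp)
  rw [h8]
  nlinarith

namespace IsWavePair

variable {σ δ Λ E C : ℝ} {μ ν : ℝ → FiniteMeasure ℝ} {a c g r s : ℝ → ℝ → ℝ}

/-- Finiteness is what allows part of the interaction term to be absorbed in
`exists_distance_estimate`. It follows from the integrability of the source and √p ≤ 1 + p. -/
lemma lintegral_comparison_lt_top (H : IsWavePair σ δ Λ E C μ ν a c g r s) {x₁ x₂ : ℝ → ℝ}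
    (hx₁ : Continuous x₁) (hx₂ : Continuous x₂) {t₀ t B k : ℝ} (h0 : 0 ≤ t₀)
    (hx : ∀ τ ∈ Icc t₀ t, x₁ τ ≤ x₂ τ) (hB : 0 ≤ B) (hk : 0 ≤ k) :
    ∫⁻ τ in Ioc t₀ t, ∫⁻ y in Ioo (x₁ τ) (x₂ τ),
      ENNReal.ofReal (B * |g τ y| + k * (1 + √(r τ y) + √(s τ y))) < ⊤ := by
  have hE := H.E_nonneg
  obtain ⟨w, hw⟩ := isCompact_Icc.exists_bound_of_continuousOn (s := Icc t₀ t)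
    (hx₂.sub hx₁).continuousOn
  have hsq : ∀ p : ℝ, 0 ≤ p → √p ≤ 1 + p := fun p hp => by
    nlinarith [Real.sq_sqrt hp, sq_nonneg (√p - 1), Real.sqrt_nonneg p]
  set V := ENNReal.ofReal (3 * k * w + k * E) + ENNReal.ofReal (0 * w + k * E) with hV
  have hslice : ∀ τ ∈ Ioc t₀ t, ∫⁻ y in Ioo (x₁ τ) (x₂ τ),
      ENNReal.ofReal (B * |g τ y| + k * (1 + √(r τ y) + √(s τ y)))
        ≤ (∫⁻ y, ENNReal.ofReal (B * |g τ y|)) + V := fun τ hτ => by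
    have hτ0 : 0 ≤ τ := h0.trans hτ.1.le
    have hτ' : τ ∈ Icc t₀ t := ⟨hτ.1.le, hτ.2⟩
    have hxw : x₂ τ - x₁ τ ≤ w := (le_abs_self _).trans (hw τ hτ')
    have i1 := integrable_of_rnDeriv (H.r_nonneg τ) (H.dens_r τ hτ0)
    have i2 := integrable_of_rnDeriv (H.s_nonneg τ) (H.dens_s τ hτ0)
    have b1 := lintegral_Ioo_density_le (k := 3 * k) (l := k) (by linarith) hk (H.r_nonneg τ)
      (H.dens_r τ hτ0) (hx τ hτ')
    have b2 := lintegral_Ioo_density_le (k := 0) (l := k) le_rfl hk (H.s_nonneg τ)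
      (H.dens_s τ hτ0) (hx τ hτ')
    have c1 : (μ τ : Measure ℝ).real (Ioo (x₁ τ) (x₂ τ)) ≤ E :=
      (measureReal_mono (subset_univ _)).trans (H.mass_μ τ)
    have c2 : (ν τ : Measure ℝ).real (Ioo (x₁ τ) (x₂ τ)) ≤ E :=
      (measureReal_mono (subset_univ _)).trans (H.mass_ν τ)
    calc _ ≤ ∫⁻ y in Ioo (x₁ τ) (x₂ τ), (ENNReal.ofReal (B * |g τ y|)
          + (ENNReal.ofReal (3 * k + k * r τ y) + ENNReal.ofReal (0 + k * s τ y))) := by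
          refine lintegral_mono fun y => ?_
          have hr0 := H.r_nonneg τ y
          have hs0 := H.s_nonneg τ y
          rw [← ENNReal.ofReal_add (by positivity) (by positivity),
            ← ENNReal.ofReal_add (by positivity) (by positivity)]
          refine ENNReal.ofReal_le_ofReal (add_le_add le_rfl ?_)
          have := mul_le_mul_of_nonneg_left (add_le_add (hsq _ hr0) (hsq _ hs0)) hk
          linarith
      _ = (∫⁻ y in Ioo (x₁ τ) (x₂ τ), ENNReal.ofReal (B * |g τ y|))
          + ((∫⁻ y in Ioo (x₁ τ) (x₂ τ), ENNReal.ofReal (3 * k + k * r τ y))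
            + ∫⁻ y in Ioo (x₁ τ) (x₂ τ), ENNReal.ofReal (0 + k * s τ y)) := by
          have m1 : AEMeasurable (fun y => ENNReal.ofReal (3 * k + k * r τ y))
              (volume.restrict (Ioo (x₁ τ) (x₂ τ))) :=
            ((i1.aemeasurable.const_mul k).const_add _).ennreal_ofReal.restrict
          have m2 : AEMeasurable (fun y => ENNReal.ofReal (0 + k * s τ y))
              (volume.restrict (Ioo (x₁ τ) (x₂ τ))) :=
            ((i2.aemeasurable.const_mul k).const_add _).ennreal_ofReal.restrict
          have m3 : AEMeasurable (fun y => ENNReal.ofReal (3 * k + k * r τ y)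
              + ENNReal.ofReal (0 + k * s τ y)) (volume.restrict (Ioo (x₁ τ) (x₂ τ))) := m1.add m2
          rw [lintegral_add_right' _ m3, lintegral_add_right' _ m2]
      _ ≤ _ := by
          refine add_le_add (setLIntegral_le_lintegral _ _) (add_le_add ?_ ?_)
          · refine b1.trans (ENNReal.ofReal_le_ofReal (add_le_add ?_ ?_))
            · exact mul_le_mul_of_nonneg_left hxw (by linarith)
            · exact mul_le_mul_of_nonneg_left c1 hk
          · refine b2.trans (ENNReal.ofReal_le_ofReal (add_le_add ?_ ?_))
            · simp
            · exact mul_le_mul_of_nonneg_left c2 hk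
  refine (setLIntegral_mono' measurableSet_Ioc hslice).trans_lt ?_
  rw [lintegral_add_right _ measurable_const, setLIntegral_const]
  refine ENNReal.add_lt_top.2 ⟨?_, ENNReal.mul_lt_top (by simp [hV]) (by simp)⟩
  have hg : Integrable (Function.uncurry g) ((volume.restrict (Ioc t₀ t)).prod volume) :=
    (H.sourceIntegrable t).mono_measure (Measure.prod_mono
      (Measure.restrict_mono (Ioc_subset_Ioc_left h0) le_rfl) le_rfl)
  have hg' := (hg.abs.const_mul B)
  have := lintegral_prod (fun z : ℝ × ℝ => ENNReal.ofReal (B * |g z.1 z.2|))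
    hg'.aemeasurable.ennreal_ofReal
  rw [← this]
  exact hg'.lintegral_lt_top

/-- Gronwall-type estimate for the distance of two ordered characteristics. -/
lemma exists_distance_estimate (H : IsWavePair σ δ Λ E C μ ν a c g r s) (T : ℝ) :
    ∃ M K : ℝ, 1 ≤ M ∧ 0 ≤ K ∧ ∀ (x₁ x₂ e₁ e₂ : ℝ → ℝ) (t₀ t : ℝ), IsBalancedCurve μ a g x₁ e₁ →
      IsBalancedCurve μ a g x₂ e₂ → 0 ≤ t₀ → t₀ ≤ t → t ≤ T → (∀ τ ∈ Icc t₀ t, x₁ τ ≤ x₂ τ) →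
      (∀ τ ∈ Icc t₀ t, e₁ τ ≤ e₂ τ) → x₁ t₀ = x₂ t₀ → e₁ t₀ = e₂ t₀ →
      M * (x₂ t - x₁ t) + (e₂ t - e₁ t)
        ≤ K * ∫ τ in t₀..t, (M * (x₂ τ - x₁ τ) + (e₂ τ - e₁ τ)) := by
  obtain ⟨B, hB1, hB⟩ := H.comparison T
  obtain ⟨M, K, hM1, hK0, hMK⟩ := exists_absorption hB1 H.C_nonneg H.δ_pos
  have hC := H.C_nonneg
  have hδ := H.δ_pos
  have hM0 : 0 ≤ M := by linarith
  refine ⟨M, K, hM1, hK0, fun x₁ x₂ e₁ e₂ t₀ t h₁ h₂ h0 h0t htT hx he hx0 he0 => ?_⟩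
  have key := hB x₁ x₂ e₁ e₂ t₀ t M h₁ h₂ h0 h0t htT hx he hx0 he0 hM0
  set D : ℝ → ℝ := fun τ => M * (x₂ τ - x₁ τ) + (e₂ τ - e₁ τ) with hD
  have hfin := H.lintegral_comparison_lt_top h₁.cont_x h₂.cont_x h0 hx (by linarith : 0 ≤ B)
    (by positivity : 0 ≤ 2 * M * B * C)
  set R := ∫⁻ τ in Ioc t₀ t, ∫⁻ y in Ioo (x₁ τ) (x₂ τ),
    ENNReal.ofReal (B * |g τ y| + 2 * M * B * C * (1 + √(r τ y) + √(s τ y)))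
  set X := ∫⁻ τ in Ioc t₀ t, ∫⁻ y in Ioo (x₁ τ) (x₂ τ),
    ENNReal.ofReal (M + r τ y) * ENNReal.ofReal (δ * s τ y) with hX
  have hD0 : ∀ τ ∈ Icc t₀ t, 0 ≤ D τ := fun τ hτ => add_nonneg
    (mul_nonneg hM0 (sub_nonneg.2 (hx τ hτ))) (sub_nonneg.2 (he τ hτ))
  have hDc : ContinuousOn D (Icc t₀ t) := by
    have hs : Icc t₀ t ⊆ Ici 0 := fun τ hτ => h0.trans hτ.1
    exact (((h₂.cont_x.sub h₁.cont_x).const_mul M).continuousOn).add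
      ((h₂.cont_e.mono hs).sub (h₁.cont_e.mono hs))
  have hDi : IntegrableOn (fun τ => K * D τ) (Ioc t₀ t) :=
    ((hDc.integrableOn_Icc).mono_set Ioc_subset_Icc_self).const_mul K
  -- X stands on the left of `key` and will reappear on the right with factor 1/2; being finite, it
  -- can be absorbed.
  have hXtop : X ≠ ⊤ := ne_of_lt ((le_add_self.trans key).trans_lt hfin)
  have hslice : ∀ τ ∈ Ioc t₀ t, ∫⁻ y in Ioo (x₁ τ) (x₂ τ),
      ENNReal.ofReal (B * |g τ y| + 2 * M * B * C * (1 + √(r τ y) + √(s τ y)))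
      ≤ ENNReal.ofReal (1 / 2) * (∫⁻ y in Ioo (x₁ τ) (x₂ τ),
          ENNReal.ofReal (M + r τ y) * ENNReal.ofReal (δ * s τ y)) + ENNReal.ofReal (K * D τ) :=
    fun τ hτ => by
      have hτ0 : 0 < τ := h0.trans_lt hτ.1
      have hτ' : τ ∈ Icc t₀ t := ⟨hτ.1.le, hτ.2⟩
      have i1 := integrable_of_rnDeriv (H.r_nonneg τ) (H.dens_r τ hτ0.le)
      have b1 := lintegral_Ioo_density_le (k := K * M) (l := K) (by positivity) hK0 (H.r_nonneg τ)
        (H.dens_r τ hτ0.le) (hx τ hτ')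
      -- The integral of r between the curves is thus controlled by the difference of the energies,
      -- which closes the estimate in terms of D.
      have b2 : (μ τ : Measure ℝ).real (Ioo (x₁ τ) (x₂ τ)) ≤ e₂ τ - e₁ τ := by
        have := setIntegral_Ioo_le_leftIntegral_sub (hx τ hτ') (he τ hτ') (h₁.mem τ hτ0.le).2
          (h₂.mem τ hτ0.le).1 (integrable_const (1 : ℝ)) fun _ => zero_le_one
        simpa [leftIntegral] using this
      calc _ ≤ ∫⁻ y in Ioo (x₁ τ) (x₂ τ), (ENNReal.ofReal (1 / 2) *
            (ENNReal.ofReal (M + r τ y) * ENNReal.ofReal (δ * s τ y))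
              + ENNReal.ofReal (K * M + K * r τ y)) := by
            refine lintegral_mono fun y => ?_
            have hr0 := H.r_nonneg τ y
            have hs0 := H.s_nonneg τ y
            rw [← ENNReal.ofReal_mul (by positivity), ← ENNReal.ofReal_mul (by positivity),
              ← ENNReal.ofReal_add (by positivity) (by positivity)]
            exact ENNReal.ofReal_le_ofReal (hMK _ _ _ hr0 hs0 (H.g_le τ hτ0 y))
        _ = ENNReal.ofReal (1 / 2) * (∫⁻ y in Ioo (x₁ τ) (x₂ τ),
              ENNReal.ofReal (M + r τ y) * ENNReal.ofReal (δ * s τ y))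
            + ∫⁻ y in Ioo (x₁ τ) (x₂ τ), ENNReal.ofReal (K * M + K * r τ y) := by
            rw [lintegral_add_right' _
              ((i1.aemeasurable.const_mul K).const_add _).ennreal_ofReal.restrict,
              lintegral_const_mul' _ _ ENNReal.ofReal_ne_top]
        _ ≤ _ := by
            refine add_le_add le_rfl (b1.trans (ENNReal.ofReal_le_ofReal ?_))
            have := mul_le_mul_of_nonneg_left b2 hK0
            simp only [hD]
            linarith
  have hR : R ≤ ENNReal.ofReal (1 / 2) * X + ENNReal.ofReal (∫ τ in Ioc t₀ t, K * D τ) := by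
    refine (setLIntegral_mono' measurableSet_Ioc hslice).trans (le_of_eq ?_)
    rw [lintegral_add_right' _ hDi.aemeasurable.ennreal_ofReal,
      lintegral_const_mul' _ _ ENNReal.ofReal_ne_top, ofReal_integral_eq_lintegral_ofReal hDi]
    rw [EventuallyLE, ae_restrict_iff' measurableSet_Ioc]
    exact Eventually.of_forall fun τ hτ => mul_nonneg hK0 (hD0 τ ⟨hτ.1.le, hτ.2⟩)
  have hI0 : 0 ≤ ∫ τ in Ioc t₀ t, K * D τ := setIntegral_nonneg measurableSet_Ioc fun τ hτ =>
    mul_nonneg hK0 (hD0 τ ⟨hτ.1.le, hτ.2⟩)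
  have hfinal := key.trans hR
  rw [← ENNReal.ofReal_toReal hXtop, ← ENNReal.ofReal_mul (by norm_num),
    ← ENNReal.ofReal_add (hD0 t ⟨h0t, le_rfl⟩) ENNReal.toReal_nonneg,
    ← ENNReal.ofReal_add (by positivity) hI0, ENNReal.ofReal_le_ofReal_iff (by positivity)] at hfinal
  rw [← intervalIntegral.integral_const_mul, intervalIntegral.integral_of_le h0t]
  have := ENNReal.toReal_nonneg (a := X)
  linarith

/-- If x₂ + e₂ exceeded x₁ + e₁ at time T, let t₀ be the last earlier time at which it did not. From
t₀ on the sums are ordered, hence so are both positions and energies, and at t₀ both pairs coincide.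
The distance estimate with Grönwall's inequality then keeps them together up to T, a contradiction.
-/
lemma add_le_add_of_balanced (H : IsWavePair σ δ Λ E C μ ν a c g r s) {x₁ x₂ e₁ e₂ : ℝ → ℝ}
    (h₁ : IsBalancedCurve μ a g x₁ e₁) (h₂ : IsBalancedCurve μ a g x₂ e₂) (hx0 : x₁ 0 = x₂ 0)
    (he0 : e₁ 0 = e₂ 0) {T : ℝ} (hT : 0 ≤ T) : x₂ T + e₂ T ≤ x₁ T + e₁ T := by
  by_contra! hlt
  obtain ⟨M, K, hM1, hK0, hest⟩ := H.exists_distance_estimate T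
  have hc : ∀ {x e : ℝ → ℝ}, IsBalancedCurve μ a g x e →
      ContinuousOn (fun τ => x τ + e τ) (Icc 0 T) := fun h =>
    h.cont_x.continuousOn.add (h.cont_e.mono fun τ hτ => hτ.1)
  have hcomp : IsCompact {τ ∈ Icc 0 T | x₂ τ + e₂ τ ≤ x₁ τ + e₁ τ} := by
    refine isCompact_Icc.of_isClosed_subset ?_ (fun τ hτ => hτ.1)
    exact isClosed_Icc.isClosed_le (hc h₂) (hc h₁)
  obtain ⟨t₀, ht₀, hmax⟩ := hcomp.exists_isGreatest ⟨0, ⟨le_rfl, hT⟩, by rw [hx0, he0]⟩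
  have h0 : 0 ≤ t₀ := ht₀.1.1
  have h0T : t₀ < T := lt_of_le_of_ne ht₀.1.2 fun h => by
    have := ht₀.2
    rw [h] at this
    linarith
  have hafter : ∀ τ ∈ Ioc t₀ T, x₁ τ + e₁ τ < x₂ τ + e₂ τ := fun τ hτ => by
    by_contra! hle
    exact absurd (hmax ⟨⟨h0.trans hτ.1.le, hτ.2⟩, hle⟩) (not_le.2 hτ.1)
  have hat : x₁ t₀ + e₁ t₀ ≤ x₂ t₀ + e₂ t₀ := by
    have hcl : t₀ ∈ closure (Ioc t₀ T) := by
      rw [closure_Ioc h0T.ne]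
      exact ⟨le_rfl, h0T.le⟩
    have hsub : closure (Ioc t₀ T) ⊆ Icc 0 T := by
      rw [closure_Ioc h0T.ne]
      exact Icc_subset_Icc_left h0
    exact ContinuousWithinAt.closure_le hcl
      (((hc h₁) t₀ ht₀.1).mono (subset_closure.trans hsub))
      (((hc h₂) t₀ ht₀.1).mono (subset_closure.trans hsub)) fun τ hτ => (hafter τ hτ).le
  have hle : ∀ τ ∈ Icc t₀ T, x₁ τ + e₁ τ ≤ x₂ τ + e₂ τ := fun τ hτ => by
    rcases hτ.1.eq_or_lt with rfl | h
    · exact hat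
    · exact (hafter τ ⟨h, hτ.2⟩).le
  -- Strictly ordered positions force ordered energies, since e₁ ≤ μ((-∞,x₁]) ≤ μ((-∞,x₂)) ≤ e₂. So
  -- the order of the sums x + e decides the order of both components.
  have hord : ∀ τ ∈ Icc t₀ T, x₁ τ ≤ x₂ τ ∧ e₁ τ ≤ e₂ τ := fun τ hτ => by
    have hτ0 := h0.trans hτ.1
    have hβ := hle τ hτ
    rcases lt_trichotomy (x₁ τ) (x₂ τ) with h | h | h
    · exact ⟨h.le, (h₁.mem τ hτ0).2.trans ((measureReal_mono fun y hy => lt_of_le_of_lt hy h).trans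
        (h₂.mem τ hτ0).1)⟩
    · exact ⟨h.le, by linarith⟩
    · have := (h₂.mem τ hτ0).2.trans ((measureReal_mono fun y hy => lt_of_le_of_lt hy h).trans
        (h₁.mem τ hτ0).1)
      linarith
  have ho0 := hord t₀ ⟨le_rfl, h0T.le⟩
  have hx0' : x₁ t₀ = x₂ t₀ := by linarith [ho0.1, ho0.2, ht₀.2]
  have he0' : e₁ t₀ = e₂ t₀ := by linarith [ho0.1, ho0.2, ht₀.2]
  have hIci : Ici t₀ ⊆ Ici 0 := Ici_subset_Ici.2 h0
  have hzero := le_zero_of_le_integral (D := fun τ => M * (x₂ τ - x₁ τ) + (e₂ τ - e₁ τ)) (K := K)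
    h0T.le ((((h₂.cont_x.sub h₁.cont_x).const_mul M).continuousOn).add
      ((h₂.cont_e.mono hIci).sub (h₁.cont_e.mono hIci)))
    (fun τ hτ => add_nonneg (mul_nonneg (by linarith) (sub_nonneg.2 (hord τ hτ).1))
      (sub_nonneg.2 (hord τ hτ).2))
    fun τ hτ => hest x₁ x₂ e₁ e₂ t₀ τ h₁ h₂ h0 hτ.1 hτ.2
      (fun z hz => (hord z ⟨hz.1, hz.2.trans hτ.2⟩).1)
      (fun z hz => (hord z ⟨hz.1, hz.2.trans hτ.2⟩).2) hx0' he0'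
  have hoT := hord T ⟨h0T.le, le_rfl⟩
  have := mul_le_mul_of_nonneg_right hM1 (sub_nonneg.2 hoT.1)
  linarith

/-- Balanced characteristics are determined by their initial values. -/
theorem balanced_unique (H : IsWavePair σ δ Λ E C μ ν a c g r s) {x₁ x₂ e₁ e₂ : ℝ → ℝ}
    (h₁ : IsBalancedCurve μ a g x₁ e₁) (h₂ : IsBalancedCurve μ a g x₂ e₂) (hx0 : x₁ 0 = x₂ 0)
    (he0 : e₁ 0 = e₂ 0) {T : ℝ} (hT : 0 ≤ T) : x₁ T = x₂ T := by
  have k1 := H.add_le_add_of_balanced h₁ h₂ hx0 he0 hT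
  have k2 := H.add_le_add_of_balanced h₂ h₁ hx0.symm he0.symm hT
  rcases lt_trichotomy (x₁ T) (x₂ T) with h | h | h
  · have := (h₁.mem T hT).2.trans ((measureReal_mono fun y hy => lt_of_le_of_lt hy h).trans
        (h₂.mem T hT).1)
    linarith
  · exact h
  · have := (h₂.mem T hT).2.trans ((measureReal_mono fun y hy => lt_of_le_of_lt hy h).trans
        (h₁.mem T hT).1)
    linarith

end IsWavePair

/-! ### Characteristics with an energy balance -/

lemma measureReal_Iic_eq (m : FiniteMeasure ℝ) (x : ℝ) :
    (m : Measure ℝ).real (Iic x) = (m : Measure ℝ).real (Iio x) + (m : Measure ℝ).real {x} := by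
  rw [← Iio_union_right, measureReal_union (by simp) (measurableSet_singleton _)]

lemma exists_fraction {m : FiniteMeasure ℝ} {x e : ℝ}
    (he : e ∈ Icc ((m : Measure ℝ).real (Iio x)) ((m : Measure ℝ).real (Iic x))) :
    ∃ θ ∈ Icc (0 : ℝ) 1, e = (m : Measure ℝ).real (Iio x) + θ * (m : Measure ℝ).real {x} := by
  rw [measureReal_Iic_eq] at he
  rcases (measureReal_nonneg (μ := (m : Measure ℝ)) (s := {x})).eq_or_lt with h | h
  · refine ⟨0, ⟨le_rfl, zero_le_one⟩, ?_⟩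
    rw [← h, add_zero] at he
    rw [zero_mul, add_zero]
    exact le_antisymm he.2 he.1
  · refine ⟨(e - (m : Measure ℝ).real (Iio x)) / (m : Measure ℝ).real {x},
      ⟨div_nonneg (sub_nonneg.2 he.1) h.le, (div_le_one h).2 (by linarith [he.2])⟩, ?_⟩
    rw [div_mul_cancel₀ _ h.ne']
    ring

lemma mem_Icc_of_fraction {m : FiniteMeasure ℝ} {x e θ : ℝ} (hθ : θ ∈ Icc (0 : ℝ) 1)
    (he : e = (m : Measure ℝ).real (Iio x) + θ * (m : Measure ℝ).real {x}) :
    e ∈ Icc ((m : Measure ℝ).real (Iio x)) ((m : Measure ℝ).real (Iic x)) := by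
  have h0 := measureReal_nonneg (μ := (m : Measure ℝ)) (s := {x})
  rw [he, measureReal_Iic_eq]
  exact ⟨le_add_of_nonneg_right (mul_nonneg hθ.1 h0),
    add_le_add le_rfl (mul_le_of_le_one_left h0 hθ.2)⟩

lemma measureReal_Iic_eq_integral {m : FiniteMeasure ℝ} (hm : (m : Measure ℝ) ≪ volume)
    {r : ℝ → ℝ} (hr : ∀ x, 0 ≤ r x)
    (hd : (m : Measure ℝ).rnDeriv volume =ᵐ[volume] fun x => ENNReal.ofReal (r x)) (x : ℝ) :
    (m : Measure ℝ).real (Iic x) = ∫ y in Iic x, r y := by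
  have hi := (IsWavePair.integrable_of_rnDeriv hr hd).integrableOn (s := Iic x)
  rw [integral_eq_lintegral_of_nonneg_ae (Eventually.of_forall hr) hi.aestronglyMeasurable,
    Measure.real, ← Measure.setLIntegral_rnDeriv hm]
  congr 1
  exact lintegral_congr_ae (ae_restrict_of_ae hd)

namespace IsWavePair

variable {σ δ Λ E C : ℝ} {μ ν : ℝ → FiniteMeasure ℝ} {a c g r s : ℝ → ℝ → ℝ}

/-- Absolute continuity of e turns the almost-everywhere derivative into the integrated balance.
Since the initial measure has no atom, the fraction θ(0) is irrelevant and every such curve starts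
with the same energy. The curve is frozen at negative times to be continuous on ℝ. -/
lemma isBalancedCurve_of_energyBalance {μ' : ℝ → FiniteMeasure ℝ} {a' : ℝ → ℝ → ℝ}
    (hμ : ∀ t, 0 ≤ t → μ t = μ' t) (ha : ∀ t, 0 ≤ t → ∀ x, a t x = a' t x)
    {ybar : ℝ} (h0 : (μ 0 : Measure ℝ) ≪ volume) {y : ℝ → ℝ}
    (hy : IsCharacteristic a' ybar y) (hb : EnergyBalance μ' r g y) :
    ∃ e, IsBalancedCurve μ a g (fun t => y (max t 0)) e ∧
      e 0 = (μ 0 : Measure ℝ).real (Iio ybar) := by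
  obtain ⟨e, hθ, -, hac, hder⟩ := hb
  obtain ⟨K, hK⟩ := hy.lipschitz
  have hmax : ∀ {t : ℝ}, 0 ≤ t → max t 0 = t := fun ht => max_eq_left ht
  refine ⟨e, ⟨?_, fun t ht => ?_, fun t ht => ?_, fun t₁ t₂ h₁ h₁₂ => ?_, fun t ht => ?_⟩, ?_⟩
  · exact hK.continuousOn.comp_continuous (by fun_prop) fun t => le_max_right t 0
  · have h1 := (hy.ode t ht.le).hasDerivAt (Ici_mem_nhds ht)
    simp only [hmax ht.le, ha t ht.le]
    refine h1.congr_of_eventuallyEq ?_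
    filter_upwards [lt_mem_nhds ht] with τ hτ
    rw [hmax hτ.le]
  · have hT : (0 : ℝ) ≤ t + 1 := by linarith [mem_Ici.1 ht]
    have h1 := (hac (t + 1) hT).continuousOn
    rw [uIcc_of_le hT] at h1
    refine (h1 t ⟨ht, by linarith⟩).mono_of_mem_nhdsWithin ?_
    rw [← Ici_inter_Iic]
    exact inter_mem_nhdsWithin _ (Iic_mem_nhds (by linarith))
  · have h1 : AbsolutelyContinuousOnInterval e t₁ t₂ := (hac t₂ (h₁.trans h₁₂)).mono (by
      rw [uIcc_of_le h₁₂, uIcc_of_le (h₁.trans h₁₂)]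
      exact Icc_subset_Icc_left h₁)
    rw [← h1.integral_deriv_eq_sub]
    refine intervalIntegral.integral_congr_ae ?_
    rw [ae_restrict_iff' measurableSet_Ioi] at hder
    filter_upwards [hder] with τ hτ hτ'
    rw [uIoc_of_le h₁₂] at hτ'
    have hτ0 : 0 < τ := h₁.trans_lt hτ'.1
    rw [hmax hτ0.le, (hτ hτ0).2.deriv]
  · obtain ⟨θ, hθ1, hθ2⟩ := hθ t ht
    rw [hmax ht, hμ t ht]
    exact mem_Icc_of_fraction hθ1 hθ2
  · obtain ⟨θ, -, hθ2⟩ := hθ 0 le_rfl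
    have : (μ 0 : Measure ℝ).real {ybar} = 0 := by
      rw [measureReal_def, h0 (by simp)]
      simp
    rw [hθ2, ← hμ 0 le_rfl, hy.init, this, mul_zero, add_zero]

/-- The curve comes from `exists_characteristic`, with e the initial energy to the left plus the
integrated source. Any competitor becomes a balanced curve with the same initial position and
energy, so `balanced_unique` applies. -/
theorem exists_unique_characteristic (H : IsWavePair σ δ Λ E C μ ν a c g r s)
    {μ' : ℝ → FiniteMeasure ℝ} {a' : ℝ → ℝ → ℝ}
    (hμ : ∀ t, 0 ≤ t → μ t = μ' t) (ha : ∀ t, 0 ≤ t → ∀ x, a t x = a' t x)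
    (h0 : (μ 0 : Measure ℝ) ≪ volume) (ybar : ℝ) :
    ∃ x : ℝ → ℝ, (IsCharacteristic a' ybar x ∧ EnergyBalance μ' r g x) ∧
      ∀ y : ℝ → ℝ, IsCharacteristic a' ybar y ∧ EnergyBalance μ' r g y → EqOn y x (Ici 0) := by
  have hT := H.isTransport
  have hΛ := hT.Λ_nonneg
  obtain ⟨x, hxL, hx0, hode, hmem⟩ := hT.exists_characteristic (ybar := ybar) (h0 (by simp))
  have hxlip : LipschitzWith Λ.toNNReal x := LipschitzWith.of_dist_le_mul fun s t => by
    rw [Real.dist_eq, Real.dist_eq, Real.coe_toNNReal _ hΛ]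
    exact hxL s t
  have hxc := hxlip.continuous
  have hchar : IsCharacteristic a' ybar x :=
    ⟨⟨_, hxlip.lipschitzOnWith⟩, hx0, fun t ht => by rw [← ha t ht]; exact hode t ht⟩
  have hint : ∀ T, 0 ≤ T → IntervalIntegrable (fun s => ∫ y in Iic (x s), g s y) volume 0 T :=
    fun T h => H.sourceIntegrable.intervalIntegrable_Iic_one hxc le_rfl h
  have hbal : EnergyBalance μ' r g x := by
    refine ⟨fun t => (μ 0 : Measure ℝ).real (Iio ybar)
      + ∫ s in (0 : ℝ)..t, ∫ y in Iic (x s), g s y, fun t ht => ?_, fun t ht hac => ?_,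
      fun T h => ?_, ?_⟩
    · rw [← hμ t ht]
      exact exists_fraction (hmem t ht)
    · have hac' : (μ t : Measure ℝ) ≪ volume := by rwa [hμ t ht]
      have hm := hmem t ht
      have hz : (μ t : Measure ℝ).real {x t} = 0 := by
        rw [measureReal_def, hac' (by simp)]
        simp
      refine ⟨(integrable_of_rnDeriv (H.r_nonneg t) (H.dens_r t ht)).integrableOn, ?_⟩
      rw [← measureReal_Iic_eq_integral hac' (H.r_nonneg t) (H.dens_r t ht)]
      rw [measureReal_Iic_eq, hz, add_zero] at hm ⊢
      exact le_antisymm hm.2 hm.1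
    · exact (LipschitzOnWith.absolutelyContinuousOnInterval (K := 0)
        (LipschitzWith.const _).lipschitzOnWith).fun_add
        ((hint T h).absolutelyContinuousOnInterval_intervalIntegral (by simp))
    · rw [ae_restrict_iff' measurableSet_Ioi]
      have h1 : ∀ n : ℕ, ∀ᵐ t : ℝ, t ∈ Ioc (0 : ℝ) n → Integrable (g t) := fun n =>
        H.sourceIntegrable.ae_integrable le_rfl
      have h2 := fun n : ℕ => (hint n (Nat.cast_nonneg n)).ae_hasDerivAt_integral
      filter_upwards [ae_all_iff.2 h1, ae_all_iff.2 h2] with t k1 k2 ht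
      obtain ⟨n, hn⟩ := exists_nat_ge t
      refine ⟨(k1 n ⟨ht, hn⟩).integrableOn, ?_⟩
      refine (k2 n ?_ 0 (by simp)).const_add _
      rw [uIcc_of_le (Nat.cast_nonneg n)]
      exact ⟨le_of_lt ht, hn⟩
  refine ⟨x, ⟨hchar, hbal⟩, fun y hy T hT => ?_⟩
  obtain ⟨e₁, b₁, i₁⟩ := isBalancedCurve_of_energyBalance hμ ha h0 hchar hbal
  obtain ⟨e₂, b₂, i₂⟩ := isBalancedCurve_of_energyBalance hμ ha h0 hy.1 hy.2
  have := H.balanced_unique b₂ b₁ (by simp [hx0, hy.1.init]) (i₂.trans i₁.symm) hT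
  simpa only [max_eq_left (mem_Ici.1 hT)] using this

end IsWavePair

/-! ### Bounds for the coefficients -/

/-- Bounded functions on the plane. -/
def IsBdd (f : ℝ × ℝ → ℝ) : Prop := ∃ M : ℝ, ∀ z, |f z| ≤ M

/-- Differentiable functions on the plane which are bounded together with their derivatives. -/
structure IsBddDiff (f : ℝ × ℝ → ℝ) : Prop where
  diff : Differentiable ℝ f
  bdd : IsBdd f
  grad : ∃ M : ℝ, ∀ z, ‖fderiv ℝ f z‖ ≤ M

namespace IsBdd

variable {f g : ℝ × ℝ → ℝ}

lemma const (c : ℝ) : IsBdd fun _ => c := ⟨|c|, fun _ => le_rfl⟩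

lemma add (hf : IsBdd f) (hg : IsBdd g) : IsBdd fun z => f z + g z := by
  obtain ⟨M, hM⟩ := hf
  obtain ⟨N, hN⟩ := hg
  exact ⟨M + N, fun z => (abs_add_le _ _).trans (add_le_add (hM z) (hN z))⟩

lemma neg (hf : IsBdd f) : IsBdd fun z => -f z := by
  obtain ⟨M, hM⟩ := hf
  exact ⟨M, fun z => by rw [abs_neg]; exact hM z⟩

lemma sub (hf : IsBdd f) (hg : IsBdd g) : IsBdd fun z => f z - g z := by
  simpa only [sub_eq_add_neg] using hf.add hg.neg

lemma mul (hf : IsBdd f) (hg : IsBdd g) : IsBdd fun z => f z * g z := by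
  obtain ⟨M, hM⟩ := hf
  obtain ⟨N, hN⟩ := hg
  refine ⟨M * N, fun z => ?_⟩
  rw [abs_mul]
  exact mul_le_mul (hM z) (hN z) (abs_nonneg _) ((abs_nonneg _).trans (hM z))

lemma div (hf : IsBdd f) {d : ℝ} (hd : 0 < d) (hg : ∀ z, d ≤ g z) : IsBdd fun z => f z / g z := by
  obtain ⟨M, hM⟩ := hf
  refine ⟨M / d, fun z => ?_⟩
  rw [abs_div, abs_of_pos (hd.trans_le (hg z))]
  exact div_le_div₀ ((abs_nonneg _).trans (hM z)) (hM z) hd (hg z)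

end IsBdd

namespace IsBddDiff

variable {f g : ℝ × ℝ → ℝ}

lemma add (hf : IsBddDiff f) (hg : IsBddDiff g) : IsBddDiff fun z => f z + g z := by
  refine ⟨hf.diff.fun_add hg.diff, hf.bdd.add hg.bdd, ?_⟩
  obtain ⟨M, hM⟩ := hf.grad
  obtain ⟨N, hN⟩ := hg.grad
  refine ⟨M + N, fun z => ?_⟩
  rw [fderiv_fun_add (hf.diff z) (hg.diff z)]
  exact (norm_add_le _ _).trans (add_le_add (hM z) (hN z))

lemma neg (hf : IsBddDiff f) : IsBddDiff fun z => -f z := by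
  refine ⟨hf.diff.fun_neg, hf.bdd.neg, ?_⟩
  obtain ⟨M, hM⟩ := hf.grad
  refine ⟨M, fun z => ?_⟩
  rw [fderiv_fun_neg, norm_neg]
  exact hM z

lemma sub (hf : IsBddDiff f) (hg : IsBddDiff g) : IsBddDiff fun z => f z - g z := by
  simpa only [sub_eq_add_neg] using hf.add hg.neg

lemma mul (hf : IsBddDiff f) (hg : IsBddDiff g) : IsBddDiff fun z => f z * g z := by
  refine ⟨hf.diff.fun_mul hg.diff, hf.bdd.mul hg.bdd, ?_⟩
  obtain ⟨M, hM⟩ := hf.grad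
  obtain ⟨N, hN⟩ := hg.grad
  obtain ⟨K, hK⟩ := hf.bdd
  obtain ⟨L, hL⟩ := hg.bdd
  refine ⟨K * N + L * M, fun z => ?_⟩
  rw [fderiv_fun_mul (hf.diff z) (hg.diff z)]
  refine (norm_add_le _ _).trans (add_le_add ?_ ?_)
  · rw [norm_smul]
    exact mul_le_mul (hK z) (hN z) (norm_nonneg _) ((abs_nonneg _).trans (hK z))
  · rw [norm_smul]
    exact mul_le_mul (hL z) (hM z) (norm_nonneg _) ((abs_nonneg _).trans (hL z))

lemma comp (hf : IsBddDiff f) {φ φ' : ℝ → ℝ} (hφ : ∀ z, HasDerivAt φ (φ' (f z)) (f z))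
    (hb : IsBdd fun z => φ (f z)) (hd : IsBdd fun z => φ' (f z)) :
    IsBddDiff fun z => φ (f z) := by
  have hF : ∀ z, HasFDerivAt (fun z => φ (f z)) (φ' (f z) • fderiv ℝ f z) z := fun z =>
    (hφ z).comp_hasFDerivAt z (hf.diff z).hasFDerivAt
  refine ⟨fun z => (hF z).differentiableAt, hb, ?_⟩
  obtain ⟨M, hM⟩ := hf.grad
  obtain ⟨K, hK⟩ := hd
  refine ⟨K * M, fun z => ?_⟩
  rw [(hF z).fderiv, norm_smul]
  exact mul_le_mul (hK z) (hM z) (norm_nonneg _) ((abs_nonneg _).trans (hK z))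

lemma inv (hf : IsBddDiff f) {d : ℝ} (hd : 0 < d) (h : ∀ z, d ≤ f z) :
    IsBddDiff fun z => (f z)⁻¹ := by
  have hne : ∀ z, f z ≠ 0 := fun z => (hd.trans_le (h z)).ne'
  refine hf.comp (φ' := fun y => -(y ^ 2)⁻¹) (fun z => hasDerivAt_inv (hne z)) ?_ ?_
  · simpa using (IsBdd.const 1).div hd h
  · simpa using ((IsBdd.const 1).div (pow_pos hd 2)
      fun z => pow_le_pow_left₀ hd.le (h z) 2).neg

lemma div (hf : IsBddDiff f) (hg : IsBddDiff g) {d : ℝ} (hd : 0 < d) (h : ∀ z, d ≤ g z) :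
    IsBddDiff fun z => f z / g z := by
  simpa only [div_eq_mul_inv] using hf.mul (hg.inv hd h)

lemma sqrt (hf : IsBddDiff f) {d : ℝ} (hd : 0 < d) (h : ∀ z, d ≤ f z) :
    IsBddDiff fun z => √(f z) := by
  have hne : ∀ z, f z ≠ 0 := fun z => (hd.trans_le (h z)).ne'
  refine hf.comp (φ' := fun y => 1 / (2 * √y)) (fun z => Real.hasDerivAt_sqrt (hne z)) ?_ ?_
  · obtain ⟨M, hM⟩ := hf.bdd
    refine ⟨√M, fun z => ?_⟩
    rw [abs_of_nonneg (Real.sqrt_nonneg _)]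
    exact Real.sqrt_le_sqrt ((le_abs_self _).trans (hM z))
  · exact (IsBdd.const 1).div (d := 2 * √d) (by positivity)
      fun z => mul_le_mul_of_nonneg_left (Real.sqrt_le_sqrt (h z)) zero_le_two

lemma exists_lipschitz (hf : IsBddDiff f) :
    ∃ L : ℝ, 0 ≤ L ∧ ∀ x x' v v' : ℝ, |f (x', v') - f (x, v)| ≤ L * (|x' - x| + |v' - v|) := by
  obtain ⟨M, hM⟩ := hf.grad
  have hM0 : 0 ≤ M := (norm_nonneg _).trans (hM 0)
  refine ⟨M, hM0, fun x x' v v' => ?_⟩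
  have h1 := Convex.norm_image_sub_le_of_norm_fderiv_le (fun z _ => hf.diff z) (fun z _ => hM z)
    convex_univ (mem_univ (x, v)) (mem_univ (x', v'))
  refine h1.trans (mul_le_mul_of_nonneg_left ?_ hM0)
  rw [Prod.norm_def]
  exact max_le (le_add_of_nonneg_right (abs_nonneg _)) (le_add_of_nonneg_left (abs_nonneg _))

lemma isBdd_pd2 {f : ℝ → ℝ → ℝ} (hf : IsBddDiff fun z => f z.1 z.2) :
    IsBdd fun z => pd2 f z.1 z.2 := by
  obtain ⟨M, hM⟩ := hf.grad
  refine ⟨M * ‖((0 : ℝ), (1 : ℝ))‖, fun z => ?_⟩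
  have h1 := (hf.diff z).hasFDerivAt.comp_hasDerivAt (x := z.2) (f := fun v => (z.1, v))
    ((hasDerivAt_const z.2 z.1).prodMk (hasDerivAt_id z.2))
  have h2 : pd2 f z.1 z.2 = fderiv ℝ (fun z : ℝ × ℝ => f z.1 z.2) z (0, 1) := h1.deriv
  simp only [h2]
  exact ContinuousLinearMap.le_of_opNorm_le _ (hM z) _

lemma isBdd_pd1 {f : ℝ → ℝ → ℝ} (hf : IsBddDiff fun z => f z.1 z.2) :
    IsBdd fun z => pd1 f z.1 z.2 := by
  obtain ⟨M, hM⟩ := hf.grad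
  refine ⟨M * ‖((1 : ℝ), (0 : ℝ))‖, fun z => ?_⟩
  have h1 := (hf.diff z).hasFDerivAt.comp_hasDerivAt (x := z.1) (f := fun x => (x, z.2))
    ((hasDerivAt_id z.1).prodMk (hasDerivAt_const z.1 z.2))
  have h2 : pd1 f z.1 z.2 = fderiv ℝ (fun z : ℝ × ℝ => f z.1 z.2) z (1, 0) := h1.deriv
  simp only [h2]
  exact ContinuousLinearMap.le_of_opNorm_le _ (hM z) _

end IsBddDiff

namespace Coeffs.Admissible

variable {A : Coeffs}

lemma isBddDiff_α (hA : A.Admissible) : IsBddDiff fun z => A.α z.1 z.2 := by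
  obtain ⟨p, q, hp, h⟩ := hA.bound_α
  refine ⟨hA.smooth_α.differentiable (by simp), ⟨q, fun z => ?_⟩, hA.grad_α⟩
  rw [abs_of_pos (hp.trans_le (h _ _).1)]
  exact (h _ _).2

lemma isBddDiff_β (hA : A.Admissible) : IsBddDiff fun z => A.β z.1 z.2 := by
  obtain ⟨q, h⟩ := hA.bound_β
  exact ⟨hA.smooth_β.differentiable (by simp), ⟨q, fun z => h _ _⟩, hA.grad_β⟩

lemma isBddDiff_γ (hA : A.Admissible) : IsBddDiff fun z => A.γ z.1 z.2 := by
  obtain ⟨p, q, hp, h⟩ := hA.bound_γ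
  refine ⟨hA.smooth_γ.differentiable (by simp), ⟨q, fun z => ?_⟩, hA.grad_γ⟩
  rw [abs_of_pos (hp.trans_le (h _ _).1)]
  exact (h _ _).2

lemma exists_discriminant (hA : A.Admissible) :
    ∃ d : ℝ, 0 < d ∧ ∀ x v, d ≤ A.β x v ^ 2 + A.α x v ^ 2 * A.γ x v ^ 2 := by
  obtain ⟨p, _, hp, h⟩ := hA.bound_α
  obtain ⟨q, _, hq, k⟩ := hA.bound_γ
  refine ⟨p ^ 2 * q ^ 2, by positivity, fun x v => ?_⟩
  have := mul_le_mul (pow_le_pow_left₀ hp.le (h x v).1 2) (pow_le_pow_left₀ hq.le (k x v).1 2)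
    (by positivity) (by positivity)
  have := sq_nonneg (A.β x v)
  linarith

lemma isBddDiff_discriminant (hA : A.Admissible) :
    IsBddDiff fun z => √(A.β z.1 z.2 ^ 2 + A.α z.1 z.2 ^ 2 * A.γ z.1 z.2 ^ 2) := by
  obtain ⟨d, hd, h⟩ := hA.exists_discriminant
  refine IsBddDiff.sqrt ?_ hd fun z => h _ _
  have hα := hA.isBddDiff_α
  have hβ := hA.isBddDiff_β
  have hγ := hA.isBddDiff_γ
  simpa only [pow_two] using (hβ.mul hβ).add ((hα.mul hα).mul (hγ.mul hγ))

lemma isBddDiff_lam (hA : A.Admissible) :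
    (IsBddDiff fun z => A.lamMinus z.1 z.2) ∧ IsBddDiff fun z => A.lamPlus z.1 z.2 := by
  obtain ⟨p, _, hp, h⟩ := hA.bound_α
  have hα := hA.isBddDiff_α
  have hα2 : IsBddDiff fun z => A.α z.1 z.2 ^ 2 := by simpa only [pow_two] using hα.mul hα
  have hl : ∀ z : ℝ × ℝ, p ^ 2 ≤ A.α z.1 z.2 ^ 2 := fun z => pow_le_pow_left₀ hp.le (h _ _).1 2
  exact ⟨(hA.isBddDiff_β.sub hA.isBddDiff_discriminant).div hα2 (pow_pos hp 2) hl,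
    (hA.isBddDiff_β.add hA.isBddDiff_discriminant).div hα2 (pow_pos hp 2) hl⟩

/-- The two characteristic speeds have opposite signs. -/
lemma exists_separation (hA : A.Admissible) :
    ∃ δ : ℝ, 0 < δ ∧ ∀ x v, A.lamMinus x v ≤ -δ ∧ δ ≤ A.lamPlus x v := by
  obtain ⟨p, q, hp, h⟩ := hA.bound_α
  obtain ⟨γ₁, _, hγ, k⟩ := hA.bound_γ
  obtain ⟨B, hB⟩ := hA.isBddDiff_β.bdd
  obtain ⟨D, hD⟩ := hA.isBddDiff_discriminant.bdd
  obtain ⟨d, hd, hd'⟩ := hA.exists_discriminant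
  have hs : ∀ x v, 0 < √(A.β x v ^ 2 + A.α x v ^ 2 * A.γ x v ^ 2) := fun x v =>
    Real.sqrt_pos.2 (hd.trans_le (hd' x v))
  have hBD : 0 < B + D := by
    have h1 := (abs_nonneg _).trans (hB 0)
    have h2 := (hs 0 0).trans_le ((le_abs_self _).trans (hD (0, 0)))
    linarith
  refine ⟨γ₁ ^ 2 / (B + D), by positivity, fun x v => ?_⟩
  have hαp := hp.trans_le (h x v).1
  have hg : γ₁ ^ 2 ≤ A.γ x v ^ 2 := pow_le_pow_left₀ hγ.le (k x v).1 2
  have hsq := Real.sq_sqrt (hd.trans_le (hd' x v)).le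
  have hs0 := hs x v
  have hβ := abs_le.1 (hB (x, v))
  have hd2 := (le_abs_self _).trans (hD (x, v))
  simp only at hβ hd2
  simp only [lamMinus, lamPlus]
  set s := √(A.β x v ^ 2 + A.α x v ^ 2 * A.γ x v ^ 2)
  have hα2 : 0 < A.α x v ^ 2 := by positivity
  have hγ2 : 0 < A.γ x v ^ 2 := lt_of_lt_of_le (by positivity) hg
  -- The numerators of -λ₋ and λ₊ multiply to α²γ². Each is at most B + D, so each is at least
  -- α²γ₁²/(B + D), and the factor α² cancels against the denominator.
  have hprod : (s - A.β x v) * (s + A.β x v) = A.α x v ^ 2 * A.γ x v ^ 2 := by nlinarith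
  have habs : |A.β x v| < s := by
    refine abs_lt_of_sq_lt_sq ?_ hs0.le
    nlinarith [mul_pos hα2 hγ2]
  rw [abs_lt] at habs
  have hm : A.α x v ^ 2 * A.γ x v ^ 2 ≤ (s - A.β x v) * (B + D) := by
    rw [← hprod]
    exact mul_le_mul_of_nonneg_left (by linarith) (by linarith)
  have hp' : A.α x v ^ 2 * A.γ x v ^ 2 ≤ (s + A.β x v) * (B + D) := by
    rw [← hprod, mul_comm (s - A.β x v)]
    exact mul_le_mul_of_nonneg_left (by linarith) (by linarith)
  have hg' := mul_le_mul_of_nonneg_left hg hα2.le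
  constructor
  · rw [div_le_iff₀ hα2, neg_mul, div_mul_eq_mul_div]
    have : γ₁ ^ 2 * A.α x v ^ 2 / (B + D) ≤ s - A.β x v := by
      rw [div_le_iff₀ hBD]; linarith
    linarith
  · rw [le_div_iff₀ hα2, div_mul_eq_mul_div, div_le_iff₀ hBD]
    linarith

lemma isBddDiff_c (hA : A.Admissible) :
    (IsBddDiff fun z => A.c1 z.1 z.2) ∧ IsBddDiff fun z => A.c2 z.1 z.2 :=
  ⟨hA.isBddDiff_α.mul hA.isBddDiff_lam.1, hA.isBddDiff_α.mul hA.isBddDiff_lam.2⟩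

lemma exists_separation_c (hA : A.Admissible) :
    ∃ d : ℝ, 0 < d ∧ ∀ x v, A.c1 x v ≤ -d ∧ d ≤ A.c2 x v := by
  obtain ⟨p, _, hp, h⟩ := hA.bound_α
  obtain ⟨δ, hδ, k⟩ := hA.exists_separation
  refine ⟨p * δ, by positivity, fun x v => ⟨?_, ?_⟩⟩
  · have := mul_le_mul (h x v).1 (le_neg_of_le_neg (k x v).1) hδ.le (hp.le.trans (h x v).1)
    simp only [c1]
    linarith
  · exact mul_le_mul (h x v).1 (k x v).2 hδ.le (hp.le.trans (h x v).1)

/-- The coefficients of the source term are bounded. -/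
lemma exists_source_bound (hA : A.Admissible) : ∃ M : ℝ, 0 ≤ M ∧ ∀ x v,
    |2 * A.c2 x v * A.a1 x v / (A.α x v * (A.c2 x v - A.c1 x v))| ≤ M ∧
    |2 * A.c1 x v * A.a2 x v / (A.α x v * (A.c2 x v - A.c1 x v))| ≤ M ∧
    |2 * A.c1 x v * A.c2 x v * A.b x v / (A.α x v * (A.c2 x v - A.c1 x v))| ≤ M := by
  obtain ⟨p, _, hp, h⟩ := hA.bound_α
  obtain ⟨d, hd, k⟩ := hA.exists_separation_c
  have hα := hA.isBddDiff_α
  obtain ⟨hc1, hc2⟩ := hA.isBddDiff_c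
  have hden : ∀ z : ℝ × ℝ, p * (2 * d) ≤ A.α z.1 z.2 * (A.c2 z.1 z.2 - A.c1 z.1 z.2) := fun z =>
    mul_le_mul (h _ _).1 (by linarith [(k z.1 z.2).1, (k z.1 z.2).2]) (by linarith)
      (hp.le.trans (h _ _).1)
  have hden2 : ∀ z : ℝ × ℝ,
      2 * (p * (2 * d)) ≤ 2 * A.α z.1 z.2 * (A.c2 z.1 z.2 - A.c1 z.1 z.2) := fun z => by
    have := hden z
    linarith
  have h0 : 0 < p * (2 * d) := by positivity
  have ha1 : IsBdd fun z => A.a1 z.1 z.2 :=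
    ((hc1.bdd.mul hα.isBdd_pd2).sub (hα.bdd.mul hc1.isBdd_pd2)).div (by positivity) hden2
  have ha2 : IsBdd fun z => A.a2 z.1 z.2 :=
    ((hc2.bdd.mul hα.isBdd_pd2).sub (hα.bdd.mul hc2.isBdd_pd2)).div (by positivity) hden2
  have hb : IsBdd fun z => A.b z.1 z.2 :=
    ((hα.bdd.mul (IsBddDiff.isBdd_pd1 (f := fun x' v' => A.c1 x' v' - A.c2 x' v')
      (hc1.sub hc2))).add ((hc1.sub hc2).bdd.mul hα.isBdd_pd1)).div (by positivity) hden2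
  obtain ⟨M₁, k₁⟩ := (((IsBdd.const 2).mul hc2.bdd).mul ha1).div h0 hden
  obtain ⟨M₂, k₂⟩ := (((IsBdd.const 2).mul hc1.bdd).mul ha2).div h0 hden
  obtain ⟨M₃, k₃⟩ := ((((IsBdd.const 2).mul hc1.bdd).mul hc2.bdd).mul hb).div h0 hden
  have n₁ := (abs_nonneg _).trans (k₁ 0)
  have n₂ := (abs_nonneg _).trans (k₂ 0)
  have n₃ := (abs_nonneg _).trans (k₃ 0)
  exact ⟨M₁ + M₂ + M₃, by positivity, fun x v => ⟨(k₁ (x, v)).trans (by linarith),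
    (k₂ (x, v)).trans (by linarith), (k₃ (x, v)).trans (by linarith)⟩⟩

/-- The weights in the two energy densities are positive. -/
lemma exists_weight_bound (hA : A.Admissible) : ∃ κ : ℝ, 0 < κ ∧ ∀ x v,
    κ ≤ -A.c1 x v / (A.c2 x v - A.c1 x v) ∧ κ ≤ A.c2 x v / (A.c2 x v - A.c1 x v) := by
  obtain ⟨d, hd, k⟩ := hA.exists_separation_c
  obtain ⟨hc1, hc2⟩ := hA.isBddDiff_c
  obtain ⟨N, hN⟩ := (hc2.sub hc1).bdd
  have hN0 : 0 < N := by
    have := (le_abs_self _).trans (hN (0, 0))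
    linarith [(k 0 0).1, (k 0 0).2]
  refine ⟨d / N, by positivity, fun x v => ?_⟩
  have h1 := (le_abs_self _).trans (hN (x, v))
  have h2 := k x v
  have h3 : 0 < A.c2 x v - A.c1 x v := by linarith
  exact ⟨div_le_div₀ (by linarith) (by linarith) h3 h1,
    div_le_div₀ (by linarith) (by linarith) h3 h1⟩

end Coeffs.Admissible

/-! ### Conservative solutions -/

namespace WaveField

variable {A : Coeffs} (w : WaveField)

lemma Rsq_nonneg (hA : A.Admissible) (t x : ℝ) : 0 ≤ w.Rsq A t x := by
  obtain ⟨κ, hκ, h⟩ := hA.exists_weight_bound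
  exact mul_nonneg (hκ.le.trans (h _ _).1) (sq_nonneg _)

lemma Ssq_nonneg (hA : A.Admissible) (t x : ℝ) : 0 ≤ w.Ssq A t x := by
  obtain ⟨κ, hκ, h⟩ := hA.exists_weight_bound
  exact mul_nonneg (hκ.le.trans (h _ _).2) (sq_nonneg _)

/-- The two energy densities add up to the energy density of the wave equation. -/
lemma Rsq_add_Ssq (hA : A.Admissible) (t x : ℝ) : w.Rsq A t x + w.Ssq A t x
    = A.α x (w.u t x) ^ 2 * w.ut t x ^ 2 + A.γ x (w.u t x) ^ 2 * w.ux t x ^ 2 := by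
  obtain ⟨d, hd, k⟩ := hA.exists_separation_c
  obtain ⟨p, _, hp, h⟩ := hA.bound_α
  obtain ⟨e, he, he'⟩ := hA.exists_discriminant
  simp only [Rsq, Ssq, R, S]
  set v := w.u t x
  have hα := hp.trans_le (h x v).1
  have hne : A.c2 x v - A.c1 x v ≠ 0 := by linarith [(k x v).1, (k x v).2]
  -- The mixed terms in u_t u_x cancel because of the weights, and the coefficient of u_x² is -c₁c₂.
  have hprod : A.c1 x v * A.c2 x v = -A.γ x v ^ 2 := by
    have hsq := Real.sq_sqrt (he.trans_le (he' x v)).le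
    simp only [Coeffs.c1, Coeffs.c2, Coeffs.lamMinus, Coeffs.lamPlus]
    set s := √(A.β x v ^ 2 + A.α x v ^ 2 * A.γ x v ^ 2)
    field_simp
    linear_combination -hsq
  field_simp
  linear_combination (-(A.c2 x v - A.c1 x v) * w.ux t x ^ 2) * hprod

variable {w}

lemma exists_riemann_bound (hA : A.Admissible) (w : WaveField) : ∃ k : ℝ, 0 ≤ k ∧ ∀ t x,
    |w.R A t x| ≤ k * √(w.Rsq A t x) ∧ |w.S A t x| ≤ k * √(w.Ssq A t x) := by
  obtain ⟨κ, hκ, h⟩ := hA.exists_weight_bound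
  have aux : ∀ {q y : ℝ}, κ ≤ q → |y| ≤ √(1 / κ) * √(q * y ^ 2) := fun {q y} hq => by
    rw [← Real.sqrt_mul (by positivity)]
    refine Real.abs_le_sqrt ?_
    have : κ * y ^ 2 ≤ q * y ^ 2 := mul_le_mul_of_nonneg_right hq (sq_nonneg _)
    rw [one_div_mul_eq_div, le_div_iff₀ hκ]
    linarith
  exact ⟨√(1 / κ), Real.sqrt_nonneg _, fun t x => ⟨aux (h _ _).1, aux (h _ _).2⟩⟩

lemma exists_ux_bound (hA : A.Admissible) (w : WaveField) : ∃ k : ℝ, 0 ≤ k ∧ ∀ t x,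
    |w.ux t x| ≤ k * (√(w.Rsq A t x) + √(w.Ssq A t x)) := by
  obtain ⟨k, hk, h⟩ := exists_riemann_bound hA w
  obtain ⟨d, hd, hc⟩ := hA.exists_separation_c
  refine ⟨k / d, by positivity, fun t x => ?_⟩
  have h1 := h t x
  have h2 := hc x (w.u t x)
  have h3 : w.R A t x - w.S A t x = (A.c2 x (w.u t x) - A.c1 x (w.u t x)) * w.ux t x := by
    simp only [R, S]; ring
  have h4 : d * |w.ux t x| ≤ |w.R A t x - w.S A t x| := by
    rw [h3, abs_mul]
    exact mul_le_mul_of_nonneg_right ((by linarith : d ≤ _).trans (le_abs_self _)) (abs_nonneg _)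
  have h5 := abs_sub (w.R A t x) (w.S A t x)
  rw [div_mul_eq_mul_div, le_div_iff₀ hd]
  linarith

/-- Every monomial of the source contains both R and S: only waves of different families interact,
which is what makes the interaction functional effective. -/
lemma exists_G_bound (hA : A.Admissible) (w : WaveField) : ∃ C : ℝ, 0 ≤ C ∧ ∀ t x,
    |w.G A t x| ≤ C * (w.Rsq A t x * √(w.Ssq A t x) + √(w.Rsq A t x) * w.Ssq A t x
      + √(w.Rsq A t x) * √(w.Ssq A t x)) := by
  obtain ⟨k, hk, h⟩ := exists_riemann_bound hA w
  obtain ⟨M, hM, hb⟩ := hA.exists_source_bound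
  refine ⟨M * (k ^ 3 + k ^ 2), by positivity, fun t x => ?_⟩
  obtain ⟨b1, b2, b3⟩ := hb x (w.u t x)
  obtain ⟨hR, hS⟩ := h t x
  have e1 := Real.sq_sqrt (w.Rsq_nonneg hA t x)
  have e2 := Real.sq_sqrt (w.Ssq_nonneg hA t x)
  have n1 := Real.sqrt_nonneg (w.Rsq A t x)
  have n2 := Real.sqrt_nonneg (w.Ssq A t x)
  simp only [G]
  set ρ := √(w.Rsq A t x)
  set τ := √(w.Ssq A t x)
  rw [← e1, ← e2]
  have i1 : |w.R A t x ^ 2 * w.S A t x| ≤ (k * ρ) ^ 2 * (k * τ) := by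
    rw [abs_mul, abs_pow]
    exact mul_le_mul (pow_le_pow_left₀ (abs_nonneg _) hR 2) hS (abs_nonneg _) (by positivity)
  have i2 : |w.R A t x * w.S A t x ^ 2| ≤ (k * ρ) * (k * τ) ^ 2 := by
    rw [abs_mul, abs_pow]
    exact mul_le_mul hR (pow_le_pow_left₀ (abs_nonneg _) hS 2) (by positivity) (by positivity)
  have i3 : |w.R A t x * w.S A t x| ≤ (k * ρ) * (k * τ) := by
    rw [abs_mul]
    exact mul_le_mul hR hS (abs_nonneg _) (by positivity)
  have j1 := mul_le_mul b1 i1 (abs_nonneg _) hM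
  have j2 := mul_le_mul b2 i2 (abs_nonneg _) hM
  have j3 := mul_le_mul b3 i3 (abs_nonneg _) hM
  rw [← abs_mul] at j1 j2 j3
  have p1 : 0 ≤ M * k ^ 2 * (ρ ^ 2 * τ + ρ * τ ^ 2) := by positivity
  have p2 : 0 ≤ M * k ^ 3 * (ρ * τ) := by positivity
  refine (abs_sub _ _).trans ((add_le_add ((abs_sub _ _).trans (add_le_add j1 j2)) j3).trans ?_)
  nlinarith

end WaveField

namespace IsWeakSolution

variable {A : Coeffs} {u0 u1 : ℝ → ℝ} {w : WaveField}

lemma continuousOn (h : IsWeakSolution A u0 u1 w) :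
    ContinuousOn (Function.uncurry w.u) (Ici 0 ×ˢ univ) := by
  intro z hz
  obtain ⟨C, hC⟩ := h.holder (Metric.closedBall z 1 ∩ Ici 0 ×ˢ univ)
    ((isCompact_closedBall z 1).inter_right (isClosed_Ici.prod isClosed_univ)) inter_subset_right
  have h1 := hC.continuousOn (by simp) z ⟨Metric.mem_closedBall_self zero_le_one, hz⟩
  refine h1.mono_of_mem_nhdsWithin ?_
  rw [inter_comm]
  exact inter_mem_nhdsWithin _ (Metric.closedBall_mem_nhds z one_pos)

lemma continuous_max (h : IsWeakSolution A u0 u1 w) :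
    Continuous fun z : ℝ × ℝ => w.u (max z.1 0) z.2 :=
  h.continuousOn.comp_continuous (f := fun z : ℝ × ℝ => (max z.1 0, z.2)) (by fun_prop)
    fun z => ⟨le_max_right z.1 0, mem_univ _⟩

lemma continuous_slice (h : IsWeakSolution A u0 u1 w) {t : ℝ} (ht : 0 ≤ t) :
    Continuous (w.u t) :=
  h.continuousOn.comp_continuous (f := fun x => (t, x)) (by fun_prop) fun _ => ⟨ht, mem_univ _⟩

lemma sub_eq_integral_ux (h : IsWeakSolution A u0 u1 w) {t : ℝ} (ht : 0 ≤ t) {x y : ℝ}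
    (hxy : x ≤ y) : w.u t y - w.u t x = ∫ z in x..y, w.ux t z :=
  sub_eq_integral_of_weakDeriv isOpen_univ hxy (subset_univ _) (h.continuous_slice ht)
    ((h.weakDeriv t ht).locInt'.locallyIntegrableOn _)
    fun χ hχ hχc _ => (h.weakDeriv t ht).integral_eq χ hχ hχc

/-- Weak derivatives are unique almost everywhere; this identifies the energy densities at time 0
with the initial data. -/
lemma ux_zero (h : IsWeakSolution A u0 u1 w) {u0x : ℝ → ℝ} (hd : HasWeakDeriv u0 u0x) :
    w.ux 0 =ᵐ[volume] u0x := by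
  have h0 := h.weakDeriv 0 le_rfl
  have hu : w.u 0 = u0 := funext h.init_u
  refine ae_eq_of_integral_contDiff_smul_eq h0.locInt' hd.locInt' fun φ hφ hφc => ?_
  have h1 := h0.integral_eq φ hφ hφc
  rw [hu, hd.integral_eq φ hφ hφc, neg_inj] at h1
  simpa only [smul_eq_mul, mul_comm] using h1.symm

lemma aemeasurable_coeff (h : IsWeakSolution A u0 u1 w) {f : ℝ → ℝ → ℝ}
    (hf : Continuous fun z : ℝ × ℝ => f z.1 z.2) :
    AEMeasurable (fun z : ℝ × ℝ => f z.2 (w.u z.1 z.2)) (volume.restrict (Ioi 0 ×ˢ univ)) := by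
  have h1 : AEMeasurable (Function.uncurry w.u) (volume.restrict (Ioi 0 ×ˢ univ)) :=
    (h.continuousOn.mono (prod_mono_left Ioi_subset_Ici_self)).aemeasurable
      (measurableSet_Ioi.prod MeasurableSet.univ)
  exact hf.measurable.comp_aemeasurable (measurable_snd.aemeasurable.prodMk h1)

lemma aemeasurable_densities (h : IsWeakSolution A u0 u1 w) (hA : A.Admissible) :
    AEMeasurable (Function.uncurry (w.Rsq A)) ((volume.restrict (Ioi 0)).prod volume) ∧
    AEMeasurable (Function.uncurry (w.Ssq A)) ((volume.restrict (Ioi 0)).prod volume) := by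
  rw [← restrict_Ioi_prod_univ]
  have hα := h.aemeasurable_coeff (f := A.α) hA.isBddDiff_α.diff.continuous
  have hc1 := h.aemeasurable_coeff (f := A.c1) hA.isBddDiff_c.1.diff.continuous
  have hc2 := h.aemeasurable_coeff (f := A.c2) hA.isBddDiff_c.2.diff.continuous
  have ht := h.meas_ut.aemeasurable
  have hx := h.meas_ux.aemeasurable
  exact ⟨(hc1.neg.div (hc2.sub hc1)).mul (((hα.mul ht).add (hc2.mul hx)).pow_const 2),
    (hc2.div (hc2.sub hc1)).mul (((hα.mul ht).add (hc1.mul hx)).pow_const 2)⟩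

/-- The speed is Lipschitz in (x,u), and u(t,·) is a primitive of u_x, which is bounded by the
square roots of the two energy densities because R - S = (c₂ - c₁) u_x. -/
lemma exists_speed_variation (h : IsWeakSolution A u0 u1 w) (hA : A.Admissible) {f : ℝ → ℝ → ℝ}
    (hf : IsBddDiff fun z => f z.1 z.2) : ∃ C : ℝ, 0 ≤ C ∧ ∀ t, 0 ≤ t →
    Integrable (w.Rsq A t) → Integrable (w.Ssq A t) → ∀ x y, x ≤ y →
      |f y (w.u t y) - f x (w.u t x)|
        ≤ C * ∫ z in x..y, (1 + √(w.Rsq A t z) + √(w.Ssq A t z)) := by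
  obtain ⟨L, hL, hf'⟩ := hf.exists_lipschitz
  obtain ⟨k, hk, hux⟩ := WaveField.exists_ux_bound hA w
  refine ⟨L * (1 + k), by positivity, fun t ht hR hS x y hxy => ?_⟩
  have i1 := IsWavePair.integrable_sqrt (w.Rsq_nonneg hA t) hR x y
  have i2 := IsWavePair.integrable_sqrt (w.Ssq_nonneg hA t) hS x y
  have i3 : IntervalIntegrable (fun z => √(w.Rsq A t z) + √(w.Ssq A t z)) volume x y := i1.add i2
  have hu : |w.u t y - w.u t x| ≤ ∫ z in x..y, k * (√(w.Rsq A t z) + √(w.Ssq A t z)) := by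
    rw [h.sub_eq_integral_ux ht hxy, ← Real.norm_eq_abs]
    exact intervalIntegral.norm_integral_le_of_norm_le hxy
      (Eventually.of_forall fun z _ => hux t z) (i3.const_mul k)
  rw [intervalIntegral.integral_const_mul] at hu
  have hsum : ∫ z in x..y, (1 + √(w.Rsq A t z) + √(w.Ssq A t z))
      = (y - x) + ∫ z in x..y, (√(w.Rsq A t z) + √(w.Ssq A t z)) := by
    simp only [add_assoc]
    rw [intervalIntegral.integral_add (intervalIntegrable_const (μ := volume) (c := (1 : ℝ))) i3]
    simp
  have hJ : 0 ≤ ∫ z in x..y, (√(w.Rsq A t z) + √(w.Ssq A t z)) :=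
    intervalIntegral.integral_nonneg hxy fun z _ => by positivity
  refine (hf' x y (w.u t x) (w.u t y)).trans ?_
  rw [hsum, abs_of_nonneg (sub_nonneg.2 hxy), mul_assoc]
  refine mul_le_mul_of_nonneg_left ?_ hL
  have := mul_nonneg hk (sub_nonneg.2 hxy)
  nlinarith

end IsWeakSolution

lemma IsMeasureSolution.congr {μ μ' : ℝ → FiniteMeasure ℝ} {a a' g g' : ℝ → ℝ → ℝ}
    (h : IsMeasureSolution μ' a' g') (hμ : ∀ t, 0 < t → μ t = μ' t)
    (ha : ∀ t, 0 < t → a t = a' t) (hg : g = g') : IsMeasureSolution μ a g := by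
  subst hg
  intro φ hφ
  refine Eq.trans ?_ (h φ hφ)
  congr 1
  refine setIntegral_congr_fun measurableSet_Ioi fun t (ht : 0 < t) => ?_
  simp only [hμ t ht, ha t ht]

lemma measureReal_univ_eq_singularPart_add {m : FiniteMeasure ℝ} {r : ℝ → ℝ} (hr : ∀ x, 0 ≤ r x)
    (hd : (m : Measure ℝ).rnDeriv volume =ᵐ[volume] fun x => ENNReal.ofReal (r x)) :
    (m : Measure ℝ).real univ
      = ((m : Measure ℝ).singularPart volume).real univ + ∫ x, r x := by
  have hi := IsWavePair.integrable_of_rnDeriv hr hd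
  conv_lhs => rw [Measure.haveLebesgueDecomposition_add (m : Measure ℝ) volume]
  rw [measureReal_add_apply]
  congr 1
  rw [integral_eq_lintegral_of_nonneg_ae (Eventually.of_forall hr) hi.aestronglyMeasurable,
    Measure.real, withDensity_apply _ MeasurableSet.univ, Measure.restrict_univ,
    lintegral_congr_ae hd]

namespace IsConservative

variable {A : Coeffs} {u0 u0x u1 : ℝ → ℝ} {w : WaveField} {μm μp : ℝ → FiniteMeasure ℝ}

/-- Initially the energy measures have no singular part. -/
lemma absolutelyContinuous_zero (h : IsConservative A u0 u0x u1 w μm μp) (hA : A.Admissible)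
    (hd : HasWeakDeriv u0 u0x) (hw : IsWeakSolution A u0 u1 w) :
    (μm 0 : Measure ℝ) ≪ volume ∧ (μp 0 : Measure ℝ) ≪ volume := by
  have hR := h.density_m 0 le_rfl
  have hS := h.density_p 0 le_rfl
  have e1 := measureReal_univ_eq_singularPart_add (w.Rsq_nonneg hA 0) hR
  have e2 := measureReal_univ_eq_singularPart_add (w.Ssq_nonneg hA 0) hS
  -- The absolutely continuous parts already exhaust the prescribed total energy, so nothing is left
  -- for the singular parts.
  have e3 : (∫ x, w.Rsq A 0 x) + ∫ x, w.Ssq A 0 x = initialEnergy A u0 u0x u1 := by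
    rw [← integral_add (IsWavePair.integrable_of_rnDeriv (w.Rsq_nonneg hA 0) hR)
      (IsWavePair.integrable_of_rnDeriv (w.Ssq_nonneg hA 0) hS), initialEnergy]
    refine integral_congr_ae ?_
    filter_upwards [hw.ux_zero hd, hw.init_ut] with x hx ht
    rw [w.Rsq_add_Ssq hA, hx, ht, hw.init_u]
  have e4 := h.total 0 le_rfl
  have n1 := measureReal_nonneg (μ := (μm 0 : Measure ℝ).singularPart volume) (s := univ)
  have n2 := measureReal_nonneg (μ := (μp 0 : Measure ℝ).singularPart volume) (s := univ)
  have z1 : ((μm 0 : Measure ℝ).singularPart volume).real univ = 0 := by linarith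
  have z2 : ((μp 0 : Measure ℝ).singularPart volume).real univ = 0 := by linarith
  rw [measureReal_eq_zero_iff, Measure.measure_univ_eq_zero] at z1 z2
  exact ⟨(Measure.singularPart_eq_zero _ _).1 z1, (Measure.singularPart_eq_zero _ _).1 z2⟩

/-- The energy measures, extended constantly to negative times, form a wave pair. -/
lemma exists_isWavePair (h : IsConservative A u0 u0x u1 w μm μp) (hA : A.Admissible)
    (hw : IsWeakSolution A u0 u1 w) : ∃ δ Λ E C : ℝ,
    IsWavePair 1 δ Λ E C (fun t => μm (max t 0)) (fun t => μp (max t 0))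
      (fun t x => A.lamMinus x (w.u (max t 0) x)) (fun t x => A.lamPlus x (w.u (max t 0) x))
      (w.G A) (w.Rsq A) (w.Ssq A) ∧
    IsWavePair (-1) δ Λ E C (fun t => μp (max t 0)) (fun t => μm (max t 0))
      (fun t x => A.lamPlus x (w.u (max t 0) x)) (fun t x => A.lamMinus x (w.u (max t 0) x))
      (fun t x => -w.G A t x) (w.Ssq A) (w.Rsq A) := by
  obtain ⟨hm, hp⟩ := hA.isBddDiff_lam
  obtain ⟨δ, hδ, hsep⟩ := hA.exists_separation
  obtain ⟨Λm, hΛm⟩ := hm.bdd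
  obtain ⟨Λp, hΛp⟩ := hp.bdd
  obtain ⟨C₁, hC₁, hG⟩ := WaveField.exists_G_bound hA w
  obtain ⟨C₂, hC₂, hvm⟩ := hw.exists_speed_variation hA (f := A.lamMinus) hm
  obtain ⟨C₃, hC₃, hvp⟩ := hw.exists_speed_variation hA (f := A.lamPlus) hp
  obtain ⟨hmR, hmS⟩ := hw.aemeasurable_densities hA
  have hR0 := w.Rsq_nonneg hA
  have hS0 := w.Ssq_nonneg hA
  have hmax : ∀ {t : ℝ}, 0 ≤ t → max t 0 = t := fun ht => max_eq_left ht
  have hΛm0 := (abs_nonneg _).trans (hΛm 0)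
  have hΛp0 := (abs_nonneg _).trans (hΛp 0)
  have hbm : ∀ x v, |A.lamMinus x v| ≤ Λm + Λp := fun x v => (hΛm (x, v)).trans (by linarith)
  have hbp : ∀ x v, |A.lamPlus x v| ≤ Λm + Λp := fun x v => (hΛp (x, v)).trans (by linarith)
  have hcm : Continuous fun t : ℝ => μm (max t 0) :=
    h.cont_m.comp_continuous (by fun_prop) fun t => le_max_right t 0
  have hcp : Continuous fun t : ℝ => μp (max t 0) :=
    h.cont_p.comp_continuous (by fun_prop) fun t => le_max_right t 0
  have ham : Continuous fun z : ℝ × ℝ => A.lamMinus z.2 (w.u (max z.1 0) z.2) :=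
    hm.diff.continuous.comp (continuous_snd.prodMk hw.continuous_max)
  have hap : Continuous fun z : ℝ × ℝ => A.lamPlus z.2 (w.u (max z.1 0) z.2) :=
    hp.diff.continuous.comp (continuous_snd.prodMk hw.continuous_max)
  have hdm : ∀ t, 0 ≤ t → (μm (max t 0) : Measure ℝ).rnDeriv volume
      =ᵐ[volume] fun x => ENNReal.ofReal (w.Rsq A t x) := fun t ht => by
    rw [hmax ht]; exact h.density_m t ht
  have hdp : ∀ t, 0 ≤ t → (μp (max t 0) : Measure ℝ).rnDeriv volume
      =ᵐ[volume] fun x => ENNReal.ofReal (w.Ssq A t x) := fun t ht => by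
    rw [hmax ht]; exact h.density_p t ht
  have hmass := fun t : ℝ => h.total (max t 0) (le_max_right t 0)
  have hvar : ∀ {f : ℝ → ℝ → ℝ} {K : ℝ}, K ≤ C₁ + C₂ + C₃ → (∀ t, 0 ≤ t →
      Integrable (w.Rsq A t) → Integrable (w.Ssq A t) → ∀ x y, x ≤ y →
      |f y (w.u t y) - f x (w.u t x)|
        ≤ K * ∫ z in x..y, (1 + √(w.Rsq A t z) + √(w.Ssq A t z))) →
      ∀ t, 0 ≤ t → ∀ x y, x ≤ y → |f y (w.u (max t 0) y) - f x (w.u (max t 0) x)|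
        ≤ (C₁ + C₂ + C₃) * ∫ z in x..y, (1 + √(w.Rsq A t z) + √(w.Ssq A t z)) :=
    fun {f K} hK hf t ht x y hxy => by
      rw [hmax ht]
      refine (hf t ht (IsWavePair.integrable_of_rnDeriv (hR0 t) (hdm t ht))
        (IsWavePair.integrable_of_rnDeriv (hS0 t) (hdp t ht)) x y hxy).trans
        (mul_le_mul_of_nonneg_right hK ?_)
      exact intervalIntegral.integral_nonneg hxy fun z _ => by positivity
  have hg : ∀ t x, |w.G A t x| ≤ (C₁ + C₂ + C₃) * (w.Rsq A t x * √(w.Ssq A t x)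
      + √(w.Rsq A t x) * w.Ssq A t x + √(w.Rsq A t x) * √(w.Ssq A t x)) := fun t x => by
    have hr := hR0 t x
    have hs := hS0 t x
    exact (hG t x).trans (mul_le_mul_of_nonneg_right (by linarith) (by positivity))
  have hbalm : IsMeasureSolution (fun t => μm (max t 0))
      (fun t x => A.lamMinus x (w.u (max t 0) x)) (w.G A) :=
    h.balance_m.congr (fun t ht => by rw [hmax ht.le]) (fun t ht => by rw [hmax ht.le]) rfl
  have hbalp : IsMeasureSolution (fun t => μp (max t 0))
      (fun t x => A.lamPlus x (w.u (max t 0) x)) (fun t x => -w.G A t x) :=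
    h.balance_p.congr (fun t ht => by rw [hmax ht.le]) (fun t ht => by rw [hmax ht.le]) rfl
  refine ⟨δ, Λm + Λp, initialEnergy A u0 u0x u1, C₁ + C₂ + C₃,
    ⟨Or.inl rfl, hδ, by positivity, hcm, hcp, ham, hap, fun t x => hbm _ _, fun t x => hbp _ _,
      fun t x => by rw [one_mul]; exact (hsep _ _).1, fun t x => by rw [one_mul]; exact (hsep _ _).2,
      fun t => (hmass t).le, hbalm, hbalp, h.locInt_G, hR0, hS0, hmR, hmS, hdm, hdp,
      fun t _ x => hg t x, hvar (by linarith) hvm⟩,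
    -- For forward characteristics the families exchange roles: σ = -1 restores the signs of the
    -- speeds, and the source changes sign.
    ⟨Or.inr rfl, hδ, by positivity, hcp, hcm, hap, ham, fun t x => hbp _ _, fun t x => hbm _ _,
      fun t x => by linarith [(hsep x (w.u (max t 0) x)).2],
      fun t x => by linarith [(hsep x (w.u (max t 0) x)).1],
      fun t => by rw [add_comm]; exact (hmass t).le, hbalp, by simpa only [neg_neg] using hbalm,
      h.locInt_G.neg, hS0, hR0, hmS, hmR, hdp, hdm, fun t _ x => ?_, fun t ht x y hxy => ?_⟩⟩
  · rw [abs_neg]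
    refine (hg t x).trans (le_of_eq ?_)
    ring
  · refine (hvar (by linarith) hvp t ht x y hxy).trans (le_of_eq ?_)
    simp only [add_right_comm]

end IsConservative

theorem lemma3p2 (A : Coeffs) (hA : A.Admissible)
    (u0 u0x u1 : ℝ → ℝ) (hinit : IsInitialData u0 u0x u1)
    (w : WaveField) (hsol : IsWeakSolution A u0 u1 w)
    (μm μp : ℝ → FiniteMeasure ℝ) (hcons : IsConservative A u0 u0x u1 w μm μp)
    (ybar : ℝ) :
    (∃ x : ℝ → ℝ, IsBackwardChar A w μm ybar x ∧
      ∀ y : ℝ → ℝ, IsBackwardChar A w μm ybar y → EqOn y x (Ici 0)) ∧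
    (∃ x : ℝ → ℝ, IsForwardChar A w μp ybar x ∧
      ∀ y : ℝ → ℝ, IsForwardChar A w μp ybar y → EqOn y x (Ici 0)) := by
  obtain ⟨δ, Λ, E, C, Hm, Hp⟩ := hcons.exists_isWavePair hA hsol
  obtain ⟨h0m, h0p⟩ := hcons.absolutelyContinuous_zero hA hinit.weakDeriv hsol
  exact ⟨Hm.exists_unique_characteristic (fun t ht => by simp only [max_eq_left ht])
      (fun t ht x => by simp only [max_eq_left ht]) (by simpa only [max_self] using h0m) ybar,
    Hp.exists_unique_characteristic (fun t ht => by simp only [max_eq_left ht])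
      (fun t ht x => by simp only [max_eq_left ht]) (by simpa only [max_self] using h0p) ybar⟩
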